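/- Let $\mathfrak A$ be an abelian $\mathbb Q$-linear symmetric monoidal category whose tensor product is $\mathbb Q$-bilinear and biexact, and give its bounded derived category $D^b(\mathfrak A)$ the induced symmetric monoidal structure (tensor product of bounded complexes, with the Koszul sign rule for the symmetry). Let $K_0(\mathfrak A)$ be the free abelian group on the objects of $\mathfrak A$ modulo the elements $\mathrm{cl}(Z)-\mathrm{cl}(X)-\mathrm{cl}(Y)$ for all short exact sequences $0\to X\to Z\to Y\to 0$, and let $K_0(D^b(\mathfrak A))$ be the free abelian group on the objects of $D^b(\mathfrak A)$ modulo the same elements for all distinguished triangles $X\to Z\to Y\to X[1]$. Both are commutative rings with $\mathrm{cl}(X)\,\mathrm{cl}(Y)=\mathrm{cl}(X\otimes Y)$ and unit $\mathrm{cl}(\mathbf 1)$. For an object $X$ the symmetric group $\Sigma_n$ acts on $X^{\otimes n}$. For a partition $\mu$ of $n$ let $c_\mu\in\mathbb Q\Sigma_n$ be the Young symmetrizer, $V_\mu=\mathbb Q\Sigma_n c_\mu$ the corresponding irreducible representation, $e_\mu$ the idempotent multiple of $c_\mu$, and $S_\mu(X)$ the image of $e_\mu$ on $X^{\otimes n}$,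 that is, an object which splits this idempotent. Let $\Lambda^nX$ be the image of $\frac1{n!}\sum_{\sigma\in\Sigma_n}\mathrm{sgn}(\sigma)\sigma$ on $X^{\otimes n}$. Let $R_n$ be the Grothendieck group of finite dimensional rational representations of $\Sigma_n$, with the product $R_p\times R_q\to R_{p+q}$, $\mathrm{cl}(V)\,\mathrm{cl}(W)=\mathrm{cl}\bigl(\mathrm{Ind}_{\Sigma_p\times\Sigma_q}^{\Sigma_{p+q}}(V\otimes W)\bigr)$, and for a commutative ring $K$ let $K_R[\![t]\!]$ be the ring of power series $\sum_n a_nt^n$ with $a_n\in K\otimes R_n$. Then: 1. All $S_\mu(X)$ and $\Lambda^nX$ exist for every object $X$ of $D^b(\mathfrak A)$, and $\Lambda^nX$ exists for every object $X$ of $\mathfrak A$. 2. $\lambda_\Sigma$ is well defined on $K_0(D^b(\mathfrak A))$: there is a homomorphism $\lambda_\Sigma\colon K_0(D^b(\mathfrak A))\to 1+t\,K_0(D^b(\mathfrak A))_R[\![t]\!]$ from the additive group to the multiplicative group such that $\lambda_\Sigma(\mathrm{cl}(X))=\sum_\mu \mathrm{cl}(S_\mu(X))\otimes\mathrm{cl}(V_\mu)\,t^{|\mu|}$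 for every object $X$ of $D^b(\mathfrak A)$. 3. There are special $\lambda$-ring structures $\lambda(x)=\sum_n\lambda^n(x)t^n$ on $K_0(\mathfrak A)$ and on $K_0(D^b(\mathfrak A))$ such that $\lambda^n(\mathrm{cl}(X))=\mathrm{cl}(\Lambda^nX)$ for all objects $X$ of $\mathfrak A$, respectively of $D^b(\mathfrak A)$, and all $n\ge 0$. Here a special $\lambda$-ring structure on a commutative ring $S$ is a family of maps $\lambda^n\colon S\to S$, $n\ge 0$, with $\lambda^0=1$, $\lambda^1=\mathrm{id}$, $\lambda^n(x+y)=\sum_{i+j=n}\lambda^i(x)\lambda^j(y)$, $\lambda^n(1)=0$ for $n\ge2$, $\lambda^n(xy)=P_n(\lambda^1(x),\dots,\lambda^n(x);\lambda^1(y),\dots,\lambda^n(y))$ and $\lambda^m(\lambda^n(x))=P_{m,n}(\lambda^1(x),\dots,\lambda^{mn}(x))$, where $P_n$ and $P_{m,n}$ are the universal polynomials with integral coefficients given by the corresponding identities for elementary symmetric polynomials. 4. There is a ring isomorphism $i_*\colon K_0(\mathfrak A)\to K_0(D^b(\mathfrak A))$ which maps $\mathrm{cl}(X)$ to the class of $X$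 regarded as a complex in degree $0$, and $i_*(\lambda^n(x))=\lambda^n(i_*(x))$ for all $n\ge0$ and $x\in K_0(\mathfrak A)$. So $i_*$ is an isomorphism of special $\lambda$-rings. -/

import Mathlib

open CategoryTheory CategoryTheory.Limits CategoryTheory.MonoidalCategory

universe w v u

/-- A bounded cochain complex of an additive category, presented by its total object
`tot = ⨁ n, Xⁿ`, the projectors `pr n` of `tot` onto the summands `Xⁿ` (all but finitely many of
which vanish) and the total differential `d`, which is homogeneous of degree one. -/
structure BddCx (A : Type u) [Category.{v} A] [Preadditive A] where
  tot : A
  supp : Finset ℤ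
  pr : ℤ → (tot ⟶ tot)
  pr_pr : ∀ i j, pr i ≫ pr j = if i = j then pr i else 0
  sum_pr : ∑ n ∈ supp, pr n = 𝟙 tot
  d : tot ⟶ tot
  pr_d : ∀ n, pr n ≫ d = d ≫ pr (n + 1)
  d_d : d ≫ d = 0

namespace BddCx

section Basic

variable {A : Type u} [Category.{v} A] [Preadditive A]

attribute [simp] d_d

lemma pr_pr_assoc (X : BddCx A) (i j : ℤ) {Z : A} (h : X.tot ⟶ Z) :
    X.pr i ≫ X.pr j ≫ h = (if i = j then X.pr i else 0) ≫ h := by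
  rw [← Category.assoc, X.pr_pr]

lemma pr_d_assoc (X : BddCx A) (n : ℤ) {Z : A} (h : X.tot ⟶ Z) :
    X.pr n ≫ X.d ≫ h = X.d ≫ X.pr (n + 1) ≫ h := by
  rw [← Category.assoc, X.pr_d, Category.assoc]

@[simp]
lemma d_d_assoc (X : BddCx A) {Z : A} (h : X.tot ⟶ Z) : X.d ≫ X.d ≫ h = 0 := by
  rw [← Category.assoc, X.d_d, zero_comp]

/-- Morphisms of complexes: they respect the grading and the differential. -/
@[ext]
structure Hom (X Y : BddCx A) where
  f : X.tot ⟶ Y.tot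
  pr_f : ∀ n, X.pr n ≫ f = f ≫ Y.pr n
  d_f : X.d ≫ f = f ≫ Y.d

lemma Hom.pr_f_assoc {X Y : BddCx A} (f : Hom X Y) (n : ℤ) {Z : A} (h : Y.tot ⟶ Z) :
    X.pr n ≫ f.f ≫ h = f.f ≫ Y.pr n ≫ h := by
  rw [← Category.assoc, f.pr_f, Category.assoc]

lemma Hom.d_f_assoc {X Y : BddCx A} (f : Hom X Y) {Z : A} (h : Y.tot ⟶ Z) :
    X.d ≫ f.f ≫ h = f.f ≫ Y.d ≫ h := by
  rw [← Category.assoc, f.d_f, Category.assoc]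

instance : Category (BddCx A) where
  Hom := Hom
  id X := ⟨𝟙 _, by simp, by simp⟩
  comp f g := ⟨f.f ≫ g.f, fun n => by rw [f.pr_f_assoc, g.pr_f, Category.assoc],
    by rw [f.d_f_assoc, g.d_f, Category.assoc]⟩

@[ext]
lemma hom_ext {X Y : BddCx A} {f g : X ⟶ Y} (h : f.f = g.f) : f = g := Hom.ext h

@[simp] lemma id_f (X : BddCx A) : Hom.f (𝟙 X) = 𝟙 X.tot := rfl
@[simp] lemma comp_f {X Y Z : BddCx A} (f : X ⟶ Y) (g : Y ⟶ Z) :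
    (f ≫ g).f = f.f ≫ g.f := rfl

/-- An isomorphism of complexes from an isomorphism of the total objects. -/
@[simps]
def isoMk {X Y : BddCx A} (e : X.tot ≅ Y.tot) (h₁ : ∀ n, X.pr n ≫ e.hom = e.hom ≫ Y.pr n)
    (h₂ : X.d ≫ e.hom = e.hom ≫ Y.d) : X ≅ Y where
  hom := ⟨e.hom, h₁, h₂⟩
  inv := ⟨e.inv, fun n => by rw [Iso.eq_inv_comp, ← Category.assoc, ← h₁ n]; simp,
    by rw [Iso.eq_inv_comp, ← Category.assoc, ← h₂]; simp⟩

lemma pr_eq_zero (X : BddCx A) {n : ℤ} (hn : n ∉ X.supp) : X.pr n = 0 := by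
  have h := congrArg (fun f => X.pr n ≫ f) X.sum_pr
  simp only [Preadditive.comp_sum, X.pr_pr, Category.comp_id] at h
  rw [← h]
  simp [hn]

/-- Two morphisms out of the total object agree if they agree on all graded pieces. -/
lemma tot_ext (X : BddCx A) {Z : A} {f g : X.tot ⟶ Z} (h : ∀ n, X.pr n ≫ f = X.pr n ≫ g) :
    f = g := by
  have : (∑ n ∈ X.supp, X.pr n) ≫ f = (∑ n ∈ X.supp, X.pr n) ≫ g := by
    simp only [Preadditive.sum_comp, h]
  simpa [X.sum_pr] using this

/-- The operator that is multiplication by `(-1) ^ n` in degree `n`. -/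
def sgn (X : BddCx A) : X.tot ⟶ X.tot := ∑ n ∈ X.supp, n.negOnePow • X.pr n

lemma pr_sgn (X : BddCx A) (n : ℤ) : X.pr n ≫ X.sgn = n.negOnePow • X.pr n := by
  simp only [sgn, Preadditive.comp_sum, Linear.comp_units_smul, X.pr_pr, smul_ite, smul_zero,
    Finset.sum_ite_eq]
  split_ifs with h
  · rfl
  · simp [X.pr_eq_zero h]

lemma pr_sgn_assoc (X : BddCx A) (n : ℤ) {Z : A} (h : X.tot ⟶ Z) :
    X.pr n ≫ X.sgn ≫ h = (n.negOnePow • X.pr n) ≫ h := by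
  rw [← Category.assoc, pr_sgn]

@[simp]
lemma sgn_sgn (X : BddCx A) : X.sgn ≫ X.sgn = 𝟙 _ := by
  refine X.tot_ext fun n => ?_
  rw [pr_sgn_assoc, Linear.units_smul_comp, pr_sgn, smul_smul]
  simp

lemma sgn_d (X : BddCx A) : X.sgn ≫ X.d = - X.d ≫ X.sgn := by
  refine X.tot_ext fun n => ?_
  rw [pr_sgn_assoc, Linear.units_smul_comp, Preadditive.comp_neg,
    pr_d_assoc, pr_sgn, Linear.comp_units_smul, pr_d]
  simp [Int.negOnePow_succ]

lemma sgn_f {X Y : BddCx A} (f : X ⟶ Y) : X.sgn ≫ f.f = f.f ≫ Y.sgn := by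
  refine X.tot_ext fun n => ?_
  rw [pr_sgn_assoc, Linear.units_smul_comp, f.pr_f_assoc, pr_sgn, f.pr_f, Linear.comp_units_smul]

end Basic

section Tensor

variable {A : Type u} [Category.{v} A] [Preadditive A] [MonoidalCategory A]
  [MonoidalPreadditive A]

lemma neg_tensor {X X' Y Y' : A} (f : X ⟶ X') (g : Y ⟶ Y') : (-f) ⊗ₘ g = -(f ⊗ₘ g) := by
  rw [eq_neg_iff_add_eq_zero, ← MonoidalPreadditive.add_tensor, neg_add_cancel,
    MonoidalPreadditive.zero_tensor]

lemma tensor_neg {X X' Y Y' : A} (f : X ⟶ X') (g : Y ⟶ Y') : f ⊗ₘ (-g) = -(f ⊗ₘ g) := by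
  rw [eq_neg_iff_add_eq_zero, ← MonoidalPreadditive.tensor_add, neg_add_cancel,
    MonoidalPreadditive.tensor_zero]

lemma smul_tensor {X X' Y Y' : A} (u : ℤˣ) (f : X ⟶ X') (g : Y ⟶ Y') :
    (u • f) ⊗ₘ g = u • (f ⊗ₘ g) := by
  rcases Int.units_eq_one_or u with rfl | rfl <;> simp [neg_tensor, tensor_neg]

lemma tensor_smul {X X' Y Y' : A} (u : ℤˣ) (f : X ⟶ X') (g : Y ⟶ Y') :
    f ⊗ₘ (u • g) = u • (f ⊗ₘ g) := by
  rcases Int.units_eq_one_or u with rfl | rfl <;> simp [neg_tensor, tensor_neg]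

lemma tot_ext₂ (X Y : BddCx A) {Z : A} {f g : X.tot ⊗ Y.tot ⟶ Z}
    (h : ∀ i j, (X.pr i ⊗ₘ Y.pr j) ≫ f = (X.pr i ⊗ₘ Y.pr j) ≫ g) : f = g := by
  have : ((∑ i ∈ X.supp, X.pr i) ⊗ₘ (∑ j ∈ Y.supp, Y.pr j)) ≫ f =
      ((∑ i ∈ X.supp, X.pr i) ⊗ₘ (∑ j ∈ Y.supp, Y.pr j)) ≫ g := by
    simp only [sum_tensor, tensor_sum, Preadditive.sum_comp, h]
  simpa [X.sum_pr, Y.sum_pr] using this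

lemma tot_ext₃ (X Y W : BddCx A) {Z : A} {f g : (X.tot ⊗ Y.tot) ⊗ W.tot ⟶ Z}
    (h : ∀ i j k, ((X.pr i ⊗ₘ Y.pr j) ⊗ₘ W.pr k) ≫ f = ((X.pr i ⊗ₘ Y.pr j) ⊗ₘ W.pr k) ≫ g) :
    f = g := by
  have : (((∑ i ∈ X.supp, X.pr i) ⊗ₘ (∑ j ∈ Y.supp, Y.pr j)) ⊗ₘ (∑ k ∈ W.supp, W.pr k)) ≫ f =
      (((∑ i ∈ X.supp, X.pr i) ⊗ₘ (∑ j ∈ Y.supp, Y.pr j)) ⊗ₘ (∑ k ∈ W.supp, W.pr k)) ≫ g := by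
    simp only [sum_tensor, tensor_sum, Preadditive.sum_comp, h]
  simpa [X.sum_pr, Y.sum_pr, W.sum_pr] using this

/-- The projector of `X ⊗ Y` onto `⨁ (i + j = n), Xⁱ ⊗ Yʲ`. -/
def tensorPr (X Y : BddCx A) (n : ℤ) : X.tot ⊗ Y.tot ⟶ X.tot ⊗ Y.tot :=
  ∑ i ∈ X.supp, ∑ j ∈ Y.supp, if i + j = n then X.pr i ⊗ₘ Y.pr j else 0

lemma pr_tensorPr (X Y : BddCx A) (i j n : ℤ) :
    (X.pr i ⊗ₘ Y.pr j) ≫ tensorPr X Y n = if i + j = n then X.pr i ⊗ₘ Y.pr j else 0 := by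
  by_cases hi : i ∈ X.supp
  · by_cases hj : j ∈ Y.supp
    · simp only [tensorPr, Preadditive.comp_sum]
      rw [Finset.sum_eq_single i, Finset.sum_eq_single j]
      · split_ifs <;> simp [pr_pr]
      · intro b _ hb
        split_ifs
        · simp [Y.pr_pr, hb.symm]
        · simp
      · simp [hj]
      · intro b _ hb
        refine Finset.sum_eq_zero fun c _ => ?_
        split_ifs
        · simp [X.pr_pr, hb.symm]
        · simp
      · simp [hi]
    · simp [Y.pr_eq_zero hj]
  · simp [X.pr_eq_zero hi]

lemma pr_tensorPr_assoc (X Y : BddCx A) (i j n : ℤ) {Z : A} (h : X.tot ⊗ Y.tot ⟶ Z) :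
    (X.pr i ⊗ₘ Y.pr j) ≫ tensorPr X Y n ≫ h =
      (if i + j = n then X.pr i ⊗ₘ Y.pr j else 0) ≫ h := by
  rw [← Category.assoc, pr_tensorPr]

/-- The differential of `X ⊗ Y`, given by `d ⊗ 1 + (-1)ⁱ ⊗ d` on `Xⁱ ⊗ Yʲ`. -/
def tensorD (X Y : BddCx A) : X.tot ⊗ Y.tot ⟶ X.tot ⊗ Y.tot :=
  X.d ▷ Y.tot + X.sgn ⊗ₘ Y.d

lemma tensorPr_tensorPr (X Y : BddCx A) (n m : ℤ) :
    tensorPr X Y n ≫ tensorPr X Y m = if n = m then tensorPr X Y n else 0 := by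
  refine tot_ext₂ X Y fun i j => ?_
  rw [pr_tensorPr_assoc]
  split_ifs with h₁ h₂ h₂
  · rw [pr_tensorPr, pr_tensorPr, h₁, if_pos h₂, if_pos rfl]
  · rw [pr_tensorPr, h₁, if_neg h₂, comp_zero]
  · rw [pr_tensorPr, if_neg h₁, zero_comp]
  · simp

/-- The set of degrees supporting `X ⊗ Y`. -/
def tensorSupp (X Y : BddCx A) : Finset ℤ := Finset.image₂ (· + ·) X.supp Y.supp

lemma pr_tensor_eq_zero (X Y : BddCx A) {i j : ℤ} (h : i + j ∉ tensorSupp X Y) :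
    X.pr i ⊗ₘ Y.pr j = 0 := by
  by_cases hi : i ∈ X.supp
  · have hj : j ∉ Y.supp := fun hj => h (Finset.mem_image₂_of_mem hi hj)
    simp [Y.pr_eq_zero hj]
  · simp [X.pr_eq_zero hi]

lemma sum_tensorPr (X Y : BddCx A) : ∑ n ∈ tensorSupp X Y, tensorPr X Y n = 𝟙 _ := by
  refine tot_ext₂ X Y fun i j => ?_
  simp only [Preadditive.comp_sum, pr_tensorPr, Finset.sum_ite_eq, Category.comp_id]
  split_ifs with h
  · rfl
  · rw [pr_tensor_eq_zero X Y h]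

lemma sum_smul_tensorPr (X Y : BddCx A) :
    ∑ n ∈ tensorSupp X Y, n.negOnePow • tensorPr X Y n = X.sgn ⊗ₘ Y.sgn := by
  refine tot_ext₂ X Y fun i j => ?_
  simp only [Preadditive.comp_sum, Linear.comp_units_smul, pr_tensorPr, smul_ite, smul_zero,
    Finset.sum_ite_eq, tensorHom_comp_tensorHom, pr_sgn]
  split_ifs with h
  · rw [smul_tensor, tensor_smul, smul_smul, Int.negOnePow_add]
  · rw [smul_tensor, tensor_smul, pr_tensor_eq_zero X Y h, smul_zero, smul_zero]

lemma pr_comp_tensorD (X Y : BddCx A) (i j : ℤ) :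
    (X.pr i ⊗ₘ Y.pr j) ≫ tensorD X Y = (X.d ⊗ₘ 𝟙 Y.tot) ≫ (X.pr (i + 1) ⊗ₘ Y.pr j) +
      i.negOnePow • ((𝟙 X.tot ⊗ₘ Y.d) ≫ (X.pr i ⊗ₘ Y.pr (j + 1))) := by
  simp only [tensorD, Preadditive.comp_add, ← tensorHom_id, tensorHom_comp_tensorHom, pr_d, pr_sgn,
    Category.id_comp, Category.comp_id, smul_tensor]

lemma tensorPr_tensorD (X Y : BddCx A) (n : ℤ) :
    tensorPr X Y n ≫ tensorD X Y = tensorD X Y ≫ tensorPr X Y (n + 1) := by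
  refine tot_ext₂ X Y fun i j => ?_
  rw [pr_tensorPr_assoc, ← Category.assoc, pr_comp_tensorD, Preadditive.add_comp,
    Linear.units_smul_comp, Category.assoc, Category.assoc, pr_tensorPr, pr_tensorPr]
  by_cases h : i + j = n
  · rw [if_pos h, if_pos (by omega), if_pos (by omega), pr_comp_tensorD]
  · rw [if_neg h, if_neg (by omega), if_neg (by omega)]
    simp

lemma tensorD_tensorD (X Y : BddCx A) : tensorD X Y ≫ tensorD X Y = 0 := by
  have h₁ : (X.d ⊗ₘ 𝟙 Y.tot) ≫ (X.sgn ⊗ₘ Y.d) = - (X.sgn ⊗ₘ Y.d) ≫ (X.d ⊗ₘ 𝟙 Y.tot) := by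
    rw [tensorHom_comp_tensorHom, tensorHom_comp_tensorHom, sgn_d, neg_tensor]
    simp
  have h₂ : (X.d ⊗ₘ 𝟙 Y.tot) ≫ (X.d ⊗ₘ 𝟙 Y.tot) = 0 := by
    rw [tensorHom_comp_tensorHom, d_d, MonoidalPreadditive.zero_tensor]
  have h₃ : (X.sgn ⊗ₘ Y.d) ≫ (X.sgn ⊗ₘ Y.d) = 0 := by
    rw [tensorHom_comp_tensorHom, d_d, MonoidalPreadditive.tensor_zero]
  simp only [tensorD, ← tensorHom_id, Preadditive.add_comp, Preadditive.comp_add, h₁, h₂, h₃]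
  simp

/-- The tensor product of bounded complexes: `(X ⊗ Y)ⁿ = ⨁ (i + j = n), Xⁱ ⊗ Yʲ` with differential
`d ⊗ 1 + (-1)ⁱ ⊗ d` on `Xⁱ ⊗ Yʲ`. -/
@[reducible]
def tensor (X Y : BddCx A) : BddCx A where
  tot := X.tot ⊗ Y.tot
  supp := tensorSupp X Y
  pr := tensorPr X Y
  pr_pr := tensorPr_tensorPr X Y
  sum_pr := sum_tensorPr X Y
  d := tensorD X Y
  pr_d := tensorPr_tensorD X Y
  d_d := tensorD_tensorD X Y

lemma tensor_sgn (X Y : BddCx A) : (tensor X Y).sgn = X.sgn ⊗ₘ Y.sgn :=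
  sum_smul_tensorPr X Y

/-- The tensor product of morphisms of complexes. -/
@[simps]
def tensorMap {X X' Y Y' : BddCx A} (f : X ⟶ X') (g : Y ⟶ Y') : tensor X Y ⟶ tensor X' Y' where
  f := f.f ⊗ₘ g.f
  pr_f n := by
    refine tot_ext₂ X Y fun i j => ?_
    rw [pr_tensorPr_assoc, tensorHom_comp_tensorHom_assoc, f.pr_f, g.pr_f,
      ← tensorHom_comp_tensorHom_assoc, pr_tensorPr]
    split_ifs
    · simp [f.pr_f, g.pr_f]
    · simp
  d_f := by
    simp only [tensorD, ← tensorHom_id, Preadditive.add_comp, Preadditive.comp_add,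
      tensorHom_comp_tensorHom, sgn_f, f.d_f, g.d_f, Category.id_comp, Category.comp_id]

/-- The monoidal unit, placed in degree `0`. -/
@[reducible]
def unit : BddCx A where
  tot := 𝟙_ A
  supp := {0}
  pr n := if n = 0 then 𝟙 _ else 0
  pr_pr i j := by split_ifs <;> simp_all
  sum_pr := by simp
  d := 0
  pr_d := by simp
  d_d := by simp

lemma unit_sgn : (unit (A := A)).sgn = 𝟙 (𝟙_ A) := by
  simp [sgn]

lemma pr_tensorPr_left (X Y Z : BddCx A) (i j k n : ℤ) :
    ((X.pr i ⊗ₘ Y.pr j) ⊗ₘ Z.pr k) ≫ tensorPr (tensor X Y) Z n =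
      if i + j + k = n then (X.pr i ⊗ₘ Y.pr j) ⊗ₘ Z.pr k else 0 := by
  have h : (X.pr i ⊗ₘ Y.pr j) ⊗ₘ Z.pr k = ((X.pr i ⊗ₘ Y.pr j) ⊗ₘ 𝟙 Z.tot) ≫
      (tensorPr X Y (i + j) ⊗ₘ Z.pr k) := by
    rw [tensorHom_comp_tensorHom, pr_tensorPr, if_pos rfl, Category.id_comp]
  have h' := pr_tensorPr (tensor X Y) Z (i + j) k n
  dsimp only at h'
  rw [h, Category.assoc, h']
  split_ifs <;> simp

lemma pr_tensorPr_right (X Y Z : BddCx A) (i j k n : ℤ) :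
    (X.pr i ⊗ₘ (Y.pr j ⊗ₘ Z.pr k)) ≫ tensorPr X (tensor Y Z) n =
      if i + j + k = n then X.pr i ⊗ₘ (Y.pr j ⊗ₘ Z.pr k) else 0 := by
  have h : X.pr i ⊗ₘ (Y.pr j ⊗ₘ Z.pr k) = (𝟙 X.tot ⊗ₘ (Y.pr j ⊗ₘ Z.pr k)) ≫
      (X.pr i ⊗ₘ tensorPr Y Z (j + k)) := by
    rw [tensorHom_comp_tensorHom, pr_tensorPr, if_pos rfl, Category.id_comp]
  have h' := pr_tensorPr X (tensor Y Z) i (j + k) n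
  dsimp only at h'
  rw [h, Category.assoc, h', add_assoc]
  split_ifs <;> simp

/-- The associator, given by the associator of the total objects. -/
@[simps!]
def assoc (X Y Z : BddCx A) : tensor (tensor X Y) Z ≅ tensor X (tensor Y Z) :=
  isoMk (α_ X.tot Y.tot Z.tot) (fun n => by
    refine tot_ext₃ X Y Z fun i j k => ?_
    rw [← Category.assoc, pr_tensorPr_left, associator_naturality_assoc, pr_tensorPr_right]
    split_ifs <;> simp) (by
    simp only [tensorD.eq_1 (tensor X Y), tensorD.eq_1 X (tensor Y Z), tensor_sgn]
    have h₁ : (X.d ⊗ₘ 𝟙 Y.tot + X.sgn ⊗ₘ Y.d) ⊗ₘ 𝟙 Z.tot =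
        (X.d ⊗ₘ 𝟙 Y.tot) ⊗ₘ 𝟙 Z.tot + (X.sgn ⊗ₘ Y.d) ⊗ₘ 𝟙 Z.tot := by
      simp only [tensorHom_id, MonoidalPreadditive.add_whiskerRight]
    have h₂ : X.sgn ⊗ₘ (Y.d ⊗ₘ 𝟙 Z.tot + Y.sgn ⊗ₘ Z.d) =
        X.sgn ⊗ₘ (Y.d ⊗ₘ 𝟙 Z.tot) + X.sgn ⊗ₘ (Y.sgn ⊗ₘ Z.d) := by
      simp only [MonoidalCategory.tensorHom_def X.sgn, MonoidalPreadditive.whiskerLeft_add, Preadditive.comp_add]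
    simp only [tensorD, Preadditive.add_comp, Preadditive.comp_add, ← tensorHom_id, h₁, h₂,
      associator_naturality, add_assoc, id_tensorHom_id])

/-- The left unitor, given by the left unitor of the total object. -/
@[simps!]
def leftUnitor (X : BddCx A) : tensor unit X ≅ X :=
  isoMk (λ_ X.tot) (fun n => by
    refine tot_ext₂ unit X fun i j => ?_
    rw [pr_tensorPr_assoc]
    dsimp only
    by_cases hi : i = 0
    · subst hi
      simp only [if_true, zero_add, id_tensorHom, leftUnitor_naturality_assoc, X.pr_pr]
      split_ifs <;> simp
    · simp [hi]) (by simp [tensorD, unit_sgn])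

/-- The right unitor, given by the right unitor of the total object. -/
@[simps!]
def rightUnitor (X : BddCx A) : tensor X unit ≅ X :=
  isoMk (ρ_ X.tot) (fun n => by
    refine tot_ext₂ X unit fun i j => ?_
    rw [pr_tensorPr_assoc]
    dsimp only
    by_cases hj : j = 0
    · subst hj
      simp only [if_true, add_zero, tensorHom_id, rightUnitor_naturality_assoc, X.pr_pr]
      split_ifs <;> simp
    · simp [hj]) (by simp [tensorD])

instance : MonoidalCategoryStruct (BddCx A) where
  tensorObj := tensor
  whiskerLeft X _ _ g := tensorMap (𝟙 X) g
  whiskerRight f Y := tensorMap f (𝟙 Y)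
  tensorHom := tensorMap
  tensorUnit := unit
  associator := assoc
  leftUnitor := leftUnitor
  rightUnitor := rightUnitor

@[simp] lemma tensorHom_f {X X' Y Y' : BddCx A} (f : X ⟶ X') (g : Y ⟶ Y') :
    (f ⊗ₘ g).f = f.f ⊗ₘ g.f := rfl
@[simp] lemma whiskerLeft_f (X : BddCx A) {Y Y' : BddCx A} (g : Y ⟶ Y') :
    (X ◁ g).f = X.tot ◁ g.f := by
  change 𝟙 X.tot ⊗ₘ g.f = _
  simp
@[simp] lemma whiskerRight_f {X X' : BddCx A} (f : X ⟶ X') (Y : BddCx A) :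
    (f ▷ Y).f = f.f ▷ Y.tot := by
  change f.f ⊗ₘ 𝟙 Y.tot = _
  simp
@[simp] lemma associator_hom_f (X Y Z : BddCx A) :
    (α_ X Y Z).hom.f = (α_ X.tot Y.tot Z.tot).hom := rfl
@[simp] lemma associator_inv_f (X Y Z : BddCx A) :
    (α_ X Y Z).inv.f = (α_ X.tot Y.tot Z.tot).inv := rfl
@[simp] lemma leftUnitor_hom_f' (X : BddCx A) : (λ_ X).hom.f = (λ_ X.tot).hom := rfl
@[simp] lemma rightUnitor_hom_f' (X : BddCx A) : (ρ_ X).hom.f = (ρ_ X.tot).hom := rfl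
@[simp] lemma tensorObj_tot (X Y : BddCx A) : (X ⊗ Y).tot = X.tot ⊗ Y.tot := rfl
@[simp] lemma tensorUnit_tot : (𝟙_ (BddCx A)).tot = 𝟙_ A := rfl

instance : MonoidalCategory (BddCx A) where
  tensorHom_def f g := by ext; exact (MonoidalCategory.tensorHom_def f.f g.f).trans (by simp)
  id_tensorHom_id X Y := by ext; exact id_tensorHom_id X.tot Y.tot
  tensorHom_comp_tensorHom f g h k := by
    ext; exact tensorHom_comp_tensorHom f.f g.f h.f k.f
  whiskerLeft_id X Y := by ext; exact id_tensorHom_id X.tot Y.tot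
  id_whiskerRight X Y := by ext; exact id_tensorHom_id X.tot Y.tot
  associator_naturality f g h := by ext; exact associator_naturality f.f g.f h.f
  leftUnitor_naturality f := by
    ext; simp
  rightUnitor_naturality f := by
    ext; simp
  pentagon W X Y Z := by
    ext; simp
  triangle X Y := by
    ext; simp

end Tensor

section Braiding

variable {A : Type u} [Category.{v} A] [Preadditive A] [MonoidalCategory A]
  [MonoidalPreadditive A] [SymmetricCategory A]

/-- The morphism `X.tot ⊗ Y.tot ⟶ Y.tot ⊗ X.tot` which is `(-1)^(ij)` times the symmetry of `A` on
`Xⁱ ⊗ Yʲ`. -/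
def braidHom (X Y : BddCx A) : X.tot ⊗ Y.tot ⟶ Y.tot ⊗ X.tot :=
  ∑ i ∈ X.supp, ∑ j ∈ Y.supp, (i * j).negOnePow • (X.pr i ⊗ₘ Y.pr j) ≫ (β_ X.tot Y.tot).hom

lemma pr_braidHom (X Y : BddCx A) (i j : ℤ) :
    (X.pr i ⊗ₘ Y.pr j) ≫ braidHom X Y =
      (i * j).negOnePow • (β_ X.tot Y.tot).hom ≫ (Y.pr j ⊗ₘ X.pr i) := by
  rw [← BraidedCategory.braiding_naturality]
  by_cases hi : i ∈ X.supp
  · by_cases hj : j ∈ Y.supp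
    · simp only [braidHom, Preadditive.comp_sum]
      rw [Finset.sum_eq_single i, Finset.sum_eq_single j]
      · simp [Linear.comp_units_smul, pr_pr]
      · intro b _ hb
        simp [Linear.comp_units_smul, Y.pr_pr, hb.symm]
      · simp [hj]
      · intro b _ hb
        refine Finset.sum_eq_zero fun c _ => ?_
        simp [Linear.comp_units_smul, X.pr_pr, hb.symm]
      · simp [hi]
    · simp [Y.pr_eq_zero hj]
  · simp [X.pr_eq_zero hi]

lemma pr_braidHom_assoc (X Y : BddCx A) (i j : ℤ) {Z : A} (h : Y.tot ⊗ X.tot ⟶ Z) :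
    (X.pr i ⊗ₘ Y.pr j) ≫ braidHom X Y ≫ h =
      ((i * j).negOnePow • (β_ X.tot Y.tot).hom ≫ (Y.pr j ⊗ₘ X.pr i)) ≫ h := by
  rw [← Category.assoc, pr_braidHom]

lemma pr_braidHom_right (X Y Z : BddCx A) (i j k : ℤ) :
    (X.pr i ⊗ₘ (Y.pr j ⊗ₘ Z.pr k)) ≫ braidHom X (tensor Y Z) =
      (i * j + i * k).negOnePow •
        (β_ X.tot (Y.tot ⊗ Z.tot)).hom ≫ ((Y.pr j ⊗ₘ Z.pr k) ⊗ₘ X.pr i) := by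
  have h : X.pr i ⊗ₘ (Y.pr j ⊗ₘ Z.pr k) = (𝟙 X.tot ⊗ₘ (Y.pr j ⊗ₘ Z.pr k)) ≫
      (X.pr i ⊗ₘ tensorPr Y Z (j + k)) := by
    rw [tensorHom_comp_tensorHom, pr_tensorPr, if_pos rfl, Category.id_comp]
  have h' := pr_braidHom X (tensor Y Z) i (j + k)
  dsimp only at h'
  rw [h, Category.assoc, h', Linear.comp_units_smul, mul_add,
    BraidedCategory.braiding_naturality_assoc, tensorHom_comp_tensorHom, pr_tensorPr, if_pos rfl,
    Category.id_comp]

lemma pr_braidHom_left (X Y Z : BddCx A) (i j k : ℤ) :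
    ((X.pr i ⊗ₘ Y.pr j) ⊗ₘ Z.pr k) ≫ braidHom (tensor X Y) Z =
      (i * k + j * k).negOnePow •
        (β_ (X.tot ⊗ Y.tot) Z.tot).hom ≫ (Z.pr k ⊗ₘ (X.pr i ⊗ₘ Y.pr j)) := by
  have h : (X.pr i ⊗ₘ Y.pr j) ⊗ₘ Z.pr k = ((X.pr i ⊗ₘ Y.pr j) ⊗ₘ 𝟙 Z.tot) ≫
      (tensorPr X Y (i + j) ⊗ₘ Z.pr k) := by
    rw [tensorHom_comp_tensorHom, pr_tensorPr, if_pos rfl, Category.id_comp]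
  have h' := pr_braidHom (tensor X Y) Z (i + j) k
  dsimp only at h'
  rw [h, Category.assoc, h', Linear.comp_units_smul, add_mul,
    BraidedCategory.braiding_naturality_assoc, tensorHom_comp_tensorHom, pr_tensorPr, if_pos rfl,
    Category.id_comp]

/-- Hexagon identity on a graded piece, for the total objects. -/
lemma hexagon_aux (X Y Z : BddCx A) :
    (α_ X.tot Y.tot Z.tot).hom ≫ braidHom X (tensor Y Z) ≫ (α_ Y.tot Z.tot X.tot).hom =
      (braidHom X Y ▷ Z.tot) ≫ (α_ Y.tot X.tot Z.tot).hom ≫ (Y.tot ◁ braidHom X Z) := by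
  refine tot_ext₃ X Y Z fun i j k => ?_
  have h₁ : ((X.pr i ⊗ₘ Y.pr j) ⊗ₘ Z.pr k) ≫ braidHom X Y ▷ Z.tot =
      (i * j).negOnePow • (β_ X.tot Y.tot).hom ▷ Z.tot ≫ ((Y.pr j ⊗ₘ X.pr i) ⊗ₘ Z.pr k) := by
    rw [← tensorHom_id, tensorHom_comp_tensorHom, pr_braidHom, smul_tensor, ← tensorHom_id,
      tensorHom_comp_tensorHom, Category.comp_id, Category.id_comp]
  have h₂ : (Y.pr j ⊗ₘ (X.pr i ⊗ₘ Z.pr k)) ≫ Y.tot ◁ braidHom X Z =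
      (i * k).negOnePow • Y.tot ◁ (β_ X.tot Z.tot).hom ≫ (Y.pr j ⊗ₘ (Z.pr k ⊗ₘ X.pr i)) := by
    rw [← id_tensorHom, tensorHom_comp_tensorHom, pr_braidHom, tensor_smul, ← id_tensorHom,
      tensorHom_comp_tensorHom, Category.comp_id, Category.id_comp]
  rw [associator_naturality_assoc, reassoc_of% (pr_braidHom_right X Y Z i j k), reassoc_of% h₁]
  simp only [Linear.comp_units_smul, Linear.units_smul_comp, Category.assoc,
    associator_naturality, associator_naturality_assoc, h₂, smul_smul, Int.negOnePow_add]
  congr 1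
  exact BraidedCategory.hexagon_forward_assoc _ _ _ _

lemma hexagon_aux' (X Y Z : BddCx A) :
    (α_ X.tot Y.tot Z.tot).inv ≫ braidHom (tensor X Y) Z ≫ (α_ Z.tot X.tot Y.tot).inv =
      (X.tot ◁ braidHom Y Z) ≫ (α_ X.tot Z.tot Y.tot).inv ≫ (braidHom X Z ▷ Y.tot) := by
  rw [← cancel_epi (α_ X.tot Y.tot Z.tot).hom]
  refine tot_ext₃ X Y Z fun i j k => ?_
  have h₁ : (X.pr i ⊗ₘ (Y.pr j ⊗ₘ Z.pr k)) ≫ X.tot ◁ braidHom Y Z =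
      (j * k).negOnePow • X.tot ◁ (β_ Y.tot Z.tot).hom ≫ (X.pr i ⊗ₘ (Z.pr k ⊗ₘ Y.pr j)) := by
    rw [← id_tensorHom, tensorHom_comp_tensorHom, pr_braidHom, tensor_smul, ← id_tensorHom,
      tensorHom_comp_tensorHom, Category.comp_id, Category.id_comp]
  have h₂ : ((X.pr i ⊗ₘ Z.pr k) ⊗ₘ Y.pr j) ≫ braidHom X Z ▷ Y.tot =
      (i * k).negOnePow • (β_ X.tot Z.tot).hom ▷ Y.tot ≫ ((Z.pr k ⊗ₘ X.pr i) ⊗ₘ Y.pr j) := by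
    rw [← tensorHom_id, tensorHom_comp_tensorHom, pr_braidHom, smul_tensor, ← tensorHom_id,
      tensorHom_comp_tensorHom, Category.comp_id, Category.id_comp]
  rw [Iso.hom_inv_id_assoc, reassoc_of% (pr_braidHom_left X Y Z i j k),
    associator_naturality_assoc, reassoc_of% h₁]
  simp only [Linear.comp_units_smul, Linear.units_smul_comp, Category.assoc,
    associator_inv_naturality, associator_inv_naturality_assoc, h₂, smul_smul, Int.negOnePow_add]
  rw [mul_comm]
  congr 1
  rw [← cancel_epi (α_ X.tot Y.tot Z.tot).inv, Iso.inv_hom_id_assoc]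
  exact BraidedCategory.hexagon_reverse_assoc _ _ _ _

lemma braidHom_braidHom (X Y : BddCx A) : braidHom X Y ≫ braidHom Y X = 𝟙 _ := by
  refine tot_ext₂ X Y fun i j => ?_
  rw [pr_braidHom_assoc, Linear.units_smul_comp, Category.assoc, pr_braidHom,
    Linear.comp_units_smul, smul_smul, SymmetricCategory.symmetry_assoc, mul_comm j i]
  simp

/-- The symmetry of the tensor product of complexes, with the Koszul sign. -/
def braid (X Y : BddCx A) : tensor X Y ≅ tensor Y X :=
  isoMk ⟨braidHom X Y, braidHom Y X, braidHom_braidHom X Y, braidHom_braidHom Y X⟩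
    (fun n => by
      refine tot_ext₂ X Y fun i j => ?_
      dsimp only
      rw [pr_tensorPr_assoc, pr_braidHom_assoc, Linear.units_smul_comp, Category.assoc,
        pr_tensorPr, add_comm j i]
      split_ifs
      · rw [pr_braidHom]
      · simp) (by
      refine tot_ext₂ X Y fun i j => ?_
      dsimp only
      rw [← Category.assoc, pr_comp_tensorD, pr_braidHom_assoc, Preadditive.add_comp,
        Linear.units_smul_comp, Linear.units_smul_comp, Category.assoc, Category.assoc,
        Category.assoc, pr_braidHom, pr_braidHom, pr_comp_tensorD]
      simp only [Linear.comp_units_smul, Preadditive.comp_add, smul_add, smul_smul,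
        ← BraidedCategory.braiding_naturality_assoc]
      rw [add_comm]
      congr 1
      · rw [mul_add, mul_one, Int.negOnePow_add, mul_comm, mul_assoc]
        simp
      · rw [add_mul, one_mul, Int.negOnePow_add])

instance : BraidedCategory (BddCx A) where
  braiding := braid
  braiding_naturality_right X Y Z f := by
    ext
    refine tot_ext₂ X Y fun i j => ?_
    change (X.pr i ⊗ₘ Y.pr j) ≫ (𝟙 X.tot ⊗ₘ f.f) ≫ braidHom X Z =
      (X.pr i ⊗ₘ Y.pr j) ≫ braidHom X Y ≫ (f.f ⊗ₘ 𝟙 X.tot)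
    rw [pr_braidHom_assoc, tensorHom_comp_tensorHom_assoc, f.pr_f, Category.comp_id,
      ← Category.id_comp (X.pr i), ← tensorHom_comp_tensorHom_assoc, pr_braidHom,
      Linear.comp_units_smul, Linear.units_smul_comp, Category.assoc, tensorHom_comp_tensorHom,
      f.pr_f, ← BraidedCategory.braiding_naturality, ← BraidedCategory.braiding_naturality,
      tensorHom_comp_tensorHom_assoc]
    simp
  braiding_naturality_left {X Y} f Z := by
    ext
    refine tot_ext₂ X Z fun i j => ?_
    change (X.pr i ⊗ₘ Z.pr j) ≫ (f.f ⊗ₘ 𝟙 Z.tot) ≫ braidHom Y Z =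
      (X.pr i ⊗ₘ Z.pr j) ≫ braidHom X Z ≫ (𝟙 Z.tot ⊗ₘ f.f)
    rw [pr_braidHom_assoc, tensorHom_comp_tensorHom_assoc, f.pr_f, Category.comp_id,
      ← Category.id_comp (Z.pr j), ← tensorHom_comp_tensorHom_assoc, pr_braidHom,
      Linear.comp_units_smul, Linear.units_smul_comp, Category.assoc, tensorHom_comp_tensorHom,
      f.pr_f, ← BraidedCategory.braiding_naturality, ← BraidedCategory.braiding_naturality,
      tensorHom_comp_tensorHom_assoc]
    simp
  hexagon_forward X Y Z := by
    ext
    change _ ≫ braidHom X (tensor Y Z) ≫ _ = (braidHom X Y ⊗ₘ 𝟙 Z.tot) ≫ _ ≫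
      (𝟙 Y.tot ⊗ₘ braidHom X Z)
    rw [tensorHom_id, id_tensorHom]
    exact hexagon_aux X Y Z
  hexagon_reverse X Y Z := by
    ext
    change _ ≫ braidHom (tensor X Y) Z ≫ _ = (𝟙 X.tot ⊗ₘ braidHom Y Z) ≫ _ ≫
      (braidHom X Z ⊗ₘ 𝟙 Y.tot)
    rw [tensorHom_id, id_tensorHom]
    exact hexagon_aux' X Y Z

instance : SymmetricCategory (BddCx A) where
  symmetry X Y := by
    ext
    exact braidHom_braidHom X Y

end Braiding

end BddCx

namespace BddLoc

open ZeroObject Pretriangulated HomologicalComplex DerivedCategory HomotopicalAlgebra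

variable (A : Type u) [Category.{v} A] [Abelian A]

/-- Cochain complexes that vanish outside of a finite range of degrees. -/
def bdd : ObjectProperty (CochainComplex A ℤ) :=
  fun K => (∃ a, K.IsStrictlyGE a) ∧ ∃ b, K.IsStrictlyLE b

/-- In the homotopy category of bounded below complexes, those that are homotopy equivalent to
a bounded complex. -/
def hbdd : ObjectProperty (HomotopyCategory.Plus A) :=
  fun K => ∃ (L : CochainComplex.Plus A) (b : ℤ), L.obj.IsStrictlyLE b ∧
    Nonempty (K ≅ (HomotopyCategory.Plus.quotient A).obj L)

instance : (hbdd A).ContainsZero where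
  exists_zero := by
    refine ⟨(HomotopyCategory.Plus.quotient A).obj ⟨0, 0, inferInstance⟩, ?_,
      ⟨0, 0, inferInstance⟩, 0, inferInstanceAs (CochainComplex.IsStrictlyLE
        (0 : CochainComplex A ℤ) 0), ⟨Iso.refl _⟩⟩
    rw [IsZero.iff_id_eq_zero]
    ext
    exact (Functor.map_isZero (HomotopyCategory.quotient A (.up ℤ)) (isZero_zero _)).eq_of_src _ _

instance : (hbdd A).IsStableUnderShift ℤ where
  isStableUnderShiftBy n :=
    { le_shift K hK := by
        obtain ⟨L, b, hb, ⟨e⟩⟩ := hK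
        obtain ⟨a, ha⟩ := L.property
        refine ⟨⟨(shiftFunctor _ n).obj L.obj, a - n, L.obj.isStrictlyGE_shift a n _ (by lia)⟩,
          b - n, L.obj.isStrictlyLE_shift b n (b - n) (by lia), ⟨?_⟩⟩
        exact (shiftFunctor _ n).mapIso e ≪≫ (HomotopyCategory.Plus.fullyFaithfulι A).preimageIso
          (((HomotopyCategory.Plus.ι A).commShiftIso n).app _ ≪≫
          (((HomotopyCategory.quotient A (.up ℤ)).commShiftIso n).symm.app L.obj)) }

lemma isStrictlyLE_mappingCone {K L : CochainComplex A ℤ} (f : K ⟶ L) (n₁ n₂ : ℤ)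
    [K.IsStrictlyLE n₁] [L.IsStrictlyLE n₂] :
    (CochainComplex.mappingCone f).IsStrictlyLE (max n₁ n₂) := by
  rw [CochainComplex.isStrictlyLE_iff]
  intro i hi
  have h₁ : n₁ < i := lt_of_le_of_lt (le_max_left _ _) hi
  have h₂ : n₂ < i := lt_of_le_of_lt (le_max_right _ _) hi
  simp only [CochainComplex.mappingCone.isZero_X_iff]
  exact ⟨K.isZero_of_isStrictlyLE n₁ _, L.isZero_of_isStrictlyLE n₂ _⟩

instance : (hbdd A).IsTriangulatedClosed₃ where
  ext₃' T hT h₁ h₂ := by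
    obtain ⟨⟨K, a₁, ha₁⟩, b₁, hb₁, ⟨e₁⟩⟩ := h₁
    obtain ⟨⟨L, a₂, ha₂⟩, b₂, hb₂, ⟨e₂⟩⟩ := h₂
    dsimp only at hb₁ hb₂
    obtain ⟨f, hf⟩ : ∃ f : K ⟶ L,
        (HomotopyCategory.quotient A (.up ℤ)).map f = (e₁.inv ≫ T.mor₁ ≫ e₂.hom).hom :=
      (HomotopyCategory.quotient _ _).map_surjective _
    have hc : CochainComplex.plus A (CochainComplex.mappingCone f) :=
      ⟨min (a₁ - 1) a₂, CochainComplex.isStrictlyGE_mappingCone f a₁ a₂ _ (by simp) (by simp)⟩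
    let e : ((HomotopyCategory.Plus.ι A).mapTriangle.obj T).obj₃ ≅
        (CochainComplex.mappingCone.triangleh f).obj₃ :=
      Triangle.π₃.mapIso (isoTriangleOfIso₁₂ _ _
        ((HomotopyCategory.Plus.ι A).map_distinguished T hT)
        (HomotopyCategory.mappingCone_triangleh_distinguished f)
        ((HomotopyCategory.Plus.ι A).mapIso e₁) ((HomotopyCategory.Plus.ι A).mapIso e₂) (by
          change T.mor₁.hom ≫ e₂.hom.hom = e₁.hom.hom ≫ (HomotopyCategory.quotient A _).map f
          rw [hf]
          exact congrArg InducedCategory.Hom.hom (e₁.hom_inv_id_assoc (T.mor₁ ≫ e₂.hom)).symm))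
    exact ⟨(HomotopyCategory.Plus.quotient A).obj ⟨_, hc⟩,
      ⟨_, _, isStrictlyLE_mappingCone A f b₁ b₂, ⟨Iso.refl _⟩⟩,
      ⟨(HomotopyCategory.Plus.fullyFaithfulι A).preimageIso e⟩⟩

instance : (hbdd A).IsTriangulated where
  toIsTriangulatedClosed₂ := .of_isTriangulatedClosed₃

/-- The homotopy category of bounded complexes. -/
abbrev HBdd := (hbdd A).FullSubcategory

instance : (hbdd A).IsVerdierLeftLocalizing (HomotopyCategory.Plus.subcategoryAcyclic A) where
  fac {K L} φ hK hL := by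
    obtain ⟨K', b, hb', ⟨e⟩⟩ := hK
    obtain ⟨L, rfl⟩ := HomotopyCategory.Plus.quotient_obj_surjective L
    obtain ⟨φ', hφ⟩ := (HomotopyCategory.Plus.quotient _).map_surjective (e.inv ≫ φ)
    have hL' : L.obj.Acyclic :=
      (HomotopyCategory.quotient_obj_mem_subcategoryAcyclic_iff_acyclic _).1 hL
    obtain ⟨a, ha⟩ := L.property
    have ht : CochainComplex.plus A (L.obj.truncLE b) := ⟨a, inferInstance⟩
    let M : CochainComplex.Plus A := ⟨_, ht⟩
    refine ⟨(HomotopyCategory.Plus.quotient A).obj M,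
      e.hom ≫ (HomotopyCategory.Plus.quotient A).map
        (ObjectProperty.homMk (inv (K'.obj.ιTruncLE b) ≫ CochainComplex.truncLEMap φ'.hom b)),
      (HomotopyCategory.Plus.quotient A).map (ObjectProperty.homMk (L.obj.ιTruncLE b)),
      ⟨M, b, ?_, ⟨Iso.refl _⟩⟩, ?_, ?_⟩
    · exact inferInstanceAs ((L.obj.truncLE b).IsStrictlyLE b)
    · exact (HomotopyCategory.quotient_obj_mem_subcategoryAcyclic_iff_acyclic _).2 (hL'.truncLE _)
    · rw [Category.assoc, ← Functor.map_comp, ← Iso.eq_inv_comp, ← hφ]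
      congr 1
      ext1
      change (inv (K'.obj.ιTruncLE b) ≫ CochainComplex.truncLEMap φ'.hom b) ≫
        L.obj.ιTruncLE b = _
      rw [Category.assoc, CochainComplex.ιTruncLE_naturality, IsIso.inv_hom_id_assoc]

section

variable [HasDerivedCategory.{w} A]

lemma plus_of_bounded {X : DerivedCategory A} (h : TStructure.t.bounded X) :
    TStructure.t.plus X := h.1

lemma bounded_Qh (K : HBdd A) :
    TStructure.t.bounded (DerivedCategory.Qh.obj K.obj.obj) := by
  obtain ⟨K, L, b, hb, ⟨e⟩⟩ := K
  obtain ⟨a, ha⟩ := L.property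
  let e' : Q.obj L.obj ≅ Qh.obj K.obj := (quotientCompQhIso A).symm.app L.obj ≪≫
    (HomotopyCategory.Plus.ι A ⋙ Qh).mapIso e.symm
  exact ⟨⟨a, TStructure.t.isGE_of_iso e' a⟩, ⟨b, TStructure.t.isLE_of_iso e' b⟩⟩

/-- The functor from the homotopy category of bounded complexes to the bounded derived category. -/
noncomputable def Qhb : HBdd A ⥤ DerivedCategory.Bounded A :=
  TStructure.t.bounded.lift ((hbdd A).ι ⋙ HomotopyCategory.Plus.ι A ⋙ DerivedCategory.Qh)
    (bounded_Qh A)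

/-- The inclusion of the bounded derived category in the bounded below derived category. -/
noncomputable def toPlus : DerivedCategory.Bounded A ⥤ DerivedCategory.Plus A :=
  TStructure.t.plus.lift TStructure.t.bounded.ι (fun X => plus_of_bounded A X.property)

instance : (toPlus A).Full := by dsimp only [toPlus]; infer_instance
instance : (toPlus A).Faithful := by dsimp only [toPlus]; infer_instance

instance : (Qhb A).EssSurj where
  mem_essImage := by
    rintro ⟨X, ⟨a, ha⟩, b, hb⟩
    obtain ⟨K, hKa, hKb, ⟨e⟩⟩ := exists_iso_Q_obj_of_isGE_of_isLE X a b
    exact ⟨⟨(HomotopyCategory.Plus.quotient A).obj ⟨K, a, hKa⟩, ⟨K, a, hKa⟩, b, hKb, ⟨Iso.refl _⟩⟩,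
      ⟨TStructure.t.bounded.fullyFaithfulι.preimageIso ((quotientCompQhIso A).app K ≪≫ e.symm)⟩⟩

/-- Quasi-isomorphisms between bounded complexes, up to homotopy. -/
abbrev hqis : MorphismProperty (HBdd A) :=
  ((HomotopyCategory.Plus.subcategoryAcyclic A).inverseImage (hbdd A).ι).trW

instance : (Qhb A).IsLocalization (hqis A) :=
  ((hbdd A).triangulatedLocalizerMorphism
    (HomotopyCategory.Plus.subcategoryAcyclic A)).isLocalization_of_isLocalizedFullyFaithful
      (L₂ := DerivedCategory.Plus.Qh) (F := toPlus A) (Iso.refl _)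

end

/-- The category of bounded complexes. -/
abbrev CB := (bdd A).FullSubcategory

/-- The functor from bounded complexes to bounded complexes up to homotopy. -/
def quotb : CB A ⥤ HBdd A :=
  (hbdd A).lift ((CochainComplex.plus A).lift (bdd A).ι (fun K => K.property.1) ⋙
    HomotopyCategory.Plus.quotient A) (fun K =>
      ⟨_, K.property.2.choose, K.property.2.choose_spec, ⟨Iso.refl _⟩⟩)

instance : (quotb A).Full where
  map_surjective f := by
    obtain ⟨g, hg⟩ := (HomotopyCategory.quotient A (.up ℤ)).map_surjective f.hom.hom
    exact ⟨ObjectProperty.homMk g, ObjectProperty.hom_ext _ (ObjectProperty.hom_ext _ hg)⟩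

instance : (quotb A).EssSurj where
  mem_essImage K := by
    obtain ⟨K, L, b, hb, ⟨e⟩⟩ := K
    exact ⟨⟨L.obj, L.property, b, hb⟩, ⟨(hbdd A).fullyFaithfulι.preimageIso e.symm⟩⟩

/-- Homotopy equivalences of bounded complexes. -/
abbrev heq : MorphismProperty (CB A) :=
  (homotopyEquivalences A (.up ℤ)).inverseImage (bdd A).ι

/-- Quasi-isomorphisms of bounded complexes. -/
abbrev qis : MorphismProperty (CB A) :=
  (HomologicalComplex.quasiIso A (.up ℤ)).inverseImage (bdd A).ι

lemma bdd_cylinder (K : CochainComplex A ℤ) (hK : bdd A K) : bdd A (cylinder K) := by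
  refine ⟨CochainComplex.plus_cylinder K hK.1, ?_⟩
  obtain ⟨-, b, hb⟩ := hK
  refine ⟨b, ?_⟩
  rw [CochainComplex.isStrictlyLE_iff]
  intro i hi
  refine homotopyCofiber.isZero_X (biprod.lift (𝟙 K) (-𝟙 K)) i ?_ (fun j hj ↦ ?_)
  · exact IsZero.of_iso ((biprod_isZero_iff _ _).2 ⟨K.isZero_of_isStrictlyLE b i,
      K.isZero_of_isStrictlyLE b i⟩) ((HomologicalComplex.eval A (.up ℤ) i).mapBiprod _ _)
  · simp only [ComplexShape.up_Rel] at hj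
    exact K.isZero_of_isStrictlyLE b _ (by lia)

/-- The localization functor from `HBdd A` to complexes up to homotopy. -/
abbrev ιι : HBdd A ⥤ HomotopyCategory A (.up ℤ) := (hbdd A).ι ⋙ HomotopyCategory.Plus.ι A

instance : (quotb A).IsLocalization (heq A) :=
  Functor.isLocalization_of_essSurj_of_full_of_exists_cylinders _ _
    (fun K L f hf ↦ by
      have h : IsIso ((ιι A).map ((quotb A).map f)) :=
        HomotopyCategory.quotient_inverts_homotopyEquivalences _ _ _ hf
      exact isIso_of_fully_faithful (ιι A) _) (by
    rintro K L f₀ f₁ hf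
    obtain ⟨f₀, rfl⟩ := ObjectProperty.homMk_surjective f₀
    obtain ⟨f₁, rfl⟩ := ObjectProperty.homMk_surjective f₁
    replace hf := HomotopyCategory.homotopyOfEq f₀ f₁ ((ιι A).congr_map hf)
    exact ⟨K.obj.precylinder.toFullSubcategory (bdd_cylinder A _ K.property),
      Precylinder.LeftHomotopy.fullSubcategoryEquiv.symm
      { h := cylinder.desc _ _ hf
        h₀ := cylinder.ι₀_desc _ _ _
        h₁ := cylinder.ι₁_desc _ _ _ }, ⟨cylinder.homotopyEquiv _ (fun n ↦ ⟨n - 1, by simp⟩), rfl⟩⟩)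

lemma hqis_iff {K L : CB A} (f : K ⟶ L) : hqis A ((quotb A).map f) ↔ qis A f := by
  have h₁ : hqis A ((quotb A).map f) ↔
      (HomotopyCategory.Plus.subcategoryAcyclic A).trW ((quotb A).map f).hom :=
    ObjectProperty.inverseImage_trW_iff _ _ _
  rw [h₁, ← HomotopyCategory.Plus.quasiIso_eq_subcategoryAcyclic_trW]
  exact HomotopyCategory.quotient_map_mem_quasiIso_iff _

variable [HasDerivedCategory.{w} A]

/-- The functor from bounded complexes to the bounded derived category. -/
noncomputable def Qb : CB A ⥤ DerivedCategory.Bounded A := quotb A ⋙ Qhb A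

instance : (Qb A).IsLocalization (qis A) := by
  refine Functor.IsLocalization.comp (quotb A) (Qhb A) (heq A) (hqis A) (qis A) ?_ ?_ ?_
  · intro K L f hf
    exact Localization.inverts (Qhb A) (hqis A) _ ((hqis_iff A f).2 hf)
  · intro K L f hf
    exact homotopyEquivalences_le_quasiIso _ _ _ hf
  · intro K L f hf
    let e₁ := (quotb A).objObjPreimageIso K
    let e₂ := (quotb A).objObjPreimageIso L
    obtain ⟨g, hg⟩ := (quotb A).map_surjective (e₁.hom ≫ f ≫ e₂.inv)
    let e : Arrow.mk ((quotb A).map g) ≅ Arrow.mk f := Arrow.isoMk e₁ e₂ (by simp [hg])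
    have hg' := ((hqis A).arrow_mk_iso_iff e).2 hf
    exact ⟨_, _, g, (hqis_iff A g).1 hg', ⟨e⟩⟩

end BddLoc

namespace BddCx

section Degrees

variable {A : Type u} [Category.{v} A] [Abelian A]

lemma exists_split (X : BddCx A) (n : ℤ) : ∃ (Y : A) (i : Y ⟶ X.tot) (p : X.tot ⟶ Y),
    i ≫ p = 𝟙 Y ∧ p ≫ i = X.pr n :=
  IsIdempotentComplete.idempotents_split X.tot (X.pr n) (by simp [X.pr_pr])

/-- The component of degree `n`. -/
noncomputable def deg (X : BddCx A) (n : ℤ) : A := (X.exists_split n).choose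

/-- The inclusion of the component of degree `n`. -/
noncomputable def inc (X : BddCx A) (n : ℤ) : X.deg n ⟶ X.tot :=
  (X.exists_split n).choose_spec.choose

/-- The projection to the component of degree `n`. -/
noncomputable def proj (X : BddCx A) (n : ℤ) : X.tot ⟶ X.deg n :=
  (X.exists_split n).choose_spec.choose_spec.choose

@[simp]
lemma inc_proj (X : BddCx A) (n : ℤ) : X.inc n ≫ X.proj n = 𝟙 _ :=
  (X.exists_split n).choose_spec.choose_spec.choose_spec.1

lemma proj_inc (X : BddCx A) (n : ℤ) : X.proj n ≫ X.inc n = X.pr n :=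
  (X.exists_split n).choose_spec.choose_spec.choose_spec.2

lemma proj_inc_assoc (X : BddCx A) (n : ℤ) {Z : A} (h : X.tot ⟶ Z) :
    X.proj n ≫ X.inc n ≫ h = X.pr n ≫ h := by
  rw [← Category.assoc, proj_inc]

lemma inc_pr (X : BddCx A) (n : ℤ) : X.inc n ≫ X.pr n = X.inc n := by
  rw [← proj_inc, ← Category.assoc, inc_proj, Category.id_comp]

lemma pr_proj (X : BddCx A) (n : ℤ) : X.pr n ≫ X.proj n = X.proj n := by
  rw [← proj_inc, Category.assoc, inc_proj, Category.comp_id]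

lemma inc_pr_assoc (X : BddCx A) (n : ℤ) {Z : A} (h : X.tot ⟶ Z) :
    X.inc n ≫ X.pr n ≫ h = X.inc n ≫ h := by
  rw [← Category.assoc, inc_pr]

lemma inc_proj_of_ne (X : BddCx A) {n m : ℤ} (h : n ≠ m) : X.inc n ≫ X.proj m = 0 := by
  rw [← inc_pr, Category.assoc, ← X.pr_proj m, pr_pr_assoc, if_neg h, zero_comp, comp_zero]

lemma inc_d (X : BddCx A) (n : ℤ) : X.inc n ≫ X.d = X.inc n ≫ X.d ≫ X.pr (n + 1) := by
  rw [← pr_d, inc_pr_assoc]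

lemma inc_f {X Y : BddCx A} (f : X ⟶ Y) (n : ℤ) :
    X.inc n ≫ f.f = X.inc n ≫ f.f ≫ Y.pr n := by
  rw [← f.pr_f, inc_pr_assoc]

lemma isZero_deg (X : BddCx A) {n : ℤ} (hn : X.pr n = 0) : IsZero (X.deg n) := by
  rw [IsZero.iff_id_eq_zero, ← inc_proj, ← inc_pr, hn]
  simp

/-- The associated cochain complex in the usual sense. -/
noncomputable def toCx (X : BddCx A) : CochainComplex A ℤ where
  X n := X.deg n
  d i j := X.inc i ≫ X.d ≫ X.proj j
  shape i j hij := by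
    rw [← Category.assoc, inc_d, Category.assoc, Category.assoc, ← X.pr_proj j, pr_pr_assoc,
      if_neg (show ¬ i + 1 = j from hij), zero_comp, comp_zero,
      comp_zero]
  d_comp_d' i j k hij hjk := by
    obtain rfl : i + 1 = j := hij
    simp only [Category.assoc, proj_inc_assoc]
    rw [← pr_d_assoc, d_d_assoc, comp_zero, comp_zero]

/-- The associated morphism of cochain complexes. -/
noncomputable def toCxMap {X Y : BddCx A} (f : X ⟶ Y) : X.toCx ⟶ Y.toCx where
  f n := X.inc n ≫ f.f ≫ Y.proj n
  comm' i j hij := by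
    obtain rfl : i + 1 = j := hij
    dsimp only [toCx]
    simp only [Category.assoc, proj_inc_assoc]
    rw [← f.pr_f_assoc, inc_pr_assoc, ← f.d_f_assoc, ← pr_d_assoc, inc_pr_assoc]

lemma toCx_bdd (X : BddCx A) : BddLoc.bdd A X.toCx := by
  obtain ⟨a, ha⟩ := X.supp.bddBelow
  obtain ⟨b, hb⟩ := X.supp.bddAbove
  refine ⟨⟨a, ?_⟩, ⟨b, ?_⟩⟩
  · rw [CochainComplex.isStrictlyGE_iff]
    intro i hi
    exact X.isZero_deg (X.pr_eq_zero fun h => absurd (ha h) (by lia))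
  · rw [CochainComplex.isStrictlyLE_iff]
    intro i hi
    exact X.isZero_deg (X.pr_eq_zero fun h => absurd (hb h) (by lia))

variable (A) in
/-- The functor to bounded cochain complexes in the usual sense. -/
noncomputable def toCB : BddCx A ⥤ BddLoc.CB A where
  obj X := ⟨X.toCx, X.toCx_bdd⟩
  map f := ObjectProperty.homMk (toCxMap f)
  map_id X := by
    ext n
    exact (congrArg (X.inc n ≫ ·) (Category.id_comp _)).trans (X.inc_proj n)
  map_comp {X Y Z} f g := by
    ext n
    change X.inc n ≫ (f.f ≫ g.f) ≫ Z.proj n =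
      (X.inc n ≫ f.f ≫ Y.proj n) ≫ Y.inc n ≫ g.f ≫ Z.proj n
    simp only [Category.assoc, proj_inc_assoc]
    rw [← f.pr_f_assoc, inc_pr_assoc]

instance : (toCB A).Faithful where
  map_injective {X Y f g} h := by
    ext
    refine X.tot_ext fun n => ?_
    have h' : X.inc n ≫ f.f ≫ Y.proj n = X.inc n ≫ g.f ≫ Y.proj n :=
      congrArg (fun k => k.hom.f n) h
    rw [← proj_inc, Category.assoc, Category.assoc, inc_f, inc_f g, ← Y.proj_inc]
    simp only [← Category.assoc] at h' ⊢
    simp only [Category.assoc] at h' ⊢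
    rw [reassoc_of% h']

lemma inc_sum {X Y : BddCx A} (g : ∀ n, X.deg n ⟶ Y.deg n) (n : ℤ) :
    X.inc n ≫ (∑ n ∈ X.supp, X.proj n ≫ g n ≫ Y.inc n) = g n ≫ Y.inc n := by
  by_cases hn : n ∈ X.supp
  · rw [Preadditive.comp_sum, Finset.sum_eq_single n, ← Category.assoc, inc_proj, Category.id_comp]
    · intro m _ hm
      rw [← Category.assoc, inc_proj_of_ne _ hm.symm, zero_comp]
    · exact fun h => absurd hn h
  · exact (X.isZero_deg (X.pr_eq_zero hn)).eq_of_src _ _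

lemma tot_ext' (X : BddCx A) {Z : A} {f g : X.tot ⟶ Z} (h : ∀ n, X.inc n ≫ f = X.inc n ≫ g) :
    f = g := by
  refine X.tot_ext fun n => ?_
  rw [← proj_inc, Category.assoc, Category.assoc, h]

instance : (toCB A).Full where
  map_surjective {X Y} g := by
    let g' : ∀ n, X.deg n ⟶ Y.deg n := fun n => g.hom.f n
    have hg : ∀ n, (X.inc n ≫ X.d ≫ X.proj (n + 1)) ≫ g' (n + 1) =
        g' n ≫ Y.inc n ≫ Y.d ≫ Y.proj (n + 1) := fun n => (g.hom.comm n (n + 1)).symm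
    refine ⟨⟨∑ n ∈ X.supp, X.proj n ≫ g' n ≫ Y.inc n, fun n => ?_, ?_⟩, ?_⟩
    · refine X.tot_ext' fun m => ?_
      rw [← Category.assoc (X.inc m) _ (Y.pr n), inc_sum, ← X.inc_pr m, Category.assoc,
        pr_pr_assoc]
      split_ifs with h
      · subst h
        rw [inc_pr_assoc, inc_sum, Category.assoc, inc_pr]
      · rw [zero_comp, comp_zero, Category.assoc, ← Y.inc_pr m, Category.assoc, Y.pr_pr, if_neg h,
          comp_zero, comp_zero]
    · refine X.tot_ext' fun m => ?_
      rw [← Category.assoc (X.inc m) _ Y.d, inc_sum, ← Category.assoc, inc_d]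
      simp only [Category.assoc]
      rw [Y.inc_d, ← X.proj_inc, ← Y.proj_inc, Category.assoc, inc_sum]
      have := hg m
      simp only [Category.assoc] at this
      simp only [← Category.assoc] at this ⊢
      rw [this]
    · ext n
      change X.inc n ≫ (∑ n ∈ X.supp, X.proj n ≫ g' n ≫ Y.inc n) ≫ Y.proj n = g' n
      rw [← Category.assoc, inc_sum, Category.assoc, inc_proj, Category.comp_id]

attribute [local instance] Abelian.hasFiniteBiproducts

/-- The bounded complex with prescribed components. -/
noncomputable def ofCx (K : CochainComplex A ℤ) (s : Finset ℤ) : BddCx A where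
  tot := ⨁ fun n : {n // n ∈ s} => K.X n.1
  supp := s
  pr n := biproduct.map fun i => if i.1 = n then 𝟙 _ else 0
  pr_pr i j := by
    ext k : 2
    split_ifs with h
    · subst h
      simp only [Category.assoc, biproduct.map_π, biproduct.map_π_assoc]
      split_ifs <;> simp
    · simp only [Category.assoc, biproduct.map_π, biproduct.map_π_assoc]
      split_ifs <;> simp_all
  sum_pr := by
    ext k : 1
    simp only [Preadditive.sum_comp, biproduct.map_π, Category.id_comp]
    rw [Finset.sum_eq_single k.1]
    · simp
    · intro m _ hm
      rw [if_neg hm.symm, comp_zero]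
    · exact fun h => absurd k.2 h
  d := biproduct.matrix fun (i j : {n // n ∈ s}) => K.d i.1 j.1
  pr_d n := by
    ext k l : 2
    simp only [Category.assoc, biproduct.map_π, biproduct.matrix_π, biproduct.ι_map_assoc,
      biproduct.matrix_π_assoc, biproduct.ι_desc, biproduct.ι_desc_assoc]
    split_ifs with h₁ h₂ h₂
    · simp
    · rw [K.shape _ _ (show ¬ (l.1 + 1 = k.1) by lia)]
      simp
    · rw [K.shape _ _ (show ¬ (l.1 + 1 = k.1) by lia)]
      simp
    · simp
  d_d := by
    ext k l : 2
    simp [biproduct.matrix_desc]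

/-- The inclusion of a component of `ofCx K s`. -/
noncomputable def io (K : CochainComplex A ℤ) (s : Finset ℤ) (i : {n // n ∈ s}) :
    K.X i.1 ⟶ (ofCx K s).tot := biproduct.ι (fun n : {n // n ∈ s} => K.X n.1) i

/-- The projection to a component of `ofCx K s`. -/
noncomputable def po (K : CochainComplex A ℤ) (s : Finset ℤ) (i : {n // n ∈ s}) :
    (ofCx K s).tot ⟶ K.X i.1 := biproduct.π (fun n : {n // n ∈ s} => K.X n.1) i

lemma ofCx_d (K : CochainComplex A ℤ) (s : Finset ℤ) (i j : {n // n ∈ s}) :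
    io K s i ≫ (ofCx K s).d ≫ po K s j = K.d i.1 j.1 := by
  simp [ofCx, io, po]

lemma io_po (K : CochainComplex A ℤ) (s : Finset ℤ) (i : {n // n ∈ s}) :
    io K s i ≫ po K s i = 𝟙 _ := biproduct.ι_π_self _ _

lemma ofCx_pr (K : CochainComplex A ℤ) (s : Finset ℤ) (i : {n // n ∈ s}) :
    (ofCx K s).pr i.1 = po K s i ≫ io K s i := by
  refine biproduct.hom_ext _ _ fun l => biproduct.hom_ext' _ _ fun k => ?_
  dsimp only [ofCx, io, po]
  simp only [Category.assoc, biproduct.map_π]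
  by_cases h₁ : k = i
  · subst h₁
    by_cases h₂ : k = l
    · subst h₂
      simp
    · rw [biproduct.ι_π_ne_assoc _ h₂, biproduct.ι_π_ne _ h₂]
      simp
  · rw [biproduct.ι_π_ne_assoc _ h₁, zero_comp]
    by_cases h₂ : k = l
    · subst h₂
      rw [if_neg fun h => h₁ (Subtype.ext h), comp_zero, comp_zero]
    · rw [biproduct.ι_π_ne_assoc _ h₂, zero_comp]

/-- The components of `ofCx K s`. -/
noncomputable def ofCxIso (K : CochainComplex A ℤ) (s : Finset ℤ) (i : {n // n ∈ s}) :
    (ofCx K s).deg i.1 ≅ K.X i.1 where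
  hom := (ofCx K s).inc i.1 ≫ po K s i
  inv := io K s i ≫ (ofCx K s).proj i.1
  hom_inv_id := by
    rw [Category.assoc, ← Category.assoc (po K s i), ← ofCx_pr, inc_pr_assoc, inc_proj]
  inv_hom_id := by
    rw [Category.assoc, proj_inc_assoc, ofCx_pr, Category.assoc, io_po, Category.comp_id, io_po]

instance : (toCB A).EssSurj where
  mem_essImage := by
    rintro ⟨K, ⟨a, ha⟩, b, hb⟩
    let s := Finset.Icc a b
    have h₁ : ∀ i, i ∉ s → IsZero (K.X i) := fun i hi => by
      by_cases h : i < a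
      · exact K.isZero_of_isStrictlyGE a i
      · exact K.isZero_of_isStrictlyLE b i (by
          by_contra h'
          exact hi (Finset.mem_Icc.2 ⟨by lia, by lia⟩))
    have h₂ : ∀ i, i ∉ s → IsZero ((ofCx K s).deg i) := fun i hi =>
      isZero_deg _ (pr_eq_zero _ hi)
    let e : ∀ i, (ofCx K s).deg i ≅ K.X i := fun i =>
      if hi : i ∈ s then ofCxIso K s ⟨i, hi⟩ else (h₂ i hi).iso (h₁ i hi)
    refine ⟨ofCx K s, ⟨(BddLoc.bdd A).fullyFaithfulι.preimageIso
      (HomologicalComplex.Hom.isoOfComponents e ?_)⟩⟩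
    intro i j hij
    by_cases hi : i ∈ s
    · by_cases hj : j ∈ s
      · have h₁ : (e i).hom = (ofCx K s).inc i ≫ po K s ⟨i, hi⟩ := by
          simp only [e, dif_pos hi]
          rfl
        have h₂ : (e j).hom = (ofCx K s).inc j ≫ po K s ⟨j, hj⟩ := by
          simp only [e, dif_pos hj]
          rfl
        have h₃ := ofCx_d K s ⟨i, hi⟩ ⟨j, hj⟩
        have h₄ := ofCx_pr K s ⟨i, hi⟩
        have h₅ := ofCx_pr K s ⟨j, hj⟩
        rw [h₁, h₂]
        change ((ofCx K s).inc i ≫ po K s ⟨i, hi⟩) ≫ K.d i j =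
          ((ofCx K s).inc i ≫ (ofCx K s).d ≫ (ofCx K s).proj j) ≫
            (ofCx K s).inc j ≫ po K s ⟨j, hj⟩
        rw [Category.assoc, Category.assoc, Category.assoc, proj_inc_assoc, h₅, Category.assoc,
          io_po, Category.comp_id, ← inc_pr_assoc (ofCx K s) i ((ofCx K s).d ≫ _), h₄, Category.assoc, h₃]
      · exact (h₁ j hj).eq_of_tgt _ _
    · exact (h₂ i hi).eq_of_src _ _

instance : (toCB A).IsEquivalence where

end Degrees

end BddCx

namespace BddCx

section Total

variable {A : Type u} [Category.{v} A] [Abelian A]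

/-- A differential object, as a complex indexed by one point. -/
def dc (T : A) (d : T ⟶ T) (h : d ≫ d = 0) : HomologicalComplex A (ComplexShape.refl Unit) where
  X _ := T
  d _ _ := d
  shape i j hij := absurd (Subsingleton.elim i j) hij
  d_comp_d' _ _ _ _ _ := h

/-- A morphism of differential objects. -/
def dcMap {T T' : A} {d : T ⟶ T} {d' : T' ⟶ T'} {h : d ≫ d = 0} {h' : d' ≫ d' = 0}
    (f : T ⟶ T') (hf : f ≫ d' = d ≫ f) : dc T d h ⟶ dc T' d' h' where
  f _ := f
  comm' _ _ _ := hf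

lemma quasiIso_τ₂ {S₁ S₂ : ShortComplex (HomologicalComplex A (ComplexShape.refl Unit))}
    (φ : S₁ ⟶ S₂) (h₁ : S₁.ShortExact) (h₂ : S₂.ShortExact) (hφ₁ : QuasiIso φ.τ₁)
    (hφ₃ : QuasiIso φ.τ₃) : QuasiIso φ.τ₂ := by
  rw [quasiIso_iff]
  intro i
  rw [quasiIsoAt_iff_isIso_homologyMap]
  have hm : Mono (HomologicalComplex.homologyMap φ.τ₂ i) := by
    apply Abelian.mono_of_epi_of_mono_of_mono
      ((ComposableArrows.δ₀Functor ⋙ ComposableArrows.δ₀Functor).map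
        (HomologicalComplex.HomologySequence.mapComposableArrows₅ φ h₁ h₂ i i rfl))
    · exact (HomologicalComplex.HomologySequence.composableArrows₅_exact h₁ i i rfl).δ₀.δ₀
    · exact (HomologicalComplex.HomologySequence.composableArrows₅_exact h₂ i i rfl).δ₀.δ₀
    · exact inferInstanceAs (Epi (HomologicalComplex.homologyMap φ.τ₃ i))
    · exact inferInstanceAs (Mono (HomologicalComplex.homologyMap φ.τ₁ i))
    · exact inferInstanceAs (Mono (HomologicalComplex.homologyMap φ.τ₃ i))
  have he : Epi (HomologicalComplex.homologyMap φ.τ₂ i) := by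
    apply Abelian.epi_of_epi_of_epi_of_mono
      ((ComposableArrows.δlastFunctor ⋙ ComposableArrows.δlastFunctor).map
        (HomologicalComplex.HomologySequence.mapComposableArrows₅ φ h₁ h₂ i i rfl))
    · exact (HomologicalComplex.HomologySequence.composableArrows₅_exact h₁ i i rfl).δlast.δlast
    · exact (HomologicalComplex.HomologySequence.composableArrows₅_exact h₂ i i rfl).δlast.δlast
    · exact inferInstanceAs (Epi (HomologicalComplex.homologyMap φ.τ₁ i))
    · exact inferInstanceAs (Epi (HomologicalComplex.homologyMap φ.τ₃ i))
    · exact inferInstanceAs (Mono (HomologicalComplex.homologyMap φ.τ₁ i))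
  exact isIso_of_mono_of_epi _

lemma homologyMap_eq_zero {S₁ S₂ : ShortComplex A} (f : S₁ ⟶ S₂) (h : f.τ₂ = 0) :
    ShortComplex.homologyMap f = 0 := by
  have h' : ShortComplex.cyclesMap f = 0 := by
    rw [← cancel_mono S₂.iCycles, ShortComplex.cyclesMap_i, h, comp_zero, zero_comp]
  rw [← cancel_epi S₁.homologyπ, ShortComplex.homologyπ_naturality, h', zero_comp, comp_zero]

/-- The total short complex. -/
def sc (X : BddCx A) : ShortComplex A := ShortComplex.mk X.d X.d X.d_d

/-- The map on total short complexes. -/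
def scMap {X Y : BddCx A} (f : X ⟶ Y) : X.sc ⟶ Y.sc where
  τ₁ := f.f
  τ₂ := f.f
  τ₃ := f.f
  comm₁₂ := f.d_f.symm
  comm₂₃ := f.d_f.symm

/-- The short complex around degree `n`. -/
noncomputable abbrev scd (X : BddCx A) (n : ℤ) : ShortComplex A := X.toCx.sc' (n - 1) n (n + 1)

/-- The map on the short complexes around degree `n`. -/
noncomputable abbrev scdMap {X Y : BddCx A} (f : X ⟶ Y) (n : ℤ) : X.scd n ⟶ Y.scd n :=
  (HomologicalComplex.shortComplexFunctor' A (.up ℤ) (n - 1) n (n + 1)).map (toCxMap f)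

lemma inc_d_of_eq (X : BddCx A) {m n : ℤ} (h : m + 1 = n) :
    X.inc m ≫ X.d = (X.inc m ≫ X.d ≫ X.proj n) ≫ X.inc n := by
  subst h
  rw [inc_d, ← proj_inc]
  simp only [Category.assoc]

lemma proj_d_of_eq (X : BddCx A) {m n : ℤ} (h : m + 1 = n) :
    X.proj m ≫ (X.inc m ≫ X.d ≫ X.proj n) = X.d ≫ X.proj n := by
  subst h
  rw [proj_inc_assoc, pr_d_assoc, pr_proj]

/-- The inclusion of the short complex around degree `n`. -/
noncomputable def scInc (X : BddCx A) (n : ℤ) : X.scd n ⟶ X.sc where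
  τ₁ := X.inc (n - 1)
  τ₂ := X.inc n
  τ₃ := X.inc (n + 1)
  comm₁₂ := X.inc_d_of_eq (by simp)
  comm₂₃ := X.inc_d_of_eq rfl

/-- The projection to the short complex around degree `n`. -/
noncomputable def scProj (X : BddCx A) (n : ℤ) : X.sc ⟶ X.scd n where
  τ₁ := X.proj (n - 1)
  τ₂ := X.proj n
  τ₃ := X.proj (n + 1)
  comm₁₂ := X.proj_d_of_eq (by simp)
  comm₂₃ := X.proj_d_of_eq rfl

lemma scInc_scProj (X : BddCx A) (n : ℤ) : X.scInc n ≫ X.scProj n = 𝟙 _ := by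
  ext
  · exact X.inc_proj _
  · exact X.inc_proj _
  · exact X.inc_proj _

lemma scInc_scMap {X Y : BddCx A} (f : X ⟶ Y) (n : ℤ) :
    X.scInc n ≫ scMap f = scdMap f n ≫ Y.scInc n := by
  have h : ∀ n, X.inc n ≫ f.f = (X.inc n ≫ f.f ≫ Y.proj n) ≫ Y.inc n := fun n => by
    rw [inc_f, ← proj_inc]
    simp only [Category.assoc]
  ext
  · exact h _
  · exact h _
  · exact h _

lemma scMap_scProj {X Y : BddCx A} (f : X ⟶ Y) (n : ℤ) :
    scMap f ≫ Y.scProj n = X.scProj n ≫ scdMap f n := by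
  have h : ∀ n, f.f ≫ Y.proj n = X.proj n ≫ (X.inc n ≫ f.f ≫ Y.proj n) := fun n => by
    rw [proj_inc_assoc, f.pr_f_assoc, pr_proj]
  ext
  · exact h _
  · exact h _
  · exact h _

lemma homologyMap_sum (X : BddCx A) (s : Finset ℤ) (hs : X.supp ⊆ s) :
    ∑ n ∈ s, ShortComplex.homologyMap (X.scProj n) ≫ ShortComplex.homologyMap (X.scInc n) =
      𝟙 _ := by
  have h : ∑ n ∈ s, ShortComplex.homologyMap (X.scProj n ≫ X.scInc n) - 𝟙 _ =
      ShortComplex.homologyMap (∑ n ∈ s, X.scProj n ≫ X.scInc n - 𝟙 _) := by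
    rw [ShortComplex.homologyMap_sub, ShortComplex.homologyMap_id]
    congr 1
    exact ((ShortComplex.homologyFunctor A).map_sum _ _).symm
  simp only [← ShortComplex.homologyMap_comp]
  rw [← sub_eq_zero, h]
  refine homologyMap_eq_zero _ ?_
  have h₂ : (∑ n ∈ s, X.scProj n ≫ X.scInc n).τ₂ = 𝟙 X.tot := by
    let t : (X.sc ⟶ X.sc) →+ (X.tot ⟶ X.tot) :=
      { toFun := fun f => f.τ₂
        map_zero' := rfl
        map_add' := fun _ _ => rfl }
    refine (map_sum t _ _).trans ?_
    rw [← X.sum_pr, Finset.sum_subset hs fun n _ hn => X.pr_eq_zero hn]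
    exact Finset.sum_congr rfl fun n _ => X.proj_inc n
  rw [ShortComplex.sub_τ₂, h₂]
  exact sub_self _

lemma isIso_homologyMap_iff {X Y : BddCx A} (f : X ⟶ Y) :
    IsIso (ShortComplex.homologyMap (scMap f)) ↔
      ∀ n, IsIso (ShortComplex.homologyMap (scdMap f n)) := by
  have e₁ : ∀ n, ShortComplex.homologyMap (X.scInc n) ≫ ShortComplex.homologyMap (scMap f) =
      ShortComplex.homologyMap (scdMap f n) ≫ ShortComplex.homologyMap (Y.scInc n) := fun n => by
    rw [← ShortComplex.homologyMap_comp, scInc_scMap, ShortComplex.homologyMap_comp]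
  have e₂ : ∀ n, ShortComplex.homologyMap (scMap f) ≫ ShortComplex.homologyMap (Y.scProj n) =
      ShortComplex.homologyMap (X.scProj n) ≫ ShortComplex.homologyMap (scdMap f n) := fun n => by
    rw [← ShortComplex.homologyMap_comp, scMap_scProj, ShortComplex.homologyMap_comp]
  have e₃ : ∀ (Z : BddCx A) (n), ShortComplex.homologyMap (Z.scInc n) ≫
      ShortComplex.homologyMap (Z.scProj n) = 𝟙 _ := fun Z n => by
    rw [← ShortComplex.homologyMap_comp, scInc_scProj, ShortComplex.homologyMap_id]
  constructor
  · intro h n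
    refine ⟨ShortComplex.homologyMap (Y.scInc n) ≫ inv (ShortComplex.homologyMap (scMap f)) ≫
      ShortComplex.homologyMap (X.scProj n), ?_, ?_⟩
    · rw [← Category.assoc, ← e₁]
      simp [e₃]
    · rw [Category.assoc, Category.assoc, ← e₂]
      simp [e₃]
  · intro h
    refine ⟨∑ n ∈ X.supp ∪ Y.supp, ShortComplex.homologyMap (Y.scProj n) ≫
      inv (ShortComplex.homologyMap (scdMap f n)) ≫ ShortComplex.homologyMap (X.scInc n), ?_, ?_⟩
    · rw [Preadditive.comp_sum, ← X.homologyMap_sum _ Finset.subset_union_left]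
      refine Finset.sum_congr rfl fun n _ => ?_
      rw [← Category.assoc, e₂]
      simp
    · rw [Preadditive.sum_comp, ← Y.homologyMap_sum _ Finset.subset_union_right]
      refine Finset.sum_congr rfl fun n _ => ?_
      rw [Category.assoc, Category.assoc, e₁]
      simp

/-- The total differential object. -/
abbrev dcObj (X : BddCx A) : HomologicalComplex A (ComplexShape.refl Unit) := dc X.tot X.d X.d_d

variable (A) in
/-- Quasi-isomorphisms. -/
def qis : MorphismProperty (BddCx A) := (BddLoc.qis A).inverseImage (toCB A)

lemma qis_iff {X Y : BddCx A} (f : X ⟶ Y) :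
    qis A f ↔ QuasiIso (dcMap f.f f.d_f.symm : dcObj X ⟶ dcObj Y) := by
  have h₁ : qis A f ↔ QuasiIso (toCxMap f) := Iff.rfl
  rw [h₁, quasiIso_iff, quasiIso_iff]
  have h₂ : ∀ n, QuasiIsoAt (toCxMap f) n ↔ IsIso (ShortComplex.homologyMap (scdMap f n)) :=
    fun n => by
      rw [quasiIsoAt_iff' (toCxMap f) (n - 1) n (n + 1) (by simp) (by simp),
        ShortComplex.quasiIso_iff]
  have h₃ : ∀ n, QuasiIsoAt (dcMap f.f f.d_f.symm : dcObj X ⟶ dcObj Y) n ↔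
      IsIso (ShortComplex.homologyMap (scMap f)) := fun n => by
    rw [quasiIsoAt_iff' _ n n n (Subsingleton.elim _ _) (Subsingleton.elim _ _),
        ShortComplex.quasiIso_iff]
    rfl
  simp only [h₂, h₃, isIso_homologyMap_iff]
  exact (forall_const _).symm

section

variable [MonoidalCategory A] [SymmetricCategory A] [MonoidalPreadditive A]
  [∀ X : A, PreservesFiniteLimits (tensorLeft X)]
  [∀ X : A, PreservesFiniteColimits (tensorLeft X)]

instance (X : A) : PreservesFiniteLimits (tensorRight X) :=
  preservesFiniteLimits_of_natIso (BraidedCategory.tensorLeftIsoTensorRight X)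

instance (X : A) : PreservesFiniteColimits (tensorRight X) :=
  preservesFiniteColimits_of_natIso (BraidedCategory.tensorLeftIsoTensorRight X)

/-- The short exact sequence `0 ⟶ X ⊗ Z ⟶ X ⊗ Y ⟶ X ⊗ B ⟶ 0` where `Z` is the kernel of `d : Y ⟶ Y`
and `B` the image. -/
noncomputable def tensorSeq (X Y : BddCx A) :
    ShortComplex (HomologicalComplex A (ComplexShape.refl Unit)) where
  X₁ := ((tensorRight (kernel Y.d)).mapHomologicalComplex _).obj (dcObj X)
  X₂ := dcObj (tensor X Y)
  X₃ := ((tensorRight (cokernel (kernel.ι Y.d))).mapHomologicalComplex _).obj (dcObj X)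
  f :=
    { f := fun _ => X.tot ◁ kernel.ι Y.d
      comm' := fun _ _ _ => by
        change X.tot ◁ kernel.ι Y.d ≫ tensorD X Y = X.d ▷ _ ≫ X.tot ◁ kernel.ι Y.d
        rw [tensorD, Preadditive.comp_add, whisker_exchange, ← id_tensorHom,
          tensorHom_comp_tensorHom, kernel.condition, MonoidalPreadditive.tensor_zero, add_zero] }
  g :=
    { f := fun _ => X.tot ◁ cokernel.π (kernel.ι Y.d)
      comm' := fun _ _ _ => by
        change X.tot ◁ _ ≫ X.d ▷ _ = tensorD X Y ≫ X.tot ◁ cokernel.π (kernel.ι Y.d)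
        have h : Y.d ≫ cokernel.π (kernel.ι Y.d) = 0 := by
          refine (congrArg (· ≫ cokernel.π (kernel.ι Y.d)) (kernel.lift_ι Y.d Y.d Y.d_d).symm).trans ?_
          rw [Category.assoc, cokernel.condition, comp_zero]
        rw [tensorD, Preadditive.add_comp, ← whisker_exchange, ← id_tensorHom X.tot (cokernel.π _),
          tensorHom_comp_tensorHom, h, MonoidalPreadditive.tensor_zero, add_zero] }
  zero := by
    ext
    change X.tot ◁ kernel.ι Y.d ≫ X.tot ◁ cokernel.π (kernel.ι Y.d) = 0
    rw [← whiskerLeft_comp, cokernel.condition]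
    simp

lemma tensorSeq_shortExact (X Y : BddCx A) : (tensorSeq X Y).ShortExact := by
  rw [HomologicalComplex.shortExact_iff_degreewise_shortExact]
  intro _
  have h : (ShortComplex.mk (kernel.ι Y.d) (cokernel.π (kernel.ι Y.d))
      (cokernel.condition _)).ShortExact :=
    { exact := ShortComplex.exact_cokernel _ }
  exact h.map_of_exact (tensorLeft X.tot)

lemma qis_tensor {X X' : BddCx A} (f : X ⟶ X') (hf : qis A f) (Y : BddCx A) :
    qis A (f ▷ Y) := by
  rw [qis_iff] at hf ⊢
  let φ : tensorSeq X Y ⟶ tensorSeq X' Y :=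
    { τ₁ := ((tensorRight _).mapHomologicalComplex _).map (dcMap f.f f.d_f.symm)
      τ₂ := dcMap (f ▷ Y).f (f ▷ Y).d_f.symm
      τ₃ := ((tensorRight _).mapHomologicalComplex _).map (dcMap f.f f.d_f.symm)
      comm₁₂ := by
        ext
        change f.f ▷ _ ≫ X'.tot ◁ _ = X.tot ◁ _ ≫ (f ▷ Y).f
        rw [whiskerRight_f, whisker_exchange]
      comm₂₃ := by
        ext
        change (f ▷ Y).f ≫ X'.tot ◁ _ = X.tot ◁ _ ≫ f.f ▷ _
        rw [whiskerRight_f, whisker_exchange] }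
  exact quasiIso_τ₂ φ (tensorSeq_shortExact X Y) (tensorSeq_shortExact X' Y)
    (HomologicalComplex.quasiIso_map_of_preservesHomology _ _)
    (HomologicalComplex.quasiIso_map_of_preservesHomology _ _)

instance : (qis A).IsMultiplicative := by
  dsimp only [qis, BddLoc.qis]
  infer_instance

instance : (qis A).RespectsIso := by
  dsimp only [qis, BddLoc.qis]
  infer_instance

instance : (qis A).IsMonoidal where
  whiskerRight f hf Y := qis_tensor f hf Y
  whiskerLeft X _ _ g hg :=
    ((qis A).arrow_mk_iso_iff (Arrow.isoMk (β_ _ _) (β_ _ _)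
      (BraidedCategory.braiding_naturality_right X g).symm)).2 (qis_tensor g hg X)

end

end Total

end BddCx

section DerivedTensor

variable (A : Type u) [Category.{v} A] [Abelian A] [HasDerivedCategory.{w} A]

/-- The functor from bounded complexes to the bounded derived category. -/
noncomputable def toDb : BddCx A ⥤ DerivedCategory.Bounded A := BddCx.toCB A ⋙ BddLoc.Qb A

instance : (toDb A).IsLocalization (BddCx.qis A) := by
  refine Functor.IsLocalization.of_equivalence_source (BddLoc.Qb A) (BddLoc.qis A) (toDb A)
    (BddCx.qis A) (BddCx.toCB A).asEquivalence.symm ?_ ?_ ((Functor.associator _ _ _).symm ≪≫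
      Functor.isoWhiskerRight (BddCx.toCB A).asEquivalence.counitIso _ ≪≫ Functor.leftUnitor _)
  · intro K L f hf
    refine MorphismProperty.le_isoClosure _ _ ?_
    exact ((BddLoc.qis A).arrow_mk_iso_iff (Arrow.isoMk
      ((BddCx.toCB A).asEquivalence.counitIso.app K) ((BddCx.toCB A).asEquivalence.counitIso.app L)
      ((BddCx.toCB A).asEquivalence.counitIso.hom.naturality f).symm)).2 hf
  · intro X Y f hf
    exact Localization.inverts (BddLoc.Qb A) (BddLoc.qis A) _ hf

variable [MonoidalCategory A] [SymmetricCategory A] [MonoidalPreadditive A]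
  [∀ X : A, PreservesFiniteLimits (tensorLeft X)]
  [∀ X : A, PreservesFiniteColimits (tensorLeft X)]

noncomputable instance : MonoidalCategory (DerivedCategory.Bounded A) :=
  inferInstanceAs (MonoidalCategory
    (LocalizedMonoidal (toDb A) (BddCx.qis A) (Iso.refl ((toDb A).obj (𝟙_ (BddCx A))))))

noncomputable instance : SymmetricCategory (DerivedCategory.Bounded A) :=
  inferInstanceAs (SymmetricCategory
    (LocalizedMonoidal (toDb A) (BddCx.qis A) (Iso.refl ((toDb A).obj (𝟙_ (BddCx A))))))

noncomputable instance : (toDb A).Monoidal := inferInstanceAs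
    ((Localization.Monoidal.toMonoidalCategory (toDb A) (BddCx.qis A) (Iso.refl _)).Monoidal)

end DerivedTensor

section TensorPower

variable {C : Type u} [Category.{v} C] [MonoidalCategory C]

/-- The tensor power `X ⊗ (X ⊗ (⋯ ⊗ 𝟙))` with `n` factors `X`. -/
@[reducible]
def tpow (X : C) : ℕ → C
  | 0 => 𝟙_ C
  | n + 1 => X ⊗ tpow X n

variable [SymmetricCategory C]

/-- The symmetry applied to the `i`-th and `(i + 1)`-st factors (counted from `0`). -/
def tswap (X : C) : (n i : ℕ) → (tpow X n ⟶ tpow X n)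
  | 0, _ => 𝟙 _
  | 1, _ => 𝟙 _
  | n + 2, 0 => (α_ X X (tpow X n)).inv ≫ (β_ X X).hom ▷ tpow X n ≫ (α_ X X (tpow X n)).hom
  | n + 2, i + 1 => X ◁ tswap X (n + 1) i

/-- The morphism which moves the first of `n + 1` factors to position `p` (counted from `0`) and
keeps the order of the other ones. -/
def tins (X : C) : (n p : ℕ) → (tpow X (n + 1) ⟶ tpow X (n + 1))
  | 0, _ => 𝟙 _
  | _ + 1, 0 => 𝟙 _
  | n + 1, p + 1 => tswap X (n + 2) 0 ≫ X ◁ tins X n p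

/-- The permutation obtained from `σ` by deleting `0` from the source and `σ 0` from the target. -/
def permTail {n : ℕ} (σ : Equiv.Perm (Fin (n + 1))) : Equiv.Perm (Fin n) :=
  Equiv.removeNone (((finSuccEquiv' 0).symm.trans σ).trans (finSuccEquiv' (σ 0)))

lemma succAbove_permTail {n : ℕ} (σ : Equiv.Perm (Fin (n + 1))) (j : Fin n) :
    (σ 0).succAbove (permTail σ j) = σ j.succ := by
  have h : some (permTail σ j) = finSuccEquiv' (σ 0) (σ j.succ) := by
    refine (Equiv.removeNone_some _ ?_).trans ?_
    · obtain ⟨k, hk⟩ := Fin.exists_succAbove_eq (show σ j.succ ≠ σ 0 by simp)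
      exact ⟨k, by simp [← hk]⟩
    · simp
  rw [← Equiv.symm_apply_eq, finSuccEquiv'_symm_some] at h
  exact h

/-- The permutation of the factors of a tensor power: the factor at position `j` is moved to
position `σ j`. -/
def tperm (X : C) : (n : ℕ) → Equiv.Perm (Fin n) → (tpow X n ⟶ tpow X n)
  | 0, _ => 𝟙 _
  | n + 1, σ => X ◁ tperm X n (permTail σ) ≫ tins X n (σ 0)

variable (X : C)

lemma tswap_zero_nat (n : ℕ) (f : tpow X n ⟶ tpow X n) :
    tswap X (n + 2) 0 ≫ X ◁ X ◁ f = X ◁ X ◁ f ≫ tswap X (n + 2) 0 := by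
  dsimp only [tswap, tpow]
  simp only [Category.assoc]
  rw [← associator_naturality_right, ← whisker_exchange_assoc,
    ← associator_inv_naturality_right_assoc]

lemma tswap_zero_zero (n : ℕ) : tswap X (n + 2) 0 ≫ tswap X (n + 2) 0 = 𝟙 _ := by
  dsimp only [tswap, tpow]
  simp only [Category.assoc, Iso.hom_inv_id_assoc]
  rw [← comp_whiskerRight_assoc]
  simp

lemma braid_aux (T : C) :
    ((α_ X X (X ⊗ T)).inv ≫ (β_ X X).hom ▷ (X ⊗ T) ≫ (α_ X X (X ⊗ T)).hom) ≫
      X ◁ ((α_ X X T).inv ≫ (β_ X X).hom ▷ T ≫ (α_ X X T).hom) ≫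
      ((α_ X X (X ⊗ T)).inv ≫ (β_ X X).hom ▷ (X ⊗ T) ≫ (α_ X X (X ⊗ T)).hom) =
    X ◁ ((α_ X X T).inv ≫ (β_ X X).hom ▷ T ≫ (α_ X X T).hom) ≫
      ((α_ X X (X ⊗ T)).inv ≫ (β_ X X).hom ▷ (X ⊗ T) ≫ (α_ X X (X ⊗ T)).hom) ≫
      X ◁ ((α_ X X T).inv ≫ (β_ X X).hom ▷ T ≫ (α_ X X T).hom) := by
  calc
    _ = 𝟙 _ ⊗≫ (((β_ X X).hom ▷ X ⊗≫ X ◁ (β_ X X).hom ⊗≫ (β_ X X).hom ▷ X) ▷ T) ⊗≫ 𝟙 _ := by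
      monoidal
    _ = _ := by
      rw [BraidedCategory.yang_baxter']
      monoidal

lemma tswap_braid (n : ℕ) :
    tswap X (n + 3) 0 ≫ X ◁ tswap X (n + 2) 0 ≫ tswap X (n + 3) 0 =
      X ◁ tswap X (n + 2) 0 ≫ tswap X (n + 3) 0 ≫ X ◁ tswap X (n + 2) 0 :=
  braid_aux X (tpow X n)

lemma tins_succ (n p : ℕ) :
    tins X (n + 1) (p + 1) = tswap X (n + 2) 0 ≫ X ◁ tins X n p := rfl

lemma tins_zero : ∀ n, tins X n 0 = 𝟙 _
  | 0 => rfl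
  | _ + 1 => rfl

lemma tswap_succ (n i : ℕ) : tswap X (n + 2) (i + 1) = X ◁ tswap X (n + 1) i := rfl

lemma tins_tswap_lt (n : ℕ) : ∀ (p i : ℕ), i + 1 < p → p ≤ n →
    tins X n p ≫ tswap X (n + 1) i = X ◁ tswap X n i ≫ tins X n p := by
  induction n with
  | zero => intro p i h h'; omega
  | succ n ih =>
    intro p i h h'
    obtain ⟨p, rfl⟩ : ∃ m, p = m + 1 := ⟨p - 1, by omega⟩
    obtain ⟨n, rfl⟩ : ∃ m, n = m + 1 := ⟨n - 1, by omega⟩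
    rw [tins_succ]
    cases i with
    | zero =>
      obtain ⟨p, rfl⟩ : ∃ m, p = m + 1 := ⟨p - 1, by omega⟩
      rw [tins_succ, MonoidalCategory.whiskerLeft_comp, Category.assoc, Category.assoc,
        ← tswap_zero_nat, reassoc_of% (tswap_braid X n)]
    | succ i =>
      have := ih p i (by omega) (by omega)
      rw [tswap_succ, tswap_succ, Category.assoc, ← MonoidalCategory.whiskerLeft_comp, this,
        MonoidalCategory.whiskerLeft_comp, ← Category.assoc, tswap_zero_nat, Category.assoc]

lemma tins_tswap_pred (n : ℕ) : ∀ p, p + 1 ≤ n →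
    tins X n (p + 1) ≫ tswap X (n + 1) p = tins X n p := by
  induction n with
  | zero => intro p h; omega
  | succ n ih =>
    intro p h
    rw [tins_succ]
    cases p with
    | zero => rw [tins_zero, tins_zero, whiskerLeft_id, Category.comp_id, tswap_zero_zero]
    | succ p =>
      rw [tswap_succ, Category.assoc, ← MonoidalCategory.whiskerLeft_comp, ih p (by omega), tins_succ]

lemma tswap_tswap : ∀ n i, tswap X n i ≫ tswap X n i = 𝟙 _
  | 0, _ => Category.comp_id _
  | 1, _ => Category.comp_id _
  | n + 2, 0 => tswap_zero_zero X n
  | n + 2, i + 1 => by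
    rw [tswap_succ, ← MonoidalCategory.whiskerLeft_comp, tswap_tswap (n + 1) i, whiskerLeft_id]

lemma tins_tswap_self (n p : ℕ) (h : p < n) :
    tins X n p ≫ tswap X (n + 1) p = tins X n (p + 1) := by
  rw [← tins_tswap_pred X n p h, Category.assoc, tswap_tswap, Category.comp_id]

lemma tins_tswap_gt (n : ℕ) : ∀ (p i : ℕ), p ≤ i → i + 1 < n →
    tins X n p ≫ tswap X (n + 1) (i + 1) = X ◁ tswap X n i ≫ tins X n p := by
  induction n with
  | zero => intro p i h h'; omega
  | succ n ih =>
    intro p i h h'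
    obtain ⟨n, rfl⟩ : ∃ m, n = m + 1 := ⟨n - 1, by omega⟩
    cases p with
    | zero => rw [tins_zero, tswap_succ, Category.comp_id, Category.id_comp]
    | succ p =>
      obtain ⟨i, rfl⟩ : ∃ m, i = m + 1 := ⟨i - 1, by omega⟩
      have := ih p i (by omega) (by omega)
      rw [tswap_succ] at this
      rw [tins_succ, tswap_succ, tswap_succ, Category.assoc, ← MonoidalCategory.whiskerLeft_comp,
        this, MonoidalCategory.whiskerLeft_comp, ← Category.assoc, tswap_zero_nat, Category.assoc]

lemma permTail_eq {n : ℕ} {σ : Equiv.Perm (Fin (n + 1))} {τ : Equiv.Perm (Fin n)}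
    (h : ∀ j, (σ 0).succAbove (τ j) = σ j.succ) : permTail σ = τ := by
  ext1 j
  exact Fin.succAbove_right_injective ((succAbove_permTail σ j).trans (h j).symm)

lemma tperm_one (n : ℕ) : tperm X n 1 = 𝟙 _ := by
  induction n with
  | zero => rfl
  | succ n ih =>
    have h : permTail (1 : Equiv.Perm (Fin (n + 1))) = 1 := permTail_eq fun j => rfl
    change X ◁ tperm X n (permTail 1) ≫ tins X n 0 = _
    rw [h, ih, tins_zero, whiskerLeft_id, Category.comp_id]

/-- The transposition of `i` and `i + 1`. -/
def adj {n : ℕ} (i : ℕ) (h : i + 1 < n) : Equiv.Perm (Fin n) :=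
  Equiv.swap ⟨i, by omega⟩ ⟨i + 1, h⟩

lemma adj_val {n : ℕ} (i : ℕ) (h : i + 1 < n) (x : Fin n) :
    (adj i h x).1 = if x.1 = i then i + 1 else if x.1 = i + 1 then i else x.1 := by
  simp only [adj, Equiv.swap_apply_def, Fin.ext_iff]
  split_ifs <;> rfl

lemma succAbove_val {n : ℕ} (p : Fin (n + 1)) (x : Fin n) :
    (p.succAbove x).1 = if x.1 < p.1 then x.1 else x.1 + 1 := by
  simp only [Fin.succAbove, Fin.lt_def, Fin.val_castSucc]
  split_ifs <;> rfl

lemma tperm_adj_mul (n : ℕ) : ∀ (i : ℕ) (h : i + 1 < n) (σ : Equiv.Perm (Fin n)),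
    tperm X n (adj i h * σ) = tperm X n σ ≫ tswap X n i := by
  induction n with
  | zero => intro i h; omega
  | succ n ih =>
    intro i h σ
    change X ◁ tperm X n (permTail (adj i h * σ)) ≫ tins X n ((adj i h * σ) 0).1 =
      (X ◁ tperm X n (permTail σ) ≫ tins X n (σ 0).1) ≫ tswap X (n + 1) i
    have hp : (σ 0).1 ≤ n := by omega
    have hs : ∀ j, (σ j.succ).1 = if (permTail σ j).1 < (σ 0).1 then (permTail σ j).1
        else (permTail σ j).1 + 1 := fun j => by rw [← succAbove_val, succAbove_permTail]
    have hv : ((adj i h * σ) 0).1 = if (σ 0).1 = i then i + 1 else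
        if (σ 0).1 = i + 1 then i else (σ 0).1 := adj_val i h _
    rw [Category.assoc]
    rcases lt_trichotomy (i + 1) (σ 0).1 with h₁ | h₁ | h₁
    · have ht : permTail (adj i h * σ) = adj i (by omega) * permTail σ := permTail_eq fun j => by
        ext
        rw [succAbove_val, hv, Equiv.Perm.mul_apply, Equiv.Perm.mul_apply, adj_val, adj_val, hs]
        split_ifs <;> omega
      rw [hv, if_neg (by omega), if_neg (by omega), ht, ih, tins_tswap_lt X n _ _ h₁ hp,
        MonoidalCategory.whiskerLeft_comp, Category.assoc]
    · have ht : permTail (adj i h * σ) = permTail σ := permTail_eq fun j => by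
        ext
        rw [succAbove_val, hv, Equiv.Perm.mul_apply, adj_val, hs]
        split_ifs <;> omega
      rw [hv, if_neg (by omega), if_pos h₁.symm, ht, ← h₁, tins_tswap_pred X n i (by omega)]
    · rcases lt_or_eq_of_le (show (σ 0).1 ≤ i by omega) with h₂ | h₂
      · obtain ⟨i, rfl⟩ : ∃ m, i = m + 1 := ⟨i - 1, by omega⟩
        have ht : permTail (adj (i + 1) h * σ) = adj i (by omega) * permTail σ :=
          permTail_eq fun j => by
            ext
            rw [succAbove_val, hv, Equiv.Perm.mul_apply, Equiv.Perm.mul_apply, adj_val, adj_val, hs]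
            split_ifs <;> omega
        rw [hv, if_neg (by omega), if_neg (by omega), ht, ih,
          tins_tswap_gt X n _ _ (by omega) (by omega), MonoidalCategory.whiskerLeft_comp,
          Category.assoc]
      · have ht : permTail (adj i h * σ) = permTail σ := permTail_eq fun j => by
          ext
          rw [succAbove_val, hv, Equiv.Perm.mul_apply, adj_val, hs]
          split_ifs <;> omega
        rw [hv, if_pos h₂, ht, h₂, tins_tswap_self X n i (by omega)]

lemma tperm_mul (n : ℕ) (σ τ : Equiv.Perm (Fin n)) :
    tperm X n (σ * τ) = tperm X n τ ≫ tperm X n σ := by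
  cases n with
  | zero => exact (Category.id_comp _).symm
  | succ n =>
    have hσ : σ ∈ Submonoid.closure (Set.range fun i : Fin n ↦ Equiv.swap i.castSucc i.succ) := by
      rw [Equiv.Perm.mclosure_swap_castSucc_succ]
      trivial
    induction hσ using Submonoid.closure_induction_left with
    | one => rw [one_mul, tperm_one, Category.comp_id]
    | mul_left x hx y _ ih =>
      obtain ⟨i, rfl⟩ := hx
      change tperm X _ (adj i.1 (by omega) * y * τ) = _ ≫ tperm X _ (adj i.1 (by omega) * y)
      rw [mul_assoc, tperm_adj_mul, tperm_adj_mul, ih, Category.assoc]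

/-- The action of the symmetric group on a tensor power. -/
def tact (n : ℕ) : Equiv.Perm (Fin n) →* End (tpow X n) where
  toFun σ := tperm X n σ
  map_one' := tperm_one X n
  map_mul' σ τ := tperm_mul X n σ τ

end TensorPower

section Grothendieck

variable {C : Type u}

/-- The Grothendieck group of a class of objects: the free abelian group on the objects, modulo
`Z - X - Y` for all `X`, `Z`, `Y` with `T X Z Y`. -/
def K0 (T : C → C → C → Prop) : Type u :=
  FreeAbelianGroup C ⧸ AddSubgroup.closure
    {z : FreeAbelianGroup C | ∃ X Z Y, T X Z Y ∧ z = .of Z - .of X - .of Y}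

namespace K0

variable (T : C → C → C → Prop)

noncomputable instance : AddCommGroup (K0 T) := inferInstanceAs (AddCommGroup (_ ⧸ _))

/-- The class of an object in the Grothendieck group. -/
def cl (X : C) : K0 T := QuotientAddGroup.mk (FreeAbelianGroup.of X)

variable {T}

lemma cl_eq {X Z Y : C} (h : T X Z Y) : cl T Z = cl T X + cl T Y := by
  have : cl T Z - cl T X - cl T Y = 0 :=
    (QuotientAddGroup.eq_zero_iff _).2 (AddSubgroup.subset_closure ⟨X, Z, Y, h, rfl⟩)
  rw [sub_sub, sub_eq_zero] at this
  exact this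

/-- An additive function on objects extends to the Grothendieck group. -/
noncomputable def lift {M : Type*} [AddCommGroup M] (f : C → M)
    (hf : ∀ X Z Y, T X Z Y → f Z = f X + f Y) : K0 T →+ M :=
  QuotientAddGroup.lift _ (FreeAbelianGroup.lift f) <| by
    rw [AddSubgroup.closure_le]
    rintro _ ⟨X, Z, Y, h, rfl⟩
    simp [hf X Z Y h]

@[simp]
lemma lift_cl {M : Type*} [AddCommGroup M] (f : C → M)
    (hf : ∀ X Z Y, T X Z Y → f Z = f X + f Y) (X : C) : lift f hf (cl T X) = f X :=
  FreeAbelianGroup.lift_apply_of f X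

lemma induction {p : K0 T → Prop} (h₁ : ∀ X, p (cl T X)) (h₂ : p 0) (h₃ : ∀ x, p x → p (-x))
    (h₄ : ∀ x y, p x → p y → p (x + y)) (x : K0 T) : p x := by
  obtain ⟨x, rfl⟩ := QuotientAddGroup.mk_surjective x
  induction x using FreeAbelianGroup.induction_on with
  | zero => exact h₂
  | of X => exact h₁ X
  | neg X h => exact h₃ _ h
  | add x y hx hy => exact h₄ _ _ hx hy

variable [Category.{v} C] [MonoidalCategory C] [SymmetricCategory C]

variable (T) in
/-- The tensor product is compatible with the relations which define the Grothendieck group. -/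
class IsTensor : Prop where
  iso : ∀ {X Y : C}, (X ≅ Y) → cl T X = cl T Y
  tensor : ∀ (W : C) {X Z Y : C}, T X Z Y → cl T (W ⊗ Z) = cl T (W ⊗ X) + cl T (W ⊗ Y)

variable [IsTensor T]

/-- The multiplication, with `cl X * cl Y = cl (X ⊗ Y)`. -/
noncomputable def mulHom : K0 T →+ K0 T →+ K0 T :=
  lift (fun X ↦ lift (fun Y ↦ cl T (X ⊗ Y)) fun _ _ _ h ↦ IsTensor.tensor X h) <| by
    intro X Z Y h
    ext W
    induction W using induction with
    | h₁ W =>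
      rw [AddMonoidHom.add_apply, lift_cl, lift_cl, lift_cl, IsTensor.iso (T := T) (β_ Z W),
        IsTensor.iso (T := T) (β_ X W), IsTensor.iso (T := T) (β_ Y W), IsTensor.tensor W h]
    | h₂ => simp
    | h₃ x h => rw [map_neg, map_neg, h]
    | h₄ x y h h' => rw [map_add, map_add, h, h']

noncomputable instance : Mul (K0 T) := ⟨fun x y ↦ mulHom x y⟩

noncomputable instance : One (K0 T) := ⟨cl T (𝟙_ C)⟩

lemma one_def : (1 : K0 T) = cl T (𝟙_ C) := rfl

lemma mul_def (x y : K0 T) : x * y = mulHom x y := rfl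

@[simp]
lemma cl_mul_cl (X Y : C) : cl T X * cl T Y = cl T (X ⊗ Y) := by
  rw [mul_def, mulHom, lift_cl, lift_cl]

/-- The Grothendieck ring. -/
noncomputable instance : CommRing (K0 T) :=
  have hc : ∀ x y : K0 T, x * y = y * x := fun x y ↦ by
    simp only [mul_def]
    induction x using induction with
    | h₁ X =>
      induction y using induction with
      | h₁ Y => simp only [← mul_def, cl_mul_cl]; exact IsTensor.iso (β_ X Y)
      | h₂ => simp
      | h₃ y h => simp [h]
      | h₄ y z h h' => simp [h, h']
    | h₂ => simp
    | h₃ x h => simp [h]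
    | h₄ x z h h' => simp [h, h']
  have ho : ∀ x : K0 T, 1 * x = x := fun x ↦ by
    simp only [mul_def]
    induction x using induction with
    | h₁ X => rw [← mul_def, one_def, cl_mul_cl]; exact IsTensor.iso (λ_ X)
    | h₂ => simp
    | h₃ x h => simp [h]
    | h₄ x z h h' => simp [h, h']
  have hl : ∀ x y z : K0 T, x * (y + z) = x * y + x * z := fun x y z ↦ map_add (mulHom x) y z
  { (inferInstance : AddCommGroup (K0 T)), (inferInstance : Mul (K0 T)),
      (inferInstance : One (K0 T)) with
    left_distrib := hl
    right_distrib := fun x y z ↦ by rw [hc, hl, hc z x, hc z y]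
    zero_mul := fun x ↦ by rw [mul_def]; simp
    mul_zero := fun x ↦ by rw [mul_def]; simp
    mul_assoc := fun x y z ↦ by
      simp only [mul_def]
      induction x using induction with
      | h₁ X =>
        induction y using induction with
        | h₁ Y =>
          induction z using induction with
          | h₁ Z =>
            simp only [← mul_def, cl_mul_cl]
            exact IsTensor.iso (α_ X Y Z)
          | h₂ => simp
          | h₃ y h => simp [h]
          | h₄ y z h h' => simp [h, h']
        | h₂ => simp
        | h₃ y h => simp [h]
        | h₄ y z h h' => simp [h, h']
      | h₂ => simp
      | h₃ x h => simp [h]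
      | h₄ x z h h' => simp [h, h']
    one_mul := ho
    mul_one := fun x ↦ by rw [hc, ho]
    mul_comm := hc }

end K0

end Grothendieck

section AbelianK0

open ZeroObject

variable (A : Type u) [Category.{v} A] [Abelian A]

/-- `0 ⟶ X ⟶ Z ⟶ Y ⟶ 0` for some morphisms is a short exact sequence. -/
def sesRel (X Z Y : A) : Prop :=
  ∃ (f : X ⟶ Z) (g : Z ⟶ Y) (h : f ≫ g = 0), (ShortComplex.mk f g h).ShortExact

variable [MonoidalCategory A] [SymmetricCategory A]
  [∀ X : A, PreservesFiniteLimits (tensorLeft X)]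
  [∀ X : A, PreservesFiniteColimits (tensorLeft X)]

lemma sesRel.iso {X Y : A} (e : X ≅ Y) : sesRel A X Y 0 :=
  ⟨e.hom, 0, by simp, by
    exact { exact := by
              rw [ShortComplex.exact_iff_epi _ rfl]; dsimp; infer_instance
            mono_f := by dsimp; infer_instance
            epi_g := ⟨fun _ _ _ ↦ (isZero_zero A).eq_of_src _ _⟩ }⟩

instance : K0.IsTensor (sesRel A) where
  iso {X Y} e := by
    have h := K0.cl_eq (sesRel.iso A e)
    have h₀ := K0.cl_eq (sesRel.iso A (Iso.refl (0 : A)))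
    rw [left_eq_add] at h₀
    rw [h, h₀, add_zero]
  tensor W {X Z Y} := by
    rintro ⟨f, g, h, hS⟩
    have : (tensorLeft W).PreservesZeroMorphisms := inferInstance
    exact K0.cl_eq ⟨_, _, _, hS.map_of_exact (tensorLeft W)⟩

end AbelianK0

namespace BddCx

variable {A : Type u} [Category.{v} A] [Abelian A] {X Z Y : BddCx A}

/-- The morphism in degree `n`. -/
noncomputable def dmap (f : X ⟶ Z) (n : ℤ) : X.deg n ⟶ Z.deg n := X.inc n ≫ f.f ≫ Z.proj n

lemma inc_dmap (f : X ⟶ Z) (n : ℤ) : X.inc n ≫ f.f = dmap f n ≫ Z.inc n := by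
  rw [dmap, inc_f, ← proj_inc]
  simp only [Category.assoc]

lemma dmap_proj (f : X ⟶ Z) (n : ℤ) : f.f ≫ Z.proj n = X.proj n ≫ dmap f n := by
  rw [dmap, proj_inc_assoc, f.pr_f_assoc, pr_proj]

lemma tot_ext_proj {T : A} {a b : T ⟶ X.tot} (h : ∀ n, a ≫ X.proj n = b ≫ X.proj n) : a = b := by
  have h' : ∀ n, a ≫ X.pr n = b ≫ X.pr n := fun n ↦ by
    rw [← proj_inc, reassoc_of% h n]
  rw [← Category.comp_id a, ← Category.comp_id b, ← X.sum_pr, Preadditive.comp_sum,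
    Preadditive.comp_sum]
  exact Finset.sum_congr rfl fun n _ ↦ h' n

/-- The short complex of the total objects. -/
abbrev tsc (f : X ⟶ Z) (g : Z ⟶ Y) (w : f.f ≫ g.f = 0) : ShortComplex A := .mk f.f g.f w

lemma dmap_zero (f : X ⟶ Z) (g : Z ⟶ Y) (w : f.f ≫ g.f = 0) (n : ℤ) :
    dmap f n ≫ dmap g n = 0 := by
  have h : dmap f n ≫ dmap g n ≫ Y.inc n = 0 := by
    rw [← inc_dmap, ← Category.assoc, ← inc_dmap, Category.assoc, w, comp_zero]
  have h' := congrArg (· ≫ Y.proj n) h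
  simpa [Category.assoc, inc_proj] using h'

lemma toCxMap_zero (f : X ⟶ Z) (g : Z ⟶ Y) (w : f.f ≫ g.f = 0) :
    toCxMap f ≫ toCxMap g = 0 := by
  ext n
  exact dmap_zero f g w n

/-- The short complex of cochain complexes. -/
noncomputable abbrev csc (f : X ⟶ Z) (g : Z ⟶ Y) (w : f.f ≫ g.f = 0) :
    ShortComplex (CochainComplex A ℤ) := .mk (toCxMap f) (toCxMap g) (toCxMap_zero f g w)

section

variable (f : X ⟶ Z) (g : Z ⟶ Y) (w : f.f ≫ g.f = 0) (n : ℤ)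

/-- The short complex in degree `n`. -/
noncomputable abbrev dsc : ShortComplex A := .mk (dmap f n) (dmap g n) (dmap_zero f g w n)

/-- The inclusion of degree `n`. -/
noncomputable def dscInc : dsc f g w n ⟶ tsc f g w where
  τ₁ := X.inc n
  τ₂ := Z.inc n
  τ₃ := Y.inc n
  comm₁₂ := inc_dmap f n
  comm₂₃ := inc_dmap g n

/-- The projection to degree `n`. -/
noncomputable def dscProj : tsc f g w ⟶ dsc f g w n where
  τ₁ := X.proj n
  τ₂ := Z.proj n
  τ₃ := Y.proj n
  comm₁₂ := (dmap_proj f n).symm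
  comm₂₃ := (dmap_proj g n).symm

lemma dscInc_dscProj : dscInc f g w n ≫ dscProj f g w n = 𝟙 _ := by
  ext
  · exact X.inc_proj _
  · exact Z.inc_proj _
  · exact Y.inc_proj _

lemma dsc_shortExact (h : (tsc f g w).ShortExact) : (dsc f g w n).ShortExact := by
  have hm := h.mono_f
  have he := h.epi_g
  refine { exact := ?_, mono_f := ?_, epi_g := ?_ }
  · rw [ShortComplex.exact_iff_isZero_homology, IsZero.iff_id_eq_zero,
      ← ShortComplex.homologyMap_id, ← dscInc_dscProj, ShortComplex.homologyMap_comp,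
      ((ShortComplex.exact_iff_isZero_homology _).1 h.exact).eq_of_tgt
        (ShortComplex.homologyMap (dscInc f g w n)) 0, zero_comp]
  · have : Mono (dmap f n ≫ Z.inc n) := by
      rw [← inc_dmap]
      have : Mono f.f := hm
      have : Mono (X.inc n) := (SplitMono.mk (X.proj n) (X.inc_proj n)).mono
      exact mono_comp _ _
    exact mono_of_mono (dmap f n) (Z.inc n)
  · have : Epi (Z.proj n ≫ dmap g n) := by
      rw [← dmap_proj]
      have : Epi g.f := he
      have : Epi (Y.proj n) := (SplitEpi.mk (Y.inc n) (Y.inc_proj n)).epi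
      exact epi_comp _ _
    exact epi_of_epi (Z.proj n) (dmap g n)

lemma tsc_shortExact (h : ∀ n, (dsc f g w n).ShortExact) : (tsc f g w).ShortExact := by
  refine { exact := ?_, mono_f := ?_, epi_g := ?_ }
  · rw [ShortComplex.exact_iff_isZero_homology, IsZero.iff_id_eq_zero,
      ← ShortComplex.homologyMap_id]
    have h₁ : ShortComplex.homologyMap
        (∑ n ∈ Z.supp, dscProj f g w n ≫ dscInc f g w n - 𝟙 _) = 0 := by
      refine homologyMap_eq_zero _ ?_
      have h₂ : (∑ n ∈ Z.supp, dscProj f g w n ≫ dscInc f g w n).τ₂ = 𝟙 Z.tot := by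
        let t : (tsc f g w ⟶ tsc f g w) →+ (Z.tot ⟶ Z.tot) :=
          { toFun := fun f => f.τ₂
            map_zero' := rfl
            map_add' := fun _ _ => rfl }
        refine (map_sum t _ _).trans ?_
        rw [← Z.sum_pr]
        exact Finset.sum_congr rfl fun n _ => Z.proj_inc n
      rw [ShortComplex.sub_τ₂, h₂]
      exact sub_self _
    rw [ShortComplex.homologyMap_sub, sub_eq_zero] at h₁
    rw [← h₁]
    refine ((ShortComplex.homologyFunctor A).map_sum _ _).trans (Finset.sum_eq_zero fun n _ ↦ ?_)
    refine ((ShortComplex.homologyFunctor A).map_comp _ _).trans ?_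
    exact ((((ShortComplex.exact_iff_isZero_homology _).1 (h n).exact).eq_of_tgt _ 0) =≫ _).trans
      zero_comp
  · refine ⟨fun a b hab ↦ tot_ext_proj fun n ↦ ?_⟩
    have := (h n).mono_f
    have : Mono (dmap f n) := this
    rw [← cancel_mono (dmap f n), Category.assoc, Category.assoc, ← dmap_proj]
    exact (Category.assoc _ _ _).symm.trans ((hab =≫ _).trans (Category.assoc _ _ _))
  · refine ⟨fun a b hab ↦ tot_ext' _ fun n ↦ ?_⟩
    have := (h n).epi_g
    have : Epi (dmap g n) := this
    rw [← cancel_epi (dmap g n), ← Category.assoc, ← Category.assoc, ← inc_dmap]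
    exact (Category.assoc _ _ _).trans ((_ ≫= hab).trans (Category.assoc _ _ _).symm)

lemma csc_shortExact (h : (tsc f g w).ShortExact) : (csc f g w).ShortExact :=
  HomologicalComplex.shortExact_of_degreewise_shortExact _ fun n ↦ dsc_shortExact f g w n h

end

end BddCx

section DerivedK0

open Pretriangulated DerivedCategory

variable (A : Type u) [Category.{v} A] [Abelian A] [HasDerivedCategory.{w} A]

/-- `X ⟶ Z ⟶ Y ⟶ X[1]` for some morphisms is a distinguished triangle. -/
def triRel {D : Type u} [Category.{v} D] [Preadditive D] [HasZeroObject D] [HasShift D ℤ]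
    [∀ n : ℤ, (shiftFunctor D n).Additive] [Pretriangulated D] (X Z Y : D) : Prop :=
  ∃ (f : X ⟶ Z) (g : Z ⟶ Y) (h : Y ⟶ X⟦(1 : ℤ)⟧), Triangle.mk f g h ∈ distTriang D

lemma triRel_of_iso {T : Triangle (DerivedCategory A)} (hT : T ∈ distTriang _)
    {X Z Y : DerivedCategory.Bounded A} (e₁ : T.obj₁ ≅ Bounded.ι.obj X)
    (e₂ : T.obj₂ ≅ Bounded.ι.obj Z) (e₃ : T.obj₃ ≅ Bounded.ι.obj Y) : triRel X Z Y := by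
  obtain ⟨f, hf⟩ := (Bounded.ι (C := A)).map_surjective (e₁.inv ≫ T.mor₁ ≫ e₂.hom)
  obtain ⟨g, hg⟩ := (Bounded.ι (C := A)).map_surjective (e₂.inv ≫ T.mor₂ ≫ e₃.hom)
  obtain ⟨h, hh⟩ := (Bounded.ι (C := A)).map_surjective
    (e₃.inv ≫ T.mor₃ ≫ e₁.hom⟦(1 : ℤ)⟧' ≫ ((Bounded.ι (C := A)).commShiftIso (1 : ℤ)).inv.app X)
  refine ⟨f, g, h, ?_⟩
  change (Bounded.ι (C := A)).mapTriangle.obj (Triangle.mk f g h) ∈ distTriang (DerivedCategory A)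
  refine isomorphic_distinguished _ hT _ (Triangle.isoMk _ _ e₁.symm e₂.symm e₃.symm ?_ ?_ ?_)
  · change (Bounded.ι (C := A)).map f ≫ e₂.inv = e₁.inv ≫ T.mor₁
    rw [hf]
    simp
  · change (Bounded.ι (C := A)).map g ≫ e₃.inv = e₂.inv ≫ T.mor₂
    rw [hg]
    simp
  · change ((Bounded.ι (C := A)).map h ≫ ((Bounded.ι (C := A)).commShiftIso (1 : ℤ)).hom.app X) ≫
      e₁.inv⟦(1 : ℤ)⟧' = e₃.inv ≫ T.mor₃
    rw [hh]
    simp only [Category.assoc, Iso.inv_hom_id_app_assoc, ← Functor.map_comp]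
    simp

/-- The object of the derived category given by a bounded complex. -/
noncomputable def toDbι (X : BddCx A) : Q.obj X.toCx ≅ Bounded.ι.obj ((toDb A).obj X) :=
  (quotientCompQhIso A).symm.app X.toCx

lemma triRel_of_shortExact {X Z Y : BddCx A} (f : X ⟶ Z) (g : Z ⟶ Y) (w : f.f ≫ g.f = 0)
    (h : (BddCx.tsc f g w).ShortExact) :
    triRel ((toDb A).obj X) ((toDb A).obj Z) ((toDb A).obj Y) :=
  triRel_of_iso A (triangleOfSES_distinguished (BddCx.csc_shortExact f g w h)) (toDbι A X)
    (toDbι A Z) (toDbι A Y)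

end DerivedK0

section DerivedK0

open Pretriangulated DerivedCategory ZeroObject

variable (A : Type u) [Category.{v} A] [Abelian A] [HasDerivedCategory.{w} A]

lemma exists_cone {X Z Y : DerivedCategory.Bounded A} (h : triRel X Z Y) :
    ∃ (K W : CochainComplex A ℤ) (g : W ⟶ K), BddLoc.bdd A K ∧
      BddLoc.bdd A (CochainComplex.mappingCone g) ∧ BddLoc.bdd A (W⟦(1 : ℤ)⟧) ∧
      Nonempty (Q.obj K ≅ Bounded.ι.obj X) ∧
      Nonempty (Q.obj (CochainComplex.mappingCone g) ≅ Bounded.ι.obj Z) ∧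
      Nonempty (Q.obj (W⟦(1 : ℤ)⟧) ≅ Bounded.ι.obj Y) := by
  obtain ⟨f, p, q, hT⟩ := h
  let T := (Bounded.ι (C := A)).mapTriangle.obj (Triangle.mk f p q)
  have hT' : T ∈ distTriang (DerivedCategory A) := Functor.map_distinguished _ _ hT
  have hT'' := inv_rot_of_distTriang _ hT'
  obtain ⟨⟨a₁, h₁⟩, b₁, h₁'⟩ := X.property
  have hY : TStructure.t.bounded (Y.obj⟦(-1 : ℤ)⟧) := TStructure.t.bounded.le_shift (-1) _ Y.property
  obtain ⟨⟨a₂, h₂⟩, b₂, h₂'⟩ := hY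
  have g₁ : X.obj.IsGE (min a₁ a₂) := TStructure.t.isGE_of_ge X.obj _ _ (min_le_left a₁ a₂)
  have g₂ : (Y.obj⟦(-1 : ℤ)⟧).IsGE (min a₁ a₂) :=
    TStructure.t.isGE_of_ge (Y.obj⟦(-1 : ℤ)⟧) _ _ (min_le_right a₁ a₂)
  obtain ⟨K, hK₁, hK₂, ⟨eK⟩⟩ := exists_iso_Q_obj_of_isGE_of_isLE X.obj (min a₁ a₂) b₁
  obtain ⟨W, hW₁, hW₂, ⟨eW⟩⟩ :=
    exists_iso_Q_obj_of_isGE_of_isLE (Y.obj⟦(-1 : ℤ)⟧) (min a₁ a₂) b₂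
  obtain ⟨W', hW₁', hW₂', s, hs, g, hg⟩ := right_fac_of_isStrictlyLE_of_isStrictlyGE
    (min a₁ a₂) b₂ (eW.inv ≫ T.invRotate.mor₁ ≫ eK.hom)
  let e := isoTriangleOfIso₁₂ _ _ hT'' ((mem_distTriang_iff _).2 ⟨_, _, g, ⟨Iso.refl _⟩⟩)
    (eW ≪≫ (asIso (Q.map s)).symm) eK (by
      exact ((Iso.inv_comp_eq eW).1 hg).trans (Category.assoc _ _ _).symm)
  refine ⟨K, W', g, ⟨⟨_, hK₁⟩, _, hK₂⟩, ⟨⟨_, CochainComplex.isStrictlyGE_mappingCone g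
    (min a₁ a₂) (min a₁ a₂) (min a₁ a₂ - 1)⟩, _, BddLoc.isStrictlyLE_mappingCone A g b₂ b₁⟩,
    ⟨⟨_, W'.isStrictlyGE_shift (min a₁ a₂) 1 (min a₁ a₂ - 1) (by lia)⟩, _,
      W'.isStrictlyLE_shift b₂ 1 (b₂ - 1) (by lia)⟩, ⟨eK.symm⟩, ⟨Triangle.π₃.mapIso e.symm⟩, ⟨?_⟩⟩
  exact (Q.commShiftIso (1 : ℤ)).app W' ≪≫
    (shiftFunctor _ (1 : ℤ)).mapIso ((asIso (Q.map s)) ≪≫ eW.symm) ≪≫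
    (shiftFunctorCompIsoId _ (-1 : ℤ) 1 (by lia)).app Y.obj

lemma exists_shortExact {X Z Y : DerivedCategory.Bounded A} (h : triRel X Z Y) :
    ∃ (X' Z' Y' : BddCx A) (f : X' ⟶ Z') (g : Z' ⟶ Y') (w : f.f ≫ g.f = 0),
      (BddCx.tsc f g w).ShortExact ∧ Nonempty ((toDb A).obj X' ≅ X) ∧
      Nonempty ((toDb A).obj Z' ≅ Z) ∧ Nonempty ((toDb A).obj Y' ≅ Y) := by
  obtain ⟨K, W, g, hK, hC, hW, ⟨eX⟩, ⟨eZ⟩, ⟨eY⟩⟩ := exists_cone A h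
  let F := BddCx.toCB A
  let i₁ : (⟨K, hK⟩ : BddLoc.CB A) ⟶ ⟨_, hC⟩ :=
    ObjectProperty.homMk (CochainComplex.mappingCone.triangle g).mor₂
  let i₂ : (⟨_, hC⟩ : BddLoc.CB A) ⟶ ⟨_, hW⟩ :=
    ObjectProperty.homMk (CochainComplex.mappingCone.triangle g).mor₃
  have hS : ∀ n, ((CochainComplex.mappingCone.triangleRotateShortComplex g).map
      (HomologicalComplex.eval _ _ n)).ShortExact := fun n ↦
    (CochainComplex.mappingCone.triangleRotateShortComplexSplitting g n).shortExact
  let e₁ := F.objObjPreimageIso ⟨K, hK⟩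
  let e₂ := F.objObjPreimageIso ⟨_, hC⟩
  let e₃ := F.objObjPreimageIso ⟨_, hW⟩
  obtain ⟨f', hf⟩ := F.map_surjective (e₁.hom ≫ i₁ ≫ e₂.inv)
  obtain ⟨g', hg⟩ := F.map_surjective (e₂.hom ≫ i₂ ≫ e₃.inv)
  have c₁ : F.map f' ≫ e₂.hom = e₁.hom ≫ i₁ := by simp [hf]
  have c₂ : F.map g' ≫ e₃.hom = e₂.hom ≫ i₂ := by simp [hg]
  have hw : i₁ ≫ i₂ = 0 :=
    ObjectProperty.hom_ext _ (CochainComplex.mappingCone.triangleRotateShortComplex g).zero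
  have hw' : F.map f' ≫ F.map g' = 0 := by
    rw [← cancel_mono e₃.hom, Category.assoc, c₂, reassoc_of% c₁, hw, comp_zero, zero_comp]
  have w : f'.f ≫ g'.f = 0 := by
    refine BddCx.tot_ext' _ fun n ↦ ?_
    have h₀ : BddCx.dmap f' n ≫ BddCx.dmap g' n = 0 := congrArg (fun k ↦ k.hom.f n) hw'
    rw [← Category.assoc, BddCx.inc_dmap, Category.assoc, BddCx.inc_dmap, reassoc_of% h₀,
      zero_comp, comp_zero]
  have i (U : BddLoc.CB A) (U' : BddCx A) (e : F.obj U' ≅ U) (V : DerivedCategory.Bounded A)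
      (e' : Q.obj U.obj ≅ Bounded.ι.obj V) : Nonempty ((toDb A).obj U' ≅ V) :=
    ⟨TStructure.t.bounded.fullyFaithfulι.preimageIso ((toDbι A U').symm ≪≫
      Q.mapIso ((BddLoc.bdd A).ι.mapIso e) ≪≫ e')⟩
  refine ⟨_, _, _, f', g', w, BddCx.tsc_shortExact f' g' w fun n ↦ ?_, i _ _ e₁ X eX,
    i _ _ e₂ Z eZ, i _ _ e₃ Y eY⟩
  let G : BddLoc.CB A ⥤ A := (BddLoc.bdd A).ι ⋙ HomologicalComplex.eval _ _ n
  exact ShortComplex.shortExact_of_iso (ShortComplex.isoMk (G.mapIso e₁) (G.mapIso e₂)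
    (G.mapIso e₃) (congrArg (fun k ↦ k.hom.f n) c₁).symm
    (congrArg (fun k ↦ k.hom.f n) c₂).symm).symm (hS n)

variable [MonoidalCategory A] [SymmetricCategory A] [MonoidalPreadditive A]
  [∀ X : A, PreservesFiniteLimits (tensorLeft X)]
  [∀ X : A, PreservesFiniteColimits (tensorLeft X)]

instance : K0.IsTensor (triRel (D := DerivedCategory.Bounded A)) := by
  have h {X Y : DerivedCategory.Bounded A} (e : X ≅ Y) : K0.cl triRel X = K0.cl triRel Y := by
    have h₁ : triRel X X 0 := ⟨_, _, _, contractible_distinguished X⟩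
    have h₂ : triRel X Y 0 := ⟨_, _, _, isomorphic_distinguished _
      (contractible_distinguished X) (Triangle.mk e.hom 0 0) (Triangle.isoMk _ _ (Iso.refl _)
        e.symm (Iso.refl _) (by exact e.hom_inv_id.trans (Category.id_comp _).symm)
        (zero_comp.trans comp_zero.symm) (zero_comp.trans comp_zero.symm))⟩
    rw [K0.cl_eq h₁, K0.cl_eq h₂]
  refine ⟨h, fun W X Z Y hT ↦ ?_⟩
  obtain ⟨X', Z', Y', f, g, w, hS, ⟨eX⟩, ⟨eZ⟩, ⟨eY⟩⟩ := exists_shortExact A hT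
  have : (toDb A).EssSurj := Localization.essSurj (toDb A) (BddCx.qis A)
  let W' := (toDb A).objPreimage W
  let e {U : BddCx A} {V : DerivedCategory.Bounded A} (i : (toDb A).obj U ≅ V) :
      (toDb A).obj (W' ⊗ U) ≅ W ⊗ V :=
    (Functor.Monoidal.μIso (toDb A) W' U).symm ≪≫ ((toDb A).objObjPreimageIso W ⊗ᵢ i)
  have w' : (W' ◁ f).f ≫ (W' ◁ g).f = 0 := by
    rw [BddCx.whiskerLeft_f, BddCx.whiskerLeft_f, ← MonoidalCategory.whiskerLeft_comp, w,
      MonoidalPreadditive.whiskerLeft_zero]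
  have hS' : (BddCx.tsc (W' ◁ f) (W' ◁ g) w').ShortExact :=
    ShortComplex.shortExact_of_iso (S₁ := (BddCx.tsc f g w).map (tensorLeft W'.tot))
      (ShortComplex.isoMk (Iso.refl _) (Iso.refl _) (Iso.refl _)
      ((Category.id_comp _).trans ((BddCx.whiskerLeft_f W' f).trans (Category.comp_id _).symm))
      ((Category.id_comp _).trans ((BddCx.whiskerLeft_f W' g).trans (Category.comp_id _).symm)))
      (hS.map_of_exact (tensorLeft W'.tot))
  rw [← h (e eX), ← h (e eZ), ← h (e eY)]
  exact K0.cl_eq (triRel_of_shortExact A _ _ w' hS')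

/-- The Grothendieck group of the bounded derived category. -/
abbrev K0D := K0 (triRel (D := DerivedCategory.Bounded A))

/-- The Grothendieck group of the abelian category. -/
abbrev K0A := K0 (sesRel A)

end DerivedK0

section RepK0

open Representation TensorProduct
open scoped MonoidAlgebra

/-- `0 ⟶ X ⟶ Z ⟶ Y ⟶ 0` for some maps of representations is exact. -/
def repRel {G : Type} [Group G] (X Z Y : FDRep ℚ G) : Prop :=
  ∃ (f : IntertwiningMap X.ρ Z.ρ) (g : IntertwiningMap Z.ρ Y.ρ),
    Function.Injective f ∧ Function.Exact f g ∧ Function.Surjective g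

/-- The Grothendieck group of finite dimensional rational representations of the symmetric
group. -/
abbrev RepK0 (n : ℕ) := K0 (repRel (G := Equiv.Perm (Fin n)))

section Coinvariants

variable {G V W U : Type*} [Group G] [Fintype G] [AddCommGroup V] [Module ℚ V]
  [AddCommGroup W] [Module ℚ W] [AddCommGroup U] [Module ℚ U]
  {ρ : Representation ℚ G V} {τ : Representation ℚ G W} {υ : Representation ℚ G U}

lemma coinv_norm (v : V) :
    Coinvariants.mk ρ (∑ g, ρ g v) = (Fintype.card G : ℚ) • Coinvariants.mk ρ v := by
  simp [map_sum, Finset.sum_const, Nat.cast_smul_eq_nsmul]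

lemma coinv_norm_eq_zero (v : V) (h : Coinvariants.mk ρ v = 0) : ∑ g, ρ g v = 0 := by
  let N : V →ₗ[ℚ] V := ∑ g, ρ g
  have hN : ∀ h, N ∘ₗ ρ h = N := fun h ↦ by
    ext x
    simp only [N, LinearMap.comp_apply, LinearMap.sum_apply]
    rw [← Equiv.sum_comp (Equiv.mulRight h) (fun g ↦ ρ g x)]
    simp
  have := congrArg (Coinvariants.lift ρ N hN) h
  simpa [N] using this

lemma coinv_exact (f : IntertwiningMap ρ τ) (g : IntertwiningMap τ υ) (hf : Function.Injective f)
    (h : Function.Exact f g) (hg : Function.Surjective g) :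
    Function.Injective (Coinvariants.map ρ τ f) ∧
      Function.Exact (Coinvariants.map ρ τ f) (Coinvariants.map τ υ g) ∧
      Function.Surjective (Coinvariants.map τ υ g) := by
  have hc : (Fintype.card G : ℚ) ≠ 0 := by exact_mod_cast Fintype.card_ne_zero
  have ef : ∀ v, f (∑ s, ρ s v) = ∑ s, τ s (f v) := fun v ↦ by
    rw [map_sum]
    exact Finset.sum_congr rfl fun s _ ↦ congr($(f.isIntertwining' s) v)
  have eg : ∀ v, g (∑ s, τ s v) = ∑ s, υ s (g v) := fun v ↦ by
    rw [map_sum]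
    exact Finset.sum_congr rfl fun s _ ↦ congr($(g.isIntertwining' s) v)
  refine ⟨?_, ?_, ?_⟩
  · rw [injective_iff_map_eq_zero]
    intro x hx
    obtain ⟨v, rfl⟩ := Coinvariants.mk_surjective _ x
    rw [Coinvariants.map_mk] at hx
    have h₁ := coinv_norm_eq_zero _ hx
    rw [← ef, ← map_zero f] at h₁
    have h₂ := coinv_norm (ρ := ρ) v
    rw [hf h₁, map_zero] at h₂
    exact (smul_eq_zero.1 h₂.symm).resolve_left hc
  · intro x
    obtain ⟨v, rfl⟩ := Coinvariants.mk_surjective _ x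
    constructor
    · intro hx
      rw [Coinvariants.map_mk] at hx
      have h₁ := coinv_norm_eq_zero _ hx
      rw [← eg] at h₁
      obtain ⟨a, ha⟩ := (h _).1 h₁
      refine ⟨(Fintype.card G : ℚ)⁻¹ • Coinvariants.mk ρ a, ?_⟩
      rw [map_smul, Coinvariants.map_mk, ha, coinv_norm, smul_smul, inv_mul_cancel₀ hc, one_smul]
    · rintro ⟨a, ha⟩
      obtain ⟨a, rfl⟩ := Coinvariants.mk_surjective _ a
      rw [← ha, Coinvariants.map_mk, Coinvariants.map_mk, (h _).2 ⟨a, rfl⟩, map_zero]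
  · intro x
    obtain ⟨v, rfl⟩ := Coinvariants.mk_surjective _ x
    obtain ⟨a, rfl⟩ := hg v
    exact ⟨Coinvariants.mk _ a, rfl⟩

end Coinvariants

section Ind

variable {H G : Type} [Group H] [Group G] (φ : H →* G)
  {V W U : Type} [AddCommGroup V] [Module ℚ V] [AddCommGroup W] [Module ℚ W] [AddCommGroup U]
  [Module ℚ U] {ρ : Representation ℚ H V} {τ : Representation ℚ H W} {υ : Representation ℚ H U}

/-- Functoriality of the induced representation. -/
noncomputable def indIntertwining (f : IntertwiningMap ρ τ) :
    IntertwiningMap (Representation.ind φ ρ) (Representation.ind φ τ) where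
  toLinearMap := Coinvariants.map _ _ ⟨f.toLinearMap.lTensor _, by
    simp [LinearMap.lTensor_comp_map, f.2, LinearMap.map_comp_lTensor]⟩
  isIntertwining' g := by ext; simp

lemma ind_exact [Fintype H] (f : IntertwiningMap ρ τ) (g : IntertwiningMap τ υ)
    (hf : Function.Injective f) (h : Function.Exact f g) (hg : Function.Surjective g) :
    Function.Injective (indIntertwining φ f) ∧
      Function.Exact (indIntertwining φ f) (indIntertwining φ g) ∧
      Function.Surjective (indIntertwining φ g) :=
  coinv_exact _ _ (Module.Flat.lTensor_preserves_injective_linearMap f.toLinearMap hf)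
    (lTensor_exact ℚ[G] (f := f.toLinearMap) (g := g.toLinearMap) h hg)
    (LinearMap.lTensor_surjective ℚ[G] (g := g.toLinearMap) hg)

end Ind

/-- The inclusion `Σ_p × Σ_q ⟶ Σ_n` for `p + q = n`. -/
def permProd {p q n : ℕ} (h : p + q = n) :
    Equiv.Perm (Fin p) × Equiv.Perm (Fin q) →* Equiv.Perm (Fin n) :=
  ((finSumFinEquiv.trans (finCongr h)).permCongrHom.toMonoidHom).comp
    (Equiv.Perm.sumCongrHom (Fin p) (Fin q))

/-- The external tensor product of representations. -/
noncomputable abbrev extProd {p q : ℕ} (V : FDRep ℚ (Equiv.Perm (Fin p)))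
    (W : FDRep ℚ (Equiv.Perm (Fin q))) :
    Representation ℚ (Equiv.Perm (Fin p) × Equiv.Perm (Fin q)) (V ⊗[ℚ] W) :=
  Representation.tprod (V.ρ.comp (MonoidHom.fst _ _)) (W.ρ.comp (MonoidHom.snd _ _))

/-- The representation of `Σ_n` induced from the representation `V ⊗ W` of `Σ_p × Σ_q`, for
`p + q = n`. -/
noncomputable def indProd {p q n : ℕ} (h : p + q = n) (V : FDRep ℚ (Equiv.Perm (Fin p)))
    (W : FDRep ℚ (Equiv.Perm (Fin q))) : FDRep ℚ (Equiv.Perm (Fin n)) :=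
  FDRep.of (Representation.ind (permProd h) (extProd V W))

lemma indProd_left {p q n : ℕ} (h : p + q = n) {X Z Y : FDRep ℚ (Equiv.Perm (Fin p))}
    (hT : repRel X Z Y) (W : FDRep ℚ (Equiv.Perm (Fin q))) :
    repRel (indProd h X W) (indProd h Z W) (indProd h Y W) := by
  obtain ⟨f, g, hf, hfg, hg⟩ := hT
  let f' : IntertwiningMap (extProd X W) (extProd Z W) := ⟨f.toLinearMap.rTensor W, fun s ↦ by
    ext a b
    exact congr($(congr($(f.isIntertwining' s.1) a)) ⊗ₜ[ℚ] (W.ρ s.2 b))⟩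
  let g' : IntertwiningMap (extProd Z W) (extProd Y W) := ⟨g.toLinearMap.rTensor W, fun s ↦ by
    ext a b
    exact congr($(congr($(g.isIntertwining' s.1) a)) ⊗ₜ[ℚ] (W.ρ s.2 b))⟩
  exact ⟨_, _, ind_exact (permProd h) f' g'
    (Module.Flat.rTensor_preserves_injective_linearMap f.toLinearMap hf)
    (rTensor_exact W (f := f.toLinearMap) (g := g.toLinearMap) hfg hg)
    (LinearMap.rTensor_surjective W (g := g.toLinearMap) hg)⟩

lemma indProd_right {p q n : ℕ} (h : p + q = n) (W : FDRep ℚ (Equiv.Perm (Fin p)))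
    {X Z Y : FDRep ℚ (Equiv.Perm (Fin q))} (hT : repRel X Z Y) :
    repRel (indProd h W X) (indProd h W Z) (indProd h W Y) := by
  obtain ⟨f, g, hf, hfg, hg⟩ := hT
  let f' : IntertwiningMap (extProd W X) (extProd W Z) := ⟨f.toLinearMap.lTensor W, fun s ↦ by
    ext a b
    exact congr((W.ρ s.1 a) ⊗ₜ[ℚ] $(congr($(f.isIntertwining' s.2) b)))⟩
  let g' : IntertwiningMap (extProd W Z) (extProd W Y) := ⟨g.toLinearMap.lTensor W, fun s ↦ by
    ext a b
    exact congr((W.ρ s.1 a) ⊗ₜ[ℚ] $(congr($(g.isIntertwining' s.2) b)))⟩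
  exact ⟨_, _, ind_exact (permProd h) f' g'
    (Module.Flat.lTensor_preserves_injective_linearMap f.toLinearMap hf)
    (lTensor_exact W (f := f.toLinearMap) (g := g.toLinearMap) hfg hg)
    (LinearMap.lTensor_surjective W (g := g.toLinearMap) hg)⟩

/-- The induction product, with `cl V * cl W = cl (Ind (V ⊗ W))`. -/
noncomputable def RepK0.mul {p q n : ℕ} (h : p + q = n) : RepK0 p →+ RepK0 q →+ RepK0 n :=
  K0.lift (fun V ↦ K0.lift (fun W ↦ K0.cl repRel (indProd h V W))
    fun _ _ _ hT ↦ K0.cl_eq (indProd_right h V hT)) <| by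
    intro X Z Y hT
    ext W
    induction W using K0.induction with
    | h₁ W =>
      rw [AddMonoidHom.add_apply, K0.lift_cl, K0.lift_cl, K0.lift_cl,
        K0.cl_eq (indProd_left h hT W)]
    | h₂ => simp
    | h₃ x h => rw [map_neg, map_neg, h]
    | h₄ x y h h' => rw [map_add, map_add, h, h']

end RepK0

section Young

open scoped MonoidAlgebra

/-- The cell (row, column) of the `k`-th box of a Young diagram with given row lengths, when the
boxes are counted from `0` row by row. -/
def cell : List ℕ → ℕ → ℕ × ℕ
  | [], k => (0, k)
  | a :: l, k => if k < a then (0, k) else ((cell l (k - a)).1 + 1, (cell l (k - a)).2)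

variable {n : ℕ} (μ : n.Partition)

/-- The row of a box of the Young diagram of `μ`. -/
def boxRow (i : Fin n) : ℕ := (cell (μ.parts.sort (· ≥ ·)) i).1

/-- The column of a box of the Young diagram of `μ`. -/
def boxCol (i : Fin n) : ℕ := (cell (μ.parts.sort (· ≥ ·)) i).2

/-- The sum of the permutations which preserve the rows. -/
noncomputable def rowSum : ℚ[Equiv.Perm (Fin n)] :=
  ∑ σ : Equiv.Perm (Fin n) with ∀ i, boxRow μ (σ i) = boxRow μ i, MonoidAlgebra.of ℚ _ σ

/-- The signed sum of the permutations which preserve the columns. -/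
noncomputable def colSum : ℚ[Equiv.Perm (Fin n)] :=
  ∑ σ : Equiv.Perm (Fin n) with ∀ i, boxCol μ (σ i) = boxCol μ i,
    ((Equiv.Perm.sign σ : ℤ) : ℚ) • MonoidAlgebra.of ℚ _ σ

/-- The Young symmetrizer. -/
noncomputable def youngSym : ℚ[Equiv.Perm (Fin n)] := rowSum μ * colSum μ

/-- The idempotent multiple of the Young symmetrizer `c`: since `c * c` is a multiple of `c` and
the coefficient of `1` in `c` is `1`, the factor is the inverse of the coefficient of `1` in
`c * c`. -/
noncomputable def youngIdem : ℚ[Equiv.Perm (Fin n)] :=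
  ((youngSym μ * youngSym μ).coeff 1)⁻¹ • youngSym μ

instance : Module.Finite ℚ (Ideal.span {youngSym μ}) :=
  inferInstanceAs (Module.Finite ℚ ((Ideal.span {youngSym μ}).restrictScalars ℚ))

/-- The irreducible representation of the symmetric group attached to `μ`. -/
noncomputable def specht : FDRep ℚ (Equiv.Perm (Fin n)) :=
  FDRep.of (Representation.ofModule' (k := ℚ) (G := Equiv.Perm (Fin n))
    (Ideal.span {youngSym μ} : Ideal ℚ[Equiv.Perm (Fin n)]))

/-- The idempotent which defines the exterior powers. -/
noncomputable def altIdem (n : ℕ) : ℚ[Equiv.Perm (Fin n)] :=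
  (n.factorial : ℚ)⁻¹ • ∑ σ : Equiv.Perm (Fin n),
    ((Equiv.Perm.sign σ : ℤ) : ℚ) • MonoidAlgebra.of ℚ _ σ

variable {C : Type u} [Category.{v} C] [MonoidalCategory C] [SymmetricCategory C] [Preadditive C]
  [Linear ℚ C]

/-- The action of the group algebra of the symmetric group on a tensor power. -/
noncomputable def groupAlgAct (X : C) (n : ℕ) : ℚ[Equiv.Perm (Fin n)] →ₐ[ℚ] End (tpow X n) :=
  MonoidAlgebra.lift ℚ (End (tpow X n)) (Equiv.Perm (Fin n)) (tact X n)

/-- `S` is the image of the idempotent `e` of the group algebra acting on the `n`-th tensor power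
of `X`. -/
def IsTensorImage (e : ℚ[Equiv.Perm (Fin n)]) (X S : C) : Prop :=
  ∃ (i : S ⟶ tpow X n) (p : tpow X n ⟶ S), i ≫ p = 𝟙 S ∧ p ≫ i = groupAlgAct X n e

/-- `S` is the Schur functor attached to `μ`, applied to `X`. -/
def IsSchur (X S : C) : Prop := IsTensorImage (youngIdem μ) X S

/-- `S` is the `n`-th exterior power of `X`. -/
def IsAlt (n : ℕ) (X S : C) : Prop := IsTensorImage (altIdem n) X S

end Young

section LambdaSigma

open TensorProduct

variable {C : Type u} [Category.{v} C] [MonoidalCategory C] [SymmetricCategory C]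
  (T : C → C → C → Prop)

/-- Power series whose coefficient at `t ^ n` is in the tensor product of the Grothendieck group
and the Grothendieck group of representations of the symmetric group `Σ_n`. -/
abbrev K0RSeries : Type (max 1 u) := ∀ n : ℕ, K0 T ⊗[ℤ] RepK0 n

variable {T} [K0.IsTensor T]

/-- The product of coefficients, with `(x ⊗ v) * (y ⊗ w) = (x * y) ⊗ (v * w)`. -/
noncomputable def coeffMul {p q n : ℕ} (h : p + q = n) :
    K0 T ⊗[ℤ] RepK0 p →ₗ[ℤ] K0 T ⊗[ℤ] RepK0 q →ₗ[ℤ] K0 T ⊗[ℤ] RepK0 n :=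
  TensorProduct.map₂
    (LinearMap.mk₂ ℤ (fun x y : K0 T ↦ x * y) add_mul (fun c x y ↦ smul_mul_assoc c x y) mul_add
      fun c x y ↦ mul_smul_comm c x y)
    (LinearMap.mk₂ ℤ (fun v w ↦ RepK0.mul h v w) (by simp) (by simp) (by simp) (by simp))

variable (T) in
/-- The power series `1`. -/
noncomputable def seriesOne : K0RSeries T := fun n ↦
  if n = 0 then (1 : K0 T) ⊗ₜ[ℤ] K0.cl repRel (FDRep.of (Representation.trivial ℚ _ ℚ)) else 0

/-- The product of power series. -/
noncomputable def seriesMul (f g : K0RSeries T) : K0RSeries T := fun n ↦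
  ∑ x : Finset.HasAntidiagonal.antidiagonal n, coeffMul (Finset.HasAntidiagonal.mem_antidiagonal.1 x.2) (f x.1.1) (g x.1.2)

/-- `Λ` is a homomorphism from the Grothendieck group to the multiplicative group of power series
with constant term `1`, and `Λ (cl X)` is the sum of all `cl (S_μ X) ⊗ cl V_μ t ^ |μ|`. -/
structure IsLambdaSigma [Preadditive C] [Linear ℚ C] (Λ : K0 T → K0RSeries T) : Prop where
  coeff_zero : ∀ x, Λ x 0 = seriesOne T 0
  map_zero : Λ 0 = seriesOne T
  map_add : ∀ x y, Λ (x + y) = seriesMul (Λ x) (Λ y)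
  map_cl : ∀ (X : C) (n : ℕ) (S : n.Partition → C), (∀ μ, IsSchur μ X (S μ)) →
    Λ (K0.cl T X) n = ∑ μ, K0.cl T (S μ) ⊗ₜ[ℤ] K0.cl repRel (specht μ)

end LambdaSigma

section LambdaRing

open MvPolynomial

/-- `P` is the polynomial with integral coefficients which expresses the `n`-th elementary symmetric
polynomial in the products `X i * Y j` by those in the `X i` and those in the `Y j`, for
`n` variables `X i` and `n` variables `Y j`. -/
def IsMulPoly (n : ℕ) (P : MvPolynomial (Fin n ⊕ Fin n) ℤ) : Prop :=
  aeval (Sum.elim (fun i ↦ rename Sum.inl (esymm (Fin n) ℤ (i.1 + 1)))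
      (fun i ↦ rename Sum.inr (esymm (Fin n) ℤ (i.1 + 1)))) P =
    aeval (fun x : Fin n × Fin n ↦ (X (Sum.inl x.1) * X (Sum.inr x.2) :
      MvPolynomial (Fin n ⊕ Fin n) ℤ)) (esymm (Fin n × Fin n) ℤ n)

/-- `P` is the polynomial with integral coefficients which expresses the `m`-th elementary symmetric
polynomial in the products of `n` different variables by the elementary symmetric polynomials, for
`m * n` variables. -/
def IsCompPoly (m n : ℕ) (P : MvPolynomial (Fin (m * n)) ℤ) : Prop :=
  aeval (fun i : Fin (m * n) ↦ esymm (Fin (m * n)) ℤ (i.1 + 1)) P =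
    aeval (fun s : Finset.powersetCard n (Finset.univ : Finset (Fin (m * n))) ↦
        (∏ i ∈ s.1, X i : MvPolynomial (Fin (m * n)) ℤ))
      (esymm (Finset.powersetCard n (Finset.univ : Finset (Fin (m * n)))) ℤ m)

/-- The operations `lam n` are a special `λ`-ring structure: `x ↦ ∑ lam n x t ^ n` is a homomorphism
from the additive group to the multiplicative group of power series with constant term `1`, with
`lam 1 x = x`, and the `lam n` of `1`, of products and of `lam m x` are as they are for elementary
symmetric polynomials. -/
structure IsSpecialLambda {S : Type*} [CommRing S] (lam : ℕ → S → S) : Prop where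
  lam_zero : ∀ x, lam 0 x = 1
  lam_one : ∀ x, lam 1 x = x
  lam_add : ∀ n x y, lam n (x + y) = ∑ k ∈ Finset.HasAntidiagonal.antidiagonal n, lam k.1 x * lam k.2 y
  lam_unit : ∀ n, 2 ≤ n → lam n 1 = 0
  lam_mul : ∀ n, ∃ P, IsMulPoly n P ∧ ∀ x y,
    lam n (x * y) = aeval (Sum.elim (fun i ↦ lam (i.1 + 1) x) (fun i ↦ lam (i.1 + 1) y)) P
  lam_lam : ∀ m n, ∃ P, IsCompPoly m n P ∧ ∀ x,
    lam m (lam n x) = aeval (fun i : Fin (m * n) ↦ lam (i.1 + 1) x) P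

end LambdaRing

section Embedding

open DerivedCategory

variable (A : Type u) [Category.{v} A] [Abelian A] [HasDerivedCategory.{w} A]

/-- The functor to the bounded derived category which regards an object as a complex in
degree `0`. -/
noncomputable def degreeZero : A ⥤ DerivedCategory.Bounded A :=
  TStructure.t.bounded.lift (singleFunctor A 0) fun X ↦
    ⟨⟨0, inferInstanceAs (((singleFunctor A 0).obj X).IsGE 0)⟩,
      ⟨0, inferInstanceAs (((singleFunctor A 0).obj X).IsLE 0)⟩⟩

end Embedding

/-! ### Boxes of Young diagrams and the dominance order. -/

section YoungCombinatorics

/-! The crux is that exterior powers and Schur functors respect distinguished triangles on the level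
of classes, and this is reduced to direct sums. Up to isomorphism, a distinguished triangle comes
from a degreewise split short exact sequence of bounded complexes (`exists_splitting`). Replacing
all differentials by zero is an additive braided functor `gr`, so it takes images of idempotents of
ℚΣ_n on tensor powers to such images. Moreover `X` and `gr X` have the same class, because both are
extensions of the same two complexes with zero differential, the cycles of `X` and the quotient by
them (`clD_gr`). Hence S_μ(X) and S_μ(gr X) have the same class (`imgCl_gr`), and after `gr` the
triangle is a direct sum (`grSumData`).

For a direct sum, the n-th tensor power is built from the objects X^{⊗p} ⊗ Y^{⊗q} by induction from
Σ_p × Σ_q to Σ_n. The image of an idempotent `e` decomposes accordingly, with the dimensions of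
corners `e A f` as multiplicities. The argument uses dual bases for the Frobenius extension given by
the two group algebras (`FrobData.decomposition`, `FrobDecomp.isSum`). The same corners compute the
induction product of the V_μ (`repK0_mul_specht`), and this equality of multiplicities, a form of
Frobenius reciprocity, is the multiplicativity of λ_Σ.

Two facts on Σ_n enter. The Young idempotents form a complete orthogonal family of absolutely
primitive idempotents (`youngSplit`), by the dominance order, the positivity of sums of squares, and
a count of conjugacy classes. And the Young modules occur unitriangularly in the images of the
column antisymmetrizers, so the class of the image of any idempotent is an integral polynomial in
the classes of exterior powers (`SymChar.mem_range`). One polynomial serves all objects of two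
categories at once (`TensorInv.exists_aeval`).

The last fact gives the axioms of a special λ-ring. Both Λ^n(X ⊗ Y) and Λ^m(Λ^n X) are images of
idempotents on tensor powers, so their classes are given by universal polynomials. To see which
ones, the second category is taken to be the representations of the multiplicative monoid ℤ^σ. There
a sum of lines with independent characters has the elementary symmetric polynomials as classes of
its exterior powers (`HasLines.alt`, `aeval_evalChar_injective`).

Finally every element of K_0(D^b) is the class of a single complex (`exists_clD_eq`), so identities
need only be checked on objects. The Euler characteristic inverts the map from K_0 of the abelian
category, and the λ-structure there is transported along the resulting ring isomorphism. -/

lemma cell_eq (l : List ℕ) : ∀ k, k < l.sum →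
    (cell l k).2 < l.getD (cell l k).1 0 ∧ k = (l.take (cell l k).1).sum + (cell l k).2 := by
  induction l with
  | nil => intro k h; simp at h
  | cons a l ih =>
    intro k h
    rw [cell]
    split_ifs with h'
    · simpa using h'
    · obtain ⟨h₁, h₂⟩ := ih (k - a) (by simp at h; omega)
      refine ⟨by simpa using h₁, ?_⟩
      simp only [List.take_succ_cons, List.sum_cons]
      omega

lemma cell_take_sum (l : List ℕ) : ∀ r c, c < l.getD r 0 →
    (l.take r).sum + c < l.sum ∧ cell l ((l.take r).sum + c) = (r, c) := by
  induction l with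
  | nil => intro r c h; simp at h
  | cons a l ih =>
    intro r c h
    cases r with
    | zero =>
      simp only [List.getD_cons_zero] at h
      refine ⟨by simp; omega, ?_⟩
      simp [cell, h]
    | succ r =>
      obtain ⟨h₁, h₂⟩ := ih r c (by simpa using h)
      refine ⟨by simp; omega, ?_⟩
      simp only [List.take_succ_cons, List.sum_cons]
      rw [cell, if_neg (by omega), show a + (l.take r).sum + c - a = (l.take r).sum + c by omega,
          h₂]

lemma getD_antitone (l : List ℕ) (hl : l.Pairwise (· ≥ ·)) {r r' : ℕ} (h : r' ≤ r) :
    l.getD r 0 ≤ l.getD r' 0 := by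
  by_cases hr : r < l.length
  · rcases h.eq_or_lt with rfl | h
    · exact le_rfl
    · rw [List.getD_eq_getElem _ _ hr, List.getD_eq_getElem _ _ (h.trans hr)]
      exact List.pairwise_iff_getElem.1 hl r' r _ hr h
  · rw [List.getD_eq_default _ _ (by omega)]
    exact Nat.zero_le _

variable {n : ℕ} (μ ν : n.Partition)

lemma sort_sum : (μ.parts.sort (· ≥ ·)).sum = n := by
  conv_rhs => rw [← μ.parts_sum, ← Multiset.sort_eq μ.parts (· ≥ ·)]
  rfl

lemma box_injective {i j : Fin n} (h₁ : boxRow μ i = boxRow μ j) (h₂ : boxCol μ i = boxCol μ j) :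
    i = j := by
  have hi := (cell_eq (μ.parts.sort (· ≥ ·)) i (by rw [sort_sum]; exact i.2)).2
  have hj := (cell_eq (μ.parts.sort (· ≥ ·)) j (by rw [sort_sum]; exact j.2)).2
  dsimp only [boxRow, boxCol] at h₁ h₂
  ext
  rw [hi, hj, h₁, h₂]

/-- The numbering row by row reaches every cell of the diagram; together with `box_injective` this
replaces the recursion of `cell` in most of what follows. -/
lemma exists_box (r c : ℕ) : (∃ i, boxRow μ i = r ∧ boxCol μ i = c) ↔
    c < (μ.parts.sort (· ≥ ·)).getD r 0 := by
  constructor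
  · rintro ⟨i, rfl, rfl⟩
    exact (cell_eq (μ.parts.sort (· ≥ ·)) i (by rw [sort_sum]; exact i.2)).1
  · intro h
    obtain ⟨h₁, h₂⟩ := cell_take_sum _ r c h
    rw [sort_sum] at h₁
    exact ⟨⟨_, h₁⟩, by simp [boxRow, h₂], by simp [boxCol, h₂]⟩

lemma finset_eq_range (s : Finset ℕ) (hs : ∀ x ∈ s, ∀ y < x, y ∈ s) : s = Finset.range s.card := by
  refine Finset.eq_of_subset_of_card_le (fun x hx ↦ ?_) (by simp)
  have : Finset.range (x + 1) ⊆ s := fun y hy ↦ by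
    rcases (Finset.mem_range_succ_iff.1 hy).eq_or_lt with rfl | h
    · exact hx
    · exact hs x hx y h
  simpa using Finset.card_le_card this

/-- The height of a column. -/
def colHeight (k : ℕ) : ℕ := Finset.card {i | boxCol μ i = k}

/-- The number of boxes in the first `k` rows. -/
def rowCount (k : ℕ) : ℕ := Finset.card {i | boxRow μ i < k}

/-- Row lengths decrease, so the rows which meet a given column form an initial segment of ℕ. Set
against the inequality `card_lt_le` for an arbitrary colouring, this equality is the source of the
dominance statements below. -/
lemma card_col_lt (k v : ℕ) :
    Finset.card {i | boxRow μ i < k ∧ boxCol μ i = v} = min k (colHeight μ v) := by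
  have hinj : Set.InjOn (boxRow μ) {i | boxCol μ i = v} := fun i hi j hj h ↦
    box_injective μ h (hi.trans hj.symm)
  let s : Finset ℕ := Finset.image (boxRow μ) {i | boxCol μ i = v}
  have hs : s.card = colHeight μ v :=
    Finset.card_image_of_injOn fun i hi j hj ↦ hinj (by simpa using hi) (by simpa using hj)
  have hr : s = Finset.range s.card := finset_eq_range s fun x hx y hy ↦ by
    obtain ⟨i, hi, rfl⟩ := Finset.mem_image.1 hx
    obtain rfl : boxCol μ i = v := by simpa using hi
    have h := (exists_box μ (boxRow μ i) (boxCol μ i)).1 ⟨i, rfl, rfl⟩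
    obtain ⟨j, hj, hj'⟩ := (exists_box μ y (boxCol μ i)).2
      (h.trans_le (getD_antitone _ (Multiset.pairwise_sort _ _) hy.le))
    exact Finset.mem_image.2 ⟨j, by simpa using hj', hj⟩
  rw [hs] at hr
  have h₂ : Finset.image (boxRow μ) {i | boxRow μ i < k ∧ boxCol μ i = v} =
      Finset.range (min k (colHeight μ v)) := by
    ext x
    rw [Finset.mem_range, lt_min_iff, ← Finset.mem_range (n := colHeight μ v), ← hr]
    simp only [s, Finset.mem_image, Finset.mem_filter, Finset.mem_univ, true_and]
    constructor
    · rintro ⟨i, ⟨h₁, h₂⟩, rfl⟩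
      exact ⟨h₁, i, h₂, rfl⟩
    · rintro ⟨h₁, i, h₂, rfl⟩
      exact ⟨i, ⟨h₁, h₂⟩, rfl⟩
  rw [← Finset.card_range (min k (colHeight μ v)), ← h₂]
  exact (Finset.card_image_of_injOn fun i hi j hj ↦ hinj (by aesop) (by aesop)).symm

lemma boxCol_lt (i : Fin n) : boxCol μ i < n := by
  have h := cell_eq (μ.parts.sort (· ≥ ·)) i (by rw [sort_sum]; exact i.2)
  have : (cell (μ.parts.sort (· ≥ ·)) i).2 ≤ i := by omega
  exact this.trans_lt i.2

lemma boxRow_lt (i : Fin n) : boxRow μ i < n := by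
  by_contra h
  -- The column of a box in row `n` or further down has a box in each of the rows `0, …, n - 1`;
  -- together with `i` these would be `n + 1` boxes.
  have h₁ : ∀ j < n, ∃ x, boxRow μ x = j ∧ boxCol μ x = boxCol μ i := fun j hj ↦
    (exists_box μ j _).2 (((exists_box μ _ _).1 ⟨i, rfl, rfl⟩).trans_le
      (getD_antitone _ (Multiset.pairwise_sort _ _) (by omega)))
  choose f hf using h₁
  have hinj : Function.Injective fun j : Fin (n + 1) ↦ if hj : j.1 < n then f j.1 hj else i := by
    intro a b hab
    have := congrArg (boxRow μ) hab
    dsimp only at this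
    ext
    split_ifs at this with h₁ h₂ h₂
    · rwa [(hf _ _).1, (hf _ _).1] at this
    · rw [(hf _ _).1] at this; omega
    · rw [(hf _ _).1] at this; omega
    · omega
  simpa using Fintype.card_le_of_injective _ hinj

lemma rowCount_eq_sum (k : ℕ) :
    rowCount μ k = ∑ v ∈ Finset.range n, min k (colHeight μ v) := by
  rw [rowCount, Finset.card_eq_sum_card_fiberwise (f := boxCol μ) (t := Finset.range n)
    (fun i _ ↦ by simpa using boxCol_lt μ i)]
  refine Finset.sum_congr rfl fun v _ ↦ ?_
  rw [← card_col_lt, Finset.filter_filter]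

/-- The number of elements of rows `< k` and a given colour is bounded, if elements of the same row
have different colours. -/
lemma card_lt_le (r c : Fin n → ℕ) (h : ∀ i j, r i = r j → c i = c j → i = j) (k v : ℕ) :
    Finset.card {i | r i < k ∧ c i = v} ≤ min k (Finset.card {i | c i = v}) := by
  refine le_min ?_ (Finset.card_le_card fun i ↦ by simp +contextual)
  rw [← Finset.card_range k]
  refine Finset.card_le_card_of_injOn r (fun i hi ↦ ?_) fun i hi j hj hij ↦ ?_
  · simp at hi
    simpa using hi.1
  · simp at hi hj
    exact h i j hij (hi.2.trans hj.2.symm)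

lemma sum_card_lt (r c : Fin n → ℕ) (hc : ∀ i, c i < n) (k : ℕ) :
    Finset.card {i | r i < k} = ∑ v ∈ Finset.range n, Finset.card {i | r i < k ∧ c i = v} := by
  rw [Finset.card_eq_sum_card_fiberwise (f := c) (t := Finset.range n)
    (fun i _ ↦ by simpa using hc i)]
  refine Finset.sum_congr rfl fun v _ ↦ ?_
  rw [Finset.filter_filter]

/-- Each colour contributes at most `min k (colHeight ν v)` boxes to the first `k` rows of `μ`, and
the columns of `ν` attain this bound in `ν`. So such a colouring exists only if `ν` dominates `μ`.
-/
lemma rowCount_le (c : Fin n → ℕ) (hc : ∀ i, c i < n)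
    (hν : ∀ v, Finset.card {i | c i = v} = colHeight ν v)
    (h : ∀ i j, boxRow μ i = boxRow μ j → c i = c j → i = j) (k : ℕ) :
    rowCount μ k ≤ rowCount ν k := by
  rw [rowCount_eq_sum ν, rowCount, sum_card_lt _ c hc]
  refine Finset.sum_le_sum fun v _ ↦ ?_
  rw [← hν]
  exact card_lt_le _ c h k v

/-- A colouring with the same column heights which separates rows is the standard one up to a
permutation that preserves the rows. -/
lemma exists_perm_row (c : Fin n → ℕ) (hc : ∀ i, c i < n)
    (hν : ∀ v, Finset.card {i | c i = v} = colHeight μ v)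
    (h : ∀ i j, boxRow μ i = boxRow μ j → c i = c j → i = j) :
    ∃ s : Equiv.Perm (Fin n), (∀ i, boxRow μ (s i) = boxRow μ i) ∧ ∀ i, boxCol μ (s i) = c i := by
  -- Both sides have the same sum over `v`, so the termwise inequalities are equalities.
  have key : ∀ k, ∀ v ∈ Finset.range n,
      Finset.card {i | boxRow μ i < k ∧ c i = v} = min k (colHeight μ v) := fun k ↦ by
    refine (Finset.sum_eq_sum_iff_of_le fun v _ ↦ ?_).1 ?_
    · rw [← hν]
      exact card_lt_le _ c h k v
    · rw [← sum_card_lt _ c hc, ← rowCount_eq_sum, rowCount]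
  -- Comparing `key` and `card_col_lt` for two consecutive values of `k` shows that a row contains a
  -- box of colour `v` exactly if it meets the column `v`.
  have ex : ∀ j, ∃ i, boxRow μ i = boxRow μ j ∧ boxCol μ i = c j := fun j ↦ by
    have h₁ := key (boxRow μ j + 1) (c j) (by simpa using hc j)
    have h₂ := key (boxRow μ j) (c j) (by simpa using hc j)
    have h₃ : Finset.card {i | boxRow μ i < boxRow μ j ∧ c i = c j} <
        Finset.card {i | boxRow μ i < boxRow μ j + 1 ∧ c i = c j} := by
      refine Finset.card_lt_card ⟨fun i ↦ ?_, fun h ↦ ?_⟩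
      · simp only [Finset.mem_filter, Finset.mem_univ, true_and]
        exact fun h ↦ ⟨by omega, h.2⟩
      · simpa using h (show j ∈ _ by simp)
    have h₄ := card_col_lt μ (boxRow μ j + 1) (c j)
    have h₅ := card_col_lt μ (boxRow μ j) (c j)
    have h₆ : ¬ (Finset.univ.filter fun i ↦ boxRow μ i < boxRow μ j + 1 ∧ boxCol μ i = c j) ⊆
        Finset.univ.filter fun i ↦ boxRow μ i < boxRow μ j ∧ boxCol μ i = c j := fun h ↦ by
      have := Finset.card_le_card h
      omega
    obtain ⟨i, hi, hi'⟩ := Finset.not_subset.1 h₆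
    simp only [Finset.mem_filter, Finset.mem_univ, true_and, not_and] at hi hi'
    exact ⟨i, le_antisymm (by omega) (by by_contra h; exact hi' (by omega) hi.2), hi.2⟩
  choose s hs using ex
  have hinj : Function.Injective s := fun i j hij ↦
    h i j (by rw [← (hs i).1, hij, (hs j).1]) (by rw [← (hs i).2, hij, (hs j).2])
  exact ⟨Equiv.ofBijective s (Finite.injective_iff_bijective.1 hinj), fun i ↦ (hs i).1,
    fun i ↦ (hs i).2⟩

lemma card_boxRow (k : ℕ) :
    Finset.card {i | boxRow μ i = k} = (μ.parts.sort (· ≥ ·)).getD k 0 := by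
  rw [← Finset.card_range ((μ.parts.sort (· ≥ ·)).getD k 0)]
  refine Finset.card_bij (fun i _ ↦ boxCol μ i) (fun i hi ↦ ?_) (fun i hi j hj h ↦ ?_) fun c hc ↦ ?_
  · simp at hi
    subst hi
    simpa using (exists_box μ _ _).1 ⟨i, rfl, rfl⟩
  · simp at hi hj
    exact box_injective μ (hi.trans hj.symm) h
  · obtain ⟨i, h₁, h₂⟩ := (exists_box μ k c).2 (by simpa using hc)
    exact ⟨i, by simpa using h₁, h₂⟩

/-- Differences of `rowCount` are the row lengths, and since parts are positive the first zero row
shows the number of parts. -/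
lemma eq_of_rowCount {μ ν : n.Partition} (h : ∀ k, rowCount μ k = rowCount ν k) : μ = ν := by
  have h₁ : ∀ (μ : n.Partition) k, rowCount μ (k + 1) =
      rowCount μ k + (μ.parts.sort (· ≥ ·)).getD k 0 := fun μ k ↦ by
    rw [← card_boxRow, rowCount, rowCount, ← Finset.card_union_of_disjoint]
    · congr 1
      ext i
      simp
      omega
    · rw [Finset.disjoint_filter]
      omega
  have h₂ : ∀ k, (μ.parts.sort (· ≥ ·)).getD k 0 = (ν.parts.sort (· ≥ ·)).getD k 0 := fun k ↦ by
    have := h₁ μ k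
    have := h₁ ν k
    have := h k
    have := h (k + 1)
    omega
  have pos : ∀ (μ : n.Partition) k, 0 < (μ.parts.sort (· ≥ ·)).getD k 0 ↔
      k < (μ.parts.sort (· ≥ ·)).length := fun μ k ↦ by
    constructor
    · intro h
      by_contra h'
      rw [List.getD_eq_default _ _ (by omega)] at h
      omega
    · intro h
      rw [List.getD_eq_getElem _ _ h]
      exact μ.parts_pos ((Multiset.mem_sort (r := (· ≥ ·))).1 (List.getElem_mem h))
  have h₃ : μ.parts.sort (· ≥ ·) = ν.parts.sort (· ≥ ·) := by
    refine List.ext_getElem ?_ fun k hk hk' ↦ ?_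
    · refine Nat.le_antisymm (not_lt.1 fun h' ↦ ?_) (not_lt.1 fun h' ↦ ?_)
      · have := (pos μ _).2 h'
        rw [h₂, pos] at this
        omega
      · have := (pos ν _).2 h'
        rw [← h₂, pos] at this
        omega
    · rw [← List.getD_eq_getElem _ 0 hk, ← List.getD_eq_getElem _ 0 hk', h₂]
  ext1
  rw [← Multiset.sort_eq μ.parts (· ≥ ·), h₃, Multiset.sort_eq]

/-- A statistic which is strictly monotone for the dominance order. -/
def rowStat : ℕ := ∑ k ∈ Finset.range (n + 1), rowCount μ k

lemma rowCount_of_le {k : ℕ} (h : n ≤ k) : rowCount μ k = n := by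
  rw [rowCount, Finset.filter_true_of_mem fun i _ ↦ (boxRow_lt μ i).trans_le h]
  simp

/-- Turns the dominance order into a number on which one can induct: equal sums of termwise ordered
row counts would mean equal row counts. -/
lemma rowStat_lt {μ ν : n.Partition} (h : ∀ k, rowCount μ k ≤ rowCount ν k) (hne : μ ≠ ν) :
    rowStat μ < rowStat ν := by
  refine lt_of_le_of_ne (Finset.sum_le_sum fun k _ ↦ h k) fun h' ↦ hne (eq_of_rowCount fun k ↦ ?_)
  by_cases hk : k < n + 1
  · exact (Finset.sum_eq_sum_iff_of_le fun k _ ↦ h k).1 h' k (by simpa using hk)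
  · rw [rowCount_of_le _ (by omega), rowCount_of_le _ (by omega)]

end YoungCombinatorics

/-! ### Split families of idempotents, and inversion in group algebras. -/

section Split

/-- A complete family of orthogonal absolutely primitive idempotents, up to isomorphism. -/
structure SplitData {A I : Type} [Ring A] [Algebra ℚ A] (e : I → A) : Prop where
  idem : ∀ i, e i * e i = e i
  scalar : ∀ i x, ∃ q : ℚ, e i * x * e i = q • e i
  orth : ∀ i j x, i ≠ j → e i * x * e j = 0
  one_mem : (1 : A) ∈ Submodule.span ℚ {x | ∃ i a b, x = a * e i * b}

end Split

section Reversal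

open scoped MonoidAlgebra

variable {G : Type} [Group G]

/-- The antiautomorphism of the group algebra which inverts the elements of the group. -/
noncomputable def groupAlgRev (x : ℚ[G]) : ℚ[G] :=
  (MonoidAlgebra.lift ℚ (ℚ[G]ᵐᵒᵖ) G
    { toFun := fun g ↦ MulOpposite.op (MonoidAlgebra.of ℚ G g⁻¹)
      map_one' := by simp [← MonoidAlgebra.one_def]
      map_mul' := fun g h ↦ by rw [mul_inv_rev, map_mul, MulOpposite.op_mul] } x).unop

lemma groupAlgRev_of (g : G) :
    groupAlgRev (MonoidAlgebra.of ℚ G g) = MonoidAlgebra.of ℚ G g⁻¹ := by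
  rw [groupAlgRev, MonoidAlgebra.lift_of]
  rfl

lemma groupAlgRev_mul (x y : ℚ[G]) : groupAlgRev (x * y) = groupAlgRev y * groupAlgRev x := by
  rw [groupAlgRev, map_mul]; rfl

lemma groupAlgRev_add (x y : ℚ[G]) : groupAlgRev (x + y) = groupAlgRev x + groupAlgRev y := by
  rw [groupAlgRev, map_add]; rfl

lemma groupAlgRev_smul (q : ℚ) (x : ℚ[G]) : groupAlgRev (q • x) = q • groupAlgRev x := by
  rw [groupAlgRev, map_smul]; rfl

lemma groupAlgRev_sum {ι : Type*} (s : Finset ι) (f : ι → ℚ[G]) :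
    groupAlgRev (∑ i ∈ s, f i) = ∑ i ∈ s, groupAlgRev (f i) := by
  rw [groupAlgRev, map_sum]
  exact map_sum MulOpposite.opAddEquiv.symm _ _

lemma groupAlgRev_zero : groupAlgRev (0 : ℚ[G]) = 0 := by
  rw [groupAlgRev, map_zero]; rfl

lemma coeff_groupAlgRev (x : ℚ[G]) (g : G) : (groupAlgRev x).coeff g = x.coeff g⁻¹ := by
  classical
  induction x using MonoidAlgebra.induction_on with
  | of h =>
    rw [groupAlgRev_of]
    simp only [MonoidAlgebra.of_apply, MonoidAlgebra.coeff_single, Finsupp.single_apply,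
      inv_eq_iff_eq_inv]
  | add x y hx hy => rw [groupAlgRev_add]; simp [hx, hy]
  | smul q x hx => rw [groupAlgRev_smul]; simp [hx]

lemma groupAlgRev_rev (x : ℚ[G]) : groupAlgRev (groupAlgRev x) = x := by
  ext g
  rw [coeff_groupAlgRev, coeff_groupAlgRev, inv_inv]

/-- The coefficient of `1` is the sum of the squares of the coefficients of `x`. Over ℚ this
positivity does the work of semisimplicity: it shows that the products in question do not vanish. -/
lemma coeff_mul_rev_pos {x : ℚ[G]} (hx : x ≠ 0) : 0 < (x * groupAlgRev x).coeff 1 := by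
  rw [MonoidAlgebra.coeff_mul_apply_left]
  simp only [coeff_groupAlgRev, mul_one, inv_inv]
  refine Finset.sum_pos (fun g hg ↦ ?_) ?_
  · exact mul_self_pos.2 (Finsupp.mem_support_iff.1 hg)
  · rw [Finsupp.support_nonempty_iff]
    exact fun h ↦ hx (MonoidAlgebra.coeff_eq_zero.1 h)

lemma mul_rev_ne_zero {x : ℚ[G]} (hx : x ≠ 0) : x * groupAlgRev x ≠ 0 := fun h ↦ by
  have := coeff_mul_rev_pos hx
  rw [h] at this
  simp at this

end Reversal

/-! ### Young symmetrizers: products, squares and orthogonality. -/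

section YoungSymmetrizer

open scoped MonoidAlgebra

variable {n : ℕ}

/-- The sum of the permutations which preserve a colouring. -/
noncomputable def symSum (c : Fin n → ℕ) : ℚ[Equiv.Perm (Fin n)] :=
  ∑ σ : Equiv.Perm (Fin n) with ∀ i, c (σ i) = c i, MonoidAlgebra.of ℚ _ σ

/-- The signed sum of the permutations which preserve a colouring. -/
noncomputable def altSum (c : Fin n → ℕ) : ℚ[Equiv.Perm (Fin n)] :=
  ∑ σ : Equiv.Perm (Fin n) with ∀ i, c (σ i) = c i,
    ((Equiv.Perm.sign σ : ℤ) : ℚ) • MonoidAlgebra.of ℚ _ σ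

/-- The number of permutations which preserve a colouring. -/
def stabCard (c : Fin n → ℕ) : ℕ :=
  Finset.card {σ : Equiv.Perm (Fin n) | ∀ i, c (σ i) = c i}

lemma stabCard_pos (c : Fin n → ℕ) : 0 < stabCard c :=
  Finset.card_pos.2 ⟨1, by simp⟩

lemma symSum_mul_of (c : Fin n → ℕ) {τ : Equiv.Perm (Fin n)} (h : ∀ i, c (τ i) = c i) :
    symSum c * MonoidAlgebra.of ℚ _ τ = symSum c := by
  rw [symSum, Finset.sum_mul]
  refine Finset.sum_bij (fun σ _ ↦ σ * τ) (fun σ hσ ↦ ?_) (fun σ _ σ' _ h ↦ mul_right_cancel h)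
    (fun σ hσ ↦ ⟨σ * τ⁻¹, ?_, by simp⟩) fun σ _ ↦ (map_mul _ _ _).symm
  · simp only [Finset.mem_filter, Finset.mem_univ, true_and] at hσ ⊢
    intro i
    rw [Equiv.Perm.mul_apply, hσ, h]
  · simp only [Finset.mem_filter, Finset.mem_univ, true_and] at hσ ⊢
    intro i
    rw [Equiv.Perm.mul_apply, hσ]
    simpa using (h (τ⁻¹ i)).symm

lemma sign_mul_sign (σ : Equiv.Perm (Fin n)) :
    ((Equiv.Perm.sign σ : ℤ) : ℚ) * ((Equiv.Perm.sign σ : ℤ) : ℚ) = 1 := by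
  rcases Int.units_eq_one_or (Equiv.Perm.sign σ) with h | h <;> simp [h]

lemma of_mul_altSum (c : Fin n → ℕ) {τ : Equiv.Perm (Fin n)} (h : ∀ i, c (τ i) = c i) :
    MonoidAlgebra.of ℚ _ τ * altSum c = ((Equiv.Perm.sign τ : ℤ) : ℚ) • altSum c := by
  rw [altSum, Finset.mul_sum, Finset.smul_sum]
  refine Finset.sum_bij (fun σ _ ↦ τ * σ) (fun σ hσ ↦ ?_) (fun σ _ σ' _ h ↦ mul_left_cancel h)
    (fun σ hσ ↦ ⟨τ⁻¹ * σ, ?_, by simp⟩) fun σ _ ↦ ?_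
  · simp only [Finset.mem_filter, Finset.mem_univ, true_and] at hσ ⊢
    intro i
    rw [Equiv.Perm.mul_apply, h, hσ]
  · simp only [Finset.mem_filter, Finset.mem_univ, true_and] at hσ ⊢
    intro i
    rw [Equiv.Perm.mul_apply, ← h]
    simpa using hσ i
  · rw [mul_smul_comm, smul_smul, map_mul, map_mul, Units.val_mul, Int.cast_mul, ← mul_assoc,
      sign_mul_sign, one_mul]

lemma groupAlgRev_symSum (c : Fin n → ℕ) : groupAlgRev (symSum c) = symSum c := by
  rw [symSum, groupAlgRev_sum]
  refine Finset.sum_bij (fun σ _ ↦ σ⁻¹) (fun σ hσ ↦ ?_) (fun σ _ σ' _ h ↦ inv_injective h)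
    (fun σ hσ ↦ ⟨σ⁻¹, ?_, by simp⟩) fun σ _ ↦ groupAlgRev_of σ
  all_goals
    simp only [Finset.mem_filter, Finset.mem_univ, true_and] at hσ ⊢
    intro i
    rw [← hσ]
    simp

lemma groupAlgRev_altSum (c : Fin n → ℕ) : groupAlgRev (altSum c) = altSum c := by
  rw [altSum, groupAlgRev_sum]
  refine Finset.sum_bij (fun σ _ ↦ σ⁻¹) (fun σ hσ ↦ ?_) (fun σ _ σ' _ h ↦ inv_injective h)
    (fun σ hσ ↦ ⟨σ⁻¹, ?_, by simp⟩) fun σ _ ↦ by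
      rw [groupAlgRev_smul, groupAlgRev_of, Equiv.Perm.sign_inv]
  all_goals
    simp only [Finset.mem_filter, Finset.mem_univ, true_and] at hσ ⊢
    intro i
    rw [← hσ]
    simp

lemma symSum_mul_self (c : Fin n → ℕ) : symSum c * symSum c = (stabCard c : ℚ) • symSum c := by
  conv_lhs => rhs; rw [symSum]
  rw [Finset.mul_sum, Finset.sum_congr rfl fun σ hσ ↦ symSum_mul_of c (by simpa using hσ),
    Finset.sum_const, stabCard, Nat.cast_smul_eq_nsmul]

lemma altSum_mul_self (c : Fin n → ℕ) : altSum c * altSum c = (stabCard c : ℚ) • altSum c := by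
  conv_lhs => lhs; rw [altSum]
  rw [Finset.sum_mul, Finset.sum_congr rfl fun σ hσ ↦ by
    rw [smul_mul_assoc, of_mul_altSum c (by simpa using hσ), smul_smul, sign_mul_sign, one_smul],
    Finset.sum_const, stabCard, Nat.cast_smul_eq_nsmul]

/-- If `σ * τ = 1`, then `σ` preserves both rows and columns and is the identity; so only one term
of the product contributes. -/
lemma coeff_symSum_mul_altSum (r c : Fin n → ℕ) (h : ∀ i j, r i = r j → c i = c j → i = j) :
    (symSum r * altSum c).coeff 1 = 1 := by
  classical
  rw [symSum, altSum, Finset.sum_mul, MonoidAlgebra.coeff_sum, Finset.sum_apply']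
  rw [Finset.sum_eq_single 1]
  · rw [map_one (MonoidAlgebra.of ℚ _), one_mul, MonoidAlgebra.coeff_sum, Finset.sum_apply',
      Finset.sum_eq_single 1]
    · simp [← MonoidAlgebra.one_def]
    · intro σ _ hσ
      simp [hσ]
    · simp
  · intro σ hσ hσ'
    rw [Finset.mul_sum, MonoidAlgebra.coeff_sum, Finset.sum_apply']
    refine Finset.sum_eq_zero fun τ hτ ↦ ?_
    rw [mul_smul_comm, ← map_mul]
    have : σ * τ ≠ 1 := fun hστ ↦ hσ' (Equiv.ext fun i ↦ h _ _ ?_ ?_)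
    · simp [this]
    · simpa using (Finset.mem_filter.1 hσ).2 i
    · obtain rfl : σ = τ⁻¹ := eq_inv_of_mul_eq_one_left hστ
      rw [← (Finset.mem_filter.1 hτ).2]
      simp
  · simp

/-- The product vanishes if two elements of the same row have the same colour. -/
lemma symSum_of_altSum_eq_zero (r c : Fin n → ℕ) (g : Equiv.Perm (Fin n)) {i j : Fin n}
    (hij : i ≠ j) (hr : r i = r j) (hc : c (g⁻¹ i) = c (g⁻¹ j)) :
    symSum r * MonoidAlgebra.of ℚ _ g * altSum c = 0 := by
  have h₁ : ∀ k, r (Equiv.swap i j k) = r k := fun k ↦ by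
    rw [Equiv.swap_apply_def]
    split_ifs with h h <;> simp [h, hr]
  have h₂ : ∀ k, c (Equiv.swap (g⁻¹ i) (g⁻¹ j) k) = c k := fun k ↦ by
    rw [Equiv.swap_apply_def]
    split_ifs with h h
    · rw [h, hc]
    · rw [h, hc]
    · rfl
  -- The transposition of `i` and `j` is absorbed by `symSum r`. Moved past `g`, it becomes a
  -- transposition which preserves `c` and is absorbed by `altSum c` at the cost of a sign. So the
  -- product is its own negative.
  have h₃ : Equiv.swap i j * g = g * Equiv.swap (g⁻¹ i) (g⁻¹ j) := by
    rw [Equiv.mul_swap_eq_swap_mul]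
    simp
  have h₄ : symSum r * MonoidAlgebra.of ℚ _ g * altSum c =
      - (symSum r * MonoidAlgebra.of ℚ _ g * altSum c) := by
    conv_lhs => rw [← symSum_mul_of r h₁]
    rw [mul_assoc (symSum r), ← map_mul, h₃, map_mul, mul_assoc, mul_assoc,
      of_mul_altSum c h₂, Equiv.Perm.sign_swap (by simpa using hij)]
    simp [mul_assoc]
  have h₅ : (2 : ℚ) • (symSum r * MonoidAlgebra.of ℚ _ g * altSum c) = 0 := by
    rw [two_smul]
    nth_rewrite 1 [h₄]
    exact neg_add_cancel _
  exact (smul_eq_zero.1 h₅).resolve_left two_ne_zero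

variable (μ ν : n.Partition)

/-- If the product does not vanish for a permutation `g`, the transported colouring `c ∘ g⁻¹`
separates the boxes of each row of `μ`, and `rowCount_le` gives the dominance relation. -/
lemma rowSum_mul_altSum_eq_zero (c : Fin n → ℕ) (hc : ∀ i, c i < n)
    (hν : ∀ v, Finset.card {i | c i = v} = colHeight ν v)
    (h : ¬ ∀ k, rowCount μ k ≤ rowCount ν k) (x : ℚ[Equiv.Perm (Fin n)]) :
    rowSum μ * x * altSum c = 0 := by
  induction x using MonoidAlgebra.induction_on with
  | of g =>
    by_contra h₀
    refine h (rowCount_le μ ν (fun i ↦ c (g⁻¹ i)) (fun i ↦ hc _) (fun v ↦ ?_) fun i j h₁ h₂ ↦ ?_)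
    · rw [← hν]
      exact Finset.card_bij (fun i _ ↦ g⁻¹ i) (by simp) (by simp) fun i hi ↦
        ⟨g i, by simpa using hi, by simp⟩
    · by_contra hij
      exact h₀ (symSum_of_altSum_eq_zero _ _ g hij h₁ h₂)
  | add x y hx hy => rw [mul_add, add_mul, hx, hy, add_zero]
  | smul q x hx => rw [mul_smul_comm, smul_mul_assoc, hx, smul_zero]

lemma rowSum_mul_colSum_eq_zero (h : ¬ ∀ k, rowCount μ k ≤ rowCount ν k)
    (x : ℚ[Equiv.Perm (Fin n)]) : rowSum μ * x * colSum ν = 0 :=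
  rowSum_mul_altSum_eq_zero μ ν _ (boxCol_lt ν) (fun _ ↦ rfl) h x

lemma colSum_mul_rowSum_eq_zero (h : ¬ ∀ k, rowCount μ k ≤ rowCount ν k)
    (x : ℚ[Equiv.Perm (Fin n)]) : colSum ν * x * rowSum μ = 0 := by
  have := congrArg groupAlgRev (rowSum_mul_colSum_eq_zero μ ν h (groupAlgRev x))
  rw [groupAlgRev_mul, groupAlgRev_mul, groupAlgRev_rev, groupAlgRev_zero, ← mul_assoc] at this
  erw [groupAlgRev_altSum, groupAlgRev_symSum] at this
  exact this

/-- Von Neumann's lemma. For a permutation `g`, either two boxes of a row have preimages under `g`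
in the same column, and the product vanishes; or `exists_perm_row` factors `g` into a row
permutation and a column permutation, both of which are absorbed up to sign. -/
lemma rowSum_mul_colSum_scalar (x : ℚ[Equiv.Perm (Fin n)]) :
    ∃ q : ℚ, rowSum μ * x * colSum μ = q • youngSym μ := by
  induction x using MonoidAlgebra.induction_on with
  | of g =>
    by_cases h : ∀ i j, boxRow μ i = boxRow μ j → boxCol μ (g⁻¹ i) = boxCol μ (g⁻¹ j) → i = j
    · obtain ⟨s, hs, hs'⟩ := exists_perm_row μ (fun i ↦ boxCol μ (g⁻¹ i)) (fun _ ↦ boxCol_lt μ _)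
        (fun v ↦ Finset.card_bij (fun i _ ↦ g⁻¹ i) (by simp) (by simp) fun i hi ↦
          ⟨g i, by simpa using hi, by simp⟩) h
      have h₁ : ∀ i, boxRow μ (s⁻¹ i) = boxRow μ i := fun i ↦ by
        rw [← hs]; simp
      have h₂ : ∀ i, boxCol μ ((s * g) i) = boxCol μ i := fun i ↦ by
        rw [Equiv.Perm.mul_apply, hs']; simp
      refine ⟨((Equiv.Perm.sign (s * g) : ℤ) : ℚ), ?_⟩
      rw [show g = s⁻¹ * (s * g) by group, map_mul, ← mul_assoc]
      have e₁ := symSum_mul_of (boxRow μ) h₁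
      have e₂ := of_mul_altSum (boxCol μ) h₂
      change symSum (boxRow μ) * _ * _ * altSum (boxCol μ) = _
      rw [e₁, mul_assoc, e₂, mul_smul_comm]
      simp only [← mul_assoc, inv_mul_cancel, one_mul]
      rfl
    · push Not at h
      obtain ⟨i, j, h₁, h₂, hij⟩ := h
      exact ⟨0, by rw [zero_smul]; exact symSum_of_altSum_eq_zero _ _ g hij h₁ h₂⟩
  | add x y hx hy =>
    obtain ⟨a, ha⟩ := hx
    obtain ⟨b, hb⟩ := hy
    exact ⟨a + b, by rw [mul_add, add_mul, ha, hb, add_smul]⟩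
  | smul q x hx =>
    obtain ⟨a, ha⟩ := hx
    exact ⟨q * a, by rw [mul_smul_comm, smul_mul_assoc, ha, smul_smul]⟩

lemma youngSym_coeff_one : (youngSym μ).coeff 1 = 1 :=
  coeff_symSum_mul_altSum _ _ fun _ _ h h' ↦ box_injective μ h h'

lemma youngSym_ne_zero : youngSym μ ≠ 0 := fun h ↦ by
  simpa [h] using youngSym_coeff_one μ

lemma youngSym_scalar (x : ℚ[Equiv.Perm (Fin n)]) :
    ∃ q : ℚ, youngSym μ * x * youngSym μ = q • youngSym μ := by
  obtain ⟨q, hq⟩ := rowSum_mul_colSum_scalar μ (colSum μ * x * rowSum μ)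
  exact ⟨q, by rw [← hq]; simp only [youngSym, mul_assoc]⟩

/-- Let `R` and `C` be the row and the column sum. Positivity for `R C` gives `R C R ≠ 0`, since `C
C` is a multiple of `C`. As `R C R` is its own reversal and `R R` is a multiple of `R`, positivity
for `R C R` gives `(R C)(R C) R ≠ 0`. -/
lemma youngSym_mul_self_ne_zero : youngSym μ * youngSym μ ≠ 0 := by
  have h₁ := mul_rev_ne_zero (youngSym_ne_zero μ)
  have hs : (stabCard (boxRow μ) : ℚ) ≠ 0 := by exact_mod_cast (stabCard_pos _).ne'
  have hr : groupAlgRev (rowSum μ) = rowSum μ := groupAlgRev_symSum _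
  have hc : groupAlgRev (colSum μ) = colSum μ := groupAlgRev_altSum _
  have h₂ : rowSum μ * colSum μ * rowSum μ ≠ 0 := fun h ↦ h₁ <| by
    have hcc : colSum μ * colSum μ = (stabCard (boxCol μ) : ℚ) • colSum μ := altSum_mul_self _
    rw [youngSym, groupAlgRev_mul, hr, hc, mul_assoc, ← mul_assoc (colSum μ), hcc, smul_mul_assoc,
      mul_smul_comm, ← mul_assoc, h, smul_zero]
  have h₃ := mul_rev_ne_zero h₂
  have hrr : rowSum μ * rowSum μ = (stabCard (boxRow μ) : ℚ) • rowSum μ := symSum_mul_self _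
  intro h
  rw [youngSym] at h
  refine h₃ ?_
  rw [groupAlgRev_mul, groupAlgRev_mul, hr, hc]
  calc _ = rowSum μ * colSum μ * (rowSum μ * rowSum μ) * colSum μ * rowSum μ := by
        simp only [mul_assoc]
    _ = (stabCard (boxRow μ) : ℚ) • (rowSum μ * colSum μ * (rowSum μ * colSum μ)) * rowSum μ := by
        rw [hrr]; simp only [mul_assoc, mul_smul_comm, smul_mul_assoc]
    _ = 0 := by rw [h]; simp

lemma youngSym_mul_self :
    youngSym μ * youngSym μ = ((youngSym μ * youngSym μ).coeff 1) • youngSym μ := by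
  obtain ⟨q, hq⟩ := youngSym_scalar μ 1
  rw [mul_one] at hq
  rw [hq]
  simp [youngSym_coeff_one]

lemma coeff_youngSym_sq_ne_zero : (youngSym μ * youngSym μ).coeff 1 ≠ 0 := fun h ↦ by
  have h' := youngSym_mul_self μ
  rw [h, zero_smul] at h'
  exact youngSym_mul_self_ne_zero μ h'

lemma youngIdem_mul_self : youngIdem μ * youngIdem μ = youngIdem μ := by
  rw [youngIdem, smul_mul_smul_comm]
  conv_lhs => rw [youngSym_mul_self μ]
  rw [smul_smul]
  congr 1
  simp only [MonoidAlgebra.coeff_smul, Finsupp.smul_apply, youngSym_coeff_one, smul_eq_mul, mul_one]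
  field_simp [coeff_youngSym_sq_ne_zero μ]

/-- Two different partitions cannot dominate each other. So either the inner product, of a column
sum and a row sum, vanishes, or the outer product, of a row sum and a column sum, does. -/
lemma youngSym_orth {μ ν : n.Partition} (h : μ ≠ ν) (x : ℚ[Equiv.Perm (Fin n)]) :
    youngSym μ * x * youngSym ν = 0 := by
  by_cases h₁ : ∀ k, rowCount μ k ≤ rowCount ν k
  · have h₂ : ¬ ∀ k, rowCount ν k ≤ rowCount μ k := fun h₂ ↦
      h (eq_of_rowCount fun k ↦ le_antisymm (h₁ k) (h₂ k))
    calc _ = rowSum μ * (colSum μ * x * rowSum ν) * colSum ν := by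
          simp only [youngSym, mul_assoc]
      _ = 0 := by rw [colSum_mul_rowSum_eq_zero ν μ h₂, mul_zero, zero_mul]
  · calc _ = rowSum μ * (colSum μ * x * rowSum ν) * colSum ν := by
          simp only [youngSym, mul_assoc]
      _ = 0 := rowSum_mul_colSum_eq_zero μ ν h₁ _

end YoungSymmetrizer

/-! ### Completeness of the Young idempotents. -/

section YoungSplit

open scoped MonoidAlgebra

variable {n : ℕ} (μ : n.Partition)

/-- A central element of the two-sided ideal generated by the Young symmetrizer. -/
noncomputable def youngCentral : ℚ[Equiv.Perm (Fin n)] :=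
  ∑ g : Equiv.Perm (Fin n), MonoidAlgebra.of ℚ _ g * (youngSym μ * groupAlgRev (youngSym μ)) *
    MonoidAlgebra.of ℚ _ g⁻¹

lemma of_mul_youngCentral (h : Equiv.Perm (Fin n)) :
    MonoidAlgebra.of ℚ _ h * youngCentral μ = youngCentral μ * MonoidAlgebra.of ℚ _ h := by
  rw [youngCentral, Finset.mul_sum, Finset.sum_mul]
  refine Fintype.sum_equiv (Equiv.mulLeft h) _ _ fun g ↦ ?_
  rw [mul_assoc (MonoidAlgebra.of ℚ _ (Equiv.mulLeft h g) * _), ← map_mul]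
  simp only [Equiv.coe_mulLeft, mul_inv_rev, inv_mul_cancel_right, ← mul_assoc, map_mul]

lemma youngCentral_mul (x : ℚ[Equiv.Perm (Fin n)]) :
    x * youngCentral μ = youngCentral μ * x := by
  induction x using MonoidAlgebra.induction_on with
  | of g => exact of_mul_youngCentral μ g
  | add x y hx hy => rw [add_mul, mul_add, hx, hy]
  | smul q x hx => rw [smul_mul_assoc, mul_smul_comm, hx]

/-- Conjugation does not change the coefficient of `1`, so the sum has a positive multiple of the
coefficient from `coeff_mul_rev_pos` there. -/
lemma youngCentral_ne_zero : youngCentral μ ≠ 0 := fun h ↦ by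
  have h₁ := congrArg (fun x ↦ x.coeff 1) h
  rw [youngCentral] at h₁
  simp only [MonoidAlgebra.coeff_sum, Finset.sum_apply', MonoidAlgebra.of_apply,
    MonoidAlgebra.coeff_mul_single_apply, MonoidAlgebra.coeff_single_mul_apply] at h₁
  simp at h₁
  exact (coeff_mul_rev_pos (youngSym_ne_zero μ)).ne' h₁

lemma groupAlgRev_youngCentral : groupAlgRev (youngCentral μ) = youngCentral μ := by
  rw [youngCentral, groupAlgRev_sum]
  refine Finset.sum_congr rfl fun g _ ↦ ?_
  simp only [groupAlgRev_mul, groupAlgRev_of, groupAlgRev_rev, inv_inv, mul_assoc]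

lemma youngCentral_mul_self_ne_zero : youngCentral μ * youngCentral μ ≠ 0 := by
  conv => lhs; rhs; rw [← groupAlgRev_youngCentral]
  exact mul_rev_ne_zero (youngCentral_ne_zero μ)

lemma youngCentral_orth {μ ν : n.Partition} (h : μ ≠ ν) :
    youngCentral μ * youngCentral ν = 0 := by
  have h₁ : youngCentral μ * youngSym ν = 0 := by
    rw [← youngCentral_mul, youngCentral, Finset.mul_sum]
    refine Finset.sum_eq_zero fun g _ ↦ ?_
    have := youngSym_orth h.symm (MonoidAlgebra.of ℚ _ g)
    simp only [← mul_assoc, this, zero_mul]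
  rw [youngCentral.eq_1 ν, Finset.mul_sum]
  refine Finset.sum_eq_zero fun g _ ↦ ?_
  rw [← mul_assoc, ← mul_assoc, ← youngCentral_mul, mul_assoc (MonoidAlgebra.of ℚ _ g),
    ← mul_assoc (youngCentral μ), h₁]
  simp

/-- Permutations with the same cycle type are conjugate. -/
lemma card_conjClasses_le :
    Fintype.card (ConjClasses (Equiv.Perm (Fin n))) ≤ Fintype.card n.Partition := by
  have e : Fintype.card (Fin n) = n := Fintype.card_fin n
  have : Fintype.card (Fintype.card (Fin n)).Partition = Fintype.card n.Partition := by
    congr!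
  rw [← this]
  refine Fintype.card_le_of_injective (Quotient.lift (fun σ : Equiv.Perm (Fin n) ↦ σ.partition)
    fun a b h ↦ Equiv.Perm.partition_eq_of_isConj.1 h) ?_
  rintro ⟨a⟩ ⟨b⟩ h
  exact Quotient.sound (Equiv.Perm.partition_eq_of_isConj.2 h)

/-- A dimension count. The elements `youngCentral μ` are orthogonal with nonzero squares, hence
linearly independent. The space `Z` of class functions has at most the dimension of the number of
conjugacy classes, thus at most that of the number of partitions. So they span `Z`, which contains
`1`. -/
lemma one_mem_span_youngCentral :
    (1 : ℚ[Equiv.Perm (Fin n)]) ∈ Submodule.span ℚ (Set.range (youngCentral (n := n))) := by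
  let Z : Submodule ℚ ℚ[Equiv.Perm (Fin n)] :=
    { carrier := {x | ∀ g h : Equiv.Perm (Fin n), x.coeff (g * h * g⁻¹) = x.coeff h}
      add_mem' := fun ha hb g h ↦ by simp only [MonoidAlgebra.coeff_add, Finsupp.add_apply, ha g h,
        hb g h]
      zero_mem' := fun g h ↦ by simp
      smul_mem' := fun q x hx g h ↦ by simp [hx g h] }
  have hZ : ∀ x, (∀ g, MonoidAlgebra.of ℚ _ g * x = x * MonoidAlgebra.of ℚ _ g) → x ∈ Z := by
    intro x hx g h
    have := congrArg (fun x ↦ x.coeff (g * h)) (hx g)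
    simp only [MonoidAlgebra.of_apply, MonoidAlgebra.coeff_mul_single_apply,
      MonoidAlgebra.coeff_single_mul_apply] at this
    simpa using this.symm
  let ev : Z →ₗ[ℚ] (ConjClasses (Equiv.Perm (Fin n)) → ℚ) :=
    { toFun := fun x C ↦ x.1.coeff C.exists_rep.choose
      map_add' := fun x y ↦ by ext; simp
      map_smul' := fun q x ↦ by ext; simp }
  have hev : Function.Injective ev := by
    rw [← LinearMap.ker_eq_bot, LinearMap.ker_eq_bot']
    intro x hx
    ext g
    have h₁ := congrFun hx (ConjClasses.mk g)
    have h₂ := (ConjClasses.mk g).exists_rep.choose_spec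
    obtain ⟨c, hc⟩ := isConj_iff.1 (ConjClasses.mk_eq_mk_iff_isConj.1 h₂)
    have h₃ := x.2 c (ConjClasses.mk g).exists_rep.choose
    rw [hc] at h₃
    exact h₃.trans h₁
  let y : n.Partition → Z := fun μ ↦ ⟨youngCentral μ, hZ _ (of_mul_youngCentral μ)⟩
  have hy : LinearIndependent ℚ y := by
    rw [Fintype.linearIndependent_iff]
    intro q hq μ
    have h₁ := congrArg (fun z : Z ↦ z.1 * youngCentral μ) hq
    simp only [AddSubmonoidClass.coe_finsetSum] at h₁
    rw [Finset.sum_mul, Finset.sum_eq_single μ] at h₁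
    · have h₂ : q μ • (youngCentral μ * youngCentral μ) = 0 := by
        rw [← smul_mul_assoc]
        simpa using h₁
      exact (smul_eq_zero.1 h₂).resolve_right (youngCentral_mul_self_ne_zero μ)
    · intro ν _ hν
      change (q ν • youngCentral ν) * _ = 0
      rw [smul_mul_assoc, youngCentral_orth hν, smul_zero]
    · simp
  have h₁ : Fintype.card n.Partition = Module.finrank ℚ Z := by
    refine le_antisymm hy.fintype_card_le_finrank ?_
    refine (LinearMap.finrank_le_finrank_of_injective hev).trans ?_
    rw [Module.finrank_pi]
    exact card_conjClasses_le
  have h₂ := hy.span_eq_top_of_card_eq_finrank' h₁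
  have h₃ : (⟨1, hZ 1 (by simp)⟩ : Z) ∈ Submodule.span ℚ (Set.range y) := by rw [h₂]; trivial
  have h₄ := Submodule.mem_map_of_mem (f := Z.subtype) h₃
  rw [Submodule.map_span, ← Set.range_comp] at h₄
  exact h₄

/-- Completeness holds because `youngCentral μ` lies in the two-sided ideal of `youngIdem μ`, and
`1` is a combination of these central elements. -/
lemma youngSplit (n : ℕ) : SplitData (youngIdem (n := n)) where
  idem := youngIdem_mul_self
  scalar μ x := by
    obtain ⟨q, hq⟩ := youngSym_scalar μ x
    refine ⟨((youngSym μ * youngSym μ).coeff 1)⁻¹ * q, ?_⟩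
    rw [youngIdem, smul_mul_assoc, smul_mul_smul_comm, hq, smul_smul, smul_smul]
    congr 1
    ring
  orth μ ν x h := by
    rw [youngIdem, youngIdem, smul_mul_assoc, smul_mul_smul_comm, youngSym_orth h, smul_zero]
  one_mem := by
    refine Submodule.span_le.2 ?_ one_mem_span_youngCentral
    rintro _ ⟨μ, rfl⟩
    refine Submodule.sum_mem _ fun g _ ↦ Submodule.subset_span ⟨μ,
      ((youngSym μ * youngSym μ).coeff 1) • MonoidAlgebra.of ℚ _ g,
      groupAlgRev (youngSym μ) * MonoidAlgebra.of ℚ _ g⁻¹, ?_⟩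
    rw [youngIdem, smul_mul_smul_comm, mul_inv_cancel₀ (coeff_youngSym_sq_ne_zero μ), one_smul]
    simp only [mul_assoc]

end YoungSplit

/-! ### External products of elements of group algebras. -/

section BoxMul

open scoped MonoidAlgebra

variable {G H : Type} [Group G] [Group H]

/-- The external product of elements of group algebras. -/
noncomputable def boxMul (x : ℚ[G]) (y : ℚ[H]) : ℚ[G × H] :=
  MonoidAlgebra.mapDomainAlgHom ℚ ℚ (MonoidHom.inl G H) x *
    MonoidAlgebra.mapDomainAlgHom ℚ ℚ (MonoidHom.inr G H) y

lemma mapDomainAlgHom_of {G H : Type} [Group G] [Group H] (φ : G →* H) (g : G) :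
    MonoidAlgebra.mapDomainAlgHom ℚ ℚ φ (MonoidAlgebra.of ℚ G g) =
      MonoidAlgebra.of ℚ H (φ g) := by
  simp [MonoidAlgebra.mapDomain_single]

lemma boxMul_of (g : G) (h : H) :
    boxMul (MonoidAlgebra.of ℚ G g) (MonoidAlgebra.of ℚ H h) = MonoidAlgebra.of ℚ _ (g, h) := by
  rw [boxMul, mapDomainAlgHom_of, mapDomainAlgHom_of, ← map_mul]
  simp

lemma boxMul_add_left (x x' : ℚ[G]) (y : ℚ[H]) :
    boxMul (x + x') y = boxMul x y + boxMul x' y := by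
  rw [boxMul, map_add, add_mul]; rfl

lemma boxMul_add_right (x : ℚ[G]) (y y' : ℚ[H]) :
    boxMul x (y + y') = boxMul x y + boxMul x y' := by
  rw [boxMul, map_add, mul_add]; rfl

lemma boxMul_smul_left (q : ℚ) (x : ℚ[G]) (y : ℚ[H]) :
    boxMul (q • x) y = q • boxMul x y := by
  rw [boxMul, map_smul, smul_mul_assoc]; rfl

lemma boxMul_smul_right (q : ℚ) (x : ℚ[G]) (y : ℚ[H]) :
    boxMul x (q • y) = q • boxMul x y := by
  rw [boxMul, map_smul, mul_smul_comm]; rfl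

lemma boxMul_zero_left (y : ℚ[H]) : boxMul (0 : ℚ[G]) y = 0 := by
  rw [boxMul, map_zero, zero_mul]

lemma boxMul_zero_right (x : ℚ[G]) : boxMul x (0 : ℚ[H]) = 0 := by
  rw [boxMul, map_zero, mul_zero]

lemma boxMul_one_one : boxMul (1 : ℚ[G]) (1 : ℚ[H]) = 1 := by
  rw [boxMul, map_one, map_one, one_mul]

/-- Induction principle for statements on the group algebra of a product. -/
lemma boxMul_induction {p : ℚ[G × H] → Prop} (x : ℚ[G × H])
    (h₁ : ∀ a b, p (boxMul a b)) (h₂ : ∀ x y, p x → p y → p (x + y)) : p x := by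
  have : ∀ x, ∀ q : ℚ, p (q • x) := fun x ↦ by
    induction x using MonoidAlgebra.induction_on with
    | of g =>
      intro q
      rw [← Prod.mk.eta (p := g), ← boxMul_of, ← boxMul_smul_left]
      exact h₁ _ _
    | add x y hx hy => intro q; rw [smul_add]; exact h₂ _ _ (hx q) (hy q)
    | smul r x hx => intro q; rw [smul_smul]; exact hx _
  simpa using this x 1

lemma boxMul_mul (x x' : ℚ[G]) (y y' : ℚ[H]) :
    boxMul x y * boxMul x' y' = boxMul (x * x') (y * y') := by
  have h : ∀ (y : ℚ[H]) (x : ℚ[G]), MonoidAlgebra.mapDomainAlgHom ℚ ℚ (MonoidHom.inr G H) y *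
      MonoidAlgebra.mapDomainAlgHom ℚ ℚ (MonoidHom.inl G H) x =
      MonoidAlgebra.mapDomainAlgHom ℚ ℚ (MonoidHom.inl G H) x *
      MonoidAlgebra.mapDomainAlgHom ℚ ℚ (MonoidHom.inr G H) y := fun y x ↦ by
    induction x using MonoidAlgebra.induction_on with
    | of g =>
      induction y using MonoidAlgebra.induction_on with
      | of h =>
        rw [mapDomainAlgHom_of, mapDomainAlgHom_of, ← map_mul, ← map_mul]
        simp
      | add x y hx hy => rw [map_add, add_mul, mul_add, hx, hy]
      | smul q x hx => rw [map_smul, smul_mul_assoc, mul_smul_comm, hx]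
    | add x y hx hy => rw [map_add, add_mul, mul_add, hx, hy]
    | smul q x hx => rw [map_smul, smul_mul_assoc, mul_smul_comm, hx]
  simp only [boxMul, map_mul]
  rw [mul_assoc, ← mul_assoc (MonoidAlgebra.mapDomainAlgHom ℚ ℚ (MonoidHom.inr G H) y), h]
  simp only [mul_assoc]

/-- All conditions are linear in the middle element, so external products suffice. With `youngSplit`
this provides the split family for Σ_p × Σ_q. -/
lemma SplitData.prod {I J : Type} {e : I → ℚ[G]} {f : J → ℚ[H]} (he : SplitData e)
    (hf : SplitData f) : SplitData fun k : I × J ↦ boxMul (e k.1) (f k.2) where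
  idem k := by rw [boxMul_mul, he.idem, hf.idem]
  scalar k x := by
    induction x using boxMul_induction with
    | h₁ a b =>
      obtain ⟨q, hq⟩ := he.scalar k.1 a
      obtain ⟨r, hr⟩ := hf.scalar k.2 b
      exact ⟨q * r, by rw [boxMul_mul, boxMul_mul, hq, hr, boxMul_smul_left, boxMul_smul_right,
        smul_smul]⟩
    | h₂ x y hx hy =>
      obtain ⟨q, hq⟩ := hx
      obtain ⟨r, hr⟩ := hy
      exact ⟨q + r, by rw [mul_add, add_mul, hq, hr, add_smul]⟩
  orth k l x h := by
    induction x using boxMul_induction with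
    | h₁ a b =>
      rw [boxMul_mul, boxMul_mul]
      by_cases h' : k.1 = l.1
      · rw [hf.orth _ _ _ fun h'' ↦ h (Prod.ext h' h''), boxMul_zero_right]
      · rw [he.orth _ _ _ h', boxMul_zero_left]
    | h₂ x y hx hy => rw [mul_add, add_mul, hx, hy, add_zero]
  one_mem := by
    have : ∀ x ∈ Submodule.span ℚ {x | ∃ i a b, x = a * e i * b},
        ∀ y ∈ Submodule.span ℚ {x | ∃ i a b, x = a * f i * b},
        boxMul x y ∈ Submodule.span ℚ {x : ℚ[G × H] | ∃ (k : I × J) (a b : _),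
          x = a * boxMul (e k.1) (f k.2) * b} := by
      intro x hx y hy
      induction hx using Submodule.span_induction with
      | mem x h =>
        obtain ⟨i, a, b, rfl⟩ := h
        induction hy using Submodule.span_induction with
        | mem y h =>
          obtain ⟨j, a', b', rfl⟩ := h
          refine Submodule.subset_span ⟨(i, j), boxMul a a', boxMul b b', ?_⟩
          rw [boxMul_mul, boxMul_mul]
        | zero => rw [boxMul_zero_right]; exact zero_mem _
        | add x y _ _ hx hy => rw [boxMul_add_right]; exact add_mem hx hy
        | smul q x _ hx => rw [boxMul_smul_right]; exact Submodule.smul_mem _ _ hx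
      | zero => rw [boxMul_zero_left]; exact zero_mem _
      | add x y _ _ hx hy => rw [boxMul_add_left]; exact add_mem hx hy
      | smul q x _ hx => rw [boxMul_smul_left]; exact Submodule.smul_mem _ _ hx
    rw [← boxMul_one_one]
    exact this 1 he.one_mem 1 hf.one_mem

end BoxMul

/-! ### Decomposition of idempotents along Frobenius extensions. -/

section Decomposition

variable {A B : Type} [Ring A] [Algebra ℚ A] [Ring B] [Algebra ℚ B]

/-- The map `a ↦ e * a * f`. -/
noncomputable def cornerMap (e f : A) : A →ₗ[ℚ] A :=
  LinearMap.mulLeft ℚ e ∘ₗ LinearMap.mulRight ℚ f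

lemma cornerMap_apply (e f a : A) : cornerMap e f a = e * (a * f) := rfl

/-- The dimension of `e A f`. -/
noncomputable def cornerDim (e f : A) : ℕ := Module.finrank ℚ (LinearMap.range (cornerMap e f))

/-- A Frobenius extension: `E` is a homomorphism of bimodules with a system of dual bases. -/
structure FrobData {S : Type} [Fintype S] (φ : B →ₐ[ℚ] A) (E : A →ₗ[ℚ] B) (r r' : S → A) :
    Prop where
  left : ∀ b a, E (φ b * a) = b * E a
  right : ∀ a b, E (a * φ b) = E a * b
  sum : ∀ a, ∑ s, r s * φ (E (r' s * a)) = a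

lemma SplitData.exists_sum {J : Type} {f : J → B} (hf : SplitData f) :
    ∃ (m : ℕ) (j : Fin m → J) (a b : Fin m → B), ∑ l, a l * f (j l) * b l = 1 := by
  obtain ⟨m, q, g, h⟩ := Submodule.mem_span_set'.1 hf.one_mem
  have hg := fun l ↦ (g l).2
  choose j a b hab using hg
  refine ⟨m, j, fun l ↦ q l • a l, b, ?_⟩
  rw [← h]
  refine Finset.sum_congr rfl fun l _ ↦ ?_
  rw [hab l]
  simp

/-- Decomposition of an idempotent along a Frobenius extension. -/
theorem FrobData.decomposition {S J : Type} [Fintype S] [Fintype J] [Module.Finite ℚ A]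
    {φ : B →ₐ[ℚ] A}
    {E : A →ₗ[ℚ] B} {r r' : S → A} (hE : FrobData φ E r r') {f : J → B} (hf : SplitData f)
    {e : A} (he : e * e = e) :
    ∃ u v : (Σ j, Fin (cornerDim e (φ (f j)))) → A,
      (∀ k, e * u k = u k) ∧ (∀ k, u k * φ (f k.1) = u k) ∧ (∀ k, φ (f k.1) * v k = v k) ∧
      (∀ k, v k * e = v k) ∧ (∀ k, E (v k * u k) = f k.1) ∧
      (∀ k l, k ≠ l → E (v k * u l) = 0) ∧
      ∀ (M : Type w) [AddCommGroup M] [Module ℚ M] (Ψ : A →ₗ[ℚ] A →ₗ[ℚ] M),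
        (∀ a b a', Ψ (a * φ b) a' = Ψ a (φ b * a')) →
        ∑ k, Ψ (u k) (v k) = ∑ s, Ψ (e * r s) (r' s * e) := by
  classical
  obtain ⟨m, j, a, b, hab⟩ := hf.exists_sum
  let R : J → Submodule ℚ A := fun i ↦ LinearMap.range (cornerMap e (φ (f i)))
  let bas : ∀ i, Module.Basis (Fin (cornerDim e (φ (f i)))) ℚ (R i) := fun i ↦
    Module.finBasis ℚ (R i)
  let P : ∀ i, A →ₗ[ℚ] R i := fun i ↦ (cornerMap e (φ (f i))).rangeRestrict
  let c : ∀ i, A → Fin (cornerDim e (φ (f i))) → ℚ := fun i x k ↦ (bas i).repr (P i x) k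
  -- `u` consists of bases of the corners `e A φ(f j)`. The family `v` is chosen so that `∑ u ⊗ v`
  -- becomes the Casimir element `∑ e r ⊗ r' e` of `A ⊗_B A`: one inserts `1 = ∑ a f b` between `r`
  -- and `r'` and expands the left factors in the bases.
  let u : (Σ j, Fin (cornerDim e (φ (f j)))) → A := fun k ↦ (bas k.1 k.2 : R k.1)
  let v : (Σ j, Fin (cornerDim e (φ (f j)))) → A := fun k ↦ ∑ l, ∑ s,
    (if j l = k.1 then c k.1 (r s * φ (a l)) k.2 else 0) •
      (φ (f k.1) * (φ (b l) * (r' s * e)))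
  have hu : ∀ k, ∃ x, u k = e * (x * φ (f k.1)) := fun k ↦ by
    obtain ⟨x, hx⟩ := (bas k.1 k.2 : R k.1).2
    exact ⟨x, hx.symm⟩
  have hc : ∀ i x, ∑ k, c i x k • u ⟨i, k⟩ = e * (x * φ (f i)) := fun i x ↦ by
    have h := congrArg Subtype.val ((bas i).sum_repr (P i x))
    rw [AddSubmonoidClass.coe_finsetSum] at h
    exact h
  have h₁ : ∀ k, e * u k = u k := fun k ↦ by
    obtain ⟨x, hx⟩ := hu k
    rw [hx, ← mul_assoc, he]
  have h₂ : ∀ k, u k * φ (f k.1) = u k := fun k ↦ by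
    obtain ⟨x, hx⟩ := hu k
    rw [hx, mul_assoc, mul_assoc, ← map_mul, hf.idem]
  have h₃ : ∀ k, φ (f k.1) * v k = v k := fun k ↦ by
    simp only [v, Finset.mul_sum, mul_smul_comm]
    refine Finset.sum_congr rfl fun l _ ↦ Finset.sum_congr rfl fun s _ ↦ ?_
    rw [← mul_assoc (φ (f k.1)) (φ (f k.1)), ← map_mul, hf.idem]
  have h₄ : ∀ k, v k * e = v k := fun k ↦ by
    simp only [v, Finset.sum_mul, smul_mul_assoc, mul_assoc, he]
  -- The identity `∑ u ⊗ v = ∑ e r ⊗ r' e` over `B`, expressed by balanced bilinear maps.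
  have h₇ : ∀ {M : Type w} [AddCommGroup M] [Module ℚ M] (Ψ : A →ₗ[ℚ] A →ₗ[ℚ] M),
      (∀ a b a', Ψ (a * φ b) a' = Ψ a (φ b * a')) →
      ∑ k, Ψ (u k) (v k) = ∑ s, Ψ (e * r s) (r' s * e) := by
    intro M _ _ Ψ hΨ
    have e₁ : ∀ i, ∑ k, Ψ (u ⟨i, k⟩) (v ⟨i, k⟩) = ∑ s, ∑ l, if j l = i then
        Ψ (e * r s * φ (a l * f i)) (φ (f i * b l) * (r' s * e)) else 0 := fun i ↦ by
      simp only [v, map_sum, map_smul]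
      rw [Finset.sum_comm, Finset.sum_comm (s := (Finset.univ : Finset S))]
      refine Finset.sum_congr rfl fun l _ ↦ ?_
      rw [Finset.sum_comm]
      refine Finset.sum_congr rfl fun s _ ↦ ?_
      split_ifs with h
      · have e₀ : e * r s * φ (a l * f i) = ∑ k, c i (r s * φ (a l)) k • u ⟨i, k⟩ := by
          rw [hc, map_mul]
          simp only [mul_assoc]
        rw [e₀]
        simp only [map_sum, LinearMap.sum_apply, map_smul, LinearMap.smul_apply, map_mul,
          mul_assoc]
      · simp
    rw [Fintype.sum_sigma]
    simp only [e₁]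
    rw [Finset.sum_comm]
    refine Finset.sum_congr rfl fun s _ ↦ ?_
    rw [Finset.sum_comm]
    simp only [Finset.sum_ite_eq, Finset.mem_univ, if_true]
    have e₂ : ∀ l, Ψ (e * r s * φ (a l * f (j l))) (φ (f (j l) * b l) * (r' s * e)) =
        Ψ (e * r s * φ (a l * f (j l) * b l)) (r' s * e) := fun l ↦ by
      rw [← hΨ, mul_assoc (e * r s), ← map_mul]
      congr 4
      rw [mul_assoc, ← mul_assoc (f (j l)), hf.idem, mul_assoc]
    simp only [e₂]
    rw [← LinearMap.sum_apply, ← map_sum, ← Finset.mul_sum, ← map_sum, hab, map_one, mul_one]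
  -- Under the balanced map `a, a' ↦ a * φ (E (a' * u k))` the Casimir element gives `u k`, by the
  -- dual basis property `hE.sum`.
  have h₈ : ∀ k, ∑ l, u l * φ (E (v l * u k)) = u k := fun k ↦ by
    -- `h₇` concerns modules in the universe `w`; `ULift` makes it available for `A` itself.
    have e₁ : ∀ (M : Type) [AddCommGroup M] [Module ℚ M] (Ψ : A →ₗ[ℚ] A →ₗ[ℚ] M),
      (∀ a b a', Ψ (a * φ b) a' = Ψ a (φ b * a')) →
      ∑ k, Ψ (u k) (v k) = ∑ s, Ψ (e * r s) (r' s * e) := by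
      intro M _ _ Ψ hΨ
      have := h₇ (M := ULift.{w} M)
        (Ψ.compr₂ (ULift.moduleEquiv (R := ℚ) (M := M)).symm.toLinearMap) fun a b a' ↦ by
          simp [hΨ]
      simp only [LinearMap.compr₂_apply, ← map_sum] at this
      exact (ULift.moduleEquiv (R := ℚ) (M := M)).symm.injective this
    have e₂ := e₁ A (LinearMap.compl₁₂ (LinearMap.mul ℚ A) LinearMap.id
      (φ.toLinearMap ∘ₗ E ∘ₗ LinearMap.mulRight ℚ (u k))) fun a b a' ↦ by
        simp [mul_assoc, hE.left]
    simp only [LinearMap.compl₁₂_apply, LinearMap.id_apply, LinearMap.comp_apply,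
      LinearMap.mul_apply', LinearMap.mulRight_apply, AlgHom.toLinearMap_apply] at e₂
    rw [e₂]
    simp only [mul_assoc, h₁]
    rw [← Finset.mul_sum, hE.sum, h₁]
  have h₉ : ∀ k l, E (v k * u l) = f k.1 * E (v k * u l) * f l.1 := fun k l ↦ by
    rw [← hE.left, ← hE.right]
    conv_lhs => rw [← h₃ k, ← h₂ l]
    simp only [mul_assoc]
  -- `E (v k * u l)` lies in the corner between `f k.1` and `f l.1`, which is spanned by an
  -- idempotent or zero. The scalars are then found by comparing coefficients of the basis `u` in
  -- `h₈`.
  have h₁₀ : ∀ k l, ∃ t : ℚ, E (v k * u l) = t • f k.1 ∧ (k.1 ≠ l.1 → t = 0) := fun k l ↦ by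
    by_cases h : k.1 = l.1
    · obtain ⟨t, ht⟩ := hf.scalar k.1 (E (v k * u l))
      exact ⟨t, by rw [h₉, ← h, ht], fun h' ↦ absurd h h'⟩
    · exact ⟨0, by rw [h₉, hf.orth _ _ _ h, zero_smul], fun _ ↦ rfl⟩
  choose t ht ht' using h₁₀
  have h₁₁ : ∀ k l, t k l = if k = l then 1 else 0 := by
    rintro ⟨i, k⟩ ⟨i', l⟩
    by_cases hi : i = i'
    · subst hi
      have e₁ := h₈ ⟨i, l⟩
      simp only [ht, map_smul, mul_smul_comm, h₂] at e₁
      rw [Fintype.sum_sigma, Finset.sum_eq_single i] at e₁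
      · have e₂ : ∑ k, t ⟨i, k⟩ ⟨i, l⟩ • bas i k = bas i l := by
          ext
          rw [AddSubmonoidClass.coe_finsetSum]
          exact e₁
        have e₃ := congrArg (fun x ↦ (bas i).repr x k) e₂
        simp only [map_sum, map_smul, Module.Basis.repr_self] at e₃
        simpa [Finsupp.single_apply, eq_comm] using e₃
      · intro i' _ hi'
        exact Finset.sum_eq_zero fun k _ ↦ by rw [ht' _ _ hi', zero_smul]
      · simp
    · rw [ht' _ _ hi, if_neg fun h ↦ hi (congrArg Sigma.fst h)]
  exact ⟨u, v, h₁, h₂, h₃, h₄, fun k ↦ by rw [ht, h₁₁, if_pos rfl, one_smul],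
    fun k l h ↦ by rw [ht, h₁₁, if_neg h, zero_smul], fun M _ _ Ψ hΨ ↦ h₇ Ψ hΨ⟩

end Decomposition

set_option linter.unusedSectionVars false


/-! ### Dimensions of corners. -/

section CornerDim

variable {A : Type} [Ring A] [Algebra ℚ A]

lemma cornerDim_conj (e f : A) {g g' : A} (h : g * g' = 1) (h' : g' * g = 1) :
    cornerDim (g * e * g') f = cornerDim e f := by
  let L : A ≃ₗ[ℚ] A := LinearEquiv.ofLinearMap (LinearMap.mulLeft ℚ g) (LinearMap.mulLeft ℚ g')
    (by ext; simp [← mul_assoc, h]) (by ext; simp [← mul_assoc, h'])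
  have : LinearMap.range (cornerMap (g * e * g') f) =
      (LinearMap.range (cornerMap e f)).map (L : A →ₗ[ℚ] A) := by
    ext x
    constructor
    · rintro ⟨a, rfl⟩
      exact ⟨_, ⟨g' * a, rfl⟩, by simp [L, cornerMap_apply, mul_assoc]⟩
    · rintro ⟨_, ⟨a, rfl⟩, rfl⟩
      refine ⟨g * a, ?_⟩
      simp only [L, cornerMap_apply, mul_assoc, LinearEquiv.coe_coe, LinearEquiv.coe_ofLinearMap,
        LinearMap.mulLeft_apply]
      rw [← mul_assoc g' g, h', one_mul]
  rw [cornerDim, this, LinearEquiv.finrank_map_eq]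
  rfl

lemma cornerDim_eq_zero {e f : A} (h : ∀ a, e * (a * f) = 0) : cornerDim e f = 0 := by
  have : LinearMap.range (cornerMap e f) = ⊥ := by
    rw [LinearMap.range_eq_bot]
    ext a
    exact h a
  rw [cornerDim, this, finrank_bot]

lemma cornerDim_eq_one {e f x : A} (hx : x ≠ 0) (h : ∃ a, e * (a * f) = x)
    (h' : ∀ a, ∃ q : ℚ, e * (a * f) = q • x) : cornerDim e f = 1 := by
  have : LinearMap.range (cornerMap e f) = Submodule.span ℚ {x} := by
    refine le_antisymm ?_ ?_
    · rintro _ ⟨a, rfl⟩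
      obtain ⟨q, hq⟩ := h' a
      exact Submodule.mem_span_singleton.2 ⟨q, hq.symm⟩
    · rw [Submodule.span_singleton_le_iff_mem]
      exact h
  rw [cornerDim, this, finrank_span_singleton hx]

/-- An algebra is a Frobenius extension of itself. -/
lemma FrobData.refl (A : Type) [Ring A] [Algebra ℚ A] :
    FrobData (S := Unit) (AlgHom.id ℚ A) LinearMap.id (fun _ ↦ (1 : A)) (fun _ ↦ 1) :=
  ⟨fun _ _ ↦ rfl, fun _ _ ↦ rfl, fun a ↦ by simp⟩

lemma SplitData.decomposition [Module.Finite ℚ A] {J : Type} [Fintype J] {f : J → A}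
    (hf : SplitData f) {e : A} (he : e * e = e) :
    ∃ u v : (Σ j, Fin (cornerDim e (f j))) → A,
      (∀ k, u k * f k.1 = u k) ∧ (∀ k, f k.1 * v k = v k) ∧ (∀ k, v k * e = v k) ∧
      (∀ k, v k * u k = f k.1) ∧ (∀ k l, k ≠ l → v k * u l = 0) ∧ ∑ k, u k * v k = e := by
  obtain ⟨u, v, -, h₂, h₃, h₄, h₅, h₆, h₇⟩ := (FrobData.refl A).decomposition hf he
  refine ⟨u, v, h₂, h₃, h₄, h₅, h₆, ?_⟩
  have := h₇ A (LinearMap.mul ℚ A) (fun a b a' ↦ by simp [mul_assoc])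
  simp only [mul_one, one_mul, LinearMap.mul_apply', he, Finset.univ_unique,
    Finset.sum_singleton] at this
  exact this

/-- The family `v` in the decomposition of `e` provides a basis of `f j * A * e`, dual to the basis
`u` of `e * A * f j`. Restriction and induction lead to the same corner with the idempotents
exchanged, so this symmetry is what remains of Frobenius reciprocity. -/
lemma cornerDim_comm [Module.Finite ℚ A] {J : Type} [Fintype J] {f : J → A} (hf : SplitData f)
    {e : A} (he : e * e = e) (j : J) : cornerDim (f j) e = cornerDim e (f j) := by
  classical
  obtain ⟨u, v, h₂, h₃, h₄, h₅, h₆, hs⟩ := hf.decomposition he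
  let x : Fin (cornerDim e (f j)) → A := fun k ↦ v ⟨j, k⟩
  have hx : LinearIndependent ℚ x := by
    rw [Fintype.linearIndependent_iff]
    intro q hq k
    have h := congrArg (fun y ↦ y * u ⟨j, k⟩) hq
    simp only [Finset.sum_mul, zero_mul, x, smul_mul_assoc] at h
    rw [Finset.sum_eq_single k, h₅] at h
    · refine (smul_eq_zero.1 h).resolve_right fun h0 ↦ ?_
      have h₈ : u ⟨j, k⟩ = 0 := by
        have := h₂ ⟨j, k⟩
        dsimp only at this h0
        rw [← this, h0, mul_zero]
      have h₉ : cornerDim e (f j) = 0 := cornerDim_eq_zero fun a ↦ by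
        rw [show f j = 0 from h0, mul_zero, mul_zero]
      exact absurd k.2 (by omega)
    · intro l _ hl
      rw [h₆ _ _ fun h' ↦ hl (by simpa using h'), smul_zero]
    · simp
  have hr : LinearMap.range (cornerMap (f j) e) = Submodule.span ℚ (Set.range x) := by
    refine le_antisymm ?_ ?_
    · rintro _ ⟨a, rfl⟩
      have hs' := congrArg (fun y ↦ f j * (a * y)) hs
      rw [cornerMap_apply, ← hs', Finset.mul_sum, Finset.mul_sum]
      refine Submodule.sum_mem _ fun k _ ↦ ?_
      by_cases hk : j = k.1
      · obtain ⟨i, k⟩ := k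
        dsimp only at hk
        subst hk
        obtain ⟨q, hq⟩ := hf.scalar j (a * u ⟨j, k⟩)
        have : f j * (a * (u ⟨j, k⟩ * v ⟨j, k⟩)) = q • v ⟨j, k⟩ := by
          have e₁ := h₂ ⟨j, k⟩
          have e₂ := h₃ ⟨j, k⟩
          dsimp only at e₁ e₂
          rw [← e₁, mul_assoc (u _), ← mul_assoc a, ← mul_assoc (f j), ← mul_assoc, hq,
            smul_mul_assoc, e₂]
        rw [this]
        exact Submodule.smul_mem _ _ (Submodule.subset_span ⟨k, rfl⟩)
      · have : f j * (a * (u k * v k)) = 0 := by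
          rw [← h₂ k, mul_assoc (u _), ← mul_assoc a, ← mul_assoc (f j), ← mul_assoc, hf.orth _ _ _ hk,
            zero_mul]
        rw [this]
        exact zero_mem _
    · rw [Submodule.span_le]
      rintro _ ⟨k, rfl⟩
      refine ⟨v ⟨j, k⟩, ?_⟩
      rw [cornerMap_apply, h₄]
      exact h₃ ⟨j, k⟩
  rw [cornerDim, hr, finrank_span_eq_card hx, Fintype.card_fin]

end CornerDim

/-! ### Group algebras as Frobenius extensions. -/

section GroupExtension

open scoped MonoidAlgebra

variable {G H : Type} [Group G] [Group H] [Fintype G] [Fintype H] (φ : H →* G)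

/-- The restriction of an element of a group algebra to a subgroup. -/
noncomputable def groupAlgRes : ℚ[G] →ₗ[ℚ] ℚ[H] where
  toFun a := ∑ h, a.coeff (φ h) • MonoidAlgebra.of ℚ H h
  map_add' a b := by simp [add_smul, Finset.sum_add_distrib]
  map_smul' q a := by simp [mul_smul, Finset.smul_sum]

lemma groupAlgRes_apply (a : ℚ[G]) :
    groupAlgRes φ a = ∑ h, a.coeff (φ h) • MonoidAlgebra.of ℚ H h := rfl

lemma groupAlgRes_of [DecidableEq G] (g : G) : groupAlgRes φ (MonoidAlgebra.of ℚ G g) =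
    ∑ h, if g = φ h then MonoidAlgebra.of ℚ H h else 0 := by
  rw [groupAlgRes_apply]
  refine Finset.sum_congr rfl fun h _ ↦ ?_
  rw [MonoidAlgebra.of_apply, MonoidAlgebra.coeff_single, Finsupp.single_apply]
  split_ifs <;> simp

/-- The dual bases run over all of `G` rather than over representatives of cosets. Every element of
`H` then contributes one copy of `x` to the sum, hence the factor `|H|⁻¹`. -/
lemma FrobData.group (φ : H →* G) :
    FrobData (S := G) (MonoidAlgebra.mapDomainAlgHom ℚ ℚ φ) (groupAlgRes φ)
      (fun g ↦ (Fintype.card H : ℚ)⁻¹ • MonoidAlgebra.of ℚ G g)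
      (fun g ↦ MonoidAlgebra.of ℚ G g⁻¹) where
  left b a := by
    induction b using MonoidAlgebra.induction_on with
    | of h =>
      rw [mapDomainAlgHom_of, groupAlgRes_apply, groupAlgRes_apply, Finset.mul_sum]
      refine Fintype.sum_equiv (Equiv.mulLeft h⁻¹) _ _ fun k ↦ ?_
      rw [mul_smul_comm, ← map_mul, MonoidAlgebra.of_apply, MonoidAlgebra.coeff_single_mul_apply]
      simp
    | add x y hx hy => rw [map_add, add_mul, map_add, add_mul, hx, hy]
    | smul q x hx => rw [map_smul, smul_mul_assoc, map_smul, smul_mul_assoc, hx]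
  right a b := by
    induction b using MonoidAlgebra.induction_on with
    | of h =>
      rw [mapDomainAlgHom_of, groupAlgRes_apply, groupAlgRes_apply, Finset.sum_mul]
      refine Fintype.sum_equiv (Equiv.mulRight h⁻¹) _ _ fun k ↦ ?_
      rw [smul_mul_assoc, ← map_mul, MonoidAlgebra.of_apply, MonoidAlgebra.coeff_mul_single_apply]
      simp
    | add x y hx hy => rw [map_add, mul_add, map_add, mul_add, hx, hy]
    | smul q x hx => rw [map_smul, mul_smul_comm, map_smul, mul_smul_comm, hx]
  sum a := by
    classical
    have hc : (Fintype.card H : ℚ) ≠ 0 := by exact_mod_cast Fintype.card_ne_zero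
    induction a using MonoidAlgebra.induction_on with
    | of x =>
      simp only [← map_mul, groupAlgRes_of, map_sum, Finset.mul_sum]
      rw [Finset.sum_comm]
      have : ∀ h : H, ∑ g : G, (Fintype.card H : ℚ)⁻¹ • MonoidAlgebra.of ℚ G g *
          MonoidAlgebra.mapDomainAlgHom ℚ ℚ φ
            (if g⁻¹ * x = φ h then MonoidAlgebra.of ℚ H h else 0) =
          (Fintype.card H : ℚ)⁻¹ • MonoidAlgebra.of ℚ G x := fun h ↦ by
        rw [Finset.sum_eq_single (x * (φ h)⁻¹)]
        · rw [if_pos (by simp), mapDomainAlgHom_of, smul_mul_assoc, ← map_mul]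
          simp
        · intro g _ hg
          rw [if_neg, map_zero, mul_zero]
          intro h'
          exact hg (by rw [← h']; simp)
        · simp
      rw [Finset.sum_congr rfl fun h _ ↦ this h]
      simp only [Finset.sum_const, Finset.card_univ]
      rw [← Nat.cast_smul_eq_nsmul ℚ, smul_smul, mul_inv_cancel₀ hc, one_smul]
    | add x y hx hy =>
      simp only [mul_add, map_add, Finset.sum_add_distrib, hx, hy]
    | smul q x hx =>
      simp only [mul_smul_comm, map_smul]
      rw [← Finset.smul_sum, hx]

end GroupExtension

/-! ### Block permutations in Σ_p × Σ_q. -/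

section PermExt

open scoped MonoidAlgebra

variable {p q n : ℕ} (h : p + q = n)

/-- The splitting of `n = p + q` positions. -/
def blockEquiv : Fin p ⊕ Fin q ≃ Fin n := finSumFinEquiv.trans (finCongr h)

lemma permProd_inl (x : Equiv.Perm (Fin p) × Equiv.Perm (Fin q)) (i : Fin p) :
    permProd h x (blockEquiv h (Sum.inl i)) = blockEquiv h (Sum.inl (x.1 i)) := by
  simp [permProd, blockEquiv]

lemma permProd_inr (x : Equiv.Perm (Fin p) × Equiv.Perm (Fin q)) (i : Fin q) :
    permProd h x (blockEquiv h (Sum.inr i)) = blockEquiv h (Sum.inr (x.2 i)) := by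
  simp [permProd, blockEquiv]

lemma permProd_injective : Function.Injective (permProd h) := by
  rw [injective_iff_map_eq_one]
  intro x hx
  ext i
  · have := permProd_inl h x i
    rw [hx] at this
    simpa using congrArg Fin.val (Sum.inl_injective ((blockEquiv h).injective this)).symm
  · have := permProd_inr h x i
    rw [hx] at this
    simpa using congrArg Fin.val (Sum.inr_injective ((blockEquiv h).injective this)).symm

lemma mem_range_permProd {σ : Equiv.Perm (Fin n)}
    (hσ : ∀ i, ∃ j, σ (blockEquiv h (Sum.inl i)) = blockEquiv h (Sum.inl j)) :
    ∃ x, permProd h x = σ := by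
  have := Equiv.Perm.mem_sumCongrHom_range_of_perm_mapsTo_inl
    (σ := ((blockEquiv h).trans σ).trans (blockEquiv h).symm) <| by
      rintro _ ⟨i, rfl⟩
      obtain ⟨j, hj⟩ := hσ i
      exact ⟨j, by simp [hj]⟩
  obtain ⟨x, hx⟩ := this
  refine ⟨x, ?_⟩
  change (blockEquiv h).permCongr (Equiv.Perm.sumCongrHom _ _ x) = σ
  rw [hx]
  ext; simp

lemma sign_permProd (x : Equiv.Perm (Fin p) × Equiv.Perm (Fin q)) :
    Equiv.Perm.sign (permProd h x) = Equiv.Perm.sign x.1 * Equiv.Perm.sign x.2 := by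
  change Equiv.Perm.sign ((blockEquiv h).permCongr (Equiv.Perm.sumCongr x.1 x.2)) = _
  rw [Equiv.Perm.sign_permCongr, Equiv.Perm.sign_sumCongr]

/-- The external product of elements of group algebras of symmetric groups. -/
noncomputable def permExt (x : ℚ[Equiv.Perm (Fin p)]) (y : ℚ[Equiv.Perm (Fin q)]) :
    ℚ[Equiv.Perm (Fin n)] :=
  MonoidAlgebra.mapDomainAlgHom ℚ ℚ (permProd h) (boxMul x y)

lemma permExt_mul (x x' : ℚ[Equiv.Perm (Fin p)]) (y y' : ℚ[Equiv.Perm (Fin q)]) :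
    permExt h x y * permExt h x' y' = permExt h (x * x') (y * y') := by
  rw [permExt, permExt, permExt, ← map_mul, boxMul_mul]

lemma boxMul_sum_sum {G H : Type} [Group G] [Group H] {ι κ : Type} (s : Finset ι) (t : Finset κ)
    (a : ι → ℚ[G]) (b : κ → ℚ[H]) :
    boxMul (∑ i ∈ s, a i) (∑ j ∈ t, b j) = ∑ x ∈ s ×ˢ t, boxMul (a x.1) (b x.2) := by
  simp only [boxMul, map_sum]
  rw [Finset.sum_mul_sum, Finset.sum_product]

/-- If no colour occurs in both blocks, a permutation which preserves the colours also preserves the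
blocks. -/
lemma altSum_permExt {c : Fin n → ℕ} (hc : ∀ i j, c (blockEquiv h (Sum.inl i)) ≠
    c (blockEquiv h (Sum.inr j))) :
    permExt h (altSum fun i ↦ c (blockEquiv h (Sum.inl i)))
      (altSum fun j ↦ c (blockEquiv h (Sum.inr j))) = altSum c := by
  rw [permExt, altSum, altSum, boxMul_sum_sum, map_sum, altSum]
  refine Finset.sum_bij (fun x _ ↦ permProd h x) ?_ (fun _ _ _ _ e ↦ permProd_injective h e) ?_ ?_
  · intro x hx
    simp only [Finset.mem_product, Finset.mem_filter, Finset.mem_univ, true_and] at hx ⊢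
    intro i
    obtain ⟨i | i, rfl⟩ := (blockEquiv h).surjective i
    · rw [permProd_inl, hx.1]
    · rw [permProd_inr, hx.2]
  · intro σ hσ
    simp only [Finset.mem_filter, Finset.mem_univ, true_and] at hσ
    obtain ⟨x, rfl⟩ := mem_range_permProd h (σ := σ) fun i ↦ by
      obtain ⟨j | j, hj⟩ := (blockEquiv h).surjective (σ (blockEquiv h (Sum.inl i)))
      · exact ⟨j, hj.symm⟩
      · refine absurd (hσ (blockEquiv h (Sum.inl i))) ?_
        rw [← hj]
        exact (hc i j).symm
    refine ⟨x, ?_, rfl⟩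
    simp only [Finset.mem_product, Finset.mem_filter, Finset.mem_univ, true_and]
    refine ⟨fun i ↦ ?_, fun i ↦ ?_⟩
    · rw [← permProd_inl, hσ]
    · rw [← permProd_inr, hσ]
  · intro x _
    rw [boxMul_smul_left, boxMul_smul_right, boxMul_of, map_smul, map_smul, mapDomainAlgHom_of,
      smul_smul, sign_permProd]
    simp

end PermExt

/-! ### Column antisymmetrizers and their Young modules. -/

section AltProj

open scoped MonoidAlgebra

variable {n : ℕ}

/-- The idempotent which antisymmetrizes in the classes of a colouring. -/
noncomputable def altProj (c : Fin n → ℕ) : ℚ[Equiv.Perm (Fin n)] :=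
  (stabCard c : ℚ)⁻¹ • altSum c

lemma stabCard_ne_zero (c : Fin n → ℕ) : (stabCard c : ℚ) ≠ 0 := by
  exact_mod_cast (stabCard_pos c).ne'

lemma altProj_mul_self (c : Fin n → ℕ) : altProj c * altProj c = altProj c := by
  rw [altProj, smul_mul_smul_comm, altSum_mul_self, smul_smul, mul_assoc,
    inv_mul_cancel₀ (stabCard_ne_zero c), mul_one]

lemma altSum_coeff_one (c : Fin n → ℕ) : (altSum c).coeff 1 = 1 := by
  rw [altSum]
  simp only [MonoidAlgebra.coeff_sum, Finset.sum_apply', MonoidAlgebra.coeff_smul,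
    Finsupp.smul_apply, MonoidAlgebra.of_apply, MonoidAlgebra.coeff_single, Finsupp.single_apply]
  rw [Finset.sum_eq_single 1] <;> simp +contextual

/-- Idempotence determines the scalar, so orders of stabilizers need not be multiplied out in
`altProj_permExt`. -/
lemma altProj_unique {c : Fin n → ℕ} {q : ℚ} (h : (q • altSum c) * (q • altSum c) = q • altSum c)
    (hq : q ≠ 0) : q • altSum c = altProj c := by
  rw [smul_mul_smul_comm, altSum_mul_self, smul_smul] at h
  have h₁ := congrArg (fun x ↦ x.coeff 1) h
  simp only [MonoidAlgebra.coeff_smul, Finsupp.smul_apply, altSum_coeff_one, smul_eq_mul,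
    mul_one] at h₁
  rw [altProj]
  congr 1
  have := stabCard_ne_zero c
  field_simp at h₁ ⊢
  exact h₁

lemma altProj_permExt {p q : ℕ} (h : p + q = n) {c : Fin n → ℕ}
    (hc : ∀ i j, c (blockEquiv h (Sum.inl i)) ≠ c (blockEquiv h (Sum.inr j))) :
    permExt h (altProj fun i ↦ c (blockEquiv h (Sum.inl i)))
      (altProj fun j ↦ c (blockEquiv h (Sum.inr j))) = altProj c := by
  have e : permExt h (altProj fun i ↦ c (blockEquiv h (Sum.inl i)))
      (altProj fun j ↦ c (blockEquiv h (Sum.inr j))) =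
      ((stabCard fun j ↦ c (blockEquiv h (Sum.inr j)) : ℚ)⁻¹ *
        (stabCard fun i ↦ c (blockEquiv h (Sum.inl i)) : ℚ)⁻¹) • altSum c := by
    rw [← altSum_permExt h hc, altProj, altProj, permExt, boxMul_smul_left, boxMul_smul_right,
      map_smul, map_smul, smul_smul, permExt, mul_comm]
  have h₁ : permExt h (altProj fun i ↦ c (blockEquiv h (Sum.inl i)))
      (altProj fun j ↦ c (blockEquiv h (Sum.inr j))) * permExt h
        (altProj fun i ↦ c (blockEquiv h (Sum.inl i)))
      (altProj fun j ↦ c (blockEquiv h (Sum.inr j))) = permExt h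
        (altProj fun i ↦ c (blockEquiv h (Sum.inl i)))
      (altProj fun j ↦ c (blockEquiv h (Sum.inr j))) := by
    rw [permExt_mul, altProj_mul_self, altProj_mul_self]
  rw [e] at h₁ ⊢
  exact altProj_unique h₁ (mul_ne_zero (inv_ne_zero (stabCard_ne_zero _))
    (inv_ne_zero (stabCard_ne_zero _)))

lemma altProj_const (a : ℕ) : altProj (fun _ : Fin n ↦ a) = altIdem n := by
  simp [altProj, altIdem, stabCard, altSum, Fintype.card_perm]

lemma altIdem_mul_self (n : ℕ) : altIdem n * altIdem n = altIdem n := by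
  rw [← altProj_const 0, altProj_mul_self]

lemma altProj_conj (c : Fin n → ℕ) (g : Equiv.Perm (Fin n)) :
    MonoidAlgebra.of ℚ _ g * altProj (c ∘ g) * MonoidAlgebra.of ℚ _ g⁻¹ = altProj c := by
  have e : MonoidAlgebra.of ℚ _ g * altSum (c ∘ g) * MonoidAlgebra.of ℚ _ g⁻¹ = altSum c := by
    rw [altSum, altSum, Finset.mul_sum, Finset.sum_mul]
    refine Finset.sum_bij (fun σ _ ↦ g * σ * g⁻¹) ?_ (fun a _ b _ ↦ by simp) ?_ ?_
    · intro σ hσ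
      simp only [Finset.mem_filter, Finset.mem_univ, true_and, Function.comp_apply] at hσ ⊢
      intro i
      have := hσ (g⁻¹ i)
      simpa using this
    · intro σ hσ
      simp only [Finset.mem_filter, Finset.mem_univ, true_and] at hσ
      refine ⟨g⁻¹ * σ * g, ?_, by group⟩
      simp [hσ]
    · intro σ _
      rw [mul_smul_comm, smul_mul_assoc, ← map_mul, ← map_mul]
      congr 2
      rw [map_mul, map_mul, Equiv.Perm.sign_inv, mul_right_comm, Int.units_mul_self, one_mul]
  -- `stabCard` is the factor in the square of `altSum`, and conjugation respects squares.
  have h : stabCard (c ∘ g) = stabCard c := by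
    have h₁ := altSum_mul_self c
    rw [← e] at h₁
    have h₂ : MonoidAlgebra.of ℚ _ g * altSum (c ∘ g) * MonoidAlgebra.of ℚ _ g⁻¹ *
        (MonoidAlgebra.of ℚ _ g * altSum (c ∘ g) * MonoidAlgebra.of ℚ _ g⁻¹) =
        MonoidAlgebra.of ℚ _ g * (altSum (c ∘ g) * altSum (c ∘ g)) *
          MonoidAlgebra.of ℚ _ g⁻¹ := by
      simp only [mul_assoc]
      rw [← mul_assoc (MonoidAlgebra.of ℚ _ g⁻¹), ← map_mul, inv_mul_cancel, map_one, one_mul]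
    rw [h₂, altSum_mul_self, mul_smul_comm, smul_mul_assoc, e] at h₁
    have h₃ := congrArg (fun x ↦ x.coeff 1) h₁
    simp only [MonoidAlgebra.coeff_smul, Finsupp.smul_apply, altSum_coeff_one, smul_eq_mul,
      mul_one] at h₃
    exact_mod_cast h₃
  rw [altProj, h, mul_smul_comm, smul_mul_assoc, e, altProj]

variable (μ ν : n.Partition)

lemma colSum_mul_rowSum_scalar (x : ℚ[Equiv.Perm (Fin n)]) :
    ∃ q : ℚ, colSum μ * x * rowSum μ = q • (colSum μ * rowSum μ) := by
  obtain ⟨q, hq⟩ := rowSum_mul_colSum_scalar μ (groupAlgRev x)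
  refine ⟨q, ?_⟩
  have hr : groupAlgRev (rowSum μ) = rowSum μ := groupAlgRev_symSum _
  have hc : groupAlgRev (colSum μ) = colSum μ := groupAlgRev_altSum _
  have := congrArg groupAlgRev hq
  rwa [groupAlgRev_mul, groupAlgRev_mul, groupAlgRev_rev, groupAlgRev_smul, youngSym,
    groupAlgRev_mul, hr, hc, ← mul_assoc] at this

/-- With row sum `R` and column sum `C` the corner is spanned by `C R C`, which is nonzero since `R
(C R C)` is the square of the Young symmetrizer. -/
lemma cornerDim_altProj_youngIdem_self : cornerDim (altProj (boxCol μ)) (youngIdem μ) = 1 := by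
  have hc := coeff_youngSym_sq_ne_zero μ
  have hs := stabCard_ne_zero (boxCol μ)
  have e : ∀ a, altProj (boxCol μ) * (a * youngIdem μ) =
      ((stabCard (boxCol μ) : ℚ)⁻¹ * ((youngSym μ * youngSym μ).coeff 1)⁻¹) •
        (colSum μ * a * rowSum μ * colSum μ) := fun a ↦ by
    rw [altProj, youngIdem, mul_smul_comm, smul_mul_smul_comm, youngSym]
    simp only [mul_assoc]
    rfl
  refine cornerDim_eq_one (x := colSum μ * rowSum μ * colSum μ) (fun h ↦ ?_) ?_ fun a ↦ ?_
  · refine youngSym_mul_self_ne_zero μ ?_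
    calc _ = rowSum μ * (colSum μ * rowSum μ * colSum μ) := by simp only [youngSym, mul_assoc]
      _ = 0 := by rw [h, mul_zero]
  · refine ⟨((stabCard (boxCol μ) : ℚ) * ((youngSym μ * youngSym μ).coeff 1)) • 1, ?_⟩
    rw [e, mul_smul_comm, mul_one, smul_mul_assoc, smul_mul_assoc, smul_smul]
    have : (stabCard (boxCol μ) : ℚ)⁻¹ * ((youngSym μ * youngSym μ).coeff 1)⁻¹ *
      ((stabCard (boxCol μ) : ℚ) * ((youngSym μ * youngSym μ).coeff 1)) = 1 := by field_simp
    rw [this, one_smul]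
  · obtain ⟨q, hq⟩ := colSum_mul_rowSum_scalar μ a
    exact ⟨_, by rw [e, hq, smul_mul_assoc, smul_smul]⟩

/-- With the preceding lemma, the multiplicities of Young modules in the images of column
antisymmetrizers form a unitriangular matrix. Its invertibility over ℤ is what `SymChar.mem_range`
exploits. -/
lemma cornerDim_altProj_youngIdem {μ ν : n.Partition}
    (h : cornerDim (altProj (boxCol ν)) (youngIdem μ) ≠ 0) (hne : μ ≠ ν) :
    rowStat μ < rowStat ν := by
  refine rowStat_lt ?_ hne
  by_contra h'
  refine h (cornerDim_eq_zero fun a ↦ ?_)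
  have : altSum (boxCol ν) * a * rowSum μ = 0 := colSum_mul_rowSum_eq_zero μ ν h' a
  rw [altProj, youngIdem, mul_smul_comm, smul_mul_smul_comm, ← mul_assoc, youngSym,
    ← mul_assoc (_ * a), this, zero_mul, smul_zero]

end AltProj

/-! ### Classes of images as polynomials in the classes of exterior powers. -/

section SymChar

open scoped MonoidAlgebra

/-- The properties of the classes of the images of the idempotents of the group algebras of the
symmetric groups on the tensor powers of an object. -/
structure SymChar {K : Type*} [CommRing K] (κ : ∀ n, ℚ[Equiv.Perm (Fin n)] → K) : Prop where
  one : κ 0 1 = 1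
  decomp : ∀ {n} {e : ℚ[Equiv.Perm (Fin n)]}, e * e = e →
    κ n e = ∑ μ, cornerDim e (youngIdem μ) • κ n (youngIdem μ)
  ext : ∀ {p q n} (h : p + q = n) {e f}, e * e = e → f * f = f →
    κ n (permExt h e f) = κ p e * κ q f

namespace SymChar

variable {K : Type*} [CommRing K] {κ : ∀ n, ℚ[Equiv.Perm (Fin n)] → K} (hκ : SymChar κ)

lemma prod {K' : Type*} [CommRing K'] {κ' : ∀ n, ℚ[Equiv.Perm (Fin n)] → K'} (hκ : SymChar κ)
    (hκ' : SymChar κ') : SymChar fun n e ↦ (κ n e, κ' n e) where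
  one := by rw [hκ.one, hκ'.one]; rfl
  decomp he := by
    ext
    · simp [hκ.decomp he, Prod.fst_sum]
    · simp [hκ'.decomp he, Prod.snd_sum]
  ext h _ _ he hf := by rw [hκ.ext h he hf, hκ'.ext h he hf]; rfl

include hκ

/-- By `decomp` the value is determined by dimensions of corners, which conjugation does not change.
-/
lemma conj {n : ℕ} {e : ℚ[Equiv.Perm (Fin n)]} (he : e * e = e) (g : Equiv.Perm (Fin n)) :
    κ n (MonoidAlgebra.of ℚ _ g * e * MonoidAlgebra.of ℚ _ g⁻¹) = κ n e := by
  have h : MonoidAlgebra.of ℚ _ g⁻¹ * MonoidAlgebra.of ℚ _ g = 1 := by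
    rw [← map_mul]; simp [MonoidAlgebra.one_def]
  have h' : MonoidAlgebra.of ℚ _ g * MonoidAlgebra.of ℚ _ g⁻¹ = 1 := by
    rw [← map_mul]; simp [MonoidAlgebra.one_def]
  rw [hκ.decomp, hκ.decomp he]
  · simp only [cornerDim_conj _ _ h' h]
  · simp only [mul_assoc]
    rw [← mul_assoc (MonoidAlgebra.of ℚ _ g⁻¹), h, one_mul, ← mul_assoc e, he]

/-- Up to conjugation, antisymmetrization in the classes of a colouring is an external product of
full antisymmetrizations. The induction splits off the class of the first position; its size `p` is
positive. -/
lemma altProj_mem (R : Subalgebra ℤ K) (N : ℕ)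
    (hR : ∀ i < N, κ (i + 1) (altIdem (i + 1)) ∈ R) :
    ∀ n ≤ N, ∀ c : Fin n → ℕ, κ n (altProj c) ∈ R := by
  intro n
  induction n using Nat.strong_induction_on with
  | _ n ih =>
  intro hn c
  rcases Nat.eq_zero_or_pos n with rfl | hpos
  · have : altProj c = 1 := by
      simp [altProj, altSum, stabCard]
      rfl
    rw [this, hκ.one]
    exact one_mem _
  let a := c ⟨0, hpos⟩
  let p := Fintype.card {i // c i = a}
  let q := Fintype.card {i // ¬ c i = a}
  have h : p + q = n := by
    have := Fintype.card_subtype_compl (fun i ↦ c i = a)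
    have h₂ := Fintype.card_subtype_le (fun i ↦ c i = a)
    rw [Fintype.card_fin] at this h₂
    omega
  have hp : 0 < p := Fintype.card_pos_iff.2 ⟨⟨0, hpos⟩, rfl⟩
  let g : Equiv.Perm (Fin n) := (blockEquiv h).symm.trans
    ((Equiv.sumCongr (Fintype.equivFin {i // c i = a}).symm
      (Fintype.equivFin {i // ¬ c i = a}).symm).trans (Equiv.sumCompl fun i ↦ c i = a))
  have h₁ : ∀ i, (c ∘ g) (blockEquiv h (Sum.inl i)) = a := fun i ↦ by
    simp only [Function.comp_apply, g, Equiv.trans_apply, Equiv.symm_apply_apply]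
    exact ((Fintype.equivFin {i // c i = a}).symm i).2
  have h₂ : ∀ i, (c ∘ g) (blockEquiv h (Sum.inr i)) ≠ a := fun i ↦ by
    simp only [Function.comp_apply, g, Equiv.trans_apply, Equiv.symm_apply_apply]
    exact ((Fintype.equivFin {i // ¬ c i = a}).symm i).2
  rw [← altProj_conj c g, hκ.conj (altProj_mul_self _), ← altProj_permExt h (fun i j ↦ by
    rw [h₁]; exact (h₂ j).symm), hκ.ext h (altProj_mul_self _) (altProj_mul_self _)]
  refine mul_mem ?_ (ih q (by omega) (by omega) _)
  simp only [h₁, altProj_const]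
  have := hR (p - 1) (by omega)
  rwa [Nat.sub_add_cancel hp] at this

/-- The classes of the images of idempotents are polynomials in those of the exterior powers. -/
theorem mem_range {n : ℕ} {e : ℚ[Equiv.Perm (Fin n)]} (he : e * e = e) :
    κ n e ∈ (MvPolynomial.aeval (R := ℤ) fun i : Fin n ↦
      κ (i.1 + 1) (altIdem (i.1 + 1))).range := by
  classical
  set R := (MvPolynomial.aeval (R := ℤ) fun i : Fin n ↦
      κ (i.1 + 1) (altIdem (i.1 + 1))).range with hR
  have h : ∀ i < n, κ (i + 1) (altIdem (i + 1)) ∈ R := fun i hi ↦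
    ⟨MvPolynomial.X ⟨i, hi⟩, by simp⟩
  have hy : ∀ s, ∀ μ : n.Partition, rowStat μ = s → κ n (youngIdem μ) ∈ R := by
    intro s
    induction s using Nat.strong_induction_on with
    | _ s ih =>
    rintro ν rfl
    -- The decomposition of this element contains the term of `ν` once and otherwise only terms of
    -- partitions with smaller `rowStat`, which belong to `R` by induction.
    have h₁ := hκ.altProj_mem R n h n le_rfl (boxCol ν)
    rw [hκ.decomp (altProj_mul_self _), ← Finset.add_sum_erase _ _ (Finset.mem_univ ν),
      cornerDim_altProj_youngIdem_self, one_smul] at h₁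
    refine (add_mem_cancel_right ?_).1 h₁
    refine sum_mem fun μ hμ ↦ ?_
    by_cases h₂ : cornerDim (altProj (boxCol ν)) (youngIdem μ) = 0
    · rw [h₂, zero_smul]
      exact zero_mem _
    · exact nsmul_mem (ih _ (cornerDim_altProj_youngIdem h₂ (Finset.ne_of_mem_erase hμ)) μ rfl) _
  rw [hκ.decomp he]
  exact sum_mem fun μ _ ↦ nsmul_mem (hy _ μ rfl) _

end SymChar

end SymChar

/-! ### The sign character. -/

section SignChar

open scoped MonoidAlgebra

/-- The sign character of the group algebra. -/
noncomputable def signChar (n : ℕ) : ℚ[Equiv.Perm (Fin n)] →ₐ[ℚ] ℚ :=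
  MonoidAlgebra.lift ℚ ℚ (Equiv.Perm (Fin n))
    (((Int.castRingHom ℚ).toMonoidHom.comp (Units.coeHom ℤ)).comp Equiv.Perm.sign)

lemma signChar_of {n : ℕ} (σ : Equiv.Perm (Fin n)) :
    signChar n (MonoidAlgebra.of ℚ _ σ) = ((Equiv.Perm.sign σ : ℤ) : ℚ) := by
  simp [signChar]

lemma altIdem_mul {n : ℕ} (x : ℚ[Equiv.Perm (Fin n)]) :
    altIdem n * x = signChar n x • altIdem n := by
  induction x using MonoidAlgebra.induction_on with
  | of σ =>
    have h := congrArg groupAlgRev (of_mul_altSum (n := n) (fun _ ↦ 0) (τ := σ⁻¹) (by simp))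
    rw [groupAlgRev_mul, groupAlgRev_altSum, groupAlgRev_of, inv_inv, groupAlgRev_smul,
      groupAlgRev_altSum, Equiv.Perm.sign_inv] at h
    rw [← altProj_const 0, altProj, smul_mul_assoc, h, signChar_of, smul_comm]
  | add x y hx hy => rw [mul_add, hx, hy, map_add, add_smul]
  | smul q x hx => rw [mul_smul_comm, hx, map_smul, smul_smul, smul_eq_mul]

lemma mul_altIdem {n : ℕ} (x : ℚ[Equiv.Perm (Fin n)]) :
    x * altIdem n = signChar n x • altIdem n := by
  induction x using MonoidAlgebra.induction_on with
  | of σ =>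
    rw [← altProj_const 0, altProj, mul_smul_comm, of_mul_altSum _ (by simp), signChar_of,
      smul_comm]
  | add x y hx hy => rw [add_mul, hx, hy, map_add, add_smul]
  | smul q x hx => rw [smul_mul_assoc, hx, map_smul, smul_smul, smul_eq_mul]

lemma altIdem_ne_zero (n : ℕ) : altIdem n ≠ 0 := fun h ↦ by
  have h₁ := congrArg (fun x ↦ x.coeff 1) (altProj_const (n := n) 0)
  simp only [h, altProj, MonoidAlgebra.coeff_smul, Finsupp.smul_apply, altSum_coeff_one,
    MonoidAlgebra.coeff_zero, Finsupp.coe_zero, Pi.zero_apply, smul_eq_mul, mul_one] at h₁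
  exact inv_ne_zero (stabCard_ne_zero _) h₁

lemma signChar_altIdem (n : ℕ) : signChar n (altIdem n) = 1 := by
  have h := altIdem_mul (altIdem n)
  rw [altIdem_mul_self] at h
  have h' : (1 - signChar n (altIdem n)) • altIdem n = 0 := by rw [sub_smul, one_smul, ← h, sub_self]
  linarith [(smul_eq_zero.1 h').resolve_right (altIdem_ne_zero n)]

lemma signChar_permExt {p q n : ℕ} (h : p + q = n) (x : ℚ[Equiv.Perm (Fin p)])
    (y : ℚ[Equiv.Perm (Fin q)]) :
    signChar n (permExt h x y) = signChar p x * signChar q y := by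
  induction x using MonoidAlgebra.induction_on with
  | of σ =>
    induction y using MonoidAlgebra.induction_on with
    | of τ =>
      rw [permExt, boxMul_of, mapDomainAlgHom_of, signChar_of, signChar_of, signChar_of,
        sign_permProd]
      simp
    | add x y hx hy => 
      rw [permExt, boxMul_add_right, map_add, map_add, map_add, mul_add, ← hx, ← hy]; rfl
    | smul r x hx =>
      rw [permExt, boxMul_smul_right, map_smul, map_smul, map_smul, mul_smul_comm, ← hx]; rfl
  | add x y hx hy => 
    rw [permExt, boxMul_add_left, map_add, map_add, map_add, add_mul, ← hx, ← hy]; rfl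
  | smul r x hx =>
    rw [permExt, boxMul_smul_left, map_smul, map_smul, map_smul, smul_mul_assoc, ← hx]; rfl

end SignChar

/-! ### Restriction of the sign representation to Σ_p × Σ_q. -/

section Decomp

open scoped MonoidAlgebra

/-- A decomposition of an idempotent along a Frobenius extension. -/
structure FrobDecomp {A B S X : Type} [Ring A] [Algebra ℚ A] [Ring B] [Algebra ℚ B] [Fintype S]
    [Fintype X] (φ : B →ₐ[ℚ] A) (E : A →ₗ[ℚ] B) (r r' : S → A) (e : A) (f : X → B) (u v : X → A) :
    Prop where
  mul_u : ∀ k, e * u k = u k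
  mul_v : ∀ k, φ (f k) * v k = v k
  res_self : ∀ k, E (v k * u k) = f k
  res_ne : ∀ k l, k ≠ l → E (v k * u l) = 0
  sum : ∀ (M : Type w) [AddCommGroup M] [Module ℚ M] (Ψ : A →ₗ[ℚ] A →ₗ[ℚ] M),
    (∀ a b a', Ψ (a * φ b) a' = Ψ a (φ b * a')) →
      ∑ k, Ψ (u k) (v k) = ∑ s, Ψ (e * r s) (r' s * e)

lemma groupAlgRes_altIdem {p q n : ℕ} (h : p + q = n) :
    groupAlgRes (permProd h) (altIdem n) =
      ((p.factorial * q.factorial : ℕ) / (n.factorial : ℕ) : ℚ) •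
        boxMul (altIdem p) (altIdem q) := by
  have e : ∀ σ, (altIdem n).coeff σ = (n.factorial : ℚ)⁻¹ * ((Equiv.Perm.sign σ : ℤ) : ℚ) :=
    fun σ ↦ by
      rw [altIdem]
      simp only [MonoidAlgebra.coeff_smul, MonoidAlgebra.coeff_sum, Finsupp.smul_apply,
        Finset.sum_apply', MonoidAlgebra.of_apply, MonoidAlgebra.coeff_single,
        Finsupp.single_apply, smul_eq_mul]
      rw [Finset.sum_eq_single σ] <;> simp +contextual
  have hp : (p.factorial : ℚ) ≠ 0 := by exact_mod_cast p.factorial_ne_zero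
  have hq : (q.factorial : ℚ) ≠ 0 := by exact_mod_cast q.factorial_ne_zero
  have e' : boxMul (altIdem p) (altIdem q) = ∑ x : Equiv.Perm (Fin p) × Equiv.Perm (Fin q),
      ((p.factorial : ℚ)⁻¹ * (q.factorial : ℚ)⁻¹) • boxMul
        (((Equiv.Perm.sign x.1 : ℤ) : ℚ) • MonoidAlgebra.of ℚ _ x.1)
        (((Equiv.Perm.sign x.2 : ℤ) : ℚ) • MonoidAlgebra.of ℚ _ x.2) := by
    rw [altIdem.eq_1 p, altIdem.eq_1 q, boxMul_smul_left, boxMul_smul_right, boxMul_sum_sum,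
      smul_smul, Finset.smul_sum, ← Finset.univ_product_univ]
  rw [groupAlgRes_apply, e', Finset.smul_sum]
  refine Finset.sum_congr rfl fun x _ ↦ ?_
  rw [e, boxMul_smul_left, boxMul_smul_right, boxMul_of, smul_smul, smul_smul, smul_smul, sign_permProd]
  congr 1
  push_cast
  field_simp

/-- The sign character restricts to the product of the sign characters, so there is a single
summand; the factor `n! / (p! q!)` makes `u` and `v` dual. This identifies the summands for exterior
powers as products of exterior powers without relating `altIdem` to a Young idempotent. -/
lemma FrobDecomp.alt {p q n : ℕ} (h : p + q = n) :
    FrobDecomp.{w} (X := Unit) (MonoidAlgebra.mapDomainAlgHom ℚ ℚ (permProd h))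
      (groupAlgRes (permProd h))
      (fun g ↦ (Fintype.card (Equiv.Perm (Fin p) × Equiv.Perm (Fin q)) : ℚ)⁻¹ •
        MonoidAlgebra.of ℚ _ g)
      (fun g ↦ MonoidAlgebra.of ℚ _ g⁻¹) (altIdem n)
      (fun _ ↦ boxMul (altIdem p) (altIdem q))
      (fun _ ↦ ((n.factorial : ℕ) / (p.factorial * q.factorial : ℕ) : ℚ) • altIdem n)
      (fun _ ↦ altIdem n) where
  mul_u _ := by rw [mul_smul_comm, altIdem_mul_self]
  mul_v _ := by
    rw [mul_altIdem]
    change signChar n (permExt h _ _) • _ = _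
    rw [signChar_permExt, signChar_altIdem, signChar_altIdem, one_mul, one_smul]
  res_self _ := by
    have hp : (p.factorial : ℚ) ≠ 0 := by exact_mod_cast p.factorial_ne_zero
    have hq : (q.factorial : ℚ) ≠ 0 := by exact_mod_cast q.factorial_ne_zero
    have hn : (n.factorial : ℚ) ≠ 0 := by exact_mod_cast n.factorial_ne_zero
    rw [mul_smul_comm, altIdem_mul_self, map_smul, groupAlgRes_altIdem, smul_smul]
    convert one_smul ℚ _ using 2
    push_cast
    field_simp
  res_ne k l hkl := absurd (Subsingleton.elim k l) hkl
  sum M _ _ Ψ _ := by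
    have e : ∀ g : Equiv.Perm (Fin n), Ψ (altIdem n *
        ((Fintype.card (Equiv.Perm (Fin p) × Equiv.Perm (Fin q)) : ℚ)⁻¹ • MonoidAlgebra.of ℚ _ g))
        (MonoidAlgebra.of ℚ _ g⁻¹ * altIdem n) =
        (Fintype.card (Equiv.Perm (Fin p) × Equiv.Perm (Fin q)) : ℚ)⁻¹ •
          Ψ (altIdem n) (altIdem n) := fun g ↦ by
      rw [mul_smul_comm, altIdem_mul, mul_altIdem, map_smul, map_smul, map_smul,
        LinearMap.smul_apply, LinearMap.smul_apply, smul_smul, smul_smul, signChar_of, signChar_of,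
        Equiv.Perm.sign_inv, mul_right_comm]
      rw [sign_mul_sign, one_mul]
    rw [Fintype.sum_unique, Finset.sum_congr rfl fun g _ ↦ e g, Finset.sum_const]
    simp only [Finset.card_univ, map_smul, LinearMap.smul_apply, Fintype.card_prod,
      Fintype.card_perm, Fintype.card_fin]
    rw [← Nat.cast_smul_eq_nsmul ℚ, smul_smul, div_eq_mul_inv]

end Decomp

universe v' u'

/-! ### Tensor powers of morphisms and permutations of factors. -/

section TensorPowerMaps

variable {C : Type u} [Category.{v} C] [MonoidalCategory C]

/-- The tensor power of a morphism. -/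
def tmap {X Y : C} (f : X ⟶ Y) : (n : ℕ) → (tpow X n ⟶ tpow Y n)
  | 0 => 𝟙 _
  | n + 1 => f ⊗ₘ tmap f n

/-- The tensor product of a family of endomorphisms of an object. -/
def thom {X : C} : (n : ℕ) → (Fin n → (X ⟶ X)) → (tpow X n ⟶ tpow X n)
  | 0, _ => 𝟙 _
  | n + 1, f => f 0 ⊗ₘ thom n fun i ↦ f i.succ

lemma tmap_succ {X Y : C} (f : X ⟶ Y) (n : ℕ) : tmap f (n + 1) = f ⊗ₘ tmap f n := rfl

lemma thom_succ {X : C} {n : ℕ} (f : Fin (n + 1) → (X ⟶ X)) :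
    thom (n + 1) f = f 0 ⊗ₘ thom n fun i ↦ f i.succ := rfl

lemma tmap_id (X : C) (n : ℕ) : tmap (𝟙 X) n = 𝟙 _ := by
  induction n with
  | zero => rfl
  | succ n ih => rw [tmap_succ, ih, id_tensorHom_id]

lemma tmap_comp {X Y Z : C} (f : X ⟶ Y) (g : Y ⟶ Z) (n : ℕ) :
    tmap (f ≫ g) n = tmap f n ≫ tmap g n := by
  induction n with
  | zero => exact (Category.id_comp _).symm
  | succ n ih => rw [tmap_succ, tmap_succ, tmap_succ, ih, tensorHom_comp_tensorHom]

lemma thom_comp {X : C} {n : ℕ} (f g : Fin n → (X ⟶ X)) :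
    thom n f ≫ thom n g = thom n fun i ↦ f i ≫ g i := by
  induction n with
  | zero => exact Category.id_comp _
  | succ n ih => rw [thom_succ, thom_succ, thom_succ, tensorHom_comp_tensorHom, ih]

lemma thom_const {X : C} (f : X ⟶ X) (n : ℕ) : thom n (fun _ ↦ f) = tmap f n := by
  induction n with
  | zero => rfl
  | succ n ih => rw [thom_succ, tmap_succ, ih]

variable [SymmetricCategory C]

/-- The symmetry of the first two factors of a tensor product. -/
def tmid (X P : C) : X ⊗ X ⊗ P ⟶ X ⊗ X ⊗ P :=
  (α_ X X P).inv ≫ (β_ X X).hom ▷ P ≫ (α_ X X P).hom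

lemma tswap_zero (X : C) (n : ℕ) : tswap X (n + 2) 0 = tmid X (tpow X n) := rfl

lemma tmid_natural {X Y P Q : C} (f g : X ⟶ Y) (h : P ⟶ Q) :
    (f ⊗ₘ (g ⊗ₘ h)) ≫ tmid Y Q = tmid X P ≫ (g ⊗ₘ (f ⊗ₘ h)) := by
  rw [tmid, tmid, associator_inv_naturality_assoc, ← tensorHom_id, ← tensorHom_id,
    tensorHom_comp_tensorHom_assoc, BraidedCategory.braiding_naturality]
  simp only [Category.assoc, ← associator_naturality, Category.comp_id]
  rw [tensorHom_comp_tensorHom_assoc, Category.id_comp]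

lemma tmid_whiskerLeft {X P Q : C} (h : P ⟶ Q) :
    X ◁ X ◁ h ≫ tmid X Q = tmid X P ≫ X ◁ X ◁ h := by
  simpa using tmid_natural (𝟙 X) (𝟙 X) h

lemma tmid_whiskerLeft_assoc {X P Q Z : C} (h : P ⟶ Q) (f : X ⊗ X ⊗ Q ⟶ Z) :
    X ◁ X ◁ h ≫ tmid X Q ≫ f = tmid X P ≫ X ◁ X ◁ h ≫ f := by
  rw [← Category.assoc, tmid_whiskerLeft, Category.assoc]

lemma tmap_tswap {X Y : C} (f : X ⟶ Y) : ∀ n i,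
    tmap f n ≫ tswap Y n i = tswap X n i ≫ tmap f n
  | 0, _ => (Category.comp_id _).trans (Category.id_comp _).symm
  | 1, _ => (Category.comp_id _).trans (Category.id_comp _).symm
  | n + 2, 0 => tmid_natural f f (tmap f n)
  | n + 2, i + 1 => by
    rw [tswap_succ, tswap_succ, tmap_succ, ← id_tensorHom, ← id_tensorHom, tensorHom_comp_tensorHom,
      tensorHom_comp_tensorHom, tmap_tswap f (n + 1) i, Category.comp_id, Category.id_comp]

lemma adj_zero_succ_succ {n : ℕ} (i : Fin n) :
    adj 0 (show 0 + 1 < n + 2 by omega) i.succ.succ = i.succ.succ := by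
  ext; rw [adj_val]; simp

lemma adj_succ_zero {n i : ℕ} (h : i + 1 + 1 < n + 1) : adj (i + 1) h 0 = 0 := by
  ext; rw [adj_val]; simp

lemma adj_succ_succ {n i : ℕ} (h : i + 1 + 1 < n + 1) (j : Fin n) :
    adj (i + 1) h j.succ = (adj i (by omega) j).succ := by
  ext; rw [adj_val, Fin.val_succ, Fin.val_succ, adj_val]; split_ifs <;> omega

lemma thom_tswap {X : C} : ∀ n i (h : i + 1 < n) (f : Fin n → (X ⟶ X)),
    thom n f ≫ tswap X n i = tswap X n i ≫ thom n (f ∘ adj i h)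
  | 0, _, h, _ => absurd h (by omega)
  | 1, _, h, _ => absurd h (by omega)
  | n + 2, 0, h, f => by
    have h₀ : adj 0 h 0 = 1 := by ext; rw [adj_val]; simp
    have h₁ : adj 0 h (Fin.succ 0) = 0 := by ext; rw [adj_val]; simp
    have := tmid_natural (f 0) (f 1) (thom n fun i ↦ f i.succ.succ)
    rw [thom_succ, thom_succ, thom_succ, thom_succ]
    simp only [Function.comp_apply, h₀, h₁, adj_zero_succ_succ]
    exact this
  | n + 2, i + 1, h, f => by
    have := thom_tswap (n + 1) i (by omega) fun j ↦ f j.succ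
    rw [tswap_succ, thom_succ f, thom_succ (f ∘ _), ← id_tensorHom, tensorHom_comp_tensorHom,
      tensorHom_comp_tensorHom, this]
    simp only [Function.comp_apply, adj_succ_zero, adj_succ_succ, Category.comp_id,
      Category.id_comp]
    rfl

lemma tperm_adj (X : C) {n i : ℕ} (h : i + 1 < n) : tperm X n (adj i h) = tswap X n i := by
  have := tperm_adj_mul X n i h 1
  rwa [mul_one, tperm_one, Category.id_comp] at this

/-- Permutations are products of transpositions of neighbours. -/
lemma perm_adj_induction {n : ℕ} {p : Equiv.Perm (Fin n) → Prop} (σ : Equiv.Perm (Fin n))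
    (one : p 1) (adj_mul : ∀ i (h : i + 1 < n) σ, p σ → p (adj i h * σ)) : p σ := by
  cases n with
  | zero => rwa [Subsingleton.elim σ 1]
  | succ n =>
    have hσ : σ ∈ Submonoid.closure (Set.range fun i : Fin n ↦ Equiv.swap i.castSucc i.succ) := by
      rw [Equiv.Perm.mclosure_swap_castSucc_succ]
      trivial
    induction hσ using Submonoid.closure_induction_left with
    | one => exact one
    | mul_left x hx y _ ih =>
      obtain ⟨i, rfl⟩ := hx
      exact adj_mul i.1 (by omega) y ih

lemma tmap_tperm {X Y : C} (f : X ⟶ Y) (n : ℕ) (σ : Equiv.Perm (Fin n)) :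
    tmap f n ≫ tperm Y n σ = tperm X n σ ≫ tmap f n := by
  induction σ using perm_adj_induction with
  | one => rw [tperm_one, tperm_one, Category.comp_id, Category.id_comp]
  | adj_mul i h σ ih =>
    rw [tperm_adj_mul, tperm_adj_mul, ← Category.assoc, ih, Category.assoc, tmap_tswap,
      Category.assoc]

lemma adj_inv {n i : ℕ} (h : i + 1 < n) : (adj i h)⁻¹ = adj i h := Equiv.swap_inv _ _

/-- Applied to orthogonal projectors, this separates the words in the tensor power of a direct sum,
and the elements of Σ_n in `actLin_injective`. -/
lemma thom_tperm {X : C} {n : ℕ} (σ : Equiv.Perm (Fin n)) (f : Fin n → (X ⟶ X)) :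
    thom n f ≫ tperm X n σ = tperm X n σ ≫ thom n (f ∘ (σ⁻¹ : Equiv.Perm (Fin n))) := by
  induction σ using perm_adj_induction with
  | one => rw [tperm_one, Category.comp_id, Category.id_comp]; rfl
  | adj_mul i h σ ih =>
    rw [tperm_adj_mul, ← Category.assoc, ih, Category.assoc, thom_tswap _ _ h, Category.assoc,
      mul_inv_rev, adj_inv]
    rfl

end TensorPowerMaps

/-! ### Concatenation of tensor powers. -/

section TensorJoin

variable {C : Type u} [Category.{v} C] [MonoidalCategory C]

/-- The concatenation of tensor powers. -/
def tjoin (X : C) : (p q n : ℕ) → p + q = n → (tpow X p ⊗ tpow X q ≅ tpow X n)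
  -- The total length is an argument with a proof of `p + q = n`, so that the recursion needs a cast
  -- only in this case.
  | 0, q, _, h => λ_ (tpow X q) ≪≫ eqToIso (congrArg (tpow X) ((Nat.zero_add q).symm.trans h))
  | p + 1, _, 0, h => absurd h (by omega)
  | p + 1, q, n + 1, h => α_ X (tpow X p) (tpow X q) ≪≫
      whiskerLeftIso X (tjoin X p q n (by omega))

variable (X : C)

lemma tjoin_zero (q : ℕ) : (tjoin X 0 q q (Nat.zero_add q)).hom = (λ_ (tpow X q)).hom := by
  simp [tjoin]

lemma tjoin_succ {p q n : ℕ} (h : p + 1 + q = n + 1) :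
    (tjoin X (p + 1) q (n + 1) h).hom = (α_ X (tpow X p) (tpow X q)).hom ≫
      X ◁ (tjoin X p q n (by omega)).hom := rfl

lemma tjoin_zero_right : ∀ p, (tjoin X p 0 p rfl).hom = (ρ_ (tpow X p)).hom
  | 0 => by rw [tjoin_zero, unitors_equal]
  | p + 1 => by rw [tjoin_succ, tjoin_zero_right p]; simp

lemma tjoin_assoc : ∀ {p q r s t n : ℕ} (h₁ : p + q = r) (h₂ : r + s = n) (h₃ : q + s = t)
    (h₄ : p + t = n), (tjoin X p q r h₁).hom ▷ tpow X s ≫ (tjoin X r s n h₂).hom =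
      (α_ _ _ _).hom ≫ tpow X p ◁ (tjoin X q s t h₃).hom ≫ (tjoin X p t n h₄).hom
  | 0, q, r, s, t, n, h₁, h₂, h₃, h₄ => by
    obtain rfl : q = r := by omega
    obtain rfl : t = n := by omega
    rw [tjoin_zero, tjoin_zero, leftUnitor_naturality, leftUnitor_tensor_hom]
    simp
  | p + 1, q, r, s, t, n, h₁, h₂, h₃, h₄ => by
    obtain ⟨r, rfl⟩ : ∃ m, r = m + 1 := ⟨r - 1, by omega⟩
    obtain ⟨n, rfl⟩ : ∃ m, n = m + 1 := ⟨n - 1, by omega⟩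
    have := tjoin_assoc (p := p) (q := q) (r := r) (s := s) (t := t) (n := n) (by omega) (by omega)
      h₃ (by omega)
    rw [tjoin_succ, tjoin_succ, tjoin_succ]
    calc _ = (α_ _ _ _).hom ▷ _ ≫ (α_ _ _ _).hom ≫ X ◁ ((tjoin X p q r (by omega)).hom ▷
          tpow X s ≫ (tjoin X r s n (by omega)).hom) := by simp
      _ = _ := by rw [this]; simp

lemma thom_tjoin {X : C} : ∀ {p q n : ℕ} (h : p + q = n) (f : Fin n → (X ⟶ X)),
    ((thom p fun i ↦ f (blockEquiv h (Sum.inl i))) ⊗ₘ (thom q fun i ↦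
      f (blockEquiv h (Sum.inr i)))) ≫ (tjoin X p q n h).hom = (tjoin X p q n h).hom ≫ thom n f
  | 0, q, n, h, f => by
    obtain rfl : q = n := by omega
    rw [tjoin_zero]
    have : ∀ i, blockEquiv h (Sum.inr i) = i := fun i ↦ by ext; simp [blockEquiv]
    simp [thom, this]
  | p + 1, q, n, h, f => by
    obtain ⟨n, rfl⟩ : ∃ m, n = m + 1 := ⟨n - 1, by omega⟩
    have h' : p + q = n := by omega
    have e₁ : ∀ i : Fin p, (blockEquiv h (Sum.inl i.succ)) = (blockEquiv h' (Sum.inl i)).succ :=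
      fun i ↦ by ext; simp [blockEquiv]
    have e₂ : ∀ i : Fin q, (blockEquiv h (Sum.inr i)) = (blockEquiv h' (Sum.inr i)).succ :=
      fun i ↦ by ext; simp [blockEquiv]; omega
    have e₃ : blockEquiv h (Sum.inl 0) = 0 := by ext; simp [blockEquiv]
    have := thom_tjoin h' fun i ↦ f i.succ
    rw [tjoin_succ, thom_succ, thom_succ, associator_naturality_assoc, ← id_tensorHom,
      tensorHom_comp_tensorHom]
    simp only [e₁, e₂, e₃, this, Category.assoc]
    rw [tensorHom_comp_tensorHom, Category.comp_id, Category.id_comp]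

variable [SymmetricCategory C]

lemma tmid_assoc (X P Q : C) :
    tmid X P ▷ Q ≫ (α_ X (X ⊗ P) Q).hom ≫ X ◁ (α_ X P Q).hom =
      (α_ X (X ⊗ P) Q).hom ≫ X ◁ (α_ X P Q).hom ≫ tmid X (P ⊗ Q) := by
  rw [tmid, tmid]
  monoidal

lemma tswap_tjoin_left : ∀ {p q n : ℕ} (h : p + q = n) (i : ℕ), i + 1 < p →
    tswap X p i ▷ tpow X q ≫ (tjoin X p q n h).hom = (tjoin X p q n h).hom ≫ tswap X n i
  | 0, _, _, _, _, hi => absurd hi (by omega)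
  | 1, _, _, _, _, hi => absurd hi (by omega)
  | p + 2, q, n, h, 0, _ => by
    obtain ⟨n, rfl⟩ : ∃ m, n = m + 2 := ⟨n - 2, by omega⟩
    rw [tjoin_succ, tjoin_succ, tswap_zero, tswap_zero, MonoidalCategory.whiskerLeft_comp]
    have := tmid_assoc X (tpow X p) (tpow X q)
    simp only [Category.assoc, tmid_whiskerLeft]
    rw [← reassoc_of% this]
  | p + 2, q, n, h, i + 1, hi => by
    obtain ⟨n, rfl⟩ : ∃ m, n = m + 2 := ⟨n - 2, by omega⟩
    have := tswap_tjoin_left (p := p + 1) (q := q) (n := n + 1) (by omega) i (by omega)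
    rw [tjoin_succ, tswap_succ, tswap_succ, Category.assoc, ← MonoidalCategory.whiskerLeft_comp,
      ← this, MonoidalCategory.whiskerLeft_comp]
    simp

lemma tswap_tjoin_right : ∀ {p q n : ℕ} (h : p + q = n) (i : ℕ), i + 1 < q →
    tpow X p ◁ tswap X q i ≫ (tjoin X p q n h).hom = (tjoin X p q n h).hom ≫ tswap X n (p + i)
  | 0, q, n, h, i, _ => by
    obtain rfl : q = n := by omega
    rw [tjoin_zero, leftUnitor_naturality, Nat.zero_add]
  | p + 1, q, n, h, i, hi => by
    obtain ⟨n, rfl⟩ : ∃ m, n = m + 2 := ⟨n - 2, by omega⟩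
    have := tswap_tjoin_right (p := p) (q := q) (n := n + 1) (by omega) i hi
    rw [tjoin_succ, Nat.add_right_comm, tswap_succ, Category.assoc,
      ← MonoidalCategory.whiskerLeft_comp, ← this, MonoidalCategory.whiskerLeft_comp]
    simp

lemma blockEquiv_inl_val {p q n : ℕ} (h : p + q = n) (x : Fin p) :
    (blockEquiv h (Sum.inl x)).1 = x := by simp [blockEquiv]

lemma blockEquiv_inr_val {p q n : ℕ} (h : p + q = n) (x : Fin q) :
    (blockEquiv h (Sum.inr x)).1 = p + x := by simp [blockEquiv]

lemma permProd_adj_left {p q n : ℕ} (h : p + q = n) {i : ℕ} (hi : i + 1 < p) :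
    permProd h (adj i hi, 1) = adj i (by omega) := by
  ext x
  obtain ⟨x | x, rfl⟩ := (blockEquiv h).surjective x
  · rw [permProd_inl, adj_val]
    simp [blockEquiv, adj_val]
  · have := blockEquiv_inr_val h x
    rw [permProd_inr, adj_val, Equiv.Perm.one_apply]
    split_ifs <;> omega

lemma permProd_adj_right {p q n : ℕ} (h : p + q = n) {i : ℕ} (hi : i + 1 < q) :
    permProd h (1, adj i hi) = adj (p + i) (by omega) := by
  ext x
  obtain ⟨x | x, rfl⟩ := (blockEquiv h).surjective x
  · have := blockEquiv_inl_val h x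
    rw [permProd_inl, adj_val, Equiv.Perm.one_apply]
    split_ifs <;> omega
  · have := blockEquiv_inr_val h x
    rw [permProd_inr, adj_val, blockEquiv_inr_val, adj_val]
    split_ifs <;> omega

/-- Both sides are multiplicative, so it is enough to treat transpositions of neighbours in either
block. -/
lemma tperm_tjoin {p q n : ℕ} (h : p + q = n) (x : Equiv.Perm (Fin p) × Equiv.Perm (Fin q)) :
    (tperm X p x.1 ⊗ₘ tperm X q x.2) ≫ (tjoin X p q n h).hom =
      (tjoin X p q n h).hom ≫ tperm X n (permProd h x) := by
  obtain ⟨σ, τ⟩ := x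
  have h₁ : tperm X p σ ▷ tpow X q ≫ (tjoin X p q n h).hom =
      (tjoin X p q n h).hom ≫ tperm X n (permProd h (σ, 1)) := by
    induction σ using perm_adj_induction with
    | one =>
      change _ = _ ≫ tperm X n (permProd h 1)
      rw [map_one, tperm_one, tperm_one]
      simp
    | adj_mul i hi σ ih =>
      rw [show (adj i hi * σ, (1 : Equiv.Perm (Fin q))) = (adj i hi, 1) * (σ, 1) by simp, map_mul,
        permProd_adj_left, tperm_adj_mul, tperm_adj_mul, comp_whiskerRight, Category.assoc,
        tswap_tjoin_left X h i hi, ← Category.assoc, ih, Category.assoc]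
  have h₂ : tpow X p ◁ tperm X q τ ≫ (tjoin X p q n h).hom =
      (tjoin X p q n h).hom ≫ tperm X n (permProd h (1, τ)) := by
    induction τ using perm_adj_induction with
    | one =>
      change _ = _ ≫ tperm X n (permProd h 1)
      rw [map_one, tperm_one, tperm_one]
      simp
    | adj_mul i hi σ ih =>
      rw [show ((1 : Equiv.Perm (Fin p)), adj i hi * σ) = (1, adj i hi) * (1, σ) by simp, map_mul,
        permProd_adj_right, tperm_adj_mul, tperm_adj_mul, MonoidalCategory.whiskerLeft_comp,
        Category.assoc, tswap_tjoin_right X h i hi, ← Category.assoc, ih, Category.assoc]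
  rw [MonoidalCategory.tensorHom_def, Category.assoc, h₂, reassoc_of% h₁, ← tperm_mul, ← map_mul]
  simp

end TensorJoin

/-! ### Monoidal and braided functors on tensor powers. -/

section Functoriality

variable {C : Type u} [Category.{v} C] [MonoidalCategory C]
  {D : Type u'} [Category.{v'} D] [MonoidalCategory D]
  (F : C ⥤ D) [F.Monoidal]

open Functor.LaxMonoidal Functor.Monoidal

/-- Monoidal functors commute with tensor powers. -/
noncomputable def tpowMap (X : C) : (n : ℕ) → (tpow (F.obj X) n ≅ F.obj (tpow X n))
  | 0 => εIso F
  | n + 1 => whiskerLeftIso (F.obj X) (tpowMap X n) ≪≫ μIso F X (tpow X n)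

lemma tpowMap_succ (X : C) (n : ℕ) : (tpowMap F X (n + 1)).hom =
    F.obj X ◁ (tpowMap F X n).hom ≫ μ F X (tpow X n) := rfl

end Functoriality

section Functoriality

variable {C : Type u} [Category.{v} C] [MonoidalCategory C] [SymmetricCategory C]
  {D : Type u'} [Category.{v'} D] [MonoidalCategory D] [SymmetricCategory D]
  (F : C ⥤ D) [F.Braided]

open Functor.LaxMonoidal Functor.Monoidal

lemma tmid_map (X P : C) : tmid (F.obj X) (F.obj P) ≫ F.obj X ◁ μ F X P ≫ μ F X (X ⊗ P) =
    F.obj X ◁ μ F X P ≫ μ F X (X ⊗ P) ≫ F.map (tmid X P) := by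
  have h : F.obj X ◁ μ F X P ≫ μ F X (X ⊗ P) = (α_ _ _ _).inv ≫ μ F X X ▷ F.obj P ≫
      μ F (X ⊗ X) P ≫ F.map (α_ X X P).hom := by
    rw [Iso.eq_inv_comp, associativity]
  rw [reassoc_of% h, h, tmid, tmid]
  simp only [Category.assoc, Iso.hom_inv_id_assoc, Functor.map_comp]
  rw [← comp_whiskerRight_assoc, ← Functor.LaxBraided.braided, comp_whiskerRight_assoc,
    μ_natural_left_assoc, Iso.map_hom_inv_id_assoc]

lemma tswap_tpowMap (X : C) : ∀ n i, tswap (F.obj X) n i ≫ (tpowMap F X n).hom =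
    (tpowMap F X n).hom ≫ F.map (tswap X n i)
  | 0, _ => by simp [tswap]
  | 1, _ => by simp [tswap]
  | n + 2, 0 => by
    rw [tpowMap_succ, tpowMap_succ, tswap_zero, tswap_zero, MonoidalCategory.whiskerLeft_comp]
    simp only [Category.assoc]
    rw [← tmid_whiskerLeft_assoc, tmid_map]
  | n + 2, i + 1 => by
    rw [tpowMap_succ, tswap_succ, tswap_succ, ← whiskerLeft_comp_assoc,
      tswap_tpowMap X (n + 1) i, Category.assoc, ← μ_natural_right]
    simp

/-- This is what carries Schur functors and exterior powers along `gr`, `conc` and `toDb`. -/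
lemma tperm_tpowMap (X : C) (n : ℕ) (σ : Equiv.Perm (Fin n)) :
    tperm (F.obj X) n σ ≫ (tpowMap F X n).hom = (tpowMap F X n).hom ≫ F.map (tperm X n σ) := by
  induction σ using perm_adj_induction with
  | one => rw [tperm_one, tperm_one]; simp
  | adj_mul i h σ ih =>
    rw [tperm_adj_mul, tperm_adj_mul, Category.assoc, tswap_tpowMap, ← Category.assoc, ih]
    simp

end Functoriality

/-! ### Tensor powers of a tensor product. -/

section TensorProducts

variable {C : Type u} [Category.{v} C] [MonoidalCategory C] [SymmetricCategory C]

/-- The tensor powers of a tensor product. -/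
def tdist (X Y : C) : (n : ℕ) → (tpow (X ⊗ Y) n ≅ tpow X n ⊗ tpow Y n)
  | 0 => (λ_ (𝟙_ C)).symm
  | n + 1 => whiskerLeftIso (X ⊗ Y) (tdist X Y n) ≪≫
      ⟨tensorμ X Y (tpow X n) (tpow Y n), tensorδ X Y (tpow X n) (tpow Y n),
        tensorμ_tensorδ _ _ _ _, tensorδ_tensorμ _ _ _ _⟩

lemma tdist_succ (X Y : C) (n : ℕ) : (tdist X Y (n + 1)).hom =
    (X ⊗ Y) ◁ (tdist X Y n).hom ≫ tensorμ X Y (tpow X n) (tpow Y n) := rfl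

/-- In a symmetric category exchanging the two middle factors is its own inverse, so the
compatibility of `tensorμ` with the symmetry can be read backwards. -/
lemma braiding_tensorμ (X Y : C) : (β_ (X ⊗ Y) (X ⊗ Y)).hom ≫ tensorμ X Y X Y =
    tensorμ X Y X Y ≫ ((β_ X X).hom ⊗ₘ (β_ Y Y).hom) := by
  have e : tensorμ X Y X Y = tensorδ X X Y Y := by
    rw [tensorμ, tensorδ, SymmetricCategory.braiding_swap_eq_inv_braiding X Y]
  have h : tensorδ X X Y Y ≫ (tensorμ X X Y Y ≫ (β_ (X ⊗ Y) (X ⊗ Y)).hom) ≫ tensorδ X X Y Y =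
      tensorδ X X Y Y ≫ (((β_ X X).hom ⊗ₘ (β_ Y Y).hom) ≫ tensorμ X X Y Y) ≫
        tensorδ X X Y Y := by
    rw [SymmetricCategory.tensorμ_braid_swap]
  rw [e]
  simpa using h

lemma tmid_tensorμ (X Y P Q : C) :
    tmid (X ⊗ Y) (P ⊗ Q) ≫ (X ⊗ Y) ◁ tensorμ X Y P Q ≫ tensorμ X Y (X ⊗ P) (Y ⊗ Q) =
      (X ⊗ Y) ◁ tensorμ X Y P Q ≫ tensorμ X Y (X ⊗ P) (Y ⊗ Q) ≫ (tmid X P ⊗ₘ tmid Y Q) := by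
  have h : (X ⊗ Y) ◁ tensorμ X Y P Q ≫ tensorμ X Y (X ⊗ P) (Y ⊗ Q) = (α_ _ _ _).inv ≫
      tensorμ X Y X Y ▷ (P ⊗ Q) ≫ tensorμ (X ⊗ X) (Y ⊗ Y) P Q ≫
        ((α_ X X P).hom ⊗ₘ (α_ Y Y Q).hom) := by
    rw [Iso.eq_inv_comp, tensor_associativity]
  rw [reassoc_of% h, h, tmid, tmid, tmid]
  simp only [Category.assoc, Iso.hom_inv_id_assoc]
  rw [← comp_whiskerRight_assoc, braiding_tensorμ, comp_whiskerRight_assoc,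
    tensorμ_natural_left_assoc]
  simp only [tensorHom_comp_tensorHom, Iso.hom_inv_id_assoc]

lemma tswap_tdist (X Y : C) : ∀ n i, tswap (X ⊗ Y) n i ≫ (tdist X Y n).hom =
    (tdist X Y n).hom ≫ (tswap X n i ⊗ₘ tswap Y n i)
  | 0, _ => by simp [tswap]
  | 1, _ => by simp [tswap]
  | n + 2, 0 => by
    rw [tdist_succ, tdist_succ, tswap_zero, tswap_zero, tswap_zero,
      MonoidalCategory.whiskerLeft_comp]
    simp only [Category.assoc]
    rw [← tmid_whiskerLeft_assoc, tmid_tensorμ]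
  | n + 2, i + 1 => by
    rw [tdist_succ, tswap_succ, tswap_succ, tswap_succ, ← whiskerLeft_comp_assoc,
      tswap_tdist X Y (n + 1) i, Category.assoc, ← tensorμ_natural_right]
    simp

/-- Through this, Λ^n(X ⊗ Y) becomes the image of a diagonal idempotent of Σ_n × Σ_n. -/
lemma tperm_tdist (X Y : C) (n : ℕ) (σ : Equiv.Perm (Fin n)) :
    tperm (X ⊗ Y) n σ ≫ (tdist X Y n).hom =
      (tdist X Y n).hom ≫ (tperm X n σ ⊗ₘ tperm Y n σ) := by
  induction σ using perm_adj_induction with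
  | one => rw [tperm_one, tperm_one, tperm_one]; simp
  | adj_mul i h σ ih =>
    rw [tperm_adj_mul, tperm_adj_mul, tperm_adj_mul, Category.assoc, tswap_tdist,
      ← Category.assoc, ih, Category.assoc, tensorHom_comp_tensorHom]

end TensorProducts

/-! ### Tensor powers of a tensor power. -/

section Plethysm

/-- The permutation which fixes `0` and acts as `σ` on the remaining positions. -/
def consPerm {n : ℕ} (σ : Equiv.Perm (Fin n)) : Equiv.Perm (Fin (n + 1)) :=
  Equiv.Perm.decomposeFin.symm (0, σ)

/-- The permutation which moves `0` to position `p`. -/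
def insPerm : (n p : ℕ) → Equiv.Perm (Fin (n + 1))
  | 0, _ => 1
  | _ + 1, 0 => 1
  | n + 1, p + 1 => consPerm (insPerm n p) * adj 0 (by omega)

/-- The permutation which exchanges a block of size `p` with the following block of size `q`. -/
def blockSwap : (p q n : ℕ) → p + q = n → Equiv.Perm (Fin n)
  | 0, _, _, _ => 1
  | p + 1, _, 0, h => absurd h (by omega)
  | p + 1, q, n + 1, h => insPerm n q * consPerm (blockSwap p q n (by omega))

/-- The permutation which exchanges two neighbouring blocks of size `n`. -/
def plethSwap (n : ℕ) : (m i : ℕ) → Equiv.Perm (Fin (m * n))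
  | 0, _ => 1
  | 1, _ => 1
  | m + 2, 0 => permProd (show n + n + m * n = (m + 2) * n by ring) (blockSwap n n _ rfl, 1)
  | m + 2, i + 1 => permProd (show n + (m + 1) * n = (m + 2) * n by ring) (1, plethSwap n (m + 1) i)

/-- The permutation which moves the first block of size `n` to position `p`. -/
def plethIns (n : ℕ) : (m p : ℕ) → Equiv.Perm (Fin ((m + 1) * n))
  | 0, _ => 1
  | _ + 1, 0 => 1
  | m + 1, p + 1 => permProd (show n + (m + 1) * n = (m + 2) * n by ring) (1, plethIns n m p) *
      plethSwap n (m + 2) 0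

/-- The permutation of `m` blocks of size `n`. -/
def plethPerm (n : ℕ) : (m : ℕ) → Equiv.Perm (Fin m) → Equiv.Perm (Fin (m * n))
  | 0, _ => 1
  | m + 1, σ => plethIns n m (σ 0) *
      permProd (show n + m * n = (m + 1) * n by ring) (1, plethPerm n m (permTail σ))

variable {C : Type u} [Category.{v} C] [MonoidalCategory C] [SymmetricCategory C] (X : C)

lemma tperm_consPerm {n : ℕ} (σ : Equiv.Perm (Fin n)) :
    tperm X (n + 1) (consPerm σ) = X ◁ tperm X n σ := by
  have h₀ : consPerm σ 0 = 0 := by simp [consPerm]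
  have h : permTail (consPerm σ) = σ := permTail_eq fun j ↦ by rw [h₀]; simp [consPerm]
  change X ◁ tperm X n (permTail (consPerm σ)) ≫ tins X n (consPerm σ 0).1 = _
  rw [h, h₀, Fin.val_zero, tins_zero, Category.comp_id]

lemma tperm_insPerm : ∀ n p, tperm X (n + 1) (insPerm n p) = tins X n p
  | 0, _ => tperm_one X 1
  | n + 1, 0 => tperm_one X (n + 2)
  | n + 1, p + 1 => by
    rw [insPerm, tperm_mul, tperm_adj, tperm_consPerm, tperm_insPerm n p, tins_succ]

/-- By the hexagon identity, moving one factor past a block of length `q` is a sequence of `q`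
transpositions of neighbours. -/
lemma braiding_tjoin_tins : ∀ {q p n : ℕ} (h : q + p = n),
    (β_ X (tpow X q)).hom ▷ tpow X p ≫ (α_ _ _ _).hom ≫
      (tjoin X q (p + 1) (n + 1) (by omega)).hom =
      (α_ _ _ _).hom ≫ X ◁ (tjoin X q p n h).hom ≫ tins X n q
  | 0, p, n, h => by
    obtain rfl : p = n := by omega
    rw [tjoin_zero, tjoin_zero, tins_zero, Category.comp_id, braiding_tensorUnit_right]
    simp
  | q + 1, p, n, h => by
    obtain ⟨n, rfl⟩ : ∃ m, n = m + 1 := ⟨n - 1, by omega⟩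
    have ih := congrArg (X ◁ ·) (braiding_tjoin_tins (q := q) (p := p) (n := n) (by omega))
    have h₁ := tmid_assoc X (tpow X q) (tpow X p)
    have e : (β_ X (tpow X (q + 1))).hom ▷ tpow X p ≫ (α_ _ _ _).hom ≫ (α_ _ _ _).hom =
        tmid X (tpow X q) ▷ tpow X p ≫ (α_ _ _ _).hom ≫
          X ◁ ((β_ X (tpow X q)).hom ▷ tpow X p ≫ (α_ _ _ _).hom) := by
      rw [BraidedCategory.braiding_tensor_right_hom, tmid]
      monoidal
    rw [tjoin_succ, tjoin_succ, tins_succ, reassoc_of% e, tswap_zero,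
      ← MonoidalCategory.whiskerLeft_comp, Category.assoc, ih]
    simp only [MonoidalCategory.whiskerLeft_comp, Category.assoc]
    rw [reassoc_of% h₁, ← tmid_whiskerLeft_assoc]

lemma braiding_tjoin : ∀ {p q n : ℕ} (h : p + q = n), (β_ (tpow X p) (tpow X q)).hom ≫
    (tjoin X q p n (by omega)).hom = (tjoin X p q n h).hom ≫ tperm X n (blockSwap p q n h)
  | 0, q, n, h => by
    obtain rfl : q = n := by omega
    rw [tjoin_zero, tjoin_zero_right, blockSwap, tperm_one, braiding_tensorUnit_left]
    simp
  | p + 1, q, n, h => by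
    obtain ⟨n, rfl⟩ : ∃ m, n = m + 1 := ⟨n - 1, by omega⟩
    have ih := congrArg (X ◁ ·) (braiding_tjoin (p := p) (q := q) (n := n) (by omega))
    have h₁ := braiding_tjoin_tins X (q := q) (p := p) (n := n) (by omega)
    rw [BraidedCategory.braiding_tensor_left_hom, blockSwap, tperm_mul, tperm_consPerm,
      tperm_insPerm, tjoin_succ]
    simp only [Category.assoc, h₁, Iso.inv_hom_id_assoc]
    rw [← whiskerLeft_comp_assoc, ih]
    simp

/-- The tensor powers of a tensor power. -/
def tpleth (n : ℕ) : (m : ℕ) → (tpow (tpow X n) m ≅ tpow X (m * n))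
  | 0 => eqToIso (congrArg (tpow X) (Nat.zero_mul n).symm)
  | m + 1 => whiskerLeftIso _ (tpleth n m) ≪≫ tjoin X n (m * n) ((m + 1) * n) (by ring)

lemma tpleth_succ (n m : ℕ) : (tpleth X n (m + 1)).hom = tpow X n ◁ (tpleth X n m).hom ≫
    (tjoin X n (m * n) ((m + 1) * n) (by ring)).hom := rfl

lemma tperm_tjoin_right {p q n : ℕ} (h : p + q = n) (σ : Equiv.Perm (Fin q)) :
    tpow X p ◁ tperm X q σ ≫ (tjoin X p q n h).hom =
      (tjoin X p q n h).hom ≫ tperm X n (permProd h (1, σ)) := by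
  rw [← tperm_tjoin, tperm_one, id_tensorHom]

lemma tswap_tpleth (n : ℕ) : ∀ m i, tswap (tpow X n) m i ≫ (tpleth X n m).hom =
    (tpleth X n m).hom ≫ tperm X (m * n) (plethSwap n m i)
  | 0, _ => by rw [plethSwap, tperm_one, Category.comp_id]; exact Category.id_comp _
  | 1, _ => by rw [plethSwap, tperm_one, Category.comp_id]; exact Category.id_comp _
  | m + 2, 0 => by
    have h₁ := tjoin_assoc X (p := n) (q := n) (r := n + n) (s := m * n) (t := (m + 1) * n)
      (n := (m + 2) * n) rfl (by ring) (by ring) (by ring)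
    have h₂ : tpow X n ◁ (tjoin X n (m * n) ((m + 1) * n) (by ring)).hom ≫
        (tjoin X n ((m + 1) * n) ((m + 2) * n) (by ring)).hom = (α_ _ _ _).inv ≫
          (tjoin X n n (n + n) rfl).hom ▷ tpow X (m * n) ≫
            (tjoin X (n + n) (m * n) ((m + 2) * n) (by ring)).hom := by
      rw [Iso.eq_inv_comp, h₁]
    have h₃ := tperm_tjoin X (show n + n + m * n = (m + 2) * n by ring) (blockSwap n n _ rfl, 1)
    rw [tperm_one, tensorHom_id] at h₃
    rw [tpleth_succ, tpleth_succ, tswap_zero, plethSwap]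
    simp only [MonoidalCategory.whiskerLeft_comp, Category.assoc]
    rw [← tmid_whiskerLeft_assoc, reassoc_of% h₂, h₂, ← h₃, tmid]
    simp only [Category.assoc, Iso.hom_inv_id_assoc]
    rw [← comp_whiskerRight_assoc, braiding_tjoin, comp_whiskerRight_assoc]
  | m + 2, i + 1 => by
    rw [tpleth_succ, tswap_succ, plethSwap, Category.assoc, ← tperm_tjoin_right,
      ← whiskerLeft_comp_assoc, tswap_tpleth n (m + 1) i, whiskerLeft_comp_assoc]

lemma tins_tpleth (n : ℕ) : ∀ m p, tins (tpow X n) m p ≫ (tpleth X n (m + 1)).hom =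
    (tpleth X n (m + 1)).hom ≫ tperm X _ (plethIns n m p)
  | 0, _ => by rw [plethIns, tperm_one, Category.comp_id]; exact Category.id_comp _
  | m + 1, 0 => by rw [plethIns, tperm_one, Category.comp_id]; exact Category.id_comp _
  | m + 1, p + 1 => by
    have h := tswap_tpleth X n (m + 2) 0
    rw [tins_succ, plethIns, tperm_mul, ← reassoc_of% h, Category.assoc, tpleth_succ X n (m + 1),
      Category.assoc, ← tperm_tjoin_right, ← whiskerLeft_comp_assoc, tins_tpleth n m p,
      whiskerLeft_comp_assoc]

/-- All that is needed of `plethPerm` is that block permutations act through elements of Σ_{mn}.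
That it is a homomorphism is not used; the idempotence which would follow from it is obtained
differently in `plethIdem_mul_self`. -/
lemma tperm_tpleth (n : ℕ) : ∀ m (σ : Equiv.Perm (Fin m)),
    tperm (tpow X n) m σ ≫ (tpleth X n m).hom =
      (tpleth X n m).hom ≫ tperm X (m * n) (plethPerm n m σ)
  | 0, _ => by rw [plethPerm, tperm_one, Category.comp_id]; exact Category.id_comp _
  | m + 1, σ => by
    change (tpow X n ◁ tperm (tpow X n) m (permTail σ) ≫ tins (tpow X n) m (σ 0).1) ≫ _ = _
    rw [Category.assoc, tins_tpleth, plethPerm, tperm_mul, tpleth_succ, Category.assoc,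
      ← whiskerLeft_comp_assoc, tperm_tpleth n m, MonoidalCategory.whiskerLeft_comp,
      Category.assoc, reassoc_of% (tperm_tjoin_right X (show n + m * n = (m + 1) * n by ring)
        (plethPerm n m (permTail σ))), Category.assoc]

end Plethysm

/-! ### Images of idempotents and their direct sum decompositions. -/

section Images

variable {C : Type u} [Category.{v} C]

/-- `S` is the image of the idempotent `θ`. -/
def IsIdemImage {Z : C} (θ : Z ⟶ Z) (S : C) : Prop :=
  ∃ (i : S ⟶ Z) (p : Z ⟶ S), i ≫ p = 𝟙 S ∧ p ≫ i = θ

lemma IsIdemImage.unique {Z : C} {θ : Z ⟶ Z} {S T : C} (hS : IsIdemImage θ S)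
    (hT : IsIdemImage θ T) :
    Nonempty (S ≅ T) := by
  obtain ⟨i, p, h, rfl⟩ := hS
  obtain ⟨j, q, h', e⟩ := hT
  refine ⟨⟨i ≫ q, j ≫ p, ?_, ?_⟩⟩
  · rw [Category.assoc, reassoc_of% e, h, Category.comp_id, h]
  · rw [Category.assoc, ← reassoc_of% e, h', Category.comp_id, h']

lemma IsIdemImage.of_iso {Z W : C} {θ : Z ⟶ Z} {θ' : W ⟶ W} {S : C} (h : IsIdemImage θ S) (e : Z ≅ W)
    (he : θ ≫ e.hom = e.hom ≫ θ') : IsIdemImage θ' S := by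
  obtain ⟨i, p, h, rfl⟩ := h
  refine ⟨i ≫ e.hom, e.inv ≫ p, by simp [h], ?_⟩
  rw [Category.assoc, Iso.inv_comp_eq, ← he, Category.assoc]

lemma IsIdemImage.map {D : Type*} [Category D] (F : C ⥤ D) {Z : C} {θ : Z ⟶ Z} {S : C}
    (h : IsIdemImage θ S) : IsIdemImage (F.map θ) (F.obj S) := by
  obtain ⟨i, p, h, rfl⟩ := h
  exact ⟨F.map i, F.map p, by rw [← F.map_comp, h, F.map_id], (F.map_comp _ _).symm⟩

lemma IsIdemImage.idem {Z : C} {θ : Z ⟶ Z} {S : C} (h : IsIdemImage θ S) : θ ≫ θ = θ := by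
  obtain ⟨i, p, h, rfl⟩ := h
  simp [reassoc_of% h]

lemma exists_isIdemImage [IsIdempotentComplete C] {Z : C} {θ : Z ⟶ Z} (h : θ ≫ θ = θ) :
    ∃ S, IsIdemImage θ S := by
  obtain ⟨S, i, p, h₁, h₂⟩ := IsIdempotentComplete.idempotents_split Z θ h
  exact ⟨S, i, p, h₁, h₂⟩

variable [Preadditive C]

/-- `S` is the direct sum of a finite family of objects. -/
def IsSum {J : Type} [Fintype J] (T : J → C) (S : C) : Prop :=
  ∃ (i : ∀ j, T j ⟶ S) (p : ∀ j, S ⟶ T j), (∀ j, i j ≫ p j = 𝟙 _) ∧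
    (∀ j k, j ≠ k → i j ≫ p k = 0) ∧ ∑ j, p j ≫ i j = 𝟙 S

lemma isSum_of_iso {S T : C} (e : S ≅ T) : IsSum (fun _ : Unit ↦ S) T :=
  ⟨fun _ ↦ e.hom, fun _ ↦ e.inv, by simp, fun j k h ↦ absurd (Subsingleton.elim j k) h, by simp⟩

lemma FrobData.frobDecomp {A B S J : Type} [Ring A] [Algebra ℚ A] [Ring B] [Algebra ℚ B]
    [Fintype S] [Fintype J] [Module.Finite ℚ A] {φ : B →ₐ[ℚ] A} {E : A →ₗ[ℚ] B} {r r' : S → A}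
    (hE : FrobData φ E r r') {f : J → B} (hf : SplitData f) {e : A} (he : e * e = e) :
    ∃ u v, FrobDecomp.{w} (X := Σ j, Fin (cornerDim e (φ (f j)))) φ E r r' e (fun x ↦ f x.1) u v :=
  have ⟨u, v, h₁, _, h₂, _, h₃, h₄, h₅⟩ := hE.decomposition.{w} hf he
  ⟨u, v, h₁, h₂, h₃, h₄, h₅⟩

/-- The decomposition of the image of an idempotent along Frobenius extensions. -/
theorem FrobDecomp.isSum [Linear ℚ C] {P A : Type} [Fintype P] [Ring A] [Algebra ℚ A]
    {B J S : P → Type} [∀ k, Ring (B k)] [∀ k, Algebra ℚ (B k)] [∀ k, Fintype (J k)]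
    [∀ k, Fintype (S k)] {φ : ∀ k, B k →ₐ[ℚ] A} {E : ∀ k, A →ₗ[ℚ] B k} {r r' : ∀ k, S k → A}
    {e : A} {f : ∀ k, J k → B k} {u v : ∀ k, J k → A}
    (hd : ∀ k, FrobDecomp.{v} (φ k) (E k) (r k) (r' k) e (f k) (u k) (v k)) {Z : C} {W : P → C}
    (R : A →ₗ[ℚ] (Z ⟶ Z)) (hR : ∀ a b, R (a * b) = R b ≫ R a)
    (R' : ∀ k, B k →ₗ[ℚ] (W k ⟶ W k)) (ι : ∀ k, W k ⟶ Z) (π : ∀ k, Z ⟶ W k)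
    (h₁ : ∀ k b, ι k ≫ R (φ k b) = R' k b ≫ ι k)
    (h₂ : ∀ k a, ι k ≫ R a ≫ π k = R' k (E k a))
    (h₃ : ∀ k l a, k ≠ l → ι k ≫ R a ≫ π l = 0)
    (h₄ : ∀ k b, R (φ k b) ≫ π k = π k ≫ R' k b)
    (h₅ : ∑ k, ∑ s, R (r' k s) ≫ π k ≫ ι k ≫ R (r k s) = 𝟙 Z)
    {U : C} (hU : IsIdemImage (R e) U) {T : ∀ k, J k → C}
    (hT : ∀ k j, IsIdemImage (R' k (f k j)) (T k j)) :
    IsSum (fun x : Σ k, J k ↦ T x.1 x.2) U := by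
  classical
  obtain ⟨i, p, hip, hpi⟩ := hU
  choose i' p' hip' hpi' using hT
  have hRe : R e ≫ p = p := by rw [← hpi, Category.assoc, hip, Category.comp_id]
  have hRe' : i ≫ R e = i := by rw [← hpi, reassoc_of% hip]
  -- An inclusion followed by a projection reduces to `ι ≫ R (v * u) ≫ π`. This is `R' (E (v * u))`
  -- if the two indices in `P` agree, and zero otherwise.
  have hk : ∀ k l x y, (i' k x ≫ ι k ≫ R (u k x) ≫ p) ≫ (i ≫ R (v l y) ≫ π l ≫ p' l y) =
      i' k x ≫ (ι k ≫ R (v l y * u k x) ≫ π l) ≫ p' l y := fun k l x y ↦ by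
    simp only [Category.assoc, hR]
    rw [reassoc_of% hpi, ← reassoc_of% (hR e (u k x)), (hd k).mul_u]
  refine ⟨fun x ↦ i' x.1 x.2 ≫ ι x.1 ≫ R (u x.1 x.2) ≫ p,
    fun x ↦ i ≫ R (v x.1 x.2) ≫ π x.1 ≫ p' x.1 x.2, ?_, ?_, ?_⟩
  · rintro ⟨k, x⟩
    rw [hk, h₂, (hd k).res_self, ← hpi', Category.assoc, hip', Category.comp_id, hip']
  · rintro ⟨k, x⟩ ⟨l, y⟩ h
    rw [hk]
    by_cases hkl : k = l
    · subst hkl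
      rw [h₂, (hd k).res_ne _ _ fun h' ↦ h (by subst h'; rfl)]
      simp
    · rw [h₃ _ _ _ hkl]
      simp
  -- That the projectors add up to the identity is the Casimir identity of `FrobDecomp` for the
  -- balanced map `Ψ k`, followed by the resolution `h₅` of the identity of `Z`.
  · let Ψ : ∀ k, A →ₗ[ℚ] A →ₗ[ℚ] (Z ⟶ Z) := fun k ↦
      LinearMap.mk₂ ℚ (fun a a' ↦ R a' ≫ π k ≫ ι k ≫ R a) (by simp) (by simp) (by simp) (by simp)
    have hΨ : ∀ k a b a', Ψ k (a * φ k b) a' = Ψ k a (φ k b * a') := fun k a b a' ↦ by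
      simp only [Ψ, LinearMap.mk₂_apply, hR, Category.assoc]
      rw [reassoc_of% h₁, reassoc_of% h₄]
    have h₈ := fun k ↦ (hd k).sum (Z ⟶ Z) (Ψ k) (hΨ k)
    simp only [Ψ, LinearMap.mk₂_apply] at h₈
    rw [Fintype.sum_sigma]
    have h₉ : ∀ k x, (i ≫ R (v k x) ≫ π k ≫ p' k x) ≫ i' k x ≫ ι k ≫ R (u k x) ≫ p =
        i ≫ (R (v k x) ≫ π k ≫ ι k ≫ R (u k x)) ≫ p := fun k x ↦ by
      simp only [Category.assoc]
      rw [reassoc_of% hpi', ← reassoc_of% h₄, ← reassoc_of% (hR (φ k (f k x)) (v k x)), (hd k).mul_v]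
    simp only [h₉]
    have h₁₁ : ∑ k, ∑ x, i ≫ (R (v k x) ≫ π k ≫ ι k ≫ R (u k x)) ≫ p =
        i ≫ (∑ k, ∑ x, R (v k x) ≫ π k ≫ ι k ≫ R (u k x)) ≫ p := by
      simp only [Preadditive.comp_sum, Preadditive.sum_comp]
    rw [h₁₁]
    simp only [h₈, hR, Category.assoc]
    have h₁₀ : ∑ k, ∑ s, R e ≫ R (r' k s) ≫ π k ≫ ι k ≫ R (r k s) ≫ R e = R e ≫ R e := by
      calc _ = R e ≫ (∑ k, ∑ s, R (r' k s) ≫ π k ≫ ι k ≫ R (r k s)) ≫ R e := by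
            simp only [Preadditive.comp_sum, Preadditive.sum_comp, Category.assoc]
        _ = _ := by rw [h₅, Category.id_comp]
    rw [h₁₀, Category.assoc, hRe, hRe, hip]

end Images

/-! ### Group algebras acting on objects. -/

section GroupAction

open scoped MonoidAlgebra

variable {C : Type u} [Category.{v} C] [Preadditive C] [Linear ℚ C]

/-- The linear extension of an action of a group on an object. -/
noncomputable def actLin {G : Type} [Group G] {Z : C} (M : G →* End Z) : ℚ[G] →ₗ[ℚ] (Z ⟶ Z) where
  toFun x := MonoidAlgebra.lift ℚ (End Z) G M x
  map_add' x y := map_add _ x y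
  map_smul' q x := map_smul _ q x

variable {G : Type} [Group G] {Z : C} (M : G →* End Z)

lemma actLin_of (g : G) : actLin M (MonoidAlgebra.of ℚ G g) = M g := by
  simp [actLin]

lemma actLin_mul (a b : ℚ[G]) : actLin M (a * b) = actLin M b ≫ actLin M a :=
  map_mul (MonoidAlgebra.lift ℚ (End Z) G M) a b

lemma actLin_one : actLin M (1 : ℚ[G]) = 𝟙 Z := map_one (MonoidAlgebra.lift ℚ (End Z) G M)

lemma actLin_mapDomain {H : Type} [Group H] (φ : H →* G) (a : ℚ[H]) :
    actLin M (MonoidAlgebra.mapDomainAlgHom ℚ ℚ φ a) = actLin (M.comp φ) a := by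
  induction a using MonoidAlgebra.induction_on with
  | of g => rw [mapDomainAlgHom_of, actLin_of, actLin_of]; rfl
  | add x y hx hy => rw [map_add, map_add, map_add, hx, hy]
  | smul q x hx => rw [map_smul, map_smul, map_smul, hx]

lemma actLin_comm {W : C} (M' : G →* End W) (f : Z ⟶ W) (h : ∀ g, M g ≫ f = f ≫ M' g) (a : ℚ[G]) :
    actLin M a ≫ f = f ≫ actLin M' a := by
  induction a using MonoidAlgebra.induction_on with
  | of g => rw [actLin_of, actLin_of, h]
  | add x y hx hy => rw [map_add, map_add, Preadditive.add_comp, Preadditive.comp_add, hx, hy]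
  | smul q x hx => rw [map_smul, map_smul, Linear.smul_comp, Linear.comp_smul, hx]

/-- The case of the trivial Frobenius extension `FrobData.refl`, with a single index. -/
lemma isSum_of_split [Finite G] {J : Type} [Fintype J] {f : J → ℚ[G]} (hf : SplitData f) {e : ℚ[G]}
    (he : e * e = e) {U : C} (hU : IsIdemImage (actLin M e) U) {T : J → C}
    (hT : ∀ j, IsIdemImage (actLin M (f j)) (T j)) :
    IsSum (fun x : Σ j, Fin (cornerDim e (f j)) ↦ T x.1) U := by
  have : Module.Finite ℚ ℚ[G] := inferInstance
  obtain ⟨u, v, hd⟩ := (FrobData.refl ℚ[G]).frobDecomp.{v} hf he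
  have h := FrobDecomp.isSum (P := Unit) (fun _ ↦ hd) (actLin M) (actLin_mul M)
    (fun _ ↦ actLin M) (fun _ ↦ 𝟙 Z) (fun _ ↦ 𝟙 Z) (by simp) (by simp)
    (fun k l _ h ↦ absurd rfl h) (by simp) (by simp [actLin_one]) hU fun _ x ↦ hT x.1
  obtain ⟨i, p, h₁, h₂, h₃⟩ := h
  refine ⟨fun x ↦ i ⟨(), x⟩, fun x ↦ p ⟨(), x⟩, fun x ↦ h₁ _, fun x y hxy ↦ h₂ _ _ ?_, ?_⟩
  · exact fun h ↦ hxy (by simpa using h)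
  · rw [Fintype.sum_sigma, Fintype.sum_unique] at h₃
    exact h₃

end GroupAction

/-! ### Actions on products of tensor powers. -/

section TensorAction

open scoped MonoidAlgebra

variable {C : Type u} [Category.{v} C] [MonoidalCategory C] [SymmetricCategory C]

/-- The action of a product of symmetric groups on a product of tensor powers. -/
def tact₂ (X Y : C) (p q : ℕ) :
    Equiv.Perm (Fin p) × Equiv.Perm (Fin q) →* End (tpow X p ⊗ tpow Y q) where
  toFun x := tperm X p x.1 ⊗ₘ tperm Y q x.2
  map_one' := by simp only [Prod.fst_one, Prod.snd_one, tperm_one]; exact id_tensorHom_id _ _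
  map_mul' x y := by
    simp only [Prod.fst_mul, Prod.snd_mul, tperm_mul]
    exact (tensorHom_comp_tensorHom _ _ _ _).symm

variable [Preadditive C] [Linear ℚ C]

lemma groupAlgAct_eq (X : C) {n : ℕ} (a : ℚ[Equiv.Perm (Fin n)]) :
    groupAlgAct X n a = actLin (tact X n) a := rfl

lemma IsTensorImage.isImage {X S : C} {n : ℕ} {e : ℚ[Equiv.Perm (Fin n)]}
    (h : IsTensorImage e X S) : IsIdemImage (actLin (tact X n) e) S := h

/-- The action of the group algebra on a product of tensor powers. -/
noncomputable abbrev act₂ (X Y : C) (p q : ℕ) := actLin (tact₂ X Y p q)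

lemma tact_apply (X : C) {n : ℕ} (σ : Equiv.Perm (Fin n)) : tact X n σ = tperm X n σ := rfl

lemma act_permProd (X : C) {p q n : ℕ} (h : p + q = n)
    (a : ℚ[Equiv.Perm (Fin p) × Equiv.Perm (Fin q)]) :
    act₂ X X p q a ≫ (tjoin X p q n h).hom = (tjoin X p q n h).hom ≫
      actLin (tact X n) (MonoidAlgebra.mapDomainAlgHom ℚ ℚ (permProd h) a) := by
  rw [actLin_mapDomain]
  exact actLin_comm _ _ _ (fun x ↦ tperm_tjoin X h x) a

variable [MonoidalPreadditive C] [MonoidalLinear ℚ C]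

lemma smul_tensorHom {X Y X' Y' : C} (q : ℚ) (f : X ⟶ Y) (g : X' ⟶ Y') :
    (q • f) ⊗ₘ g = q • (f ⊗ₘ g) := by
  rw [MonoidalCategory.tensorHom_def, MonoidalCategory.tensorHom_def,
    MonoidalLinear.smul_whiskerRight, Linear.smul_comp]

lemma tensorHom_smul {X Y X' Y' : C} (q : ℚ) (f : X ⟶ Y) (g : X' ⟶ Y') :
    f ⊗ₘ (q • g) = q • (f ⊗ₘ g) := by
  rw [MonoidalCategory.tensorHom_def, MonoidalCategory.tensorHom_def,
    MonoidalLinear.whiskerLeft_smul, Linear.comp_smul]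

lemma act₂_boxMul (X Y : C) {p q : ℕ} (a : ℚ[Equiv.Perm (Fin p)]) (b : ℚ[Equiv.Perm (Fin q)]) :
    act₂ X Y p q (boxMul a b) = actLin (tact X p) a ⊗ₘ actLin (tact Y q) b := by
  induction a using MonoidAlgebra.induction_on with
  | of σ =>
    induction b using MonoidAlgebra.induction_on with
    | of τ => rw [boxMul_of, actLin_of, actLin_of, actLin_of]; rfl
    | add x y hx hy => rw [boxMul_add_right, map_add, map_add, hx, hy,
        MonoidalPreadditive.tensor_add]
    | smul q x hx => rw [boxMul_smul_right, map_smul, map_smul, hx, tensorHom_smul]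
  | add x y hx hy => rw [boxMul_add_left, map_add, map_add, hx, hy, MonoidalPreadditive.add_tensor]
  | smul q x hx => rw [boxMul_smul_left, map_smul, map_smul, hx, smul_tensorHom]

lemma IsIdemImage.tensor {Z W S T : C} {θ : Z ⟶ Z} {θ' : W ⟶ W} (h : IsIdemImage θ S)
    (h' : IsIdemImage θ' T) : IsIdemImage (θ ⊗ₘ θ') (S ⊗ T) := by
  obtain ⟨i, p, h, rfl⟩ := h
  obtain ⟨j, q, h', rfl⟩ := h'
  exact ⟨i ⊗ₘ j, p ⊗ₘ q, by rw [tensorHom_comp_tensorHom, h, h', id_tensorHom_id],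
    by rw [tensorHom_comp_tensorHom]⟩

lemma isImage_boxMul {X Y S T : C} {p q : ℕ} {e : ℚ[Equiv.Perm (Fin p)]}
    {f : ℚ[Equiv.Perm (Fin q)]} (hS : IsTensorImage e X S) (hT : IsTensorImage f Y T) :
    IsIdemImage (act₂ X Y p q (boxMul e f)) (S ⊗ T) := by
  rw [act₂_boxMul]
  exact hS.isImage.tensor hT.isImage

lemma isTensorImage_permExt {X S T : C} {p q n : ℕ} (h : p + q = n) {e : ℚ[Equiv.Perm (Fin p)]}
    {f : ℚ[Equiv.Perm (Fin q)]} (hS : IsTensorImage e X S) (hT : IsTensorImage f X T) :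
    IsTensorImage (permExt h e f) X (S ⊗ T) :=
  (isImage_boxMul hS hT).of_iso (tjoin X p q n h) (act_permProd X h _)

end TensorAction

/-! ### Tensor powers of a direct sum. -/

section SumOfObjects

open scoped MonoidAlgebra

/-- The word with `p` letters `true` followed by `q` letters `false`. -/
def blockWord {p q n : ℕ} (h : p + q = n) (i : Fin n) : Bool :=
  Sum.elim (fun _ ↦ true) (fun _ ↦ false) ((blockEquiv h).symm i)

lemma blockWord_inl {p q n : ℕ} (h : p + q = n) (i : Fin p) :
    blockWord h (blockEquiv h (Sum.inl i)) = true := by simp [blockWord]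

lemma blockWord_inr {p q n : ℕ} (h : p + q = n) (i : Fin q) :
    blockWord h (blockEquiv h (Sum.inr i)) = false := by simp [blockWord]

lemma card_blockWord {p q n : ℕ} (h : p + q = n) (b : Bool) :
    Fintype.card {i // blockWord h i = b} = bif b then p else q := by
  rw [Fintype.card_subtype, ← Finset.card_map (blockEquiv h).symm.toEmbedding]
  cases b
  · have : Finset.map (blockEquiv h).symm.toEmbedding {i | blockWord h i = false} =
        Finset.univ.map Function.Embedding.inr := by
      ext x
      obtain ⟨x, rfl⟩ := (blockEquiv h).symm.surjective x
      obtain ⟨x | x, rfl⟩ := (blockEquiv h).surjective x <;>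
        simp [blockWord_inl, blockWord_inr]
    rw [this]; simp
  · have : Finset.map (blockEquiv h).symm.toEmbedding {i | blockWord h i = true} =
        Finset.univ.map Function.Embedding.inl := by
      ext x
      obtain ⟨x, rfl⟩ := (blockEquiv h).symm.surjective x
      obtain ⟨x | x, rfl⟩ := (blockEquiv h).surjective x <;>
        simp [blockWord_inl, blockWord_inr]
    rw [this]; simp

lemma mem_range_permProd_iff {p q n : ℕ} (h : p + q = n) (σ : Equiv.Perm (Fin n)) :
    (∃ x, permProd h x = σ) ↔ blockWord h ∘ σ = blockWord h := by
  constructor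
  · rintro ⟨x, rfl⟩
    ext i
    obtain ⟨i | i, rfl⟩ := (blockEquiv h).surjective i
    · rw [Function.comp_apply, permProd_inl, blockWord_inl, blockWord_inl]
    · rw [Function.comp_apply, permProd_inr, blockWord_inr, blockWord_inr]
  · intro hσ
    refine mem_range_permProd h fun i ↦ ?_
    have := congrFun hσ (blockEquiv h (Sum.inl i))
    rw [blockWord_inl, Function.comp_apply] at this
    obtain ⟨j | j, hj⟩ := (blockEquiv h).surjective (σ (blockEquiv h (Sum.inl i)))
    · exact ⟨j, hj.symm⟩
    · rw [← hj, blockWord_inr] at this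
      exact absurd this (by simp)

lemma exists_perm_word {n : ℕ} {w w' : Fin n → Bool}
    (h : Fintype.card {i // w i = true} = Fintype.card {i // w' i = true}) :
    ∃ g : Equiv.Perm (Fin n), w ∘ g = w' := by
  have h' : Fintype.card {i // w i = false} = Fintype.card {i // w' i = false} := by
    have e₁ := Fintype.card_subtype_compl fun i ↦ w i = true
    have e₂ := Fintype.card_subtype_compl fun i ↦ w' i = true
    simp only [Bool.not_eq_true] at e₁ e₂
    omega
  let e : ∀ b : Bool, {i // w' i = b} ≃ {i // w i = b} := fun b ↦ Fintype.equivOfCardEq (by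
    cases b
    · exact h'.symm
    · exact h.symm)
  exact ⟨Equiv.ofFiberEquiv e, funext fun i ↦ Equiv.ofFiberEquiv_map e i⟩

/-- The permutations in question form a coset of Σ_p × Σ_q as soon as there is one, and one exists
exactly if the numbers of letters agree. -/
lemma card_perm_blockWord {p q n : ℕ} (h : p + q = n) (w : Fin n → Bool) :
    Finset.card {g : Equiv.Perm (Fin n) | blockWord h ∘ (g⁻¹ : Equiv.Perm (Fin n)) = w} =
      if Fintype.card {i // w i = true} = p then
        Fintype.card (Equiv.Perm (Fin p) × Equiv.Perm (Fin q)) else 0 := by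
  have hp := card_blockWord h true
  dsimp only [cond_true] at hp
  split_ifs with hw
  · obtain ⟨g₀, hg₀⟩ := exists_perm_word (w := blockWord h) (w' := w) (by rw [hw, hp])
    symm
    refine Finset.card_bij (fun x _ ↦ g₀⁻¹ * permProd h x) ?_ ?_ ?_
    · intro x _
      simp only [Finset.mem_filter, Finset.mem_univ, true_and, mul_inv_rev, inv_inv]
      rw [← map_inv, ← hg₀]
      funext i
      exact congrFun ((mem_range_permProd_iff h _).1 ⟨x⁻¹, rfl⟩) (g₀ i)
    · intro x _ y _ hxy
      exact permProd_injective h (mul_left_cancel hxy)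
    · intro g hg
      simp only [Finset.mem_filter, Finset.mem_univ, true_and] at hg
      obtain ⟨x, hx⟩ := (mem_range_permProd_iff h (g₀ * g)).2 <| by
        funext i
        have h₁ := congrFun hg (g i)
        have h₂ := congrFun hg₀ (g i)
        have h₃ : (g⁻¹ : Equiv.Perm (Fin n)) (g i) = i := by simp
        simp only [Function.comp_apply, h₃] at h₁ h₂
        simp [h₂, ← h₁]
      exact ⟨x, Finset.mem_univ _, by simp [hx]⟩
  · rw [Finset.card_eq_zero, Finset.filter_eq_empty_iff]
    intro g _ hg
    refine hw ?_
    rw [← hp]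
    refine Fintype.card_congr ((Equiv.subtypeEquiv g⁻¹ fun i ↦ ?_))
    rw [← hg]
    rfl

variable {C : Type u} [Category.{v} C] [MonoidalCategory C] [SymmetricCategory C]
  [Preadditive C] [MonoidalPreadditive C]

lemma thom_eq_zero {X : C} {n : ℕ} {f : Fin n → (X ⟶ X)} {i : Fin n} (h : f i = 0) :
    thom n f = 0 := by
  induction n with
  | zero => exact i.elim0
  | succ n ih =>
    rw [thom_succ]
    cases i using Fin.cases with
    | zero => rw [h, MonoidalPreadditive.zero_tensor]
    | succ i => rw [ih (i := i) h, MonoidalPreadditive.tensor_zero]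

lemma thom_sum {X : C} {ι : Type} [Fintype ι] (P : ι → (X ⟶ X)) (n : ℕ) :
    ∑ w : Fin n → ι, thom n (P ∘ w) = tmap (∑ k, P k) n := by
  induction n with
  | zero => simp [thom, tmap]
  | succ n ih =>
    rw [tmap_succ, ← ih, sum_tensor]
    simp only [tensor_sum]
    rw [← Fintype.sum_prod_type', ← Equiv.sum_comp (Fin.consEquiv fun _ ↦ ι)]
    refine Finset.sum_congr rfl fun x _ ↦ ?_
    rw [thom_succ]
    simp [Fin.consEquiv]
    rfl

/-- The inclusions and projections of a direct sum of two objects. -/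
structure SumData (X Y Z : C) where
  inl : X ⟶ Z
  inr : Y ⟶ Z
  fst : Z ⟶ X
  snd : Z ⟶ Y
  inl_fst : inl ≫ fst = 𝟙 X
  inr_snd : inr ≫ snd = 𝟙 Y
  inl_snd : inl ≫ snd = 0
  inr_fst : inr ≫ fst = 0
  total : fst ≫ inl + snd ≫ inr = 𝟙 Z

namespace SumData

variable {X Y Z : C} (s : SumData X Y Z)

/-- The projectors of a direct sum of two objects. -/
def projector (b : Bool) : Z ⟶ Z := bif b then s.fst ≫ s.inl else s.snd ≫ s.inr

lemma projector_comp (b c : Bool) :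
    s.projector b ≫ s.projector c = if b = c then s.projector b else 0 := by
  have e₁ : ∀ {W : C} (f : X ⟶ W), s.inl ≫ s.fst ≫ f = f := fun f ↦ by
    rw [← Category.assoc, s.inl_fst, Category.id_comp]
  have e₂ : ∀ {W : C} (f : Y ⟶ W), s.inr ≫ s.snd ≫ f = f := fun f ↦ by
    rw [← Category.assoc, s.inr_snd, Category.id_comp]
  have e₃ : ∀ {W : C} (f : Y ⟶ W), s.inl ≫ s.snd ≫ f = 0 := fun f ↦ by
    rw [← Category.assoc, s.inl_snd, zero_comp]
  have e₄ : ∀ {W : C} (f : X ⟶ W), s.inr ≫ s.fst ≫ f = 0 := fun f ↦ by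
    rw [← Category.assoc, s.inr_fst, zero_comp]
  cases b <;> cases c <;> simp [projector, e₁, e₂, e₃, e₄]

/-- The inclusion of a product of tensor powers in the tensor powers of a direct sum. -/
def inc {p q n : ℕ} (h : p + q = n) : tpow X p ⊗ tpow Y q ⟶ tpow Z n :=
  (tmap s.inl p ⊗ₘ tmap s.inr q) ≫ (tjoin Z p q n h).hom

/-- The projection of the tensor powers of a direct sum. -/
def proj {p q n : ℕ} (h : p + q = n) : tpow Z n ⟶ tpow X p ⊗ tpow Y q :=
  (tjoin Z p q n h).inv ≫ (tmap s.fst p ⊗ₘ tmap s.snd q)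

lemma inc_proj {p q n : ℕ} (h : p + q = n) : s.inc h ≫ s.proj h = 𝟙 _ := by
  simp only [inc, proj, Category.assoc, Iso.hom_inv_id_assoc, tensorHom_comp_tensorHom,
    ← tmap_comp, s.inl_fst, s.inr_snd, tmap_id, id_tensorHom_id]

lemma inc_proj_assoc {p q n : ℕ} (h : p + q = n) {W : C} (f : tpow X p ⊗ tpow Y q ⟶ W) :
    s.inc h ≫ s.proj h ≫ f = f := by
  rw [← Category.assoc, inc_proj, Category.id_comp]

lemma proj_inc {p q n : ℕ} (h : p + q = n) :
    s.proj h ≫ s.inc h = thom n (s.projector ∘ blockWord h) := by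
  have := thom_tjoin h (s.projector ∘ blockWord h)
  simp only [Function.comp_apply, blockWord_inl, blockWord_inr] at this
  rw [proj, inc, Category.assoc, Iso.inv_comp_eq, ← this, tensorHom_comp_tensorHom_assoc,
    ← tmap_comp, ← tmap_comp, thom_const, thom_const]
  rfl

lemma proj_inc_assoc {p q n : ℕ} (h : p + q = n) {W : C} (f : tpow Z n ⟶ W) :
    s.proj h ≫ s.inc h ≫ f = thom n (s.projector ∘ blockWord h) ≫ f := by
  rw [← Category.assoc, proj_inc]

lemma inc_tperm {p q n : ℕ} (h : p + q = n) (x : Equiv.Perm (Fin p) × Equiv.Perm (Fin q)) :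
    s.inc h ≫ tperm Z n (permProd h x) = tact₂ X Y p q x ≫ s.inc h := by
  change _ = (tperm X p x.1 ⊗ₘ tperm Y q x.2) ≫ _
  rw [inc, Category.assoc, ← tperm_tjoin, tensorHom_comp_tensorHom_assoc,
    tensorHom_comp_tensorHom_assoc, tmap_tperm, tmap_tperm]

lemma tperm_proj {p q n : ℕ} (h : p + q = n) (x : Equiv.Perm (Fin p) × Equiv.Perm (Fin q)) :
    tperm Z n (permProd h x) ≫ s.proj h = s.proj h ≫ tact₂ X Y p q x := by
  change _ = _ ≫ (tperm X p x.1 ⊗ₘ tperm Y q x.2)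
  have e : tperm Z n (permProd h x) ≫ (tjoin Z p q n h).inv =
      (tjoin Z p q n h).inv ≫ (tperm Z p x.1 ⊗ₘ tperm Z q x.2) := by
    rw [Iso.eq_inv_comp, ← Category.assoc, ← tperm_tjoin]
    simp
  rw [proj, reassoc_of% e, Category.assoc, tensorHom_comp_tensorHom, tensorHom_comp_tensorHom,
    tmap_tperm, tmap_tperm]

/-- Inserting the projectors `proj ≫ inc` on both sides of the permutation gives a tensor product of
endomorphisms. At a position where the words differ, its factor is a product of orthogonal
projectors. -/
lemma inc_tperm_proj {p q p' q' n : ℕ} (h : p + q = n) (h' : p' + q' = n)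
    (g : Equiv.Perm (Fin n))
    (hg : blockWord h ∘ (g⁻¹ : Equiv.Perm (Fin n)) ≠ blockWord h') :
    s.inc h ≫ tperm Z n g ≫ s.proj h' = 0 := by
  obtain ⟨i, hi⟩ := Function.ne_iff.1 hg
  calc _ = s.inc h ≫ (s.proj h ≫ s.inc h) ≫ tperm Z n g ≫ (s.proj h' ≫ s.inc h') ≫
        s.proj h' := by
        simp only [Category.assoc, inc_proj, inc_proj_assoc, Category.comp_id]
    _ = s.inc h ≫ tperm Z n g ≫ (thom n ((s.projector ∘ blockWord h) ∘
        (g⁻¹ : Equiv.Perm (Fin n))) ≫ thom n (s.projector ∘ blockWord h')) ≫ s.proj h' := by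
        rw [proj_inc, proj_inc]
        simp only [Category.assoc]
        rw [← Category.assoc (thom n _), thom_tperm, Category.assoc]
    _ = 0 := by
        rw [thom_comp, thom_eq_zero (i := i)]
        · simp
        · simp only [Function.comp_apply] at hi ⊢
          rw [projector_comp, if_neg hi]

/-- The conjugates of the projector of the block word are the projectors of all words with `p`
letters `true`, and each of them appears `|Σ_p × Σ_q|` times. -/
lemma sum_tperm_proj_inc [Linear ℚ C] {p q n : ℕ} (h : p + q = n) :
    ∑ g : Equiv.Perm (Fin n), tperm Z n g⁻¹ ≫ s.proj h ≫ s.inc h ≫ tperm Z n g =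
      (Fintype.card (Equiv.Perm (Fin p) × Equiv.Perm (Fin q)) : ℚ) •
        ∑ w : Fin n → Bool, if Fintype.card {i // w i = true} = p then
          thom n (s.projector ∘ w) else 0 := by
  have h₁ : ∀ g : Equiv.Perm (Fin n), tperm Z n g⁻¹ ≫ s.proj h ≫ s.inc h ≫ tperm Z n g =
      thom n (s.projector ∘ (blockWord h ∘ (g⁻¹ : Equiv.Perm (Fin n)))) := fun g ↦ by
    rw [proj_inc_assoc, thom_tperm, ← Category.assoc, ← tperm_mul, mul_inv_cancel, tperm_one,
      Category.id_comp]
    rfl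
  simp only [h₁]
  rw [← Finset.sum_fiberwise (s := Finset.univ)
    (g := fun g : Equiv.Perm (Fin n) ↦ blockWord h ∘ (g⁻¹ : Equiv.Perm (Fin n))), Finset.smul_sum]
  refine Finset.sum_congr rfl fun w _ ↦ ?_
  rw [Finset.sum_congr rfl (g := fun _ ↦ thom n (s.projector ∘ w)) fun g hg ↦ by
    rw [(Finset.mem_filter.1 hg).2], Finset.sum_const, card_perm_blockWord h w]
  split_ifs
  · rw [Nat.cast_smul_eq_nsmul]
  · simp

/-- The decomposition of the image of an idempotent on a tensor power of a direct sum. -/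
theorem isSum_of_frobDecomp (s : SumData X Y Z) [Linear ℚ C] {n : ℕ} {e : ℚ[Equiv.Perm (Fin n)]}
    {J : Finset.HasAntidiagonal.antidiagonal n → Type} [∀ k, Fintype (J k)]
    {f : ∀ k, J k → ℚ[Equiv.Perm (Fin k.1.1) × Equiv.Perm (Fin k.1.2)]}
    {u v : ∀ k, J k → ℚ[Equiv.Perm (Fin n)]}
    (hd : ∀ k, FrobDecomp.{v} (MonoidAlgebra.mapDomainAlgHom ℚ ℚ
        (permProd (Finset.HasAntidiagonal.mem_antidiagonal.1 k.2)))
      (groupAlgRes (permProd (Finset.HasAntidiagonal.mem_antidiagonal.1 k.2)))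
      (fun g ↦ (Fintype.card (Equiv.Perm (Fin k.1.1) × Equiv.Perm (Fin k.1.2)) : ℚ)⁻¹ •
        MonoidAlgebra.of ℚ _ g)
      (fun g ↦ MonoidAlgebra.of ℚ _ g⁻¹) e (f k) (u k) (v k))
    {U : C} (hU : IsTensorImage e Z U) {T : ∀ k, J k → C}
    (hT : ∀ k x, IsIdemImage (act₂ X Y k.1.1 k.1.2 (f k x)) (T k x)) :
    IsSum (fun x : Σ k, J k ↦ T x.1 x.2) U := by
  classical
  have hk : ∀ k : Finset.HasAntidiagonal.antidiagonal n, k.1.1 + k.1.2 = n := fun k ↦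
    Finset.HasAntidiagonal.mem_antidiagonal.1 k.2
  -- A permutation preserves the number of letters `true`, so the block words of different pairs are
  -- never related.
  have hw : ∀ (k l : Finset.HasAntidiagonal.antidiagonal n) (g : Equiv.Perm (Fin n)),
      blockWord (hk k) ∘ (g⁻¹ : Equiv.Perm (Fin n)) = blockWord (hk l) → k = l := by
    intro k l g hg
    have h₁ := card_perm_blockWord (hk k) (blockWord (hk l))
    rw [card_blockWord] at h₁
    split_ifs at h₁ with h₂
    · have := hk k
      have := hk l
      dsimp only [cond_true] at h₂
      exact Subtype.ext (Prod.ext h₂.symm (by omega))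
    · rw [Finset.card_eq_zero] at h₁
      exact absurd (Finset.mem_filter.2 ⟨Finset.mem_univ g, hg⟩) (by rw [h₁]; simp)
  refine FrobDecomp.isSum hd (actLin (tact Z n)) (actLin_mul _)
    (fun k ↦ act₂ X Y k.1.1 k.1.2) (fun k ↦ s.inc (hk k))
    (fun k ↦ s.proj (hk k)) ?_ ?_ ?_ ?_ ?_ hU.isImage hT
  · intro k b
    rw [actLin_mapDomain]
    exact (actLin_comm _ _ _ (fun x ↦ (s.inc_tperm (hk k) x).symm) b).symm
  -- A permutation outside of Σ_p × Σ_q changes the block word and contributes zero; so between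
  -- `inc` and `proj` only the restriction `groupAlgRes` is visible.
  · intro k a
    induction a using MonoidAlgebra.induction_on with
    | of g =>
      rw [groupAlgRes_of, map_sum, actLin_of, tact_apply]
      by_cases hg : ∃ x, permProd (hk k) x = g
      · obtain ⟨x, rfl⟩ := hg
        rw [Finset.sum_eq_single x, if_pos rfl, actLin_of, s.tperm_proj, inc_proj_assoc]
        · intro y _ hy
          rw [if_neg fun h ↦ hy (permProd_injective _ h.symm), map_zero]
        · simp
      · rw [s.inc_tperm_proj, Finset.sum_eq_zero]
        · intro x _
          rw [if_neg fun h ↦ hg ⟨x, h.symm⟩, map_zero]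
        · intro h
          obtain ⟨x, hx⟩ := (mem_range_permProd_iff (hk k) _).2 h
          exact hg ⟨x⁻¹, by rw [map_inv, hx, inv_inv]⟩
    | add x y hx hy => rw [map_add, map_add, map_add, Preadditive.add_comp, Preadditive.comp_add,
        hx, hy]
    | smul q x hx => rw [map_smul, map_smul, map_smul, Linear.smul_comp, Linear.comp_smul, hx]
  · intro k l a hkl
    induction a using MonoidAlgebra.induction_on with
    | of g =>
      rw [actLin_of, tact_apply, s.inc_tperm_proj _ _ _ fun h ↦ hkl (hw _ _ _ h)]
    | add x y hx hy => rw [map_add, Preadditive.add_comp, Preadditive.comp_add, hx, hy, add_zero]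
    | smul q x hx => rw [map_smul, Linear.smul_comp, Linear.comp_smul, hx, smul_zero]
  · intro k b
    rw [actLin_mapDomain]
    exact actLin_comm _ _ _ (fun x ↦ s.tperm_proj (hk k) x) b
  · have h₁ : ∀ k : Finset.HasAntidiagonal.antidiagonal n, ∑ g : Equiv.Perm (Fin n),
        actLin (tact Z n) (MonoidAlgebra.of ℚ _ g⁻¹) ≫ s.proj (hk k) ≫ s.inc (hk k) ≫
          actLin (tact Z n) ((Fintype.card (Equiv.Perm (Fin k.1.1) × Equiv.Perm (Fin k.1.2)) :
            ℚ)⁻¹ • MonoidAlgebra.of ℚ _ g) =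
        ∑ w : Fin n → Bool, if Fintype.card {i // w i = true} = k.1.1 then
          thom n (s.projector ∘ w) else 0 := fun k ↦ by
      have hc : (Fintype.card (Equiv.Perm (Fin k.1.1) × Equiv.Perm (Fin k.1.2)) : ℚ) ≠ 0 := by
        exact_mod_cast Fintype.card_ne_zero
      simp only [map_smul, actLin_of, tact_apply, Linear.comp_smul]
      rw [← Finset.smul_sum, s.sum_tperm_proj_inc, smul_smul, inv_mul_cancel₀ hc, one_smul]
    rw [Finset.sum_congr rfl fun k _ ↦ h₁ k, Finset.sum_comm]
    -- Each word belongs to exactly one pair `(p, q)`, so the sum over the pairs yields all words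
    -- once, and these add up to the tensor power of the identity.
    have h₂ : ∀ w : Fin n → Bool, (∑ k : Finset.HasAntidiagonal.antidiagonal n,
        if Fintype.card {i // w i = true} = k.1.1 then thom n (s.projector ∘ w) else 0) =
        thom n (s.projector ∘ w) := fun w ↦ by
      have hle := Fintype.card_subtype_le (fun i ↦ w i = true)
      rw [Fintype.card_fin] at hle
      rw [Finset.sum_eq_single ⟨(Fintype.card {i // w i = true},
        n - Fintype.card {i // w i = true}), Finset.HasAntidiagonal.mem_antidiagonal.2 (by omega)⟩,
        if_pos rfl]
      · intro l _ hl
        rw [if_neg]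
        intro h
        have := hk l
        exact hl (Subtype.ext (Prod.ext h.symm (by dsimp only; omega)))
      · simp
    simp only [h₂]
    rw [thom_sum, Fintype.sum_bool]
    have := s.total
    rw [show s.projector true + s.projector false = 𝟙 Z from this, tmap_id]

/-- The decomposition of the image of an idempotent by the irreducible representations of the
products of symmetric groups. -/
theorem isSum (s : SumData X Y Z) [Linear ℚ C] {n : ℕ} {e : ℚ[Equiv.Perm (Fin n)]} (he : e * e = e)
    {U : C} (hU : IsTensorImage e Z U)
    {T : ∀ k : Finset.HasAntidiagonal.antidiagonal n, k.1.1.Partition × k.1.2.Partition → C}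
    (hT : ∀ k x, IsIdemImage (act₂ X Y k.1.1 k.1.2 (boxMul (youngIdem x.1) (youngIdem x.2)))
      (T k x)) :
    IsSum (fun x : Σ k : Finset.HasAntidiagonal.antidiagonal n,
      Σ y : k.1.1.Partition × k.1.2.Partition, Fin (cornerDim e
        (permExt (Finset.HasAntidiagonal.mem_antidiagonal.1 k.2) (youngIdem y.1)
          (youngIdem y.2))) ↦ T x.1 x.2.1) U := by
  have hd := fun k : Finset.HasAntidiagonal.antidiagonal n ↦ (FrobData.group (permProd
    (Finset.HasAntidiagonal.mem_antidiagonal.1 k.2))).frobDecomp.{v}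
      ((youngSplit k.1.1).prod (youngSplit k.1.2)) he
  choose u v hd using hd
  exact s.isSum_of_frobDecomp hd hU (T := fun k x ↦ T k x.1) fun k x ↦ hT k x.1

/-- The exterior powers of a direct sum. -/
theorem isSum_alt (s : SumData X Y Z) [Linear ℚ C] [MonoidalLinear ℚ C] {n : ℕ} {U : C}
    (hU : IsAlt n Z U) {S T : ℕ → C} (hS : ∀ i, IsAlt i X (S i)) (hT : ∀ i, IsAlt i Y (T i)) :
    IsSum (fun k : Finset.HasAntidiagonal.antidiagonal n ↦ S k.1.1 ⊗ T k.1.2) U := by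
  obtain ⟨i, p, h₁, h₂, h₃⟩ := s.isSum_of_frobDecomp (fun k ↦ FrobDecomp.alt.{v}
    (Finset.HasAntidiagonal.mem_antidiagonal.1 k.2)) hU (T := fun k _ ↦ S k.1.1 ⊗ T k.1.2)
    fun k _ ↦ isImage_boxMul (hS _) (hT _)
  refine ⟨fun x ↦ i ⟨x, ()⟩, fun x ↦ p ⟨x, ()⟩, fun x ↦ h₁ _, fun x y hxy ↦ h₂ _ _ ?_, ?_⟩
  · exact fun h ↦ hxy congr($(h).1)
  · rw [Fintype.sum_sigma] at h₃
    simpa only [Fintype.sum_unique] using h₃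

end SumData

end SumOfObjects

universe w'

/-! ### Additive and multiplicative invariants of objects. -/

section TensorInvariants

open scoped MonoidAlgebra

variable {C : Type u} [Category.{v} C] [MonoidalCategory C] [SymmetricCategory C]
  [Preadditive C] [Linear ℚ C]

/-- An invariant of objects which is additive for direct sums and multiplicative for tensor
products. -/
structure TensorInv {K : Type*} [CommRing K] (cl : C → K) : Prop where
  sum : ∀ {J : Type} [Fintype J] {T : J → C} {S : C}, IsSum T S → cl S = ∑ j, cl (T j)
  tensor : ∀ X Y, cl (X ⊗ Y) = cl X * cl Y
  unit : cl (𝟙_ C) = 1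

open Classical in
/-- The invariant of the image of an element of the group algebra on a tensor power. -/
noncomputable def imgCl {K : Type*} [CommRing K] (cl : C → K) (X : C) (n : ℕ)
    (e : ℚ[Equiv.Perm (Fin n)]) : K :=
  -- The default `0` does not occur for idempotents in an idempotent complete category.
  if h : ∃ S, IsTensorImage e X S then cl h.choose else 0

/-- The invariant of an exterior power. -/
noncomputable abbrev altCl {K : Type*} [CommRing K] (cl : C → K) (X : C) (n : ℕ) : K :=
  imgCl cl X n (altIdem n)

variable {K : Type*} [CommRing K] {cl : C → K}

namespace TensorInv

lemma iso (hcl : TensorInv cl) {S T : C} (e : S ≅ T) : cl S = cl T := by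
  rw [hcl.sum (isSum_of_iso e)]; simp

lemma zero (hcl : TensorInv cl) {S : C} (h : 𝟙 S = 0) : cl S = 0 := by
  have : IsSum (J := Empty) (fun x ↦ x.elim) S :=
    ⟨fun x ↦ x.elim, fun x ↦ x.elim, fun x ↦ x.elim, fun x ↦ x.elim, by simp [h]⟩
  rw [hcl.sum this]; simp

lemma imgCl_eq (hcl : TensorInv cl) {X S : C} {n : ℕ} {e : ℚ[Equiv.Perm (Fin n)]}
    (h : IsTensorImage e X S) : imgCl cl X n e = cl S := by
  have h' : ∃ S, IsTensorImage e X S := ⟨S, h⟩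
  rw [imgCl, dif_pos h']
  obtain ⟨i⟩ := h'.choose_spec.isImage.unique h.isImage
  exact hcl.iso i

end TensorInv

lemma exists_isTensorImage [IsIdempotentComplete C] {n : ℕ} {e : ℚ[Equiv.Perm (Fin n)]}
    (he : e * e = e) (X : C) : ∃ S, IsTensorImage e X S :=
  exists_isIdemImage (θ := actLin (tact X n) e) (by rw [← actLin_mul, he])

lemma exists_isAlt [IsIdempotentComplete C] (X : C) (n : ℕ) : ∃ S, IsAlt n X S :=
  exists_isTensorImage (altIdem_mul_self n) X

variable [MonoidalPreadditive C] [MonoidalLinear ℚ C] [IsIdempotentComplete C]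

namespace TensorInv

/-- The decomposition is `isSum_of_split` for the Young idempotents, and the product formula comes
from concatenation of tensor powers. -/
lemma symChar (hcl : TensorInv cl) (X : C) : SymChar (imgCl cl X) where
  one := by
    rw [hcl.imgCl_eq (S := 𝟙_ C) ⟨𝟙 _, 𝟙 _, Category.id_comp _, ?_⟩, hcl.unit]
    rw [groupAlgAct_eq, actLin_one]
    exact Category.id_comp _
  decomp {n e} he := by
    obtain ⟨S, hS⟩ := exists_isTensorImage he X
    choose T hT using fun μ : n.Partition ↦ exists_isTensorImage (youngIdem_mul_self μ) X
    rw [hcl.imgCl_eq hS, hcl.sum (isSum_of_split (tact X n) (youngSplit n) he hS hT),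
      Fintype.sum_sigma]
    simp [fun μ ↦ hcl.imgCl_eq (hT μ)]
  ext h e f he hf := by
    obtain ⟨S, hS⟩ := exists_isTensorImage he X
    obtain ⟨T, hT⟩ := exists_isTensorImage hf X
    rw [hcl.imgCl_eq (isTensorImage_permExt h hS hT), hcl.imgCl_eq hS, hcl.imgCl_eq hT,
      hcl.tensor]

end TensorInv

lemma SymChar.pi {ι : Type*} {K : Type*} [CommRing K]
    {κ : ι → ∀ n, ℚ[Equiv.Perm (Fin n)] → K} (h : ∀ i, SymChar (κ i)) :
    SymChar fun n e i ↦ κ i n e where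
  one := funext fun i ↦ (h i).one
  decomp he := funext fun i ↦ by simp [(h i).decomp he]
  ext h' _ _ he hf := funext fun i ↦ (h i).ext h' he hf

/-- The invariants of the images of an idempotent are the values of a polynomial at the
invariants of the exterior powers. -/
lemma TensorInv.exists_aeval {C' : Type u'} [Category.{v'} C'] [MonoidalCategory C']
    [SymmetricCategory C'] [Preadditive C'] [Linear ℚ C'] [MonoidalPreadditive C']
    [MonoidalLinear ℚ C'] [IsIdempotentComplete C'] {K' : Type*} [CommRing K'] {cl' : C' → K'}
    (hcl : TensorInv cl) (hcl' : TensorInv cl') {n : ℕ} {e : ℚ[Equiv.Perm (Fin n)]}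
    (he : e * e = e) : ∃ Q : MvPolynomial (Fin n) ℤ,
      (∀ X, imgCl cl X n e = MvPolynomial.aeval (fun i ↦ altCl cl X (i.1 + 1)) Q) ∧
      ∀ X, imgCl cl' X n e = MvPolynomial.aeval (fun i ↦ altCl cl' X (i.1 + 1)) Q := by
  -- The invariants of all objects of both categories make up one `SymChar` with values in a product
  -- of rings of functions, so a single polynomial serves all objects at once. In the universal
  -- identities the second category is a test category, where the polynomial can be identified.
  obtain ⟨Q, hQ⟩ := ((SymChar.pi hcl.symChar).prod (SymChar.pi hcl'.symChar)).mem_range he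
  refine ⟨Q, fun X ↦ ?_, fun X ↦ ?_⟩
  · have := congrArg (((Pi.evalRingHom _ X).comp (RingHom.fst _ _)).toIntAlgHom) hQ
    exact this.symm.trans (MvPolynomial.comp_aeval_apply _
      (((Pi.evalRingHom _ X).comp (RingHom.fst (C → K) (C' → K'))).toIntAlgHom) Q)
  · have := congrArg (((Pi.evalRingHom _ X).comp (RingHom.snd _ _)).toIntAlgHom) hQ
    exact this.symm.trans (MvPolynomial.comp_aeval_apply _
      (((Pi.evalRingHom _ X).comp (RingHom.snd (C → K) (C' → K'))).toIntAlgHom) Q)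

/-- The image of the alternating idempotent under the diagonal. -/
noncomputable def diagAlt (n : ℕ) : ℚ[Equiv.Perm (Fin n) × Equiv.Perm (Fin n)] :=
  MonoidAlgebra.mapDomainAlgHom ℚ ℚ ((MonoidHom.id _).prod (MonoidHom.id _)) (altIdem n)

lemma diagAlt_mul_self (n : ℕ) : diagAlt n * diagAlt n = diagAlt n := by
  rw [diagAlt, ← map_mul, altIdem_mul_self]

lemma IsAlt.diag {X Y S : C} {n : ℕ} (h : IsAlt n (X ⊗ Y) S) :
    IsIdemImage (act₂ X Y n n (diagAlt n)) S := by
  refine h.isImage.of_iso (tdist X Y n) ?_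
  rw [diagAlt, act₂, actLin_mapDomain]
  exact actLin_comm _ _ _ (fun σ ↦ tperm_tdist X Y n σ) _

/-- By `IsAlt.diag` the exterior power is the image of an idempotent of ℚ[Σ_n × Σ_n], which is
decomposed by external products of Young idempotents. The multiplicities do not depend on `X` and
`Y`. -/
lemma TensorInv.altCl_tensor (hcl : TensorInv cl) (X Y : C) (n : ℕ) :
    altCl cl (X ⊗ Y) n = ∑ x : n.Partition × n.Partition,
      cornerDim (diagAlt n) (boxMul (youngIdem x.1) (youngIdem x.2)) •
        (imgCl cl X n (youngIdem x.1) * imgCl cl Y n (youngIdem x.2)) := by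
  obtain ⟨S, hS⟩ := exists_isAlt (X ⊗ Y) n
  choose T hT using fun μ : n.Partition ↦ exists_isTensorImage (youngIdem_mul_self μ) X
  choose U hU using fun μ : n.Partition ↦ exists_isTensorImage (youngIdem_mul_self μ) Y
  rw [altCl, hcl.imgCl_eq hS, hcl.sum (isSum_of_split (tact₂ X Y n n)
    ((youngSplit n).prod (youngSplit n)) (diagAlt_mul_self n) hS.diag fun x ↦
      isImage_boxMul (hT x.1) (hU x.2)), Fintype.sum_sigma]
  simp [fun μ ↦ hcl.imgCl_eq (hT μ), fun μ ↦ hcl.imgCl_eq (hU μ), hcl.tensor]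

/-- The external power of an element of the group algebra of a symmetric group. -/
noncomputable def plethBox (n : ℕ) (a : ℚ[Equiv.Perm (Fin n)]) :
    ∀ m, ℚ[Equiv.Perm (Fin (m * n))]
  | 0 => 1
  | m + 1 => permExt (show n + m * n = (m + 1) * n by ring) a (plethBox n a m)

lemma tmap_tpleth (X : C) (n : ℕ) (a : ℚ[Equiv.Perm (Fin n)]) : ∀ m,
    tmap (actLin (tact X n) a) m ≫ (tpleth X n m).hom =
      (tpleth X n m).hom ≫ actLin (tact X (m * n)) (plethBox n a m)
  | 0 => by
    rw [plethBox, actLin_one, Category.comp_id]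
    exact Category.id_comp _
  | m + 1 => by
    have h := act_permProd X (show n + m * n = (m + 1) * n by ring) (boxMul a (plethBox n a m))
    rw [act₂_boxMul] at h
    rw [tpleth_succ, plethBox, permExt, Category.assoc, ← h, tmap_succ, ← id_tensorHom,
      tensorHom_comp_tensorHom_assoc, tensorHom_comp_tensorHom_assoc, tmap_tpleth X n a m,
      Category.comp_id, Category.id_comp]

/-- The alternating sum of the permutations of `m` blocks of size `n`. -/
noncomputable def plethAlt (n m : ℕ) : ℚ[Equiv.Perm (Fin (m * n))] :=
  (m.factorial : ℚ)⁻¹ • ∑ σ : Equiv.Perm (Fin m),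
    ((Equiv.Perm.sign σ : ℤ) : ℚ) • MonoidAlgebra.of ℚ _ (plethPerm n m σ)

lemma altIdem_tpleth (X : C) (n m : ℕ) :
    actLin (tact (tpow X n) m) (altIdem m) ≫ (tpleth X n m).hom =
      (tpleth X n m).hom ≫ actLin (tact X (m * n)) (plethAlt n m) := by
  simp only [altIdem, plethAlt, map_smul, map_sum, actLin_of, Linear.smul_comp, Linear.comp_smul,
    Preadditive.sum_comp, Preadditive.comp_sum, tact_apply, tperm_tpleth]

/-- The idempotent which defines the exterior powers of exterior powers. -/
noncomputable def plethIdem (n m : ℕ) : ℚ[Equiv.Perm (Fin (m * n))] :=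
  plethBox n (altIdem n) m * plethAlt n m

/-- The m-th tensor power of `S` is the image of the m-th tensor power of the antisymmetrizer on
X^{⊗n}. The antisymmetrizer of Σ_m commutes with this projector by naturality, and `tpleth` turns
the composite into the action of an element of ℚΣ_{mn}. -/
lemma IsAlt.pleth {X S T : C} {n m : ℕ} (h : IsAlt n X S) (h' : IsAlt m S T) :
    IsTensorImage (plethIdem n m) X T := by
  obtain ⟨i, p, hip, hpi⟩ := h
  obtain ⟨j, q, hjq, hqj⟩ := h'
  have e : ∀ {W Z : C} (f : W ⟶ Z) (a : ℚ[Equiv.Perm (Fin m)]), tmap f m ≫ actLin (tact Z m) a =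
      actLin (tact W m) a ≫ tmap f m := fun f a ↦
    (actLin_comm _ _ _ (fun σ ↦ (tmap_tperm f m σ).symm) a).symm
  rw [groupAlgAct_eq] at hpi hqj
  have key : IsIdemImage (actLin (tact (tpow X n) m) (altIdem m) ≫
      tmap (actLin (tact X n) (altIdem n)) m) T := by
    refine ⟨j ≫ tmap i m, tmap p m ≫ q, ?_, ?_⟩
    · rw [Category.assoc, ← reassoc_of% (tmap_comp i p m), hip, tmap_id, Category.id_comp, hjq]
    · rw [Category.assoc, reassoc_of% hqj, ← hpi, tmap_comp, reassoc_of% e]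
  refine key.of_iso (tpleth X n m) ?_
  change _ = _ ≫ actLin (tact X (m * n)) _
  rw [plethIdem, actLin_mul, Category.assoc, tmap_tpleth, reassoc_of% altIdem_tpleth X n m]

end TensorInvariants

/-! ### Objects with trivial self-symmetry, and direct sums of two objects. -/

section Lines

open scoped MonoidAlgebra

variable {C : Type u} [Category.{v} C] [MonoidalCategory C] [SymmetricCategory C]

/-- The symmetry of the tensor square of `L` is the identity. -/
def IsLine (L : C) : Prop := (β_ L L).hom = 𝟙 _

lemma isLine_unit : IsLine (𝟙_ C) := by
  rw [IsLine, braiding_tensorUnit_left, unitors_equal]; simp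

lemma IsLine.tswap {L : C} (h : IsLine L) : ∀ n i, tswap L n i = 𝟙 _
  | 0, _ => rfl
  | 1, _ => rfl
  | n + 2, 0 => by
    rw [tswap_zero, tmid, show (β_ L L).hom = 𝟙 _ from h]; simp
  | n + 2, i + 1 => by
    change L ◁ _root_.tswap L (n + 1) i = _
    rw [h.tswap (n + 1) i, whiskerLeft_id]

lemma IsLine.tperm {L : C} (h : IsLine L) (n : ℕ) (σ : Equiv.Perm (Fin n)) :
    tperm L n σ = 𝟙 _ := by
  induction σ using perm_adj_induction with
  | one => exact tperm_one L n
  | adj_mul i hi σ ih => rw [tperm_adj_mul, ih, h.tswap, Category.id_comp]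

lemma IsLine.tensor {L M : C} (h : IsLine L) (h' : IsLine M) : IsLine (L ⊗ M) := by
  have := braiding_tensorμ L M
  rw [IsLine] at h h'
  rw [h, h', id_tensorHom_id, Category.comp_id] at this
  have h₁ := congr($this ≫ tensorδ L M L M)
  rwa [Category.assoc, tensorμ_tensorδ, Category.comp_id] at h₁

variable [Preadditive C] [Linear ℚ C]

lemma sum_sign_eq_zero {n : ℕ} (hn : 2 ≤ n) :
    ∑ σ : Equiv.Perm (Fin n), ((Equiv.Perm.sign σ : ℤ) : ℚ) = 0 := by
  obtain ⟨n, rfl⟩ : ∃ m, n = m + 2 := ⟨n - 2, by omega⟩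
  have h : Function.Injective (Equiv.mulLeft (Equiv.swap (0 : Fin (n + 2)) 1)) :=
    Equiv.injective _
  have := Equiv.sum_comp (Equiv.mulLeft (Equiv.swap (0 : Fin (n + 2)) 1))
    fun σ ↦ ((Equiv.Perm.sign σ : ℤ) : ℚ)
  simp only [Equiv.coe_mulLeft, Equiv.Perm.sign_mul,
    Equiv.Perm.sign_swap (show (0 : Fin (n + 2)) ≠ 1 by simp), neg_mul, one_mul, Units.val_neg,
    Int.cast_neg, Finset.sum_neg_distrib] at this
  linarith

/-- All permutations act as the identity on the tensor powers of a line, so `altIdem n` acts as the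
mean of the signs, which is zero. -/
lemma IsLine.isAlt {L S : C} (h : IsLine L) {n : ℕ} (hn : 2 ≤ n) (hS : IsAlt n L S) :
    𝟙 S = 0 := by
  have e : actLin (tact L n) (altIdem n) = 0 := by
    simp only [altIdem, map_smul, map_sum, actLin_of, tact_apply, h.tperm]
    rw [← Finset.sum_smul, sum_sign_eq_zero hn, zero_smul, smul_zero]
  obtain ⟨i, p, hip, hpi⟩ := hS
  rw [groupAlgAct_eq, e] at hpi
  calc 𝟙 S = i ≫ (p ≫ i) ≫ p := by simp [hip]
    _ = 0 := by rw [hpi]; simp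

lemma IsAlt.iso_unit {X S : C} (h : IsAlt 0 X S) : Nonempty (S ≅ 𝟙_ C) := by
  have e : altIdem 0 = 1 := by
    simp [altIdem, MonoidAlgebra.one_def]
  obtain ⟨i, p, hip, hpi⟩ := h
  rw [e, groupAlgAct_eq, actLin_one] at hpi
  exact ⟨⟨i, p, hip, hpi⟩⟩

lemma IsAlt.iso_self {X S : C} (h : IsAlt 1 X S) : Nonempty (S ≅ X) := by
  have e : altIdem 1 = 1 := by
    simp [altIdem, MonoidAlgebra.one_def]
  obtain ⟨i, p, hip, hpi⟩ := h
  rw [e, groupAlgAct_eq, actLin_one] at hpi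
  exact ⟨(⟨i, p, hip, hpi⟩ : S ≅ X ⊗ 𝟙_ C) ≪≫ ρ_ X⟩

end Lines

namespace SumData

variable {C : Type u} [Category.{v} C] [Preadditive C] {X Y Z : C} (s : SumData X Y Z)

lemma isSum_bool (s : SumData X Y Z) : IsSum (fun b : Bool ↦ bif b then X else Y) Z := by
  refine ⟨fun b ↦ match b with | true => s.inl | false => s.inr,
    fun b ↦ match b with | true => s.fst | false => s.snd, ?_, ?_, ?_⟩
  · rintro (_ | _)
    exacts [s.inr_snd, s.inl_fst]
  · rintro (_ | _) (_ | _) h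
    exacts [absurd rfl h, s.inr_fst, s.inl_snd, absurd rfl h]
  · rw [Fintype.sum_bool]
    exact s.total

/-- Transport of a direct sum by an isomorphism. -/
def congr {W : C} (e : Z ≅ W) : SumData X Y W where
  inl := s.inl ≫ e.hom
  inr := s.inr ≫ e.hom
  fst := e.inv ≫ s.fst
  snd := e.inv ≫ s.snd
  inl_fst := by simp [s.inl_fst]
  inr_snd := by simp [s.inr_snd]
  inl_snd := by simp [s.inl_snd]
  inr_fst := by simp [s.inr_fst]
  total := by
    have := congr(e.inv ≫ $s.total ≫ e.hom)
    simpa using this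

/-- Associativity of direct sums. -/
def assoc {W U B : C} (d : SumData Z W U) (b : SumData Y W B) : SumData X B U where
  inl := s.inl ≫ d.inl
  inr := b.fst ≫ s.inr ≫ d.inl + b.snd ≫ d.inr
  fst := d.fst ≫ s.fst
  snd := d.fst ≫ s.snd ≫ b.inl + d.snd ≫ b.inr
  inl_fst := by simp [reassoc_of% d.inl_fst, s.inl_fst]
  inr_snd := by
    simp only [Preadditive.add_comp, Preadditive.comp_add, Category.assoc,
      reassoc_of% d.inl_fst, reassoc_of% d.inr_fst, reassoc_of% d.inl_snd, reassoc_of% d.inr_snd,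
      reassoc_of% s.inr_snd, zero_comp, comp_zero, add_zero, zero_add]
    exact b.total
  inl_snd := by
    simp [reassoc_of% d.inl_fst, reassoc_of% d.inl_snd, reassoc_of% s.inl_snd]
  inr_fst := by
    simp [reassoc_of% d.inl_fst, reassoc_of% d.inr_fst, s.inr_fst]
  total := by
    simp only [Preadditive.add_comp, Preadditive.comp_add, Category.assoc,
      reassoc_of% b.inl_fst, reassoc_of% b.inr_fst, reassoc_of% b.inl_snd, reassoc_of% b.inr_snd,
      zero_comp, comp_zero, add_zero, zero_add]
    have h := congr(d.fst ≫ $s.total ≫ d.inl)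
    simp only [Preadditive.add_comp, Preadditive.comp_add, Category.assoc, Category.id_comp] at h
    rw [← d.total, ← h, add_assoc]

/-- The direct sum with an object which is zero. -/
def ofZero {W U : C} (hX : 𝟙 X = 0) (d : SumData X W U) : W ≅ U where
  hom := d.inr
  inv := d.snd
  hom_inv_id := d.inr_snd
  inv_hom_id := by
    have : d.fst = 0 := by rw [← Category.comp_id d.fst, hX, comp_zero]
    simpa [this] using d.total

variable [MonoidalCategory C] [MonoidalPreadditive C]

/-- The tensor product distributes over direct sums. -/
def tensorRight (W : C) : SumData (X ⊗ W) (Y ⊗ W) (Z ⊗ W) where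
  inl := s.inl ▷ W
  inr := s.inr ▷ W
  fst := s.fst ▷ W
  snd := s.snd ▷ W
  inl_fst := by rw [← comp_whiskerRight, s.inl_fst, id_whiskerRight]
  inr_snd := by rw [← comp_whiskerRight, s.inr_snd, id_whiskerRight]
  inl_snd := by rw [← comp_whiskerRight, s.inl_snd, MonoidalPreadditive.zero_whiskerRight]
  inr_fst := by rw [← comp_whiskerRight, s.inr_fst, MonoidalPreadditive.zero_whiskerRight]
  total := by
    rw [← comp_whiskerRight, ← comp_whiskerRight, ← MonoidalPreadditive.add_whiskerRight,
      s.total, id_whiskerRight]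

/-- The tensor product distributes over direct sums. -/
def tensorLeft (W : C) : SumData (W ⊗ X) (W ⊗ Y) (W ⊗ Z) where
  inl := W ◁ s.inl
  inr := W ◁ s.inr
  fst := W ◁ s.fst
  snd := W ◁ s.snd
  inl_fst := by rw [← MonoidalCategory.whiskerLeft_comp, s.inl_fst, whiskerLeft_id]
  inr_snd := by rw [← MonoidalCategory.whiskerLeft_comp, s.inr_snd, whiskerLeft_id]
  inl_snd := by
    rw [← MonoidalCategory.whiskerLeft_comp, s.inl_snd, MonoidalPreadditive.whiskerLeft_zero]
  inr_fst := by
    rw [← MonoidalCategory.whiskerLeft_comp, s.inr_fst, MonoidalPreadditive.whiskerLeft_zero]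
  total := by
    rw [← MonoidalCategory.whiskerLeft_comp, ← MonoidalCategory.whiskerLeft_comp,
      ← MonoidalPreadditive.whiskerLeft_add, s.total, whiskerLeft_id]

end SumData

lemma exists_sumData {C : Type u} [Category.{v} C] [Preadditive C] [HasBinaryBiproducts C]
    (X Y : C) : ∃ Z, Nonempty (SumData X Y Z) :=
  ⟨X ⊞ Y, ⟨⟨biprod.inl, biprod.inr, biprod.fst, biprod.snd, by simp, by simp, by simp, by simp,
    biprod.total⟩⟩⟩

lemma exists_id_eq_zero {C : Type u} [Category.{v} C] [Preadditive C] [IsIdempotentComplete C]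
    (X : C) : ∃ O : C, 𝟙 O = 0 := by
  obtain ⟨O, i, p, hip, hpi⟩ := exists_isIdemImage (θ := (0 : X ⟶ X)) (by simp)
  exact ⟨O, by
    calc 𝟙 O = i ≫ (p ≫ i) ≫ p := by simp [hip]
      _ = 0 := by rw [hpi]; simp⟩

/-! ### Exterior powers of sums of lines. -/

section SumsOfLines

variable {C : Type u} [Category.{v} C] [MonoidalCategory C] [SymmetricCategory C]
  [Preadditive C] {K : Type*} (cl : C → K)

/-- `X` is a direct sum of lines with given invariants. -/
inductive HasLines : C → Multiset K → Prop
  | zero {X : C} (h : 𝟙 X = 0) : HasLines X 0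
  | cons {L X Z : C} {s : Multiset K} (hL : IsLine L) (d : SumData L X Z) (h : HasLines X s) :
    HasLines Z (cl L ::ₘ s)

variable {cl}

lemma HasLines.congr {X Y : C} {s : Multiset K} (h : HasLines cl X s) (e : X ≅ Y) :
    HasLines cl Y s := by
  cases h with
  | zero h => exact .zero (by rw [← e.inv_hom_id, ← Category.id_comp e.hom, h]; simp)
  | cons hL d h => exact .cons hL (d.congr e) h

lemma HasLines.add [HasBinaryBiproducts C] {X Y Z : C} {s t : Multiset K} (h : HasLines cl X s)
    (h' : HasLines cl Y t) (d : SumData X Y Z) : HasLines cl Z (s + t) := by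
  induction h generalizing Z with
  | zero h => rw [zero_add]; exact h'.congr (d.ofZero h)
  | @cons L X' X s hL d' _ ih =>
    obtain ⟨B, ⟨b⟩⟩ := exists_sumData X' Y
    rw [Multiset.cons_add]
    exact .cons hL (d'.assoc d b) (ih b)

variable [Linear ℚ C] [MonoidalPreadditive C] [MonoidalLinear ℚ C]

lemma HasLines.zero_tensor {X Y : C} (h : 𝟙 X = 0) : 𝟙 (X ⊗ Y) = 0 := by
  rw [← id_whiskerRight, h, MonoidalPreadditive.zero_whiskerRight]

lemma HasLines.tensor_zero {X Y : C} (h : 𝟙 X = 0) : 𝟙 (Y ⊗ X) = 0 := by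
  rw [← whiskerLeft_id, h, MonoidalPreadditive.whiskerLeft_zero]

variable [CommRing K]

lemma HasLines.cl_eq (hcl : TensorInv cl) {X : C} {s : Multiset K} (h : HasLines cl X s) :
    cl X = s.sum := by
  induction h with
  | zero h => rw [hcl.zero h, Multiset.sum_zero]
  | cons hL d _ ih =>
    rw [hcl.sum d.isSum_bool, Fintype.sum_bool, Multiset.sum_cons, ← ih]; rfl

lemma HasLines.line_tensor (hcl : TensorInv cl) {L X : C} {s : Multiset K} (hL : IsLine L)
    (h : HasLines cl X s) : HasLines cl (L ⊗ X) (s.map (cl L * ·)) := by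
  induction h with
  | zero h => exact .zero (tensor_zero h)
  | cons hM d _ ih =>
    rw [Multiset.map_cons, ← hcl.tensor]
    exact .cons (hL.tensor hM) (d.tensorLeft L) ih

lemma HasLines.tensor [HasBinaryBiproducts C] (hcl : TensorInv cl) {X Y : C} {s t : Multiset K}
    (h : HasLines cl X s) (h' : HasLines cl Y t) :
    HasLines cl (X ⊗ Y) ((s ×ˢ t).map fun x ↦ x.1 * x.2) := by
  induction h with
  | zero h => exact .zero (zero_tensor h)
  | cons hL d _ ih =>
    rw [Multiset.cons_product, Multiset.map_add, Multiset.map_map]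
    exact (h'.line_tensor hcl hL).add ih (d.tensorRight Y)

/-- Exterior powers of a sum with a line. -/
lemma IsLine.sumData_alt {L X Z : C} (hL : IsLine L) (d : SumData L X Z) {n : ℕ} {U : C}
    (hU : IsAlt (n + 1) Z U) {S : ℕ → C} (hS : ∀ i, IsAlt i X (S i)) {T : ℕ → C}
    (hT : ∀ i, IsAlt i L (T i)) : Nonempty (SumData (L ⊗ S n) (S (n + 1)) U) := by
  classical
  obtain ⟨i, p, h₁, h₂, h₃⟩ := d.isSum_alt hU hT hS
  obtain ⟨e₀⟩ := (hT 0).iso_unit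
  obtain ⟨e₁⟩ := (hT 1).iso_self
  let a : Finset.HasAntidiagonal.antidiagonal (n + 1) :=
    ⟨(0, n + 1), Finset.HasAntidiagonal.mem_antidiagonal.2 (by simp)⟩
  let b : Finset.HasAntidiagonal.antidiagonal (n + 1) :=
    ⟨(1, n), Finset.HasAntidiagonal.mem_antidiagonal.2 (by simp [add_comm])⟩
  have hab : a ≠ b := fun h ↦ by simpa [a, b] using congr(($h).1.1)
  let ea : T 0 ⊗ S (n + 1) ≅ S (n + 1) := whiskerRightIso e₀ _ ≪≫ λ_ _
  let eb : T 1 ⊗ S n ≅ L ⊗ S n := whiskerRightIso e₁ _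
  -- Λ^i L vanishes for `i ≥ 2`, so only the pairs `(0, n + 1)` and `(1, n)` contribute.
  have ht : p a ≫ i a + p b ≫ i b = 𝟙 U := by
    rw [← h₃, ← Finset.sum_pair (f := fun j ↦ p j ≫ i j) hab]
    refine Finset.sum_subset (Finset.subset_univ _) fun k _ hk ↦ ?_
    have hk' := Finset.HasAntidiagonal.mem_antidiagonal.1 k.2
    have h2 : 2 ≤ k.1.1 := by
      by_contra! h
      refine hk ?_
      simp only [Finset.mem_insert, Finset.mem_singleton, a, b, Subtype.ext_iff, Prod.ext_iff]
      omega
    have := HasLines.zero_tensor (Y := S k.1.2) (hL.isAlt h2 (hT k.1.1))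
    rw [← Category.id_comp (i k), this, zero_comp, comp_zero]
  refine ⟨⟨eb.inv ≫ i b, ea.inv ≫ i a, p b ≫ eb.hom, p a ≫ ea.hom, ?_, ?_, ?_, ?_, ?_⟩⟩
  · rw [Category.assoc, reassoc_of% (h₁ b), Iso.inv_hom_id]
  · rw [Category.assoc, reassoc_of% (h₁ a), Iso.inv_hom_id]
  · rw [Category.assoc, reassoc_of% (h₂ b a hab.symm), zero_comp, comp_zero]
  · rw [Category.assoc, reassoc_of% (h₂ a b hab), zero_comp, comp_zero]
  · rw [← ht, add_comm]; simp

/-- Splitting off a line with `IsLine.sumData_alt` is the recursion `Multiset.powersetCard_cons`.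
Since the lines are recorded and not only their sum, exterior powers of exterior powers are covered
as well. -/
lemma HasLines.alt [IsIdempotentComplete C] [HasBinaryBiproducts C] (hcl : TensorInv cl)
    {X : C} {s : Multiset K} (h : HasLines cl X s) : ∀ {n : ℕ} {U : C}, IsAlt n X U →
      HasLines cl U ((s.powersetCard n).map Multiset.prod) := by
  have h₀ : ∀ {X U : C} (s : Multiset K), IsAlt 0 X U →
      HasLines cl U ((s.powersetCard 0).map Multiset.prod) := fun s hU ↦ by
    obtain ⟨e⟩ := hU.iso_unit
    rw [Multiset.powersetCard_zero_left, Multiset.map_singleton, Multiset.prod_zero, ← hcl.unit]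
    obtain ⟨O, hO⟩ := exists_id_eq_zero (𝟙_ C)
    exact .cons isLine_unit (X := O)
      ⟨e.inv, 0, e.hom, 0, by simp, by simp [hO], by simp, by simp, by simp⟩ (.zero hO)
  induction h with
  | @zero X hX =>
    rintro (_ | n) U hU
    · exact h₀ _ hU
    · rw [Multiset.powersetCard_zero_right, Multiset.map_zero]
      obtain ⟨i, p, hip, _⟩ := hU
      refine .zero ?_
      have : 𝟙 (tpow X (n + 1)) = 0 := zero_tensor hX
      rw [← hip, ← Category.id_comp p, this]
      simp
  | @cons L X Z s hL d _ ih =>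
    rintro (_ | n) U hU
    · exact h₀ _ hU
    · choose S hS using fun i ↦ exists_isAlt X i
      choose T hT using fun i ↦ exists_isAlt L i
      obtain ⟨d'⟩ := hL.sumData_alt d hU hS hT
      have := ((ih (hS n)).line_tensor hcl hL).add (ih (hS (n + 1))) d'
      rw [Multiset.powersetCard_cons, Multiset.map_add, add_comm]
      simpa only [Multiset.map_map, Function.comp_def, Multiset.prod_cons] using this

end SumsOfLines

/-! ### Faithfulness of the action of ℚΣ_n on tensor powers. -/

section Faithful

open scoped MonoidAlgebra

lemma groupAlg_eq_sum {G : Type} [Group G] [Fintype G] (a : ℚ[G]) :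
    a = ∑ g, a.coeff g • MonoidAlgebra.of ℚ G g := by
  classical
  ext g
  simp only [MonoidAlgebra.coeff_sum, Finset.sum_apply', MonoidAlgebra.coeff_smul,
    Finsupp.smul_apply, MonoidAlgebra.of_apply, MonoidAlgebra.coeff_single, Finsupp.single_apply]
  simp

variable {C : Type u} [Category.{v} C] [MonoidalCategory C] [SymmetricCategory C]
  [Preadditive C] [MonoidalPreadditive C] [Linear ℚ C]

/-- Between `thom n P` and its translate by `τ`, the action of `a` retains only the coefficient of
`τ`. -/
lemma actLin_injective {X : C} {n : ℕ} {P : Fin n → (X ⟶ X)}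
    (h : ∀ i j, P i ≫ P j = if i = j then P i else 0)
    (h₀ : ∀ σ : Equiv.Perm (Fin n), thom n (P ∘ σ) ≠ 0) {a : ℚ[Equiv.Perm (Fin n)]}
    (ha : actLin (tact X n) a = 0) : a = 0 := by
  have key : ∀ τ g : Equiv.Perm (Fin n), thom n P ≫ tperm X n g ≫
      thom n (P ∘ (τ⁻¹ : Equiv.Perm (Fin n))) = if g = τ then
        tperm X n τ ≫ thom n (P ∘ (τ⁻¹ : Equiv.Perm (Fin n))) else 0 := fun τ g ↦ by
    rw [← Category.assoc, thom_tperm, Category.assoc, thom_comp]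
    simp only [Function.comp_apply, h]
    split_ifs with hg
    · subst hg
      simp only [if_true]
      rfl
    · obtain ⟨i, hi⟩ : ∃ i, g⁻¹ i ≠ τ⁻¹ i := by
        by_contra! hi
        exact hg (inv_injective (Equiv.ext hi))
      rw [thom_eq_zero (i := i) (by rw [if_neg hi]), comp_zero]
  ext τ
  by_contra hτ
  have h₁ : thom n P ≫ actLin (tact X n) a ≫ thom n (P ∘ (τ⁻¹ : Equiv.Perm (Fin n))) =
      a.coeff τ • tperm X n τ ≫ thom n (P ∘ (τ⁻¹ : Equiv.Perm (Fin n))) := by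
    conv_lhs => rw [groupAlg_eq_sum a]
    simp only [map_sum, map_smul, actLin_of, tact_apply, Preadditive.sum_comp,
      Preadditive.comp_sum, Linear.smul_comp, Linear.comp_smul, key]
    rw [Finset.sum_eq_single τ (fun g _ hg ↦ by rw [if_neg hg, smul_zero]) (by simp), if_pos rfl]
  rw [ha, zero_comp, comp_zero] at h₁
  have h₂ := (smul_eq_zero.1 h₁.symm).resolve_left hτ
  refine h₀ τ⁻¹ ?_
  have h₃ := congr(tperm X n τ⁻¹ ≫ $h₂)
  rwa [← Category.assoc, ← tperm_mul, mul_inv_cancel, tperm_one, Category.id_comp,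
    comp_zero] at h₃

lemma thom_ne_zero_of_module {X : ModuleCat.{0} ℚ} : ∀ {n : ℕ} {P : Fin n → (X ⟶ X)},
    (∀ i, P i ≠ 0) → thom n P ≠ 0
  | 0, _, _ => fun h ↦ by
    have h₁ := congr(($h).hom (1 : ℚ))
    exact one_ne_zero (α := ℚ) h₁
  | n + 1, P, hP => fun h ↦ by
    have ih := thom_ne_zero_of_module fun i : Fin n ↦ hP i.succ
    obtain ⟨x, hx⟩ : ∃ x, (P 0).hom x ≠ 0 := by
      by_contra! hx
      exact hP 0 (by ext x; exact hx x)
    obtain ⟨y, hy⟩ : ∃ y, (thom n fun i ↦ P i.succ).hom y ≠ 0 := by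
      by_contra! hy
      exact ih (by ext y; exact hy y)
    have h₁ : ((P 0).hom x ⊗ₜ[ℚ] (thom n fun i ↦ P i.succ).hom y : TensorProduct ℚ _ _) = 0 :=
      congr(($h).hom (x ⊗ₜ[ℚ] y))
    obtain ⟨f, hf⟩ : ∃ f : Module.Dual ℚ X, f ((P 0).hom x) ≠ 0 := by
      by_contra! hf
      exact hx ((Module.forall_dual_apply_eq_zero_iff ℚ _).1 hf)
    obtain ⟨g, hg⟩ : ∃ g : Module.Dual ℚ (tpow X n : ModuleCat ℚ),
        g ((thom n fun i ↦ P i.succ).hom y) ≠ 0 := by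
      by_contra! hg
      exact hy ((Module.forall_dual_apply_eq_zero_iff ℚ _).1 hg)
    have h₂ := congrArg (LinearMap.mul' ℚ ℚ ∘ₗ TensorProduct.map f g) h₁
    rw [LinearMap.comp_apply, TensorProduct.map_tmul, LinearMap.mul'_apply, map_zero] at h₂
    exact mul_ne_zero hf hg h₂

/-- The coordinate projectors of ℚ^n are orthogonal, and tensor products of nonzero linear maps are
nonzero. -/
lemma exists_faithful (n : ℕ) : ∃ X : ModuleCat.{0} ℚ, ∀ a : ℚ[Equiv.Perm (Fin n)],
    actLin (tact X n) a = 0 → a = 0 := by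
  let P : Fin n → (ModuleCat.of ℚ (Fin n → ℚ) ⟶ ModuleCat.of ℚ (Fin n → ℚ)) := fun i ↦
    ModuleCat.ofHom (LinearMap.single ℚ (fun _ ↦ ℚ) i ∘ₗ LinearMap.proj i)
  refine ⟨_, fun a ↦ actLin_injective (P := P) (fun i j ↦ ?_)
    fun σ ↦ thom_ne_zero_of_module fun i h ↦ ?_⟩
  · refine ModuleCat.hom_ext (LinearMap.ext fun x ↦ funext fun k ↦ ?_)
    change (Pi.single j ((Pi.single i (x i) : Fin n → ℚ) j) : Fin n → ℚ) k = _
    split_ifs with hij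
    · subst hij
      simp
      rfl
    · rw [Pi.single_eq_of_ne (Ne.symm hij), Pi.single_zero]
      rfl
  · have h₁ : (Pi.single (σ i) (1 : ℚ) : Fin n → ℚ) (σ i) = 0 :=
      congr(($h).hom (fun _ ↦ 1) (σ i))
    simp at h₁

/-- The identity may be tested on a faithful tensor power, where `plethIdem n m` acts as a projector
by `IsAlt.pleth`. No computation with block permutations is needed. -/
lemma plethIdem_mul_self (n m : ℕ) : plethIdem n m * plethIdem n m = plethIdem n m := by
  obtain ⟨X, hX⟩ := exists_faithful (m * n)
  obtain ⟨S, hS⟩ := exists_isAlt X n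
  obtain ⟨T, hT⟩ := exists_isAlt S m
  have h := (hS.pleth hT).isImage.idem
  rw [← actLin_mul] at h
  rw [← sub_eq_zero]
  exact hX _ (by rw [map_sub, h, sub_self])

end Faithful

/-! ### Representations of monoids as a test category. -/

section TestCategory

attribute [local instance] Abelian.hasFiniteBiproducts

variable (M : Type) [Monoid M]

/-- Traces are additive for direct sums and multiplicative for tensor products. Monoids rather than
groups are allowed so that evaluation at any integral point, with zero coordinates included, is a
character. -/
lemma charInv : TensorInv (C := FDRep ℚ M) (K := M → ℚ) fun V ↦ V.character where
  sum {J _ T S} h := by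
    obtain ⟨i, p, h₁, _, h₃⟩ := h
    funext g
    rw [Finset.sum_apply]
    let I : ∀ j, T j →ₗ[ℚ] S := fun j ↦ (i j).hom.hom.hom
    let P : ∀ j, S →ₗ[ℚ] T j := fun j ↦ (p j).hom.hom.hom
    have e₁ : ∀ j, P j ∘ₗ I j = LinearMap.id := fun j ↦ congr(($(h₁ j)).hom.hom.hom)
    have e₂ : ∀ j, S.ρ g ∘ₗ I j = I j ∘ₗ (T j).ρ g := fun j ↦
      congr(($((i j).comm g)).hom.hom).symm
    have e₃ : ∑ j, I j ∘ₗ P j = LinearMap.id := by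
      let Φ : (S ⟶ S) →+ (S →ₗ[ℚ] S) :=
        ⟨⟨fun f ↦ f.hom.hom.hom, rfl⟩, fun _ _ ↦ rfl⟩
      have := congrArg Φ h₃
      rw [map_sum] at this
      exact this
    calc LinearMap.trace ℚ S (S.ρ g) = LinearMap.trace ℚ S (S.ρ g * ∑ j, I j ∘ₗ P j) := by
          rw [e₃]; rfl
      _ = ∑ j, LinearMap.trace ℚ S (S.ρ g ∘ₗ I j ∘ₗ P j) := by
          rw [Finset.mul_sum, map_sum]; rfl
      _ = ∑ j, LinearMap.trace ℚ (T j) ((T j).ρ g) := by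
          refine Finset.sum_congr rfl fun j _ ↦ ?_
          rw [← LinearMap.comp_assoc, e₂, LinearMap.trace_comp_comm', ← LinearMap.comp_assoc, e₁,
            LinearMap.id_comp]
  tensor X Y := FDRep.char_tensor X Y
  unit := by
    funext g
    exact (LinearMap.trace_one ℚ ℚ).trans (by simp)

variable {M}

/-- The one-dimensional representation given by a character. -/
noncomputable def lineRep (χ : M →* ℚ) : FDRep ℚ M :=
  FDRep.of (V := ℚ) (((Algebra.lmul ℚ ℚ).toRingHom.toMonoidHom.comp χ : M →* Module.End ℚ ℚ))

lemma character_lineRep (χ : M →* ℚ) : (lineRep χ).character = χ := by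
  funext g
  change LinearMap.trace ℚ ℚ (Algebra.lmul ℚ ℚ (χ g)) = _
  rw [show Algebra.lmul ℚ ℚ (χ g) = χ g • 1 by ext; simp, map_smul, LinearMap.trace_one]
  simp

/-- In ℚ ⊗ ℚ scalars pass from one factor to the other, so exchanging the factors changes nothing.
-/
lemma isLine_lineRep (χ : M →* ℚ) : IsLine (lineRep χ) := by
  rw [IsLine]
  refine Action.Hom.ext (InducedCategory.hom_ext (ModuleCat.hom_ext ?_))
  let f : TensorProduct ℚ ℚ ℚ →ₗ[ℚ] TensorProduct ℚ ℚ ℚ :=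
    (β_ (lineRep χ) (lineRep χ)).hom.hom.hom.hom
  change f = LinearMap.id
  refine TensorProduct.ext' fun a b ↦ ?_
  change (b ⊗ₜ[ℚ] a : TensorProduct ℚ ℚ ℚ) = a ⊗ₜ[ℚ] b
  have h := TensorProduct.smul_tmul (R := ℚ) b (1 : ℚ) a
  have h' := TensorProduct.smul_tmul (R := ℚ) a (1 : ℚ) b
  simp only [smul_eq_mul, mul_one] at h h'
  rw [h, h', mul_comm]

lemma exists_hasLines (s : Multiset (M →* ℚ)) : ∃ X : FDRep ℚ M,
    HasLines (fun V : FDRep ℚ M ↦ V.character) X (s.map fun χ : M →* ℚ ↦ (χ : M → ℚ)) := by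
  induction s using Multiset.induction with
  | empty =>
    obtain ⟨X, hX⟩ := exists_id_eq_zero (𝟙_ (FDRep ℚ M))
    exact ⟨X, .zero hX⟩
  | cons χ s ih =>
    obtain ⟨X, hX⟩ := ih
    obtain ⟨Z, ⟨d⟩⟩ := exists_sumData (lineRep χ) X
    refine ⟨Z, ?_⟩
    rw [Multiset.map_cons, ← character_lineRep χ]
    exact .cons (isLine_lineRep χ) d hX

/-- The evaluation at an integral vector. -/
def evalChar {σ : Type} (i : σ) : (σ → ℤ) →* ℚ :=
  ((Int.castRingHom ℚ).toMonoidHom).comp (Pi.evalMonoidHom _ i)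

/-- An integral polynomial is determined by its values at integral points. So identities between
characters of sums of the lines `evalChar i` are identities of polynomials. -/
lemma aeval_evalChar_injective (σ : Type) : Function.Injective
    (MvPolynomial.aeval (R := ℤ) fun i : σ ↦ (evalChar i : (σ → ℤ) → ℚ)) := by
  intro p q h
  refine MvPolynomial.funext fun x ↦ ?_
  have key : ∀ p : MvPolynomial σ ℤ, MvPolynomial.aeval (R := ℤ)
      (fun i : σ ↦ (evalChar i : (σ → ℤ) → ℚ)) p x = (MvPolynomial.eval x p : ℤ) := fun p ↦ by
    induction p using MvPolynomial.induction_on with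
    | C a => simp
    | add p q hp hq => simp [hp, hq]
    | mul_X p i hp =>
      simp only [map_mul, MvPolynomial.aeval_X, Pi.mul_apply, hp, MvPolynomial.eval_X, Int.cast_mul]
      rfl
  have := congrFun h x
  rw [key, key] at this
  exact_mod_cast this

end TestCategory

/-! ### The universal polynomials of special λ-rings. -/

section UniversalPolynomials

open scoped MonoidAlgebra

attribute [local instance] Abelian.hasFiniteBiproducts

lemma HasLines.altCl_eq {C : Type u} [Category.{v} C] [MonoidalCategory C] [SymmetricCategory C]
    [Preadditive C] [Linear ℚ C] [MonoidalPreadditive C] [MonoidalLinear ℚ C]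
    [IsIdempotentComplete C] [HasBinaryBiproducts C] {K : Type*} [CommRing K] {cl : C → K}
    (hcl : TensorInv cl) {X : C} {s : Multiset K} (h : HasLines cl X s) (n : ℕ) :
    altCl cl X n = s.esymm n := by
  obtain ⟨U, hU⟩ := exists_isAlt X n
  rw [altCl, hcl.imgCl_eq hU, (h.alt hcl hU).cl_eq hcl, Multiset.esymm]

lemma exists_family {σ ι : Type} [Fintype ι] (f : ι → σ) : ∃ X : FDRep ℚ (σ → ℤ),
    HasLines (fun V : FDRep ℚ (σ → ℤ) ↦ V.character) X
      ((Finset.univ : Finset ι).val.map fun i ↦ (evalChar (f i) : (σ → ℤ) → ℚ)) := by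
  obtain ⟨X, hX⟩ := exists_hasLines ((Finset.univ : Finset ι).val.map fun i ↦ evalChar (f i))
  rw [Multiset.map_map] at hX
  exact ⟨X, hX⟩

variable {C : Type u} [Category.{v} C] [MonoidalCategory C] [SymmetricCategory C]
  [Preadditive C] [Linear ℚ C] [MonoidalPreadditive C] [MonoidalLinear ℚ C]
  [IsIdempotentComplete C] {K : Type*} [CommRing K] {cl : C → K}

/-- `altCl_tensor` and `exists_aeval` provide one polynomial for all objects of `C` and of the test
category. In the latter, for two sums of `n` lines with independent characters, the formula for the
exterior power of the tensor product is the identity which defines `IsMulPoly`. -/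
theorem TensorInv.exists_isMulPoly (hcl : TensorInv cl) (n : ℕ) : ∃ P, IsMulPoly n P ∧ ∀ X Y,
    altCl cl (X ⊗ Y) n = MvPolynomial.aeval
      (Sum.elim (fun i : Fin n ↦ altCl cl X (i.1 + 1)) fun i : Fin n ↦ altCl cl Y (i.1 + 1)) P := by
  have hcl' := charInv (Fin n ⊕ Fin n → ℤ)
  choose Q hQ hQ' using fun μ : n.Partition ↦ hcl.exists_aeval hcl' (youngIdem_mul_self μ)
  let P : MvPolynomial (Fin n ⊕ Fin n) ℤ := ∑ x : n.Partition × n.Partition,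
    cornerDim (diagAlt n) (boxMul (youngIdem x.1) (youngIdem x.2)) •
      (MvPolynomial.rename Sum.inl (Q x.1) * MvPolynomial.rename Sum.inr (Q x.2))
  refine ⟨P, ?_, fun X Y ↦ ?_⟩
  · obtain ⟨X, hX⟩ := exists_family (Sum.inl : Fin n → Fin n ⊕ Fin n)
    obtain ⟨Y, hY⟩ := exists_family (Sum.inr : Fin n → Fin n ⊕ Fin n)
    have h := hcl'.altCl_tensor X Y n
    rw [(hX.tensor hcl' hY).altCl_eq hcl'] at h
    refine aeval_evalChar_injective _ ?_
    rw [MvPolynomial.comp_aeval_apply, MvPolynomial.comp_aeval_apply,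
      MvPolynomial.aeval_esymm_eq_multiset_esymm]
    refine Eq.trans ?_ (h.symm.trans ?_)
    · simp only [P, map_sum, map_nsmul, map_mul, MvPolynomial.aeval_rename, hQ',
        Function.comp_def, Sum.elim_inl, Sum.elim_inr, MvPolynomial.aeval_esymm_eq_multiset_esymm,
        hX.altCl_eq hcl', hY.altCl_eq hcl']
      congr!
    · have e : ∀ {α β γ δ : Type} (f : α → γ) (g : β → δ) (s : Multiset α) (t : Multiset β),
          s.map f ×ˢ t.map g = (s ×ˢ t).map fun x ↦ (f x.1, g x.2) := fun f g s t ↦ by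
        induction s using Multiset.induction with
        | empty => simp
        | cons a s ih => simp [ih]
      rw [e, Multiset.map_map, ← Finset.univ_product_univ, Finset.product_val]
      simp only [map_mul, MvPolynomial.aeval_X, Function.comp_def]
  · rw [hcl.altCl_tensor]
    simp only [P, map_sum, map_nsmul, map_mul, MvPolynomial.aeval_rename, hQ, Function.comp_def,
      Sum.elim_inl, Sum.elim_inr]

/-- Here a single idempotent `plethIdem n m` of ℚΣ_{mn} is at issue, so `exists_aeval` applies
directly; the polynomial is again recognized on a sum of `m * n` independent lines. -/
theorem TensorInv.exists_isCompPoly (hcl : TensorInv cl) (m n : ℕ) :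
    ∃ P, IsCompPoly m n P ∧ ∀ X S, IsAlt n X S →
      altCl cl S m = MvPolynomial.aeval (fun i : Fin (m * n) ↦ altCl cl X (i.1 + 1)) P := by
  have hcl' := charInv (Fin (m * n) → ℤ)
  obtain ⟨P, hP, hP'⟩ := hcl.exists_aeval hcl' (plethIdem_mul_self n m)
  refine ⟨P, ?_, fun X S hS ↦ ?_⟩
  · obtain ⟨X, hX⟩ := exists_family (id : Fin (m * n) → Fin (m * n))
    obtain ⟨S, hS⟩ := exists_isAlt X n
    obtain ⟨T, hT⟩ := exists_isAlt S m
    have h := hP' X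
    rw [hcl'.imgCl_eq (hS.pleth hT), ← hcl'.imgCl_eq hT] at h
    change altCl _ S m = _ at h
    rw [(hX.alt hcl' hS).altCl_eq hcl'] at h
    refine aeval_evalChar_injective _ ?_
    rw [MvPolynomial.comp_aeval_apply, MvPolynomial.comp_aeval_apply,
      MvPolynomial.aeval_esymm_eq_multiset_esymm]
    refine Eq.trans ?_ (h.symm.trans ?_)
    · simp only [MvPolynomial.aeval_esymm_eq_multiset_esymm, hX.altCl_eq hcl']
      rfl
    · simp only [map_prod, MvPolynomial.aeval_X]
      rw [Finset.univ_eq_attach, Multiset.powersetCard_map, ← Finset.map_val_val_powersetCard,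
        Multiset.map_map, Multiset.map_map, Finset.attach_val]
      congr 1
      exact (Multiset.attach_map_val' _ _).symm
  · obtain ⟨T, hT⟩ := exists_isAlt S m
    rw [altCl, hcl.imgCl_eq hT, ← hcl.imgCl_eq (hS.pleth hT), hP]

end UniversalPolynomials

/-! ### Linear structure, underlying graded objects and idempotents of bounded complexes. -/

namespace BddCx

section Preadditive

variable {A : Type u} [Category.{v} A] [Preadditive A]

instance (X Y : BddCx A) : Zero (X ⟶ Y) := ⟨⟨0, by simp, by simp⟩⟩
instance (X Y : BddCx A) : Add (X ⟶ Y) :=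
  ⟨fun f g ↦ ⟨f.f + g.f, fun n ↦ by simp [f.pr_f, g.pr_f], by simp [f.d_f, g.d_f]⟩⟩
instance (X Y : BddCx A) : Neg (X ⟶ Y) :=
  ⟨fun f ↦ ⟨-f.f, fun n ↦ by simp [f.pr_f], by simp [f.d_f]⟩⟩

@[simp] lemma zero_f (X Y : BddCx A) : (0 : X ⟶ Y).f = 0 := rfl
@[simp] lemma add_f {X Y : BddCx A} (f g : X ⟶ Y) : (f + g).f = f.f + g.f := rfl

instance (X Y : BddCx A) : AddCommGroup (X ⟶ Y) where
  add_assoc f g h := by ext; exact add_assoc _ _ _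
  zero_add f := by ext; exact zero_add _
  add_zero f := by ext; exact add_zero _
  add_comm f g := by ext; exact add_comm _ _
  neg_add_cancel f := by ext; exact neg_add_cancel _
  nsmul := nsmulRec
  zsmul := zsmulRec

instance : Preadditive (BddCx A) where
  add_comp _ _ _ f g h := by ext; exact Preadditive.add_comp _ _ _ _ _ _
  comp_add _ _ _ f g h := by ext; exact Preadditive.comp_add _ _ _ _ _ _

lemma sum_f {X Y : BddCx A} {ι : Type*} (s : Finset ι) (f : ι → (X ⟶ Y)) :
    (∑ i ∈ s, f i).f = ∑ i ∈ s, (f i).f :=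
  map_sum (AddMonoidHom.mk' (fun g : X ⟶ Y ↦ g.f) fun _ _ ↦ rfl) f s

variable [Linear ℚ A]

instance (X Y : BddCx A) : SMul ℚ (X ⟶ Y) :=
  ⟨fun q f ↦ ⟨q • f.f, fun n ↦ by simp [f.pr_f], by simp [f.d_f]⟩⟩

@[simp] lemma smul_f {X Y : BddCx A} (q : ℚ) (f : X ⟶ Y) : (q • f).f = q • f.f := rfl

instance (X Y : BddCx A) : Module ℚ (X ⟶ Y) where
  one_smul f := by ext; exact one_smul _ _
  mul_smul a b f := by ext; exact mul_smul _ _ _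
  smul_zero a := by ext; exact smul_zero _
  smul_add a f g := by ext; exact smul_add _ _ _
  add_smul a b f := by ext; exact add_smul _ _ _
  zero_smul f := by ext; exact zero_smul _ _

instance : Linear ℚ (BddCx A) where
  smul_comp _ _ _ q f g := by ext; exact Linear.smul_comp _ _ _ _ _ _
  comp_smul _ _ _ f q g := by ext; exact Linear.comp_smul _ _ _ _ _ _

end Preadditive

section

variable {A : Type u} [Category.{v} A] [Preadditive A] [MonoidalCategory A] [MonoidalPreadditive A]

instance : MonoidalPreadditive (BddCx A) where
  whiskerLeft_zero := by intros; ext; simp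
  zero_whiskerRight := by intros; ext; simp
  whiskerLeft_add f g := by ext; simp
  add_whiskerRight f g := by ext; simp

instance [Linear ℚ A] [MonoidalLinear ℚ A] : MonoidalLinear ℚ (BddCx A) where
  whiskerLeft_smul X _ _ q f := by ext; simp
  smul_whiskerRight q _ _ f X := by ext; simp

end

section Grading

variable {A : Type u} [Category.{v} A] [Preadditive A]

/-- The object with the same components and zero differential. -/
@[reducible]
def grObj (X : BddCx A) : BddCx A where
  tot := X.tot
  supp := X.supp
  pr := X.pr
  pr_pr := X.pr_pr
  sum_pr := X.sum_pr
  d := 0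
  pr_d := by simp
  d_d := by simp

variable (A) in
/-- The functor which replaces the differential by zero. -/
def gr : BddCx A ⥤ BddCx A where
  obj := grObj
  map f := ⟨f.f, f.pr_f, by simp⟩

instance : (gr A).Additive where

/-- The complex with a single component `M` in degree `n`. -/
@[reducible]
def concObj (n : ℤ) (M : A) : BddCx A where
  tot := M
  supp := {n}
  pr i := if i = n then 𝟙 M else 0
  pr_pr i j := by split_ifs <;> simp_all
  sum_pr := by simp
  d := 0
  pr_d := by simp
  d_d := by simp

variable (A) in
/-- The functor which regards an object as a complex in degree `0`. -/
def conc (n : ℤ) : A ⥤ BddCx A where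
  obj := concObj n
  map f := ⟨f, fun _ ↦ by dsimp; split_ifs <;> simp, by simp⟩

instance (n : ℤ) : (conc A n).Additive where

lemma conc_tensorPr [MonoidalCategory A] [MonoidalPreadditive A] (M N : A) (n : ℤ) :
    tensorPr (concObj 0 M) (concObj 0 N) n = if n = 0 then 𝟙 (M ⊗ N) else 0 := by
  split_ifs with h <;> simp [tensorPr, h, eq_comm]

end Grading

section Monoidal

variable {A : Type u} [Category.{v} A] [Preadditive A] [MonoidalCategory A] [MonoidalPreadditive A]

lemma tensorD_grObj (X Y : BddCx A) : tensorD (grObj X) (grObj Y) = 0 := by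
  simp [tensorD]

/-- The total object and the degrees of a tensor product do not involve the differentials, so
identities serve as structure morphisms. -/
instance : (gr A).Monoidal := Functor.CoreMonoidal.toMonoidal
  { εIso := isoMk (Iso.refl _) (fun n ↦ (Category.comp_id _).trans (Category.id_comp _).symm)
      ((Category.comp_id _).trans (Category.id_comp _).symm)
    μIso X Y := isoMk (Iso.refl _) (fun n ↦ (Category.comp_id _).trans (Category.id_comp _).symm)
      ((Category.comp_id _).trans ((tensorD_grObj X Y).trans (Category.id_comp _).symm))
    μIso_hom_natural_left f X := by
      ext
      exact (Category.comp_id _).trans (Category.id_comp _).symm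
    μIso_hom_natural_right X f := by
      ext
      exact (Category.comp_id _).trans (Category.id_comp _).symm
    associativity X Y Z := by
      ext
      change (𝟙 _ ⊗ₘ 𝟙 _) ≫ 𝟙 _ ≫ (α_ X.tot Y.tot Z.tot).hom =
        (α_ X.tot Y.tot Z.tot).hom ≫ (𝟙 _ ⊗ₘ 𝟙 _) ≫ 𝟙 _
      simp
    left_unitality X := by
      ext
      change (λ_ X.tot).hom = (𝟙 _ ⊗ₘ 𝟙 _) ≫ 𝟙 _ ≫ (λ_ X.tot).hom
      simp
    right_unitality X := by
      ext
      change (ρ_ X.tot).hom = (𝟙 _ ⊗ₘ 𝟙 _) ≫ 𝟙 _ ≫ (ρ_ X.tot).hom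
      simp }

instance : (conc A 0).Monoidal := Functor.CoreMonoidal.toMonoidal
  { εIso := isoMk (Iso.refl _) (fun n ↦ (Category.comp_id _).trans (Category.id_comp _).symm)
      ((Category.comp_id _).trans (Category.id_comp _).symm)
    μIso X Y := isoMk (Iso.refl _)
      (fun n ↦ (Category.comp_id _).trans ((conc_tensorPr X Y n).trans (Category.id_comp _).symm))
      ((Category.comp_id _).trans ((tensorD_grObj (concObj 0 X) (concObj 0 Y)).trans
        (Category.id_comp _).symm))
    μIso_hom_natural_left f X := by
      ext
      change (f ⊗ₘ 𝟙 _) ≫ 𝟙 _ = 𝟙 _ ≫ f ▷ X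
      simp
    μIso_hom_natural_right X f := by
      ext
      change (𝟙 _ ⊗ₘ f) ≫ 𝟙 _ = 𝟙 _ ≫ X ◁ f
      simp
    associativity X Y Z := by
      ext
      change (𝟙 _ ⊗ₘ 𝟙 _) ≫ 𝟙 _ ≫ (α_ X Y Z).hom =
        (α_ X Y Z).hom ≫ (𝟙 _ ⊗ₘ 𝟙 _) ≫ 𝟙 _
      simp
    left_unitality X := by
      ext
      change (λ_ X).hom = (𝟙 _ ⊗ₘ 𝟙 _) ≫ 𝟙 _ ≫ (λ_ X).hom
      simp
    right_unitality X := by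
      ext
      change (ρ_ X).hom = (𝟙 _ ⊗ₘ 𝟙 _) ≫ 𝟙 _ ≫ (ρ_ X).hom
      simp }

variable [SymmetricCategory A]

/-- Koszul signs depend only on the degrees, which `gr` keeps. -/
instance : (gr A).Braided where
  braided X Y := by
    ext
    exact (Category.id_comp _).trans (Category.comp_id _).symm

instance : (conc A 0).Braided where
  braided X Y := by
    ext
    refine (Category.id_comp _).trans (Eq.trans ?_ (Category.comp_id _).symm)
    change (β_ X Y).hom = braidHom (concObj 0 X) (concObj 0 Y)
    simp [braidHom]

end Monoidal

section Idempotents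

variable {A : Type u} [Category.{v} A] [Preadditive A]

/-- The complex structure induced on the image of an idempotent. -/
def retract (X : BddCx A) {T : A} (i : T ⟶ X.tot) (p : X.tot ⟶ T) (h : i ≫ p = 𝟙 T)
    (h₁ : ∀ n, X.pr n ≫ p ≫ i = (p ≫ i) ≫ X.pr n) (h₂ : X.d ≫ p ≫ i = (p ≫ i) ≫ X.d) :
    BddCx A where
  tot := T
  supp := X.supp
  pr n := i ≫ X.pr n ≫ p
  pr_pr m n := by
    simp only [Category.assoc] at h₁ ⊢
    rw [← reassoc_of% h₁, h, Category.comp_id, pr_pr_assoc]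
    split_ifs <;> simp
  sum_pr := by
    rw [← Preadditive.comp_sum, ← Preadditive.sum_comp, X.sum_pr, Category.id_comp, h]
  d := i ≫ X.d ≫ p
  pr_d n := by
    simp only [Category.assoc] at h₁ h₂ ⊢
    rw [← reassoc_of% h₂, ← reassoc_of% h₁, h, Category.comp_id, pr_d_assoc]
  d_d := by
    simp only [Category.assoc] at h₂ ⊢
    rw [← reassoc_of% h₂, h, Category.comp_id, d_d_assoc, comp_zero]

/-- The idempotent is split on the total object; the image inherits the projectors and the
differential because they commute with the idempotent. -/
instance [IsIdempotentComplete A] : IsIdempotentComplete (BddCx A) where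
  idempotents_split X θ hθ := by
    obtain ⟨T, i, p, h, h'⟩ := IsIdempotentComplete.idempotents_split X.tot θ.f (congrArg Hom.f hθ)
    have h₁ : ∀ n, X.pr n ≫ p ≫ i = (p ≫ i) ≫ X.pr n := fun n ↦ by rw [h', θ.pr_f]
    have h₂ : X.d ≫ p ≫ i = (p ≫ i) ≫ X.d := by rw [h', θ.d_f]
    refine ⟨X.retract i p h h₁ h₂, ⟨i, fun n ↦ ?_, ?_⟩, ⟨p, fun n ↦ ?_, ?_⟩, hom_ext h, hom_ext h'⟩
    · simp only [retract, Category.assoc, h₁]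
      rw [reassoc_of% h]
    · simp only [retract, Category.assoc, h₂]
      rw [reassoc_of% h]
    · simp only [retract]
      rw [← reassoc_of% (h₁ n), h, Category.comp_id]
    · simp only [retract]
      rw [← reassoc_of% h₂, h, Category.comp_id]

end Idempotents

end BddCx

/-! ### Finite direct sums. -/

section SumsInduction

variable {C : Type u} [Category.{v} C] [Preadditive C]

lemma IsSum.id_eq_zero {J : Type} [Fintype J] [IsEmpty J] {T : J → C} {S : C} (h : IsSum T S) :
    𝟙 S = 0 := by
  obtain ⟨i, p, -, -, h⟩ := h
  rw [← h]
  simp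

lemma IsSum.reindex {J J' : Type} [Fintype J] [Fintype J'] (e : J' ≃ J) {T : J → C} {S : C}
    (h : IsSum T S) : IsSum (fun j ↦ T (e j)) S := by
  obtain ⟨i, p, h₁, h₂, h₃⟩ := h
  exact ⟨fun j ↦ i (e j), fun j ↦ p (e j), fun j ↦ h₁ _, fun j k h ↦ h₂ _ _ (e.injective.ne h),
    (Equiv.sum_comp e fun j ↦ p j ≫ i j).trans h₃⟩

/-- A finite direct sum is the direct sum of one summand and of the others. -/
lemma IsSum.exists_option [IsIdempotentComplete C] {J : Type} [Fintype J] {T : Option J → C}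
    {S : C} (h : IsSum T S) :
    ∃ S', IsSum (fun j ↦ T (some j)) S' ∧ Nonempty (SumData (T none) S' S) := by
  obtain ⟨i, p, h₁, h₂, h₃⟩ := h
  rw [Fintype.sum_option] at h₃
  set θ := ∑ j, p (some j) ≫ i (some j) with hθ
  have hi : i none ≫ θ = 0 := by
    rw [hθ, Preadditive.comp_sum]
    exact Finset.sum_eq_zero fun j _ ↦ by rw [← Category.assoc, h₂ _ _ (by simp), zero_comp]
  have hp : θ ≫ p none = 0 := by
    rw [hθ, Preadditive.sum_comp]
    exact Finset.sum_eq_zero fun j _ ↦ by rw [Category.assoc, h₂ _ _ (by simp), comp_zero]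
  have hθi : ∀ j, i (some j) ≫ θ = i (some j) := fun j ↦ by
    have := congr(i (some j) ≫ $h₃)
    rwa [Preadditive.comp_add, ← Category.assoc, h₂ _ _ (by simp), zero_comp, zero_add,
      Category.comp_id] at this
  have hθp : ∀ j, θ ≫ p (some j) = p (some j) := fun j ↦ by
    have := congr($h₃ ≫ p (some j))
    rwa [Preadditive.add_comp, Category.assoc, h₂ _ _ (by simp), comp_zero, zero_add,
      Category.id_comp] at this
  have hθθ : θ ≫ θ = θ := by
    have := congr(θ ≫ $h₃)
    rwa [Preadditive.comp_add, ← Category.assoc, hp, zero_comp, zero_add,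
      Category.comp_id] at this
  obtain ⟨S', a, b, hab, hba⟩ := exists_isIdemImage hθθ
  refine ⟨S', ⟨fun j ↦ i (some j) ≫ b, fun j ↦ a ≫ p (some j), fun j ↦ ?_, fun j k hjk ↦ ?_, ?_⟩,
    ⟨⟨i none, a, p none, b, h₁ _, hab, ?_, ?_, ?_⟩⟩⟩
  · rw [Category.assoc, reassoc_of% hba, hθp, h₁]
  · rw [Category.assoc, reassoc_of% hba, hθp, h₂ _ _ (by simpa using hjk)]
  · have : ∑ j, (a ≫ p (some j)) ≫ i (some j) ≫ b = a ≫ θ ≫ b := by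
      simp only [hθ, Preadditive.sum_comp, Preadditive.comp_sum, Category.assoc]
    rw [this, ← hba, Category.assoc, hab, Category.comp_id, hab]
  · rw [← Category.comp_id b, ← hab, reassoc_of% hba, reassoc_of% hi, zero_comp]
  · rw [← Category.id_comp a, ← hab, Category.assoc, Category.assoc, reassoc_of% hba, hp, comp_zero]
  · rw [hba, h₃]

/-- An invariant which is additive for direct sums of two objects is additive for finite direct
sums. -/
lemma IsSum.cl_eq [IsIdempotentComplete C] {K : Type*} [AddCommGroup K] {cl : C → K}
    (hcl : ∀ {X Y Z : C}, SumData X Y Z → cl Z = cl X + cl Y) {J : Type} [Fintype J] :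
    ∀ {T : J → C} {S : C}, IsSum T S → cl S = ∑ j, cl (T j) := by
  refine Fintype.induction_empty_option (P := fun J [Fintype J] ↦ ∀ {T : J → C} {S : C},
    IsSum T S → cl S = ∑ j, cl (T j)) ?_ ?_ ?_ J
  · intro J J' _ e h T S hS
    let _ := Fintype.ofEquiv J' e.symm
    have h' := h (IsSum.reindex e hS)
    rw [h']
    exact Fintype.sum_equiv e _ _ fun _ ↦ rfl
  · intro T S hS
    have h₀ := hS.id_eq_zero
    have := hcl (⟨0, 0, 0, 0, by simp [h₀], by simp [h₀], by simp, by simp, by simp [h₀]⟩ :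
      SumData S S S)
    rw [left_eq_add] at this
    simpa using this
  · intro J _ h T S hS
    obtain ⟨S', h', ⟨d⟩⟩ := hS.exists_option
    rw [hcl d, h h', Fintype.sum_option]

end SumsInduction

namespace BddCx

variable {A : Type u} [Category.{v} A] [Abelian A]

/-- The direct sum of the components. -/
lemma isSum_gr (X : BddCx A) :
    IsSum (fun n : X.supp ↦ (conc A n).obj (X.deg n)) ((gr A).obj X) := by
  refine ⟨fun n ↦ ⟨X.inc n, fun k ↦ ?_, ?_⟩, fun n ↦ ⟨X.proj n, fun k ↦ ?_, ?_⟩, fun n ↦ ?_,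
    fun n m h ↦ ?_, ?_⟩
  · change (if k = n.1 then 𝟙 _ else 0) ≫ X.inc n = X.inc n ≫ X.pr k
    split_ifs with h
    · rw [h, inc_pr, Category.id_comp]
    · rw [← X.inc_pr, Category.assoc, X.pr_pr, if_neg (Ne.symm h), zero_comp, comp_zero]
  · exact zero_comp.trans comp_zero.symm
  · change X.pr k ≫ X.proj n = X.proj n ≫ (if k = n.1 then 𝟙 _ else 0)
    split_ifs with h
    · rw [h, pr_proj, Category.comp_id]
    · rw [← X.pr_proj, ← Category.assoc, X.pr_pr, if_neg h, zero_comp, comp_zero]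
  · exact zero_comp.trans comp_zero.symm
  · ext
    exact X.inc_proj n
  · ext
    exact X.inc_proj_of_ne (fun h' ↦ h (Subtype.ext h'))
  · ext
    rw [sum_f, Finset.univ_eq_attach]
    change ∑ j ∈ X.supp.attach, X.proj j ≫ X.inc j = 𝟙 X.tot
    simp only [proj_inc]
    rw [Finset.sum_attach X.supp X.pr, X.sum_pr]

end BddCx

/-! ### Classes of bounded complexes in the derived category. -/

section ToDerived

open DerivedCategory Pretriangulated ZeroObject

variable (A : Type u) [Category.{v} A] [Abelian A] [HasDerivedCategory.{w} A]

lemma toDbι_naturality {X Y : BddCx A} (f : X ⟶ Y) :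
    Q.map (BddCx.toCxMap f) ≫ (toDbι A Y).hom = (toDbι A X).hom ≫ Bounded.ι.map ((toDb A).map f) :=
  quotientCompQhIso_inv_naturality _

instance : (toDb A).Additive where
  map_add {X Y f g} := by
    apply (Bounded.ι (C := A)).map_injective
    rw [(Bounded.ι (C := A)).map_add, ← cancel_epi (toDbι A X).hom, Preadditive.comp_add,
      ← toDbι_naturality,
      ← toDbι_naturality, ← toDbι_naturality, ← Preadditive.add_comp, ← Q.map_add]
    congr 2
    ext n
    change X.inc n ≫ (f.f + g.f) ≫ Y.proj n = X.inc n ≫ f.f ≫ Y.proj n + X.inc n ≫ g.f ≫ Y.proj n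
    simp

instance : (toDb A).EssSurj := Localization.essSurj (toDb A) (BddCx.qis A)

variable {A}

/-- The class of a bounded complex in the Grothendieck group of the derived category. -/
noncomputable def clD (X : BddCx A) : K0 (triRel (D := DerivedCategory.Bounded A)) :=
  K0.cl triRel ((toDb A).obj X)

lemma clD_shortExact {X Z Y : BddCx A} (f : X ⟶ Z) (g : Z ⟶ Y) (w : f.f ≫ g.f = 0)
    (h : (BddCx.tsc f g w).ShortExact) : clD Z = clD X + clD Y :=
  K0.cl_eq (triRel_of_shortExact A f g w h)

lemma clD_sumData {X Y Z : BddCx A} (d : SumData X Y Z) : clD Z = clD X + clD Y := by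
  have w := congrArg BddCx.Hom.f d.inl_snd
  refine clD_shortExact d.inl d.snd w (ShortComplex.Splitting.shortExact
    ⟨d.fst.f, d.inr.f, congrArg BddCx.Hom.f d.inl_fst, congrArg BddCx.Hom.f d.inr_snd,
      congrArg BddCx.Hom.f d.total⟩)

/-- The class of a complex does not depend on the differential. -/
lemma clD_gr (X : BddCx A) : clD ((BddCx.gr A).obj X) = clD X := by
  have hk : ∀ n, kernel.ι X.d ≫ X.pr n ≫ X.d = 0 := fun n ↦ by
    rw [X.pr_d, kernel.condition_assoc, zero_comp]
  -- The cycles `Z` and the quotient `B` by them are complexes with zero differential, since `X.d`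
  -- kills cycles and its image consists of cycles. So the same `Z` and `B` fit into short exact
  -- sequences around `X` and around `gr X`.
  let Z : BddCx A :=
    { tot := kernel X.d
      supp := X.supp
      pr n := kernel.lift X.d (kernel.ι X.d ≫ X.pr n) (by rw [Category.assoc, hk])
      pr_pr i j := by
        rw [← cancel_mono (kernel.ι X.d)]
        simp only [Category.assoc, kernel.lift_ι, kernel.lift_ι_assoc, X.pr_pr]
        split_ifs <;> simp
      sum_pr := by
        rw [← cancel_mono (kernel.ι X.d), Preadditive.sum_comp]
        simp only [kernel.lift_ι]
        rw [← Preadditive.comp_sum, X.sum_pr, Category.comp_id, Category.id_comp]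
      d := 0
      pr_d := by simp
      d_d := by simp }
  have hc : ∀ n, kernel.ι X.d ≫ X.pr n ≫ cokernel.π (kernel.ι X.d) = 0 := fun n ↦ by
    have h := (kernel.lift_ι X.d (kernel.ι X.d ≫ X.pr n) (by rw [Category.assoc, hk]))
    rw [← Category.assoc, ← h, Category.assoc, cokernel.condition, comp_zero]
  let B : BddCx A :=
    { tot := cokernel (kernel.ι X.d)
      supp := X.supp
      pr n := cokernel.desc _ (X.pr n ≫ cokernel.π (kernel.ι X.d)) (hc n)
      pr_pr i j := by
        rw [← cancel_epi (cokernel.π (kernel.ι X.d))]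
        simp only [cokernel.π_desc, cokernel.π_desc_assoc, Category.assoc, X.pr_pr_assoc]
        split_ifs <;> simp
      sum_pr := by
        rw [← cancel_epi (cokernel.π (kernel.ι X.d)), Preadditive.comp_sum]
        simp only [cokernel.π_desc]
        rw [← Preadditive.sum_comp, X.sum_pr, Category.comp_id, Category.id_comp]
      d := 0
      pr_d := by simp
      d_d := by simp }
  have hd : X.d ≫ cokernel.π (kernel.ι X.d) = 0 := by
    have h : (kernel.lift X.d X.d X.d_d ≫ kernel.ι X.d) ≫ cokernel.π (kernel.ι X.d) = 0 := by simp
    rwa [kernel.lift_ι] at h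
  let f : Z ⟶ X := ⟨kernel.ι X.d, fun n ↦ kernel.lift_ι _ _ _,
    zero_comp.trans (kernel.condition _).symm⟩
  let f' : Z ⟶ (BddCx.gr A).obj X := ⟨kernel.ι X.d, fun n ↦ kernel.lift_ι _ _ _,
    zero_comp.trans comp_zero.symm⟩
  let g : X ⟶ B := ⟨cokernel.π (kernel.ι X.d), fun n ↦ (cokernel.π_desc _ _ _).symm,
    hd.trans comp_zero.symm⟩
  let g' : (BddCx.gr A).obj X ⟶ B := ⟨cokernel.π (kernel.ι X.d),
    fun n ↦ (cokernel.π_desc _ _ _).symm, zero_comp.trans comp_zero.symm⟩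
  have h : (ShortComplex.mk (kernel.ι X.d) _ (cokernel.condition (kernel.ι X.d))).ShortExact :=
    { exact := ShortComplex.exact_cokernel _
      mono_f := inferInstanceAs (Mono (kernel.ι X.d))
      epi_g := inferInstanceAs (Epi (cokernel.π (kernel.ι X.d))) }
  rw [clD_shortExact f g (cokernel.condition _) h, clD_shortExact f' g' (cokernel.condition _) h]

lemma clD_zero {X : BddCx A} (h : 𝟙 X = 0) : clD X = 0 := by
  have := clD_sumData (⟨0, 0, 0, 0, by simp [h], by simp [h], by simp, by simp, by simp [h]⟩ :
    SumData X X X)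
  rwa [left_eq_add] at this

lemma clD_isSum {J : Type} [Fintype J] {T : J → BddCx A} {S : BddCx A} (h : IsSum T S) :
    clD S = ∑ j, clD (T j) := h.cl_eq clD_sumData

lemma exists_iso_single (n : ℤ) (M : A) :
    Nonempty (Bounded.ι.obj ((toDb A).obj ((BddCx.conc A n).obj M)) ≅
      (singleFunctor A n).obj M) := by
  let X := (BddCx.conc A n).obj M
  have hX : ∀ k, k ≠ n → IsZero (X.deg k) := fun k hk ↦ X.isZero_deg (if_neg hk)
  have h₁ : X.toCx.IsStrictlyGE n := by
    rw [CochainComplex.isStrictlyGE_iff]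
    exact fun i hi ↦ hX i hi.ne
  have h₂ : X.toCx.IsStrictlyLE n := by
    rw [CochainComplex.isStrictlyLE_iff]
    exact fun i hi ↦ hX i hi.ne'
  obtain ⟨N, ⟨e⟩⟩ := X.toCx.exists_iso_single n
  have hp : X.pr n = 𝟙 _ := if_pos rfl
  let e₁ : M ≅ X.deg n := ⟨X.proj n, X.inc n, (X.proj_inc n).trans hp, X.inc_proj n⟩
  let e₂ : M ≅ N := e₁ ≪≫ (HomologicalComplex.eval _ _ n).mapIso e ≪≫
    HomologicalComplex.singleObjXSelf (.up ℤ) n N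
  exact ⟨(toDbι A X).symm ≪≫ Q.mapIso (e ≪≫ (HomologicalComplex.single _ _ n).mapIso e₂.symm)⟩

lemma cl_zero_bounded {Z : DerivedCategory.Bounded A} (h : IsZero Z) : K0.cl triRel Z = 0 := by
  have := K0.cl_eq (T := triRel (D := DerivedCategory.Bounded A)) (X := Z) (Z := Z) (Y := 0)
    ⟨_, _, _, contractible_distinguished Z⟩
  have h' := K0.cl_eq (T := triRel (D := DerivedCategory.Bounded A)) (X := Z) (Z := 0) (Y := 0)
    ⟨0, 0, 0, isomorphic_distinguished _ (contractible_distinguished Z) _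
      (Triangle.isoMk _ _ (Iso.refl _) ((isZero_zero _).iso h) (Iso.refl _)
        (h.eq_of_src _ _) ((isZero_zero _).eq_of_src _ _) ((isZero_zero _).eq_of_src _ _))⟩
  rw [left_eq_add] at this
  rw [this, add_zero] at h'
  exact h'.symm

/-- The rotated trivial triangle of `M` in degree `n + 1` has zero in the middle and ends with the
shift, which is `M` in degree `n`. -/
lemma clD_conc_succ (n : ℤ) (M : A) :
    clD ((BddCx.conc A n).obj M) = -clD ((BddCx.conc A (n + 1)).obj M) := by
  obtain ⟨e⟩ := exists_iso_single n M
  obtain ⟨e'⟩ := exists_iso_single (n + 1) M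
  have hT := rot_of_distTriang _ (contractible_distinguished ((singleFunctor A (n + 1)).obj M))
  have h₀ : IsZero (Bounded.ι.obj (0 : DerivedCategory.Bounded A)) :=
    (Bounded.ι (C := A)).map_isZero (isZero_zero _)
  have := K0.cl_eq (triRel_of_iso A hT e'.symm ((isZero_zero _).iso h₀)
    (((singleFunctors A).shiftIso 1 n (n + 1) (add_comm _ _)).app M ≪≫ e.symm))
  rw [cl_zero_bounded (isZero_zero _)] at this
  exact eq_neg_of_add_eq_zero_right this.symm

lemma clD_conc (n : ℤ) (M : A) : clD ((BddCx.conc A n).obj M) =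
    n.negOnePow • clD ((BddCx.conc A 0).obj M) := by
  induction n with
  | zero => simp
  | succ n h =>
    rw [clD_conc_succ] at h
    rw [Int.negOnePow_succ, Units.neg_smul, ← h, neg_neg]
  | pred n h =>
    rw [clD_conc_succ, sub_add_cancel, h, Int.negOnePow_sub]
    simp

lemma cl_iso_bounded {V W : DerivedCategory.Bounded A} (e : V ≅ W) :
    K0.cl triRel V = K0.cl triRel W := by
  have := K0.cl_eq (T := triRel) (X := V) (Z := W) (Y := 0)
    ⟨_, _, _, isomorphic_distinguished _ (contractible_distinguished W)
      (Triangle.mk e.hom 0 0) (Triangle.isoMk _ _ e (Iso.refl _) (Iso.refl _)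
        rfl (zero_comp.trans comp_zero.symm) (zero_comp.trans comp_zero.symm))⟩
  rw [cl_zero_bounded (isZero_zero _), add_zero] at this
  exact this.symm

/-- Negatives are realized by shifts and sums by direct sums. So an identity for all elements of the
Grothendieck ring need only be checked on classes of complexes, which is how the axioms of a special
λ-ring come down to objects. -/
lemma exists_clD_eq (x : K0 (triRel (D := DerivedCategory.Bounded A))) : ∃ X, clD X = x := by
  have key (V : DerivedCategory.Bounded A) : ∃ X : BddCx A, clD X = K0.cl triRel V :=
    ⟨_, cl_iso_bounded ((toDb A).objObjPreimageIso V)⟩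
  induction x using K0.induction with
  | h₁ V => exact key V
  | h₂ =>
    obtain ⟨X, hX⟩ := key 0
    exact ⟨X, hX.trans (cl_zero_bounded (isZero_zero _))⟩
  | h₃ x h =>
    obtain ⟨X, rfl⟩ := h
    obtain ⟨Y, hY⟩ := key (((toDb A).obj X)⟦(1 : ℤ)⟧)
    refine ⟨Y, ?_⟩
    have := K0.cl_eq (T := triRel) (X := (toDb A).obj X) (Z := 0) (Y := ((toDb A).obj X)⟦(1 : ℤ)⟧)
      ⟨_, _, _, rot_of_distTriang _ (contractible_distinguished ((toDb A).obj X))⟩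
    rw [cl_zero_bounded (isZero_zero _)] at this
    rw [hY]
    exact eq_neg_of_add_eq_zero_right this.symm
  | h₄ x y h h' =>
    obtain ⟨X, rfl⟩ := h
    obtain ⟨Y, rfl⟩ := h'
    obtain ⟨Z, hZ⟩ := key ((toDb A).obj X ⊞ (toDb A).obj Y)
    refine ⟨Z, hZ.trans ?_⟩
    exact K0.cl_eq ⟨_, _, _, binaryBiproductTriangle_distinguished _ _⟩

end ToDerived

/-! ### Euler characteristics and the comparison of Grothendieck groups. -/

section EulerCharacteristic

open ZeroObject

variable {A : Type u} [Category.{v} A] [Abelian A]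

lemma sesRel.cl_eq_add {X Y : A} (f : X ⟶ Y) [Epi f] :
    K0.cl (sesRel A) X = K0.cl (sesRel A) (kernel f) + K0.cl (sesRel A) Y :=
  K0.cl_eq ⟨_, f, kernel.condition f,
    { exact := ShortComplex.exact_kernel f
      mono_f := inferInstanceAs (Mono (kernel.ι f))
      epi_g := inferInstanceAs (Epi f) }⟩

lemma sesRel.cl_zero {X : A} (h : IsZero X) : K0.cl (sesRel A) X = 0 := by
  have h₀ := K0.cl_eq (T := sesRel A) (X := X) (Z := X) (Y := X)
    ⟨0, 0, comp_zero, { exact := ShortComplex.exact_of_isZero_X₂ _ h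
                        mono_f := ⟨fun _ _ _ ↦ h.eq_of_tgt _ _⟩
                        epi_g := ⟨fun _ _ _ ↦ h.eq_of_src _ _⟩ }⟩
  rwa [left_eq_add] at h₀

lemma sesRel.cl_iso {X Y : A} (e : X ≅ Y) : K0.cl (sesRel A) X = K0.cl (sesRel A) Y := by
  rw [sesRel.cl_eq_add e.hom, sesRel.cl_zero (isZero_kernel_of_mono e.hom), zero_add]

variable (K : CochainComplex A ℤ)

lemma cl_cycles (n : ℤ) : K0.cl (sesRel A) (K.cycles n) =
    K0.cl (sesRel A) (kernel (K.homologyπ n)) + K0.cl (sesRel A) (K.homology n) :=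
  sesRel.cl_eq_add _

/-- The kernel of `homologyπ (n + 1)` is the object of boundaries, onto which the differential maps
`K.X n` with the cycles as kernel. -/
lemma cl_component (n : ℤ) : K0.cl (sesRel A) (K.X n) =
    K0.cl (sesRel A) (K.cycles n) + K0.cl (sesRel A) (kernel (K.homologyπ (n + 1))) := by
  have h₁ : K.toCycles n (n + 1) ≫ K.homologyπ (n + 1) = 0 := K.toCycles_comp_homologyπ _ _
  let k := kernel.lift (K.homologyπ (n + 1)) (K.toCycles n (n + 1)) h₁
  have hex : (ShortComplex.mk (K.toCycles n (n + 1)) (K.homologyπ (n + 1)) h₁).Exact :=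
    ShortComplex.exact_of_g_is_cokernel _ (K.homologyIsCokernel n (n + 1) (by simp))
  have : Epi k := hex.epi_kernelLift
  have hk : k ≫ kernel.ι _ ≫ K.iCycles (n + 1) = K.d n (n + 1) := by simp [k]
  have hz : K.iCycles n ≫ k = 0 := by
    rw [← cancel_mono (kernel.ι _ ≫ K.iCycles (n + 1)), Category.assoc, hk]
    simp
  refine K0.cl_eq ⟨K.iCycles n, k, hz, ⟨?_⟩⟩
  refine ShortComplex.exact_of_f_is_kernel _ ?_
  refine Limits.KernelFork.IsLimit.ofι _ _ (fun g hg ↦ K.liftCycles g (n + 1) (by simp)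
    (by rw [← hk, reassoc_of% hg, zero_comp])) (fun g hg ↦ by simp) (fun g hg m hm ↦ by
      rw [← cancel_mono (K.iCycles n), hm]; simp)

/-- The Euler characteristic of a bounded complex is that of its homology. -/
lemma finsum_cl_homology (hK : BddLoc.bdd A K) :
    ∑ᶠ n : ℤ, n.negOnePow • K0.cl (sesRel A) (K.homology n) =
      ∑ᶠ n : ℤ, n.negOnePow • K0.cl (sesRel A) (K.X n) := by
  obtain ⟨⟨a, ha⟩, b, hb⟩ := hK
  have hX : ∀ n, n ∉ Set.Icc a b → IsZero (K.X n) := fun n hn ↦ by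
    by_cases h : n < a
    · exact K.isZero_of_isStrictlyGE a n h
    · exact K.isZero_of_isStrictlyLE b n (by simp at hn; lia)
  have hZ : ∀ n, n ∉ Set.Icc a b → IsZero (K.cycles n) := fun n hn ↦
    (hX n hn).of_mono (K.iCycles n)
  have hB : ∀ n, n ∉ Set.Icc a b → IsZero (kernel (K.homologyπ n)) := fun n hn ↦
    (hZ n hn).of_mono (kernel.ι _)
  have hH : ∀ n, n ∉ Set.Icc a b → IsZero (K.homology n) := fun n hn ↦
    (hZ n hn).of_epi (K.homologyπ n)
  let b' := fun n : ℤ ↦ n.negOnePow • K0.cl (sesRel A) (kernel (K.homologyπ n))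
  have fin {F : ℤ → A} (hF : ∀ n, n ∉ Set.Icc a b → IsZero (F n)) :
      (Function.support fun n : ℤ ↦ n.negOnePow • K0.cl (sesRel A) (F n)).Finite :=
    (Set.finite_Icc a b).subset fun n hn ↦ by
      by_contra h
      exact hn (by simp [sesRel.cl_zero (hF n h)])
  have hb' : (Function.support fun n : ℤ ↦ b' (n + 1)).Finite :=
    (fin hB).preimage (add_left_injective (1 : ℤ)).injOn
  -- The boundaries enter twice, in neighbouring degrees with opposite signs, and telescope.
  have h : (fun n : ℤ ↦ n.negOnePow • K0.cl (sesRel A) (K.X n)) = fun n ↦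
      (b' n + n.negOnePow • K0.cl (sesRel A) (K.homology n)) - b' (n + 1) := by
    funext n
    rw [cl_component, cl_cycles]
    simp only [b', Int.negOnePow_succ, Units.neg_smul, smul_add]
    abel
  rw [h, finsum_sub_distrib _ hb', finsum_add_distrib (fin hB) (fin hH),
    show ∑ᶠ n, b' (n + 1) = ∑ᶠ n, b' n from finsum_comp_equiv (Equiv.addRight (1 : ℤ))]
  · exact (add_sub_cancel_left _ _).symm
  · exact ((fin hB).union (fin hH)).subset (Function.support_add _ _)

end EulerCharacteristic

section EulerHom

open DerivedCategory Pretriangulated ZeroObject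

variable {A : Type u} [Category.{v} A] [Abelian A] [HasDerivedCategory.{w} A]

/-- The Euler characteristic. -/
noncomputable def eulerChar (V : DerivedCategory.Bounded A) : K0 (sesRel A) :=
  ∑ᶠ n : ℤ, n.negOnePow • K0.cl (sesRel A) ((homologyFunctor A n).obj (Bounded.ι.obj V))

lemma eulerChar_iso {V W : DerivedCategory.Bounded A} (e : V ≅ W) : eulerChar V = eulerChar W :=
  finsum_congr fun n ↦ congrArg _ (sesRel.cl_iso ((homologyFunctor A n).mapIso
    (Bounded.ι.mapIso e)))

lemma eulerChar_toDb (X : BddCx A) : eulerChar ((toDb A).obj X) =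
    ∑ n ∈ X.supp, n.negOnePow • K0.cl (sesRel A) (X.deg n) := by
  rw [← finsum_eq_sum_of_support_subset]
  · refine Eq.trans ?_ (finsum_cl_homology X.toCx X.toCx_bdd)
    exact finsum_congr fun n ↦ congrArg _ (sesRel.cl_iso ((homologyFunctor A n).mapIso
      (toDbι A X).symm ≪≫ (homologyFunctorFactors A n).app X.toCx))
  · intro n hn
    by_contra h
    exact hn (by simp [sesRel.cl_zero (X.isZero_deg (X.pr_eq_zero h))])

/-- The definition by cohomology makes `eulerChar` invariant under isomorphisms; additivity is seen
on components, after the triangle is replaced by a short exact sequence of complexes. -/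
lemma eulerChar_triRel {X Z Y : DerivedCategory.Bounded A} (h : triRel X Z Y) :
    eulerChar Z = eulerChar X + eulerChar Y := by
  obtain ⟨X', Z', Y', f, g, w, hS, ⟨eX⟩, ⟨eZ⟩, ⟨eY⟩⟩ := exists_shortExact A h
  have sub (W : BddCx A) {s : Finset ℤ} (hs : W.supp ⊆ s) : eulerChar ((toDb A).obj W) =
      ∑ n ∈ s, n.negOnePow • K0.cl (sesRel A) (W.deg n) := by
    rw [eulerChar_toDb]
    exact Finset.sum_subset hs fun n _ hn ↦ by
      simp [sesRel.cl_zero (W.isZero_deg (W.pr_eq_zero hn))]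
  rw [← eulerChar_iso eX, ← eulerChar_iso eZ, ← eulerChar_iso eY,
    sub X' (s := X'.supp ∪ Z'.supp ∪ Y'.supp) (by grind),
    sub Z' (s := X'.supp ∪ Z'.supp ∪ Y'.supp) (by grind),
    sub Y' (s := X'.supp ∪ Z'.supp ∪ Y'.supp) (by grind), ← Finset.sum_add_distrib]
  refine Finset.sum_congr rfl fun n _ ↦ ?_
  rw [← smul_add, K0.cl_eq ⟨_, _, _, BddCx.dsc_shortExact f g w n hS⟩]

/-- The Euler characteristic on the Grothendieck group. -/
noncomputable def eulerHom : K0 (triRel (D := DerivedCategory.Bounded A)) →+ K0 (sesRel A) :=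
  K0.lift eulerChar fun _ _ _ h ↦ eulerChar_triRel h

/-- The homomorphism induced by the inclusion of complexes concentrated in degree `0`. -/
noncomputable def concHom : K0 (sesRel A) →+ K0 (triRel (D := DerivedCategory.Bounded A)) :=
  K0.lift (fun M ↦ clD ((BddCx.conc A 0).obj M)) fun _ _ _ ⟨f, g, w, h⟩ ↦
    clD_shortExact ((BddCx.conc A 0).map f) ((BddCx.conc A 0).map g) w h

lemma concHom_cl (M : A) : concHom (K0.cl (sesRel A) M) = clD ((BddCx.conc A 0).obj M) :=
  K0.lift_cl _ _ _

lemma eulerHom_concHom (x : K0 (sesRel A)) : eulerHom (concHom x) = x := by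
  induction x using K0.induction with
  | h₁ M =>
    rw [concHom_cl]
    refine (K0.lift_cl _ _ _).trans ((eulerChar_toDb _).trans ?_)
    let X := (BddCx.conc A 0).obj M
    have hp : X.pr 0 = 𝟙 _ := if_pos (c := (0 : ℤ) = 0) (e := 0) rfl
    change ∑ n ∈ {0}, n.negOnePow • K0.cl (sesRel A) (X.deg n) = _
    rw [Finset.sum_singleton, Int.negOnePow_zero, one_smul]
    exact sesRel.cl_iso ⟨X.inc 0, X.proj 0, X.inc_proj 0, (X.proj_inc 0).trans hp⟩
  | h₂ => simp
  | h₃ x h => rw [map_neg, map_neg, h]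
  | h₄ x y h h' => rw [map_add, map_add, h, h']

/-- A complex has the class of its `gr`, which is the direct sum of its components; a component in
degree `n` has, up to the sign of `n`, the class of the same object in degree `0`. -/
lemma concHom_surjective : Function.Surjective (concHom (A := A)) := by
  intro x
  obtain ⟨X, rfl⟩ := exists_clD_eq x
  refine ⟨∑ n : X.supp, n.1.negOnePow • K0.cl (sesRel A) (X.deg n), ?_⟩
  rw [← clD_gr, clD_isSum X.isSum_gr, map_sum]
  refine Finset.sum_congr rfl fun n _ ↦ ?_
  rw [clD_conc, ← concHom_cl]
  rcases Int.units_eq_one_or n.1.negOnePow with h | h <;> simp [h]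

variable (A) in
/-- The comparison of the Grothendieck groups of an abelian category and of its bounded derived
category. -/
noncomputable def concEquiv : K0 (sesRel A) ≃+ K0 (triRel (D := DerivedCategory.Bounded A)) :=
  AddEquiv.ofBijective concHom ⟨Function.LeftInverse.injective eulerHom_concHom, concHom_surjective⟩

lemma concEquiv_cl (M : A) :
    concEquiv A (K0.cl (sesRel A) M) = K0.cl triRel ((degreeZero A).obj M) := by
  obtain ⟨e⟩ := exists_iso_single 0 M
  let e' : (toDb A).obj ((BddCx.conc A 0).obj M) ≅ (degreeZero A).obj M :=
    TStructure.t.bounded.fullyFaithfulι.preimageIso e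
  exact (concHom_cl M).trans (cl_iso_bounded e')

end EulerHom

/-! ### Multiplicativity of classes. -/

section TensorInvariant

open DerivedCategory

variable {A : Type u} [Category.{v} A] [Abelian A] [HasDerivedCategory.{w} A]
  [MonoidalCategory A] [SymmetricCategory A] [MonoidalPreadditive A]
  [∀ X : A, PreservesFiniteLimits (tensorLeft X)]
  [∀ X : A, PreservesFiniteColimits (tensorLeft X)]

noncomputable instance : (toDb A).Braided := inferInstanceAs
  ((Localization.Monoidal.toMonoidalCategory (toDb A) (BddCx.qis A) (Iso.refl _)).Braided)

lemma clD_tensor (X Y : BddCx A) : clD (X ⊗ Y) = clD X * clD Y := by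
  rw [clD, clD, clD, K0.cl_mul_cl]
  exact cl_iso_bounded (Functor.Monoidal.μIso (toDb A) X Y).symm

/-- The theory of invariants is applied to the category of bounded complexes, where idempotents
split on total objects; `toDb` then carries the results to the derived category. -/
lemma tensorInv_clD [Linear ℚ A] : TensorInv (clD : BddCx A → K0D A) where
  sum := clD_isSum
  tensor := clD_tensor
  unit := cl_iso_bounded (Functor.Monoidal.εIso (toDb A)).symm

variable (A) in
/-- The ring isomorphism of the Grothendieck groups. -/
noncomputable def concRingEquiv : K0A A ≃+* K0D A :=
  { concEquiv A with
    map_mul' x y := by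
      change concHom (x * y) = concHom x * concHom y
      induction x using K0.induction with
      | h₁ M =>
        induction y using K0.induction with
        | h₁ N =>
          rw [K0.cl_mul_cl, concHom_cl, concHom_cl, concHom_cl, ← clD_tensor]
          exact cl_iso_bounded ((toDb A).mapIso (Functor.Monoidal.μIso (BddCx.conc A 0) M N).symm)
        | h₂ => simp
        | h₃ x h => rw [mul_neg, map_neg, h, map_neg, mul_neg]
        | h₄ x y h h' => rw [mul_add, map_add, h, h', map_add, mul_add]
      | h₂ => simp
      | h₃ x h => rw [neg_mul, map_neg, h, map_neg, neg_mul]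
      | h₄ x y h h' => rw [add_mul, map_add, h, h', map_add, add_mul] }

end TensorInvariant

/-! ### Transport of images, and exterior powers of direct sums. -/

section TensorImages

open scoped MonoidAlgebra

variable {C : Type u} [Category.{v} C] [MonoidalCategory C] [SymmetricCategory C]
  [Preadditive C] [Linear ℚ C] {D : Type u'} [Category.{v'} D] [MonoidalCategory D]
  [SymmetricCategory D] [Preadditive D] [Linear ℚ D] {n : ℕ} {e : ℚ[Equiv.Perm (Fin n)]}

lemma map_actLin (F : C ⥤ D) [F.Additive] {G : Type} [Group G] {Z : C} (M : G →* End Z)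
    (a : ℚ[G]) : F.map (actLin M a) = actLin ((F.mapEnd Z).comp M) a := by
  induction a using MonoidAlgebra.induction_on with
  | of g => rw [actLin_of, actLin_of]; rfl
  | add x y hx hy => rw [map_add, map_add, F.map_add, hx, hy]
  | smul q x hx => rw [map_smul, map_smul, F.map_smul, hx]

lemma IsTensorImage.map (F : C ⥤ D) [F.Additive] [F.Braided] {X S : C}
    (h : IsTensorImage e X S) : IsTensorImage e (F.obj X) (F.obj S) := by
  refine IsIdemImage.of_iso (h.isImage.map F) (tpowMap F X n).symm ?_
  rw [map_actLin]
  refine actLin_comm _ _ _ (fun σ ↦ ?_) e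
  change F.map (tperm X n σ) ≫ (tpowMap F X n).inv = (tpowMap F X n).inv ≫ tperm (F.obj X) n σ
  rw [Iso.comp_inv_eq, Category.assoc, tperm_tpowMap, Iso.inv_hom_id_assoc]

lemma IsTensorImage.of_iso {X Y S : C} (h : IsTensorImage e X S) (i : X ≅ Y) :
    IsTensorImage e Y S := by
  refine IsIdemImage.of_iso h.isImage ⟨tmap i.hom n, tmap i.inv n,
    by rw [← tmap_comp, i.hom_inv_id, tmap_id], by rw [← tmap_comp, i.inv_hom_id, tmap_id]⟩ ?_
  exact actLin_comm _ _ _ (fun σ ↦ (tmap_tperm i.hom n σ).symm) e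

lemma TensorInv.altCl_eq {K : Type*} [CommRing K] {cl : C → K} (hcl : TensorInv cl) {X S : C}
    (h : IsAlt n X S) : altCl cl X n = cl S := hcl.imgCl_eq h

lemma TensorInv.altCl_sumData [MonoidalPreadditive C] [MonoidalLinear ℚ C]
    [IsIdempotentComplete C] {K : Type*} [CommRing K] {cl : C → K} (hcl : TensorInv cl) {X Y Z : C}
    (d : SumData X Y Z) (n : ℕ) : altCl cl Z n =
      ∑ k ∈ Finset.HasAntidiagonal.antidiagonal n, altCl cl X k.1 * altCl cl Y k.2 := by
  obtain ⟨U, hU⟩ := exists_isAlt Z n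
  choose S hS using fun i ↦ exists_isAlt X i
  choose T hT using fun i ↦ exists_isAlt Y i
  rw [hcl.altCl_eq hU, hcl.sum (d.isSum_alt hU hS hT),
    ← Finset.sum_coe_sort (Finset.HasAntidiagonal.antidiagonal n)]
  exact Finset.sum_congr rfl fun k _ ↦ by
    rw [hcl.tensor, ← hcl.altCl_eq (hS _), ← hcl.altCl_eq (hT _)]

end TensorImages

/-! ### Degreewise split sequences and distinguished triangles. -/

namespace BddCx

variable {A : Type u} [Category.{v} A] [Abelian A]

/-- The morphism of total objects with given components. -/
noncomputable def ofDeg {X Y : BddCx A} (g : ∀ n, X.deg n ⟶ Y.deg n) : X.tot ⟶ Y.tot :=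
  ∑ n ∈ X.supp, X.proj n ≫ g n ≫ Y.inc n

lemma inc_ofDeg {X Y : BddCx A} (g : ∀ n, X.deg n ⟶ Y.deg n) (n : ℤ) :
    X.inc n ≫ ofDeg g = g n ≫ Y.inc n := inc_sum g n

lemma inc_ofDeg_assoc {X Y : BddCx A} (g : ∀ n, X.deg n ⟶ Y.deg n) (n : ℤ) {W : A}
    (h : Y.tot ⟶ W) : X.inc n ≫ ofDeg g ≫ h = g n ≫ Y.inc n ≫ h := by
  rw [← Category.assoc, inc_ofDeg, Category.assoc]

lemma pr_ofDeg {X Y : BddCx A} (g : ∀ n, X.deg n ⟶ Y.deg n) (n : ℤ) :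
    X.pr n ≫ ofDeg g = ofDeg g ≫ Y.pr n := by
  refine X.tot_ext' fun m ↦ ?_
  rw [inc_ofDeg_assoc, ← X.inc_pr m, Category.assoc, pr_pr_assoc]
  split_ifs with h
  · subst h
    rw [inc_pr_assoc, inc_ofDeg, inc_pr]
  · rw [zero_comp, comp_zero, ← Y.inc_pr, Category.assoc, Y.pr_pr, if_neg h, comp_zero, comp_zero]

/-- The components of a degreewise split short exact sequence are direct sums. -/
noncomputable def grSumData {X Z Y : BddCx A} (f : X ⟶ Z) (g : Z ⟶ Y) (w : f.f ≫ g.f = 0)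
    (s : ∀ n, (dsc f g w n).Splitting) :
    SumData ((gr A).obj X) ((gr A).obj Y) ((gr A).obj Z) where
  inl := (gr A).map f
  snd := (gr A).map g
  fst := ⟨ofDeg fun n ↦ (s n).r, pr_ofDeg _, zero_comp.trans comp_zero.symm⟩
  inr := ⟨ofDeg fun n ↦ (s n).s, pr_ofDeg _, zero_comp.trans comp_zero.symm⟩
  inl_fst := hom_ext <| show f.f ≫ (ofDeg fun n ↦ (s n).r) = 𝟙 X.tot from X.tot_ext' fun n ↦ by
    rw [← Category.assoc, inc_dmap, Category.assoc, inc_ofDeg, Category.comp_id]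
    exact (s n).f_r_assoc _
  inr_snd := hom_ext <| show (ofDeg fun n ↦ (s n).s) ≫ g.f = 𝟙 Y.tot from Y.tot_ext' fun n ↦ by
    rw [inc_ofDeg_assoc, inc_dmap, Category.comp_id]
    exact (s n).s_g_assoc _
  inl_snd := hom_ext w
  inr_fst := hom_ext <| show (ofDeg fun n ↦ (s n).s) ≫ (ofDeg fun n ↦ (s n).r) = 0 from
    Y.tot_ext' fun n ↦ by
      rw [inc_ofDeg_assoc, inc_ofDeg, comp_zero, ← Category.assoc, (s n).s_r, zero_comp]
  total := hom_ext <| show (ofDeg fun n ↦ (s n).r) ≫ f.f + g.f ≫ (ofDeg fun n ↦ (s n).s) = 𝟙 Z.tot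
    from Z.tot_ext' fun n ↦ by
      rw [Preadditive.comp_add, inc_ofDeg_assoc, inc_dmap, ← Category.assoc (Z.inc n) g.f, inc_dmap,
        Category.assoc, inc_ofDeg, ← Category.assoc, ← Category.assoc,
        ← Preadditive.add_comp, Category.comp_id]
      exact ((s n).id =≫ Z.inc n).trans (Category.id_comp _)

end BddCx

section SplitTriangles

open Pretriangulated DerivedCategory ZeroObject

variable (A : Type u) [Category.{v} A] [Abelian A] [HasDerivedCategory.{w} A]

/-- Distinguished triangles come from degreewise split short exact sequences of bounded
complexes. -/
lemma exists_splitting {X Z Y : DerivedCategory.Bounded A} (h : triRel X Z Y) :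
    ∃ (X' Z' Y' : BddCx A) (f : X' ⟶ Z') (g : Z' ⟶ Y') (w : f.f ≫ g.f = 0),
      (∀ n, Nonempty (BddCx.dsc f g w n).Splitting) ∧ Nonempty ((toDb A).obj X' ≅ X) ∧
      Nonempty ((toDb A).obj Z' ≅ Z) ∧ Nonempty ((toDb A).obj Y' ≅ Y) := by
  obtain ⟨K, W, g, hK, hC, hW, ⟨eX⟩, ⟨eZ⟩, ⟨eY⟩⟩ := exists_cone A h
  let F := BddCx.toCB A
  let i₁ : (⟨K, hK⟩ : BddLoc.CB A) ⟶ ⟨_, hC⟩ :=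
    ObjectProperty.homMk (CochainComplex.mappingCone.triangle g).mor₂
  let i₂ : (⟨_, hC⟩ : BddLoc.CB A) ⟶ ⟨_, hW⟩ :=
    ObjectProperty.homMk (CochainComplex.mappingCone.triangle g).mor₃
  -- `Z` is represented by the mapping cone of a morphism `g` from a complex `W` whose shift
  -- represents `Y`; the sequence of a cone splits in each degree.
  have hS : ∀ n, ((CochainComplex.mappingCone.triangleRotateShortComplex g).map
      (HomologicalComplex.eval _ _ n)).Splitting :=
    CochainComplex.mappingCone.triangleRotateShortComplexSplitting g
  let e₁ := F.objObjPreimageIso ⟨K, hK⟩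
  let e₂ := F.objObjPreimageIso ⟨_, hC⟩
  let e₃ := F.objObjPreimageIso ⟨_, hW⟩
  obtain ⟨f', hf⟩ := F.map_surjective (e₁.hom ≫ i₁ ≫ e₂.inv)
  obtain ⟨g', hg⟩ := F.map_surjective (e₂.hom ≫ i₂ ≫ e₃.inv)
  have c₁ : F.map f' ≫ e₂.hom = e₁.hom ≫ i₁ := by simp [hf]
  have c₂ : F.map g' ≫ e₃.hom = e₂.hom ≫ i₂ := by simp [hg]
  have hw : i₁ ≫ i₂ = 0 :=
    ObjectProperty.hom_ext _ (CochainComplex.mappingCone.triangleRotateShortComplex g).zero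
  have hw' : F.map f' ≫ F.map g' = 0 := by
    rw [← cancel_mono e₃.hom, Category.assoc, c₂, reassoc_of% c₁, hw, comp_zero, zero_comp]
  have w : f'.f ≫ g'.f = 0 := by
    refine BddCx.tot_ext' _ fun n ↦ ?_
    have h₀ : BddCx.dmap f' n ≫ BddCx.dmap g' n = 0 := congrArg (fun k ↦ k.hom.f n) hw'
    rw [← Category.assoc, BddCx.inc_dmap, Category.assoc, BddCx.inc_dmap, reassoc_of% h₀,
      zero_comp, comp_zero]
  have i (U : BddLoc.CB A) (U' : BddCx A) (e : F.obj U' ≅ U) (V : DerivedCategory.Bounded A)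
      (e' : Q.obj U.obj ≅ Bounded.ι.obj V) : Nonempty ((toDb A).obj U' ≅ V) :=
    ⟨TStructure.t.bounded.fullyFaithfulι.preimageIso ((toDbι A U').symm ≪≫
      Q.mapIso ((BddLoc.bdd A).ι.mapIso e) ≪≫ e')⟩
  refine ⟨_, _, _, f', g', w, fun n ↦ ?_, i _ _ e₁ X eX,
    i _ _ e₂ Z eZ, i _ _ e₃ Y eY⟩
  let G : BddLoc.CB A ⥤ A := (BddLoc.bdd A).ι ⋙ HomologicalComplex.eval _ _ n
  exact ⟨(hS n).ofIso (ShortComplex.isoMk (G.mapIso e₁) (G.mapIso e₂)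
    (G.mapIso e₃) (congrArg (fun k ↦ k.hom.f n) c₁).symm
    (congrArg (fun k ↦ k.hom.f n) c₂).symm).symm⟩

end SplitTriangles

/-! ### The λ-operations on the Grothendieck ring of the derived category. -/

section LambdaOperations

open DerivedCategory
open scoped MonoidAlgebra

variable {A : Type u} [Category.{v} A] [Abelian A] [Linear ℚ A] [MonoidalCategory A]
  [SymmetricCategory A] [MonoidalPreadditive A] [MonoidalLinear ℚ A]
  [∀ X : A, PreservesFiniteLimits (tensorLeft X)]
  [∀ X : A, PreservesFiniteColimits (tensorLeft X)] [HasDerivedCategory.{w} A]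
  {n : ℕ} {e : ℚ[Equiv.Perm (Fin n)]}

/-- The image is formed for a complex which represents `V` and carried over by the braided functor
`toDb`. -/
lemma exists_isTensorImage_bounded (he : e * e = e) (V : DerivedCategory.Bounded A) :
    ∃ S, IsTensorImage e V S := by
  obtain ⟨S, hS⟩ := exists_isTensorImage he ((toDb A).objPreimage V)
  exact ⟨_, (hS.map (toDb A)).of_iso ((toDb A).objObjPreimageIso V)⟩

lemma cl_eq_imgCl (he : e * e = e) {V S : DerivedCategory.Bounded A} (h : IsTensorImage e V S)
    {X : BddCx A} (i : (toDb A).obj X ≅ V) :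
    K0.cl triRel S = imgCl (clD : BddCx A → K0D A) X n e := by
  obtain ⟨T, hT⟩ := exists_isTensorImage he X
  rw [tensorInv_clD.imgCl_eq hT]
  obtain ⟨j⟩ := h.isImage.unique ((hT.map (toDb A)).of_iso i).isImage
  exact cl_iso_bounded j

/-- As an additive braided functor, `gr` takes images on tensor powers to images, and classes do not
see differentials. This is what makes Schur functors compatible with triangles. -/
lemma imgCl_gr (he : e * e = e) (X : BddCx A) :
    imgCl (clD : BddCx A → K0D A) ((BddCx.gr A).obj X) n e = imgCl clD X n e := by
  obtain ⟨S, hS⟩ := exists_isTensorImage he X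
  rw [tensorInv_clD.imgCl_eq hS, tensorInv_clD.imgCl_eq (hS.map (BddCx.gr A)), clD_gr]

variable (A) in
/-- The generating series of the classes of the exterior powers. -/
noncomputable def lamSeries (X : BddCx A) : PowerSeries (K0D A) := PowerSeries.mk (altCl clD X)

lemma altCl_zero (X : BddCx A) : altCl (clD : BddCx A → K0D A) X 0 = 1 := by
  obtain ⟨S, hS⟩ := exists_isAlt X 0
  obtain ⟨i⟩ := hS.iso_unit
  rw [tensorInv_clD.altCl_eq hS, tensorInv_clD.iso i, tensorInv_clD.unit]

lemma altCl_one (X : BddCx A) : altCl (clD : BddCx A → K0D A) X 1 = clD X := by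
  obtain ⟨S, hS⟩ := exists_isAlt X 1
  obtain ⟨i⟩ := hS.iso_self
  rw [tensorInv_clD.altCl_eq hS, tensorInv_clD.iso i]

lemma isUnit_lamSeries (X : BddCx A) : IsUnit (lamSeries A X) := by
  rw [PowerSeries.isUnit_iff_constantCoeff, ← PowerSeries.coeff_zero_eq_constantCoeff_apply,
    lamSeries, PowerSeries.coeff_mk, altCl_zero]
  exact isUnit_one

/-- Images of idempotents in the derived category are unique up to isomorphism, so the choice of a
representing complex does not matter. -/
lemma lamSeries_congr {X Y : BddCx A} (i : (toDb A).obj X ≅ (toDb A).obj Y) :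
    lamSeries A X = lamSeries A Y := by
  ext n
  obtain ⟨S, hS⟩ := exists_isAlt X n
  rw [lamSeries, lamSeries, PowerSeries.coeff_mk, PowerSeries.coeff_mk,
    tensorInv_clD.altCl_eq hS]
  exact cl_eq_imgCl (altIdem_mul_self n) (hS.map (toDb A)) i.symm

lemma lamSeries_sumData {X Y Z : BddCx A} (d : SumData X Y Z) :
    lamSeries A Z = lamSeries A X * lamSeries A Y := by
  ext n
  rw [PowerSeries.coeff_mul]
  simp only [lamSeries, PowerSeries.coeff_mk]
  exact tensorInv_clD.altCl_sumData d n

lemma lamSeries_gr (X : BddCx A) : lamSeries A ((BddCx.gr A).obj X) = lamSeries A X := by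
  ext n
  rw [lamSeries, lamSeries, PowerSeries.coeff_mk, PowerSeries.coeff_mk]
  exact imgCl_gr (altIdem_mul_self n) X

variable (A) in
/-- The homomorphism which maps the class of an object to the generating series of the classes of
its exterior powers. -/
noncomputable def lamHom : K0D A →+ Additive (PowerSeries (K0D A))ˣ :=
  K0.lift (fun V ↦ Additive.ofMul (isUnit_lamSeries ((toDb A).objPreimage V)).unit)
    fun X Z Y h ↦ by
      obtain ⟨X', Z', Y', f, g, w, s, ⟨eX⟩, ⟨eZ⟩, ⟨eY⟩⟩ := exists_splitting A h
      have hc {V : DerivedCategory.Bounded A} {U : BddCx A} (i : (toDb A).obj U ≅ V) :=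
        lamSeries_congr ((toDb A).objObjPreimageIso V ≪≫ i.symm)
      refine Additive.toMul.injective (Units.ext ?_)
      change lamSeries A _ = lamSeries A _ * lamSeries A _
      -- After passing to `gr` the degreewise splittings are morphisms of complexes, and the middle
      -- term is a direct sum.
      rw [hc eX, hc eZ, hc eY, ← lamSeries_gr, ← lamSeries_gr X', ← lamSeries_gr Y']
      exact lamSeries_sumData (BddCx.grSumData f g w fun n ↦ (s n).some)

variable (A) in
/-- The `λ`-operations on the Grothendieck group of the bounded derived category. -/
noncomputable def lamD (n : ℕ) (x : K0D A) : K0D A :=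
  PowerSeries.coeff n ((lamHom A x).toMul : PowerSeries (K0D A))

lemma lamD_clD (n : ℕ) (X : BddCx A) : lamD A n (clD X) = altCl clD X n := by
  have h : lamHom A (clD X) =
      Additive.ofMul (isUnit_lamSeries ((toDb A).objPreimage ((toDb A).obj X))).unit :=
    K0.lift_cl _ _ _
  rw [lamD, h]
  change PowerSeries.coeff n (lamSeries A _) = _
  rw [lamSeries_congr ((toDb A).objObjPreimageIso ((toDb A).obj X)), lamSeries,
    PowerSeries.coeff_mk]

theorem isSpecialLambda_lamD : IsSpecialLambda (lamD A) where
  lam_zero x := by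
    obtain ⟨X, rfl⟩ := exists_clD_eq x
    rw [lamD_clD, altCl_zero]
  lam_one x := by
    obtain ⟨X, rfl⟩ := exists_clD_eq x
    rw [lamD_clD, altCl_one]
  lam_add n x y := by
    simp only [lamD, map_add, toMul_add, Units.val_mul, PowerSeries.coeff_mul]
  lam_unit n hn := by
    obtain ⟨S, hS⟩ := exists_isAlt (𝟙_ (BddCx A)) n
    rw [← tensorInv_clD.unit, lamD_clD, tensorInv_clD.altCl_eq hS,
      tensorInv_clD.zero (isLine_unit.isAlt hn hS)]
  lam_mul n := by
    obtain ⟨P, hP, h⟩ := TensorInv.exists_isMulPoly (tensorInv_clD (A := A)) n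
    refine ⟨P, hP, fun x y ↦ ?_⟩
    obtain ⟨X, rfl⟩ := exists_clD_eq x
    obtain ⟨Y, rfl⟩ := exists_clD_eq y
    simp only [← tensorInv_clD.tensor, lamD_clD, h]
  lam_lam m n := by
    obtain ⟨P, hP, h⟩ := TensorInv.exists_isCompPoly (tensorInv_clD (A := A)) m n
    refine ⟨P, hP, fun x ↦ ?_⟩
    obtain ⟨X, rfl⟩ := exists_clD_eq x
    obtain ⟨S, hS⟩ := exists_isAlt X n
    simp only [lamD_clD, tensorInv_clD.altCl_eq hS]
    exact h X S hS

lemma lamD_isAlt {n : ℕ} {V S : DerivedCategory.Bounded A} (h : IsAlt n V S) :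
    lamD A n (K0.cl _ V) = K0.cl _ S := by
  have i := (toDb A).objObjPreimageIso V
  rw [cl_eq_imgCl (altIdem_mul_self n) h i]
  exact (congrArg _ (cl_iso_bounded i.symm)).trans (lamD_clD n _)

lemma lamD_conc {n : ℕ} {X S : A} (h : IsAlt n X S) :
    lamD A n (concRingEquiv A (K0.cl _ X)) = concRingEquiv A (K0.cl _ S) := by
  have h₁ (M : A) : concRingEquiv A (K0.cl _ M) = clD ((BddCx.conc A 0).obj M) := concHom_cl M
  rw [h₁, h₁, lamD_clD]
  exact tensorInv_clD.imgCl_eq (h.map (BddCx.conc A 0))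

end LambdaOperations

/-- Special `λ`-ring structures may be transported along isomorphisms. -/
lemma IsSpecialLambda.of_ringEquiv {R S : Type*} [CommRing R] [CommRing S] (i : R ≃+* S)
    {lam : ℕ → S → S} (h : IsSpecialLambda lam) :
    IsSpecialLambda fun n x ↦ i.symm (lam n (i x)) where
  lam_zero x := by rw [h.lam_zero, map_one]
  lam_one x := by rw [h.lam_one, i.symm_apply_apply]
  lam_add n x y := by simp [h.lam_add]
  lam_unit n hn := by rw [map_one, h.lam_unit n hn, map_zero]
  lam_mul n := by
    obtain ⟨P, hP, hP'⟩ := h.lam_mul n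
    refine ⟨P, hP, fun x y ↦ ?_⟩
    have := MvPolynomial.comp_aeval_apply (Sum.elim (fun j : Fin n ↦ lam (j.1 + 1) (i x))
      fun j : Fin n ↦ lam (j.1 + 1) (i y)) i.symm.toRingHom.toIntAlgHom P
    rw [map_mul, hP']
    refine this.trans (congrArg (fun f ↦ MvPolynomial.aeval f P) (funext fun j ↦ ?_))
    cases j <;> rfl
  lam_lam m n := by
    obtain ⟨P, hP, hP'⟩ := h.lam_lam m n
    refine ⟨P, hP, fun x ↦ ?_⟩
    rw [i.apply_symm_apply, hP']
    exact MvPolynomial.comp_aeval_apply _ i.symm.toRingHom.toIntAlgHom P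

/-! ### Left ideals of group algebras in the representation ring. -/

section RepSums

open Representation TensorProduct
open scoped MonoidAlgebra

variable {G : Type} [Group G]

lemma repRel_sumData {X Y Z : FDRep ℚ G} (d : SumData X Y Z) : repRel X Z Y := by
  let inl : X →ₗ[ℚ] Z := d.inl.hom.hom.hom
  let inr : Y →ₗ[ℚ] Z := d.inr.hom.hom.hom
  let fst : Z →ₗ[ℚ] X := d.fst.hom.hom.hom
  let snd : Z →ₗ[ℚ] Y := d.snd.hom.hom.hom
  have h₁ : fst ∘ₗ inl = LinearMap.id := congr(($(d.inl_fst)).hom.hom.hom)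
  have h₂ : snd ∘ₗ inr = LinearMap.id := congr(($(d.inr_snd)).hom.hom.hom)
  have h₃ : snd ∘ₗ inl = 0 := congr(($(d.inl_snd)).hom.hom.hom)
  have h₄ : inl ∘ₗ fst + inr ∘ₗ snd = LinearMap.id := congr(($(d.total)).hom.hom.hom)
  refine ⟨⟨inl, fun g ↦ congr(($(d.inl.comm g)).hom.hom)⟩,
    ⟨snd, fun g ↦ congr(($(d.snd.comm g)).hom.hom)⟩, ?_, fun z ↦ ⟨fun hz ↦ ⟨fst z, ?_⟩, ?_⟩, ?_⟩
  · exact Function.LeftInverse.injective (g := fst) fun x ↦ congr($h₁ x)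
  · have hz' : snd z = 0 := hz
    have := congr($h₄ z)
    simp only [LinearMap.add_apply, LinearMap.comp_apply, hz', map_zero, add_zero] at this
    exact this
  · rintro ⟨x, rfl⟩
    exact congr($h₃ x)
  · exact Function.RightInverse.surjective (g := inr) fun x ↦ congr($h₂ x)

lemma cl_isSum_rep {J : Type} [Fintype J] {T : J → FDRep ℚ G} {S : FDRep ℚ G} (h : IsSum T S) :
    K0.cl repRel S = ∑ j, K0.cl repRel (T j) :=
  h.cl_eq fun d ↦ K0.cl_eq (repRel_sumData d)

/-- Morphisms of representations. -/
def repHom {V W : FDRep ℚ G} (f : V →ₗ[ℚ] W) (h : ∀ g, f ∘ₗ V.ρ g = W.ρ g ∘ₗ f) : V ⟶ W :=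
  ⟨InducedCategory.homMk (ModuleCat.ofHom f), fun g ↦
    InducedCategory.hom_ext (ModuleCat.hom_ext (h g))⟩

lemma repHom_ext {V W : FDRep ℚ G} {f g : V ⟶ W}
    (h : ∀ x : V, f.hom.hom.hom x = g.hom.hom.hom x) : f = g :=
  Action.Hom.ext (InducedCategory.hom_ext (ModuleCat.hom_ext (LinearMap.ext h)))

lemma cl_rep_iso {V W : FDRep ℚ G} (f : V →ₗ[ℚ] W) (h : ∀ g, f ∘ₗ V.ρ g = W.ρ g ∘ₗ f)
    (hf : Function.Bijective f) : K0.cl repRel V = K0.cl repRel W := by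
  let e := LinearEquiv.ofBijective f hf
  have h' : ∀ g, e.symm.toLinearMap ∘ₗ W.ρ g = V.ρ g ∘ₗ e.symm.toLinearMap := fun g ↦ by
    refine LinearMap.ext fun x ↦ e.injective ?_
    have := congr($(h g) (e.symm x))
    have h₁ : f (e.symm x) = x := e.apply_symm_apply x
    simp only [LinearMap.comp_apply, h₁] at this
    simpa [e] using this.symm
  have i : V ≅ W := ⟨repHom f h, repHom e.symm.toLinearMap h',
    repHom_ext fun x ↦ e.symm_apply_apply x, repHom_ext fun x ↦ e.apply_symm_apply x⟩
  rw [cl_isSum_rep (isSum_of_iso i)]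
  simp

variable [Finite G]

instance (I : Ideal ℚ[G]) : Module.Finite ℚ I :=
  inferInstanceAs (Module.Finite ℚ (I.restrictScalars ℚ))

/-- A left ideal of the group algebra as a representation. -/
noncomputable def idealRep (I : Ideal ℚ[G]) : FDRep ℚ G :=
  FDRep.of (Representation.ofModule' (k := ℚ) (G := G) I)

/-- Right multiplication with an element. -/
noncomputable def mulRightHom {I J : Ideal ℚ[G]} (w : ℚ[G]) (hw : ∀ x ∈ I, x * w ∈ J) :
    idealRep I ⟶ idealRep J :=
  repHom (V := idealRep I) (W := idealRep J)
    ((LinearMap.mulRight ℚ w).restrict (p := I.restrictScalars ℚ) (q := J.restrictScalars ℚ) hw)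
    fun _ ↦ LinearMap.ext fun _ ↦ Subtype.ext (mul_assoc _ _ _)

lemma mem_span_idem {A : Type} [Ring A] {e : A} (he : e * e = e) {x : A} :
    x ∈ Ideal.span {e} ↔ x * e = x := by
  rw [Ideal.mem_span_singleton']
  exact ⟨by rintro ⟨a, rfl⟩; rw [mul_assoc, he], fun h ↦ ⟨x, h⟩⟩

/-- The class of the left ideal of an idempotent. -/
lemma cl_idealRep {J : Type} [Fintype J] {f : J → ℚ[G]} (hf : SplitData f) {e : ℚ[G]}
    (he : e * e = e) : K0.cl repRel (idealRep (Ideal.span {e})) =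
      ∑ j, cornerDim e (f j) • K0.cl repRel (idealRep (Ideal.span {f j})) := by
  have _ := Fintype.ofFinite G
  obtain ⟨u, v, h₁, h₂, h₃, h₄, h₅, h₆⟩ := hf.decomposition he
  -- Right multiplications with `v k` and `u k` are the inclusions and projections, since they
  -- commute with the action from the left.
  have : IsSum (fun k : Σ j, Fin (cornerDim e (f j)) ↦ idealRep (Ideal.span {f k.1}))
      (idealRep (Ideal.span {e})) := by
    have hv : ∀ k, ∀ x ∈ Ideal.span {f k.1}, x * v k ∈ Ideal.span {e} := fun k x _ ↦ by
      rw [mem_span_idem he, mul_assoc, h₃]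
    have hu : ∀ k, ∀ x ∈ Ideal.span {e}, x * u k ∈ Ideal.span {f k.1} := fun k x _ ↦ by
      rw [mem_span_idem (hf.idem _), mul_assoc, h₁]
    refine ⟨fun k ↦ mulRightHom (v k) (hv k), fun k ↦ mulRightHom (u k) (hu k),
      fun k ↦ ?_, fun k l hkl ↦ ?_, ?_⟩
    · refine repHom_ext fun x ↦ Subtype.ext ?_
      change x.1 * v k * u k = x.1
      rw [mul_assoc, h₄]
      exact (mem_span_idem (hf.idem _)).1 x.2
    · refine repHom_ext fun x ↦ Subtype.ext ?_
      change x.1 * v k * u l = 0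
      rw [mul_assoc, h₅ k l hkl, mul_zero]
    · refine repHom_ext fun x ↦ Subtype.ext ?_
      let Φ : (idealRep (Ideal.span {e}) ⟶ idealRep (Ideal.span {e})) →+ ℚ[G] :=
        ⟨⟨fun f ↦ (f.hom.hom.hom x : Ideal.span {e}).1, rfl⟩, fun _ _ ↦ rfl⟩
      have h : ∀ k, Φ (mulRightHom (u k) (hu k) ≫ mulRightHom (v k) (hv k)) = x.1 * (u k * v k) :=
        fun k ↦ mul_assoc _ _ _
      refine (map_sum Φ _ _).trans ((Finset.sum_congr rfl fun k _ ↦ h k).trans ?_)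
      rw [← Finset.mul_sum, h₆]
      exact (mem_span_idem he).1 x.2
  rw [cl_isSum_rep this, Fintype.sum_sigma]
  simp

end RepSums

/-! ### Representations induced from left ideals. -/

section IndIdeal

open Representation TensorProduct
open scoped MonoidAlgebra

variable {H₁ H₂ G : Type} [Group H₁] [Group H₂] [Group G] (φ : H₁ × H₂ →* G)

/-- The linear extension of the inversion of a group. -/
noncomputable def invLin : ℚ[G] →ₗ[ℚ] ℚ[G] := MonoidAlgebra.mapDomainLinearMap ℚ ℚ fun g ↦ g⁻¹

lemma invLin_of (g : G) : invLin (MonoidAlgebra.of ℚ G g) = MonoidAlgebra.of ℚ G g⁻¹ := by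
  simp [invLin]

lemma invLin_mul (x y : ℚ[G]) : invLin (x * y) = invLin y * invLin x := by
  induction x using MonoidAlgebra.induction_on with
  | of g =>
    induction y using MonoidAlgebra.induction_on with
    | of h => rw [← map_mul, invLin_of, invLin_of, invLin_of, ← map_mul, mul_inv_rev]
    | add x y hx hy => rw [mul_add, map_add, hx, hy, map_add, add_mul]
    | smul q x hx => rw [mul_smul_comm, map_smul, hx, map_smul, smul_mul_assoc]
  | add x y hx hy => rw [add_mul, map_add, hx, hy, map_add, mul_add]
  | smul q x hx => rw [smul_mul_assoc, map_smul, hx, map_smul, mul_smul_comm]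

lemma invLin_invLin (x : ℚ[G]) : invLin (invLin x) = x := by
  induction x using MonoidAlgebra.induction_on with
  | of g => rw [invLin_of, invLin_of, inv_inv]
  | add x y hx hy => rw [map_add, map_add, hx, hy]
  | smul q x hx => rw [map_smul, map_smul, hx]

/-- The external product of elements of group algebras, as a bilinear map. -/
noncomputable def extLin : ℚ[H₁] →ₗ[ℚ] ℚ[H₂] →ₗ[ℚ] ℚ[G] :=
  LinearMap.mk₂ ℚ (fun x y ↦ MonoidAlgebra.mapDomainAlgHom ℚ ℚ φ (boxMul x y))
    (fun _ _ _ ↦ by rw [boxMul_add_left, map_add]) (fun _ _ _ ↦ by rw [boxMul_smul_left, map_smul])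
    (fun _ _ _ ↦ by rw [boxMul_add_right, map_add])
    (fun _ _ _ ↦ by rw [boxMul_smul_right, map_smul])

lemma extLin_mul (x x' : ℚ[H₁]) (y y' : ℚ[H₂]) :
    extLin φ (x * x') (y * y') = extLin φ x y * extLin φ x' y' := by
  change MonoidAlgebra.mapDomainAlgHom ℚ ℚ φ (boxMul _ _) = MonoidAlgebra.mapDomainAlgHom ℚ ℚ φ _ *
    MonoidAlgebra.mapDomainAlgHom ℚ ℚ φ _
  rw [← map_mul, boxMul_mul]

lemma extLin_of (s : H₁ × H₂) : extLin φ (MonoidAlgebra.of ℚ _ s.1) (MonoidAlgebra.of ℚ _ s.2) =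
    MonoidAlgebra.of ℚ G (φ s) := by
  change MonoidAlgebra.mapDomainAlgHom ℚ ℚ φ (boxMul _ _) = _
  rw [boxMul_of, mapDomainAlgHom_of]

lemma ofMulAction_eq_mul (s : G) (z : ℚ[G]) :
    Representation.ofMulAction ℚ G G s z = MonoidAlgebra.of ℚ G s * z := by
  induction z using MonoidAlgebra.induction_on with
  | of g => simp [Representation.ofMulAction_single]
  | add x y hx hy => rw [map_add, hx, hy, mul_add]
  | smul q x hx => rw [map_smul, hx, mul_smul_comm]

lemma mapDomain_mul_right (s : G) (z : ℚ[G]) :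
    MonoidAlgebra.mapDomainLinearMap ℚ ℚ (fun x ↦ x * s) z = z * MonoidAlgebra.of ℚ G s := by
  induction z using MonoidAlgebra.induction_on with
  | of g => simp
  | add x y hx hy => rw [map_add, hx, hy, add_mul]
  | smul q x hx => rw [map_smul, hx, smul_mul_assoc]

variable {V W : Type} [AddCommGroup V] [Module ℚ V] [AddCommGroup W] [Module ℚ W]
  (ρ : Representation ℚ H₁ V) (τ : Representation ℚ H₂ W)

/-- The external tensor product of representations of two groups. -/
noncomputable abbrev extRep : Representation ℚ (H₁ × H₂) (V ⊗[ℚ] W) :=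
  Representation.tprod (ρ.comp (MonoidHom.fst _ _)) (τ.comp (MonoidHom.snd _ _))

variable {ρ τ}

/-- The induced representation of an external tensor product of representations in group algebras
maps to the group algebra. -/
noncomputable def indToAlg (a : V →ₗ[ℚ] ℚ[H₁]) (b : W →ₗ[ℚ] ℚ[H₂])
    (ha : ∀ s v, a (ρ s v) = MonoidAlgebra.of ℚ _ s * a v)
    (hb : ∀ s w, b (τ s w) = MonoidAlgebra.of ℚ _ s * b w) :
    IndV φ (extRep ρ τ) →ₗ[ℚ] ℚ[G] :=
  -- The coinvariants are formed for the action of the subgroup on `ℚ[G]` from the left, while `G`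
  -- acts through inverses from the right; `invLin` exchanges the sides, so that the result lands in
  -- a left ideal.
  Coinvariants.lift _ (TensorProduct.lift ((LinearMap.mul ℚ ℚ[G]).compl₁₂ invLin
    (TensorProduct.lift ((extLin φ).compl₁₂ a b)))) fun s ↦ by
    refine TensorProduct.ext' fun z w ↦ ?_
    induction w using TensorProduct.induction_on with
    | zero => simp
    | add w w' h h' => rw [tmul_add, map_add, map_add, h, h']
    | tmul x y =>
      change invLin (Representation.ofMulAction ℚ G G (φ s) z) *
        extLin φ (a (ρ s.1 x)) (b (τ s.2 y)) = invLin z * extLin φ (a x) (b y)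
      rw [ofMulAction_eq_mul, ha, hb, invLin_mul, invLin_of, extLin_mul, extLin_of, mul_assoc,
        ← mul_assoc (MonoidAlgebra.of ℚ G _), ← map_mul, inv_mul_cancel, map_one, one_mul]

lemma indToAlg_mk (a : V →ₗ[ℚ] ℚ[H₁]) (b : W →ₗ[ℚ] ℚ[H₂])
    (ha : ∀ s v, a (ρ s v) = MonoidAlgebra.of ℚ _ s * a v)
    (hb : ∀ s w, b (τ s w) = MonoidAlgebra.of ℚ _ s * b w) (z : ℚ[G]) (x : V) (y : W) :
    indToAlg φ a b ha hb (Coinvariants.mk _ (z ⊗ₜ (x ⊗ₜ y))) = invLin z * extLin φ (a x) (b y) :=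
  rfl

/-- In the coinvariants, elements of the two groups move across the tensor product, and by linearity
so do elements of their group algebras. -/
lemma coinv_mk_mul (z : ℚ[G]) (x : ℚ[H₁]) (y : ℚ[H₂]) (v : V) (w : W) :
    Coinvariants.mk (Representation.tprod ((leftRegular ℚ G).comp φ) (extRep ρ τ))
      (invLin (z * extLin φ x y) ⊗ₜ[ℚ] (v ⊗ₜ[ℚ] w)) =
    Coinvariants.mk (Representation.tprod ((leftRegular ℚ G).comp φ) (extRep ρ τ))
      (invLin z ⊗ₜ[ℚ] (ρ.asAlgebraHom x v ⊗ₜ[ℚ] τ.asAlgebraHom y w)) := by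
  induction x using MonoidAlgebra.induction_on with
  | of s =>
    induction y using MonoidAlgebra.induction_on with
    | of t =>
      have h := Coinvariants.mk_self_apply
        (Representation.tprod ((leftRegular ℚ G).comp φ) (extRep ρ τ)) (s, t)
        (invLin (z * MonoidAlgebra.of ℚ G (φ (s, t))) ⊗ₜ[ℚ] (v ⊗ₜ[ℚ] w))
      rw [extLin_of φ (s, t), ← h]
      change Coinvariants.mk _ (Representation.ofMulAction ℚ G G (φ (s, t)) _ ⊗ₜ[ℚ]
        (ρ s v ⊗ₜ[ℚ] τ t w)) = _
      rw [ofMulAction_eq_mul, invLin_mul, invLin_of, ← mul_assoc, ← map_mul, mul_inv_cancel,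
        map_one, one_mul, asAlgebraHom_of, asAlgebraHom_of]
    | add x y hx hy =>
      simp only [map_add, mul_add, add_tmul, LinearMap.add_apply, tmul_add, hx, hy]
    | smul q x hx =>
      simp only [map_smul, mul_smul_comm, ← smul_tmul', LinearMap.smul_apply, tmul_smul, hx]
  | add x y hx hy =>
    simp only [map_add, mul_add, add_tmul, LinearMap.add_apply, tmul_add, hx, hy]
  | smul q x hx =>
    simp only [map_smul, mul_smul_comm, ← smul_tmul', LinearMap.smul_apply, tmul_smul, hx]

lemma asAlgebraHom_apply_of_hom {a : V →ₗ[ℚ] ℚ[H₁]}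
    (ha : ∀ s v, a (ρ s v) = MonoidAlgebra.of ℚ _ s * a v) (x : ℚ[H₁]) (v : V) :
    a (ρ.asAlgebraHom x v) = x * a v := by
  induction x using MonoidAlgebra.induction_on with
  | of s => rw [asAlgebraHom_of, ha]
  | add x y hx hy => rw [map_add, LinearMap.add_apply, map_add, hx, hy, add_mul]
  | smul q x hx => rw [map_smul, LinearMap.smul_apply, map_smul, hx, smul_mul_assoc]

lemma ind_coinv_mk {U : Type} [AddCommGroup U] [Module ℚ U] {H : Type} [Group H] (φ : H →* G)
    (σ : Representation ℚ H U) (g : G) (z : ℚ[G]) (u : U) :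
    Representation.ind φ σ g (Coinvariants.mk _ (z ⊗ₜ[ℚ] u)) =
      Coinvariants.mk _ ((z * MonoidAlgebra.of ℚ G g⁻¹) ⊗ₜ[ℚ] u) := by
  rw [← mapDomain_mul_right]
  rfl

/-- The representation induced from an external tensor product of left ideals of idempotents. -/
lemma exists_ind_equiv (e : ℚ[H₁]) (f : ℚ[H₂]) {a : V →ₗ[ℚ] ℚ[H₁]} {b : W →ₗ[ℚ] ℚ[H₂]}
    (ha : ∀ s v, a (ρ s v) = MonoidAlgebra.of ℚ _ s * a v)
    (hb : ∀ s w, b (τ s w) = MonoidAlgebra.of ℚ _ s * b w)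
    (ia : Function.Injective a) (ib : Function.Injective b) (v₀ : V) (w₀ : W) (hv₀ : a v₀ = e)
    (hw₀ : b w₀ = f) (hae : ∀ v, a v * e = a v) (hbf : ∀ w, b w * f = b w) {I : Ideal ℚ[G]}
    (hI : ∀ x, x ∈ I ↔ x * extLin φ e f = x) :
    ∃ Ψ : I →ₗ[ℚ] IndV φ (extRep ρ τ), (∀ g (x : I), Ψ (MonoidAlgebra.of ℚ G g • x) =
      Representation.ind φ (extRep ρ τ) g (Ψ x)) ∧ Function.Bijective Ψ := by
  have hff : extLin φ e f * extLin φ e f = extLin φ e f := by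
    rw [← extLin_mul, ← hv₀, ← hw₀]
    nth_rw 2 [hv₀]
    nth_rw 2 [hw₀]
    rw [hae, hbf]
  -- `indToAlg` is a left inverse, since `v₀` and `w₀` correspond to the idempotents. Surjectivity
  -- holds because each `v` is obtained from `v₀` by the action of `a v`, and likewise each `w` from
  -- `w₀`.
  let Ψ : I →ₗ[ℚ] IndV φ (extRep ρ τ) := (Coinvariants.mk _ ∘ₗ
    (TensorProduct.mk ℚ _ _).flip (v₀ ⊗ₜ[ℚ] w₀) ∘ₗ invLin) ∘ₗ (I.restrictScalars ℚ).subtype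
  have hΨ : ∀ x : I, Ψ x = Coinvariants.mk _ (invLin x.1 ⊗ₜ[ℚ] (v₀ ⊗ₜ[ℚ] w₀)) := fun _ ↦ rfl
  have hinv : ∀ x : I, indToAlg φ a b ha hb (Ψ x) = x.1 := fun x ↦ by
    rw [hΨ, indToAlg_mk, invLin_invLin, hv₀, hw₀]
    exact (hI x.1).1 x.2
  refine ⟨Ψ, fun g x ↦ ?_, fun x y hxy ↦ Subtype.ext (by rw [← hinv, hxy, hinv]), fun y ↦ ?_⟩
  · rw [hΨ, hΨ, ind_coinv_mk, ← invLin_of, ← invLin_mul]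
    rfl
  · obtain ⟨y, rfl⟩ := Coinvariants.mk_surjective _ y
    change y ∈ (LinearMap.range Ψ).comap (Coinvariants.mk _)
    induction y using TensorProduct.induction_on with
    | zero => exact Submodule.zero_mem _
    | add x y hx hy => exact Submodule.add_mem _ hx hy
    | tmul z u =>
      induction u using TensorProduct.induction_on with
      | zero => rw [tmul_zero]; exact Submodule.zero_mem _
      | add x y hx hy => rw [tmul_add]; exact Submodule.add_mem _ hx hy
      | tmul v w =>
        have hv : ρ.asAlgebraHom (a v) v₀ = v := ia (by
          rw [asAlgebraHom_apply_of_hom ha, hv₀, hae])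
        have hw : τ.asAlgebraHom (b w) w₀ = w := ib (by
          rw [asAlgebraHom_apply_of_hom hb, hw₀, hbf])
        have h := coinv_mk_mul (ρ := ρ) (τ := τ) φ (invLin z) (a v) (b w) v₀ w₀
        rw [invLin_invLin, hv, hw] at h
        refine ⟨⟨invLin z * extLin φ (a v) (b w), (hI _).2 ?_⟩, h⟩
        rw [mul_assoc, ← extLin_mul, hae, hbf]

end IndIdeal

/-! ### Induction products of Specht modules. -/

section SpechtMul

open Representation TensorProduct
open scoped MonoidAlgebra

lemma specht_eq {n : ℕ} (μ : n.Partition) : specht μ = idealRep (Ideal.span {youngIdem μ}) := by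
  have h : (Ideal.span {youngSym μ} : Ideal ℚ[Equiv.Perm (Fin n)]) = Ideal.span {youngIdem μ} := by
    have hc := inv_ne_zero (coeff_youngSym_sq_ne_zero μ)
    refine le_antisymm ?_ ?_
    · rw [Ideal.span_singleton_le_iff_mem, Ideal.mem_span_singleton']
      refine ⟨algebraMap ℚ _ (((youngSym μ * youngSym μ).coeff 1)⁻¹)⁻¹, ?_⟩
      rw [← Algebra.smul_def, youngIdem, smul_smul, inv_mul_cancel₀ hc, one_smul]
    · rw [Ideal.span_singleton_le_iff_mem, Ideal.mem_span_singleton']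
      exact ⟨algebraMap ℚ _ ((youngSym μ * youngSym μ).coeff 1)⁻¹, (Algebra.smul_def _ _).symm⟩
  rw [← h]
  rfl

lemma cl_indProd_idealRep {p q n : ℕ} (h : p + q = n) {e : ℚ[Equiv.Perm (Fin p)]}
    {f : ℚ[Equiv.Perm (Fin q)]} (he : e * e = e) (hf : f * f = f) :
    K0.cl repRel (indProd h (idealRep (Ideal.span {e})) (idealRep (Ideal.span {f}))) =
      K0.cl repRel (idealRep (Ideal.span {permExt h e f})) := by
  have hext : permExt h e f * permExt h e f = permExt h e f := by rw [permExt_mul, he, hf]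
  obtain ⟨Ψ, h₁, h₂⟩ := exists_ind_equiv (permProd h) e f
    (V := idealRep (Ideal.span {e})) (W := idealRep (Ideal.span {f}))
    (ρ := (idealRep (Ideal.span {e})).ρ) (τ := (idealRep (Ideal.span {f})).ρ)
    (a := ((Ideal.span {e}).restrictScalars ℚ).subtype)
    (b := ((Ideal.span {f}).restrictScalars ℚ).subtype) (fun _ _ ↦ rfl) (fun _ _ ↦ rfl)
    Subtype.val_injective Subtype.val_injective
    (⟨e, Ideal.mem_span_singleton_self e⟩ : (Ideal.span {e} : Ideal _))
    (⟨f, Ideal.mem_span_singleton_self f⟩ : (Ideal.span {f} : Ideal _)) rfl rfl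
    (fun v ↦ (mem_span_idem he).1 v.2) (fun w ↦ (mem_span_idem hf).1 w.2)
    (I := Ideal.span {permExt h e f}) (fun x ↦ mem_span_idem hext)
  exact (cl_rep_iso (V := idealRep (Ideal.span {permExt h e f}))
    (W := indProd h (idealRep (Ideal.span {e})) (idealRep (Ideal.span {f}))) Ψ
    (fun g ↦ LinearMap.ext (h₁ g)) h₂).symm

/-- The Littlewood-Richardson rule for the induction product. -/
lemma repK0_mul_specht {p q n : ℕ} (h : p + q = n) (ν : p.Partition) (ξ : q.Partition) :
    RepK0.mul h (K0.cl repRel (specht ν)) (K0.cl repRel (specht ξ)) =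
      ∑ μ, cornerDim (youngIdem μ) (permExt h (youngIdem ν) (youngIdem ξ)) •
        K0.cl repRel (specht μ) := by
  have hext : permExt h (youngIdem ν) (youngIdem ξ) * permExt h (youngIdem ν) (youngIdem ξ) =
      permExt h (youngIdem ν) (youngIdem ξ) := by
    rw [permExt_mul, youngIdem_mul_self, youngIdem_mul_self]
  rw [RepK0.mul, K0.lift_cl, K0.lift_cl, specht_eq, specht_eq,
    cl_indProd_idealRep h (youngIdem_mul_self ν) (youngIdem_mul_self ξ),
    cl_idealRep (youngSplit n) hext]
  -- Frobenius reciprocity: the multiplicity takes the form in which it occurs for Schur functors of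
  -- a direct sum in `imgCl_sumData`.
  exact Finset.sum_congr rfl fun μ _ ↦ by rw [cornerDim_comm (youngSplit n) hext, specht_eq]

end SpechtMul

/-! ### The constant coefficient. -/

section DegreeZeroPart

open scoped MonoidAlgebra

lemma youngIdem_eq_one (μ : Nat.Partition 0) : youngIdem μ = 1 := by
  have h : youngSym μ = 1 := by
    refine MonoidAlgebra.ext (Finsupp.ext fun g ↦ ?_)
    rw [Subsingleton.elim g 1, youngSym_coeff_one]
    simp
  rw [youngIdem, h, mul_one]
  simp

lemma cl_idealRep_one {G : Type} [Group G] [Finite G] [Subsingleton G] :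
    K0.cl repRel (idealRep (Ideal.span {(1 : ℚ[G])})) =
      K0.cl repRel (FDRep.of (Representation.trivial ℚ G ℚ)) := by
  have h (x : ℚ[G]) : x ∈ Ideal.span {(1 : ℚ[G])} := by rw [Ideal.span_singleton_one]; trivial
  refine (cl_rep_iso (V := FDRep.of (Representation.trivial ℚ G ℚ))
    (W := idealRep (Ideal.span {(1 : ℚ[G])}))
    ((LinearMap.toSpanSingleton ℚ ((Ideal.span {(1 : ℚ[G])}).restrictScalars ℚ) ⟨1, h 1⟩))
    (fun g ↦ LinearMap.ext fun q ↦ Subtype.ext ?_) ⟨fun q q' hq ↦ ?_, fun x ↦ ?_⟩).symm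
  · change q • (1 : ℚ[G]) = MonoidAlgebra.of ℚ G g * q • 1
    rw [Subsingleton.elim g 1, map_one, one_mul]
  · have := congrArg (fun x : Ideal.span {(1 : ℚ[G])} ↦ x.1.coeff 1) hq
    change (q • (1 : ℚ[G])).coeff 1 = (q' • (1 : ℚ[G])).coeff 1 at this
    simpa using this
  · let y : Ideal.span {(1 : ℚ[G])} := x
    refine ⟨y.1.coeff 1, Subtype.ext ?_⟩
    change y.1.coeff 1 • (1 : ℚ[G]) = y.1
    ext g
    rw [Subsingleton.elim g 1]
    simp

end DegreeZeroPart

/-! ### The homomorphism λ_Σ, and the theorem. -/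

section LambdaSigmaMap

open DerivedCategory Pretriangulated TensorProduct
open scoped MonoidAlgebra

variable {A : Type u} [Category.{v} A] [Abelian A] [Linear ℚ A] [MonoidalCategory A]
  [SymmetricCategory A] [MonoidalPreadditive A] [MonoidalLinear ℚ A]
  [∀ X : A, PreservesFiniteLimits (tensorLeft X)]
  [∀ X : A, PreservesFiniteColimits (tensorLeft X)] [HasDerivedCategory.{w} A]

/-- The class of the image is a polynomial in the classes of exterior powers, and these depend only
on the class of the complex because `lamHom` is defined on the Grothendieck group. So the choice in
`lamSigma` is harmless. -/
lemma imgCl_congr {n : ℕ} {e : ℚ[Equiv.Perm (Fin n)]} (he : e * e = e) {X Y : BddCx A}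
    (h : clD X = clD Y) : imgCl (clD : BddCx A → K0D A) X n e = imgCl clD Y n e := by
  obtain ⟨Q, hQ, _⟩ := TensorInv.exists_aeval (tensorInv_clD (A := A)) (tensorInv_clD (A := A)) he
  rw [hQ, hQ]
  simp only [← lamD_clD, h]

variable (A) in
/-- The generating series of the classes of the Schur functors. -/
noncomputable def lamSigma (x : K0D A) : K0RSeries (triRel (D := DerivedCategory.Bounded A)) :=
  fun n ↦ ∑ μ : n.Partition, imgCl clD (exists_clD_eq x).choose n (youngIdem μ) ⊗ₜ[ℤ]
    K0.cl repRel (specht μ)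

lemma lamSigma_clD (X : BddCx A) (n : ℕ) : lamSigma A (clD X) n =
    ∑ μ : n.Partition, imgCl clD X n (youngIdem μ) ⊗ₜ[ℤ] K0.cl repRel (specht μ) :=
  Finset.sum_congr rfl fun μ _ ↦ by
    rw [imgCl_congr (youngIdem_mul_self μ) (exists_clD_eq (clD X)).choose_spec]

lemma imgCl_sumData {X Y Z : BddCx A} (s : SumData X Y Z) {n : ℕ} {e : ℚ[Equiv.Perm (Fin n)]}
    (he : e * e = e) : imgCl (clD : BddCx A → K0D A) Z n e =
      ∑ k : Finset.HasAntidiagonal.antidiagonal n, ∑ y : k.1.1.Partition × k.1.2.Partition,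
        cornerDim e (permExt (Finset.HasAntidiagonal.mem_antidiagonal.1 k.2) (youngIdem y.1)
          (youngIdem y.2)) •
            (imgCl clD X k.1.1 (youngIdem y.1) * imgCl clD Y k.1.2 (youngIdem y.2)) := by
  obtain ⟨U, hU⟩ := exists_isTensorImage he Z
  choose S hS using fun (i : ℕ) (ν : i.Partition) ↦
    exists_isTensorImage (youngIdem_mul_self ν) X
  choose T hT using fun (i : ℕ) (ν : i.Partition) ↦
    exists_isTensorImage (youngIdem_mul_self ν) Y
  rw [tensorInv_clD.imgCl_eq hU, tensorInv_clD.sum (s.isSum he hU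
    (T := fun k y ↦ S k.1.1 y.1 ⊗ T k.1.2 y.2) fun k y ↦ isImage_boxMul (hS _ _) (hT _ _)),
    Fintype.sum_sigma]
  refine Finset.sum_congr rfl fun k _ ↦ ?_
  rw [Fintype.sum_sigma]
  refine Finset.sum_congr rfl fun y _ ↦ ?_
  rw [tensorInv_clD.imgCl_eq (hS _ _), tensorInv_clD.imgCl_eq (hT _ _), ← tensorInv_clD.tensor]
  simp

/-- The multiplicity of S_ν X ⊗ S_ξ Y in S_μ Z and that of V_μ in the induction product of V_ν and
V_ξ are the same number; what remains is to exchange sums. -/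
lemma lamSigma_sumData {X Y Z : BddCx A} (s : SumData X Y Z) :
    lamSigma A (clD Z) = seriesMul (lamSigma A (clD X)) (lamSigma A (clD Y)) := by
  funext n
  rw [lamSigma_clD]
  simp only [imgCl_sumData s (youngIdem_mul_self _), sum_tmul]
  rw [Finset.sum_comm]
  refine Finset.sum_congr rfl fun k _ ↦ ?_
  rw [Finset.sum_comm, lamSigma_clD, lamSigma_clD, LinearMap.map_sum₂,
    Fintype.sum_prod_type]
  refine Finset.sum_congr rfl fun ν _ ↦ ?_
  rw [map_sum]
  refine Finset.sum_congr rfl fun ξ _ ↦ ?_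
  have h := repK0_mul_specht (Finset.HasAntidiagonal.mem_antidiagonal.1 k.2) ν ξ
  refine Eq.trans ?_ (congrArg (fun v ↦ (imgCl (clD : BddCx A → K0D A) X k.1.1 (youngIdem ν) *
    imgCl clD Y k.1.2 (youngIdem ξ)) ⊗ₜ[ℤ] v) h).symm
  rw [tmul_sum]
  exact Finset.sum_congr rfl fun μ _ ↦ by rw [smul_tmul]

lemma lamSigma_coeff_zero (x : K0D A) : lamSigma A x 0 = seriesOne triRel 0 := by
  obtain ⟨X, rfl⟩ := exists_clD_eq x
  rw [lamSigma_clD, Fintype.sum_unique, seriesOne, if_pos rfl, specht_eq, youngIdem_eq_one,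
    (tensorInv_clD.symChar X).one, cl_idealRep_one]

lemma isLambdaSigma_lamSigma : IsLambdaSigma (lamSigma A) where
  coeff_zero := lamSigma_coeff_zero
  map_zero := by
    obtain ⟨O, hO⟩ := exists_id_eq_zero (𝟙_ (BddCx A))
    rw [← clD_zero hO]
    funext n
    obtain _ | n := n
    · exact lamSigma_coeff_zero _
    rw [lamSigma_clD, seriesOne, if_neg n.succ_ne_zero]
    refine Finset.sum_eq_zero fun μ _ ↦ ?_
    obtain ⟨S, hS⟩ := exists_isTensorImage (youngIdem_mul_self μ) O
    have h : 𝟙 S = 0 := by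
      obtain ⟨i, p, hip, _⟩ := hS
      have : 𝟙 (tpow O (n + 1)) = 0 := HasLines.zero_tensor hO
      rw [← hip, ← Category.id_comp p, this, zero_comp, comp_zero]
    rw [tensorInv_clD.imgCl_eq hS, tensorInv_clD.zero h, zero_tmul]
  map_add x y := by
    obtain ⟨X, rfl⟩ := exists_clD_eq x
    obtain ⟨Y, rfl⟩ := exists_clD_eq y
    -- The triangle of a direct sum in the derived category is lifted to complexes; after `gr` it
    -- becomes a direct sum there, with the given classes.
    obtain ⟨X', Z', Y', f, g, w, s, ⟨eX⟩, ⟨eZ⟩, ⟨eY⟩⟩ := exists_splitting A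
      ⟨_, _, _, binaryBiproductTriangle_distinguished ((toDb A).obj X) ((toDb A).obj Y)⟩
    have d := BddCx.grSumData f g w fun n ↦ (s n).some
    have hX : clD ((BddCx.gr A).obj X') = clD X := (clD_gr _).trans (cl_iso_bounded eX)
    have hY : clD ((BddCx.gr A).obj Y') = clD Y := (clD_gr _).trans (cl_iso_bounded eY)
    rw [← hX, ← hY, ← clD_sumData d, lamSigma_sumData d]
  map_cl V n S hS := by
    have i := (toDb A).objObjPreimageIso V
    have h : K0.cl triRel V = clD ((toDb A).objPreimage V) := cl_iso_bounded i.symm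
    rw [h, lamSigma_clD]
    exact Finset.sum_congr rfl fun μ _ ↦ by
      rw [cl_eq_imgCl (youngIdem_mul_self μ) (hS μ) i]

end LambdaSigmaMap

theorem mainTheorem3 {A : Type u} [Category.{v} A] [Abelian A] [Linear ℚ A] [MonoidalCategory A]
    [SymmetricCategory A] [MonoidalPreadditive A] [MonoidalLinear ℚ A]
    [∀ X : A, PreservesFiniteLimits (tensorLeft X)]
    [∀ X : A, PreservesFiniteColimits (tensorLeft X)] [HasDerivedCategory.{w} A] :
    (∀ (X : DerivedCategory.Bounded A) (n : ℕ) (μ : n.Partition), ∃ S, IsSchur μ X S) ∧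
    (∀ (X : DerivedCategory.Bounded A) (n : ℕ), ∃ S, IsAlt n X S) ∧
    (∀ (X : A) (n : ℕ), ∃ S, IsAlt n X S) ∧
    (∃ Λ : K0D A → K0RSeries (triRel (D := DerivedCategory.Bounded A)), IsLambdaSigma Λ) ∧
    ∃ (lamA : ℕ → K0A A → K0A A) (lamD : ℕ → K0D A → K0D A) (i : K0A A ≃+* K0D A),
      IsSpecialLambda lamA ∧ IsSpecialLambda lamD ∧
      (∀ (n : ℕ) (X S : A), IsAlt n X S → lamA n (K0.cl _ X) = K0.cl _ S) ∧
      (∀ (n : ℕ) (X S : DerivedCategory.Bounded A), IsAlt n X S →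
        lamD n (K0.cl _ X) = K0.cl _ S) ∧
      (∀ X : A, i (K0.cl _ X) = K0.cl _ ((degreeZero A).obj X)) ∧
      ∀ n x, i (lamA n x) = lamD n (i x) := by
  -- The λ-structure on `K0A A` is transported from the derived category along the ring isomorphism,
  -- so compatibility is automatic; that it is given by exterior powers in `A` itself is
  -- `lamD_conc`.
  refine ⟨fun X n μ ↦ exists_isTensorImage_bounded (youngIdem_mul_self μ) X,
    fun X n ↦ exists_isTensorImage_bounded (altIdem_mul_self n) X, fun X n ↦ exists_isAlt X n,
    ⟨lamSigma A, isLambdaSigma_lamSigma⟩,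
    fun n x ↦ (concRingEquiv A).symm (lamD A n (concRingEquiv A x)), lamD A, concRingEquiv A,
    isSpecialLambda_lamD.of_ringEquiv _, isSpecialLambda_lamD, fun n X S h ↦ ?_,
    fun n X S h ↦ lamD_isAlt h, concEquiv_cl, fun n x ↦ (concRingEquiv A).apply_symm_apply _⟩
  dsimp only
  rw [lamD_conc h, RingEquiv.symm_apply_apply]
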